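/- **Setting.** Let $m\ge 3$, let $c_1,\dots,c_m$ be distinct reals, let $2\le \ell\le m-1$, and let $\varepsilon>0$ be smaller than $|c_i-c_j|$ for all $i\ne j$. For a list $c_s,\dots,c_t$ of at least two of these values, its *map* $v$ has $v(i)=c_i$ for $s\le i\le t$ and the two *hooks* $v(s-1)=c_s+\varepsilon\,\mathrm{sign}(c_{s+1}-c_s)$ and $v(t+1)=c_t+\varepsilon\,\mathrm{sign}(c_{t-1}-c_t)$. Let $f,g,h$ be the maps of $c_1,\dots,c_m$, of $c_1,\dots,c_\ell$ and of $c_{\ell+1},\dots,c_m$ (the last one is defined if $\ell\le m-2$). Let $\delta>0$ be smaller than the difference of any two distinct values of $f$ (at the integers $0,\dots,m+1$). **Up-tree.** The *critical points* of $v$ are the items that are local maxima or local minima, and each hook whose neighboring item is a maximum. Take the unique full binary tree whose in-order sequence is the sequence of critical points from left to right and whose values increase along every path from a leaf to the root; its leaves are minima, its internal nodes maxima. Add above the root a *special root* $\beta$, larger than all items in position and in value. Decompose the tree into paths: the path of a leaf $a$ ends at the nearest ancestor $b$ in whose subtree $a$ is not the smallest leaf, and at $\beta$ if there is none. Split each path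 into two trails: the *left trail* has the interior nodes $u<a$, the *right trail* the interior nodes $u>a$. The pair of trails from $a$ to $b$ is the *banana* spanned by $a,b$. If $a<b$, its left trail is called the in-trail and its right trail the mid-trail; if $b<a$ it is the other way round. The resulting tree of bananas is the *up-tree* of $v$; the *down-tree* of $v$ is the up-tree of $-v$. The *left (right) spine* consists of $\beta$ and the uppermost interior node of every left (right) trail whose upper end is in the left (right) spine. **Algorithm Split.** Input: the up-tree and the down-tree of $f$, and $\ell$. Let $x=\ell+\frac12$ and $f(x)=\frac12(f(\ell)+f(\ell+1))$. 1. *Smallest banana.* Let $a<x<b$ be the consecutive critical points around $x$, and say that $b$ is a maximum (the other case is the mirror image). If $b$ is interior to a right trail, let $q$ be the upper end of that trail and $r$ the node below $b$ on it; otherwise let $q=b$ and let $r$ be the uppermost node below $b$ on the mid-trail of the banana with upper end $b$. While $r\neq a$ and $f(x)<f(r)$, replace $q$ by $r$ and $r$ by the uppermost node below the old $r$ on the in-trail of the banana with upper end the old $r$. The result is the banana with upper end $q$. 2. *Stacks.* Starting with the smallest banana, walk up in the up-tree (from a banana with upper end $q$ to the banana that has $q$ as an interior node of a trail) until the upper end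 is in the spine, and push each banana $(p,q)$, this last one included, on the stack $L^{up}$, $M^{up}$ or $R^{up}$ according to whether both of $p,q$ are left of $x$, they are separated by $x$, or both are right of $x$. Do the same in the down-tree with $-f$; of the resulting left and right stacks, drop bananas with upper end in the spine of the down-tree and reverse the other pairs; call the results $L^{dn},R^{dn}$. There may be one missing banana with upper end in the spine of the up-tree and $x$ in the out-panel of its window: let $(p',q')$ be the banana whose upper end is the uppermost interior node of the in-trail of the top banana, if $x$ cuts that in-trail (if the top banana is the special one, spanned with $\beta$, take the trail on the side of $x$). If it exists, if $f(p')<f(x)<f(q')$, and if pushing it on $L^{dn}$ (if $q'<x$) or $R^{dn}$ (if $q'>x$) keeps that stack sorted and mergeable with $M^{up}$ and the up-stack of the same side into one sorted stack (minima decreasing, maxima increasing towards the top), then push it. 3. *Loop.* Besides the given tree, there is a second tree that consists of one banana with empty trails spanned by a dummy leaf $\alpha$ and a second special root. It is the left tree if the upper end of the top banana is in the left spine, and the right tree otherwise; $f(\alpha)$ is set to $f(p)-\delta$ where $(p,q)$ is the top banana. As long as there are bananas on the stacks, take the one, $(p,q)$, with the highest maximum. * *Injury* ($R^{up}$, $x<p<q$):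 the interior nodes $<x$ of the left trail from $p$ to $q$, with the bananas they carry, move from the right tree to the bottom of the left trail of $\alpha$ in the left tree. ($L^{up}$: mirror image.) * *Fatality* ($M^{up}$, $p<x<q$): $p$, the left trail from $p$ to $q$, and the interior nodes $<x$ of the right trail move from the right tree to the left tree, where $p$ replaces $\alpha$ and the moved trails are put below the trails of $\alpha$; $\alpha$ replaces $p$ as lower end of the banana with upper end $q$ in the right tree, and $f(\alpha)=f(p)-\delta$. ($q<x<p$: mirror image.) * *Scare* ($L^{dn}$, $p<q<x$): $f(\alpha)=f(p)+\delta$, and the minima $p$ and $\alpha$ are interchanged in the left tree: if $q$ is interior to a trail of the banana spanned by $\alpha,b$, then the parts of its two trails above $q$ (on the trail of $q$), respectively with value larger than $f(q)$ (on the other trail), are put on top of the trails of $p$, the node $q$ being placed between them on the side opposite to its former trail; the banana is now spanned by $p,b$; and the lower parts become the trails of the banana spanned by $\alpha,q$. ($R^{dn}$: the same in the right tree.) 4. *Final adjustment.* If $f(\ell)>f(\ell+1)$, the leaf $\alpha$ of the left tree becomes the hook $\ell+1$ with value $f(\ell)-\varepsilon$ if $\ell$ is a maximum of $f$, and the minimum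 $\ell$ with value $f(\ell)$ otherwise; its value is increased to this value, and on the way $\alpha$ is interchanged as above with the minima it passes whose bananas are attached to its trails, in increasing order of value. If $\ell+1$ is not a minimum of $f$, it is inserted according to its value as a new maximum into the left spine of the right tree, spanning a banana with empty trails with its hook $\ell$. If $f(\ell)<f(\ell+1)$, proceed symmetrically. **Theorem (Correctness of Split).** For $2\le\ell\le m-1$, applied to the up-tree and the down-tree of $f$, Split returns two trees of which the left one is the up-tree of $g$ (its nodes are the critical points of the map of the items $\le\ell$) and, if $\ell\le m-2$, so that $h$ is defined, the right one is the up-tree of $h$ (its nodes are the critical points of the map of the items $>\ell$). -/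

import Mathlib

namespace BananaTree

/-! ### Lists viewed as maps -/

/-- The map of the list `c s, c (s+1), …, c t` (at least two items), read at integer positions: the
items are `s, …, t`, and the positions `s - 1` and `t + 1` carry the hooks. -/
noncomputable def hooked (c : ℕ → ℝ) (ε : ℝ) (s t : ℕ) (i : ℕ) : ℝ :=
  if i < s then c s + ε * (SignType.sign (c (s + 1) - c s) : ℝ)
  else if t < i then c t + ε * (SignType.sign (c (t - 1) - c t) : ℝ)
  else c i

/-- Item `i` is a proper maximum. -/
def IsMaxItem (v : ℕ → ℝ) (i : ℕ) : Prop := v (i - 1) < v i ∧ v (i + 1) < v i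

/-- Item `i` is a proper minimum. -/
def IsMinItem (v : ℕ → ℝ) (i : ℕ) : Prop := v i < v (i - 1) ∧ v i < v (i + 1)

noncomputable instance (v : ℕ → ℝ) (i : ℕ) : Decidable (IsMaxItem v i) :=
  inferInstanceAs (Decidable (_ ∧ _))

noncomputable instance (v : ℕ → ℝ) (i : ℕ) : Decidable (IsMinItem v i) :=
  inferInstanceAs (Decidable (_ ∧ _))

/-- The critical points represented in the tree of a map with items `s, …, t` and hooks `s - 1`,
`t + 1`, from left to right: the maxima and minima among the items, and each hook whose neighbouring
item is a maximum (a hook next to a minimum is ignored). -/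
noncomputable def critPoints (v : ℕ → ℝ) (s t : ℕ) : List ℕ :=
  (List.range (t + 2)).filter fun i =>
    (i + 1 = s ∧ IsMaxItem v s) ∨
    (s ≤ i ∧ i ≤ t ∧ (IsMaxItem v i ∨ IsMinItem v i)) ∨
    (i = t + 1 ∧ IsMaxItem v t)

/-! ### Full binary trees and banana trees -/

inductive FullTree where
  | leaf (a : ℕ) : FullTree
  | node (l : FullTree) (b : ℕ) (r : FullTree) : FullTree

def FullTree.root : FullTree → ℕ
  | .leaf a => a
  | .node _ b _ => b

def FullTree.inorder : FullTree → List ℕ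
  | .leaf a => [a]
  | .node l b r => l.inorder ++ b :: r.inorder

/-- Along every path from a leaf to the root the values increase. -/
def FullTree.Increasing (v : ℕ → ℝ) : FullTree → Prop
  | .leaf _ => True
  | .node l b r => v l.root < v b ∧ v r.root < v b ∧ l.Increasing v ∧ r.Increasing v

/-- A banana with lower end (minimum) `lo` and upper end (maximum) `hi`, together with all bananas
below it. The lists `left` and `right` are the interior nodes of its left and right trail *from
bottom to top*; each interior node is given with the banana of which it is the upper end.
Upper ends live in `WithTop ℕ`, where `⊤` is the special root; it is larger than all items, both in
position and in value. A banana tree is a banana with upper end `⊤`. -/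
inductive Banana where
  | mk (lo : ℕ) (hi : WithTop ℕ) (left right : List Banana) : Banana

namespace Banana

def lo : Banana → ℕ
  | mk a _ _ _ => a

def hi : Banana → WithTop ℕ
  | mk _ b _ _ => b

def left : Banana → List Banana
  | mk _ _ l _ => l

def right : Banana → List Banana
  | mk _ _ _ r => r

end Banana

/-- Decomposition of a full binary tree into paths, and of each path into its two trails.
The path of a leaf ends at its nearest ancestor whose subtree has a smaller leaf. So, in the subtree
of `b`, the path of the smallest leaf `a` is still open (it is closed by `⊤` if it reaches the root
of the whole tree), while the path of the smallest leaf on the other side of `b` ends at `b`. The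
node `b` is then interior to the path of `a`: on the right trail if `a < b`, that is, `a` is in the
left subtree, and on the left trail if `b < a`. -/
noncomputable def FullTree.toBanana (v : ℕ → ℝ) : FullTree → Banana
  | .leaf a => .mk a ⊤ [] []
  | .node l b r =>
    let A := l.toBanana v
    let C := r.toBanana v
    if v A.lo < v C.lo then
      .mk A.lo ⊤ A.left (A.right ++ [.mk C.lo b C.left C.right])
    else
      .mk C.lo ⊤ (C.left ++ [.mk A.lo b A.left A.right]) C.right

/-- `B` is the banana tree (the up-tree) of the map `v` with items `s, …, t`: the trails of the
path-decomposition of the full binary tree whose in-order sequence is the sequence of critical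
points and in which values increase towards the root. -/
def IsUpTree (v : ℕ → ℝ) (s t : ℕ) (B : Banana) : Prop :=
  ∃ T : FullTree, T.inorder = critPoints v s t ∧ T.Increasing v ∧ B = T.toBanana v

/-- The down-tree of `v` is the up-tree of `-v`. -/
def IsDownTree (v : ℕ → ℝ) (s t : ℕ) (B : Banana) : Prop :=
  IsUpTree (fun i => -v i) s t B

/-! ### Pointers and spine

Only the values at nodes of the tree matter; elsewhere the functions return a default. -/

/-- Value of a node that is possibly the special root. -/
def height (v : ℕ → ℝ) (q : WithTop ℕ) : WithTop ℝ := q.map v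

namespace Banana

mutual
/-- All bananas of a tree. -/
def bananas : Banana → List Banana
  | mk a b l r => mk a b l r :: (bananasTrail l ++ bananasTrail r)
def bananasTrail : List Banana → List Banana
  | [] => []
  | B :: t => bananas B ++ bananasTrail t
end

/-- The banana with upper end `q`. -/
def at? (T : Banana) (q : WithTop ℕ) : Option Banana :=
  T.bananas.find? fun B => B.hi = q

/-- The banana that has `q` as an interior node of one of its trails. -/
def owner? (T : Banana) (q : WithTop ℕ) : Option Banana :=
  T.bananas.find? fun B => q ∈ (B.left ++ B.right).map hi

/-- The lower end of the banana with upper end `q`. -/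
def birth (T : Banana) (q : WithTop ℕ) : ℕ := ((T.at? q).map lo).getD 0

/-- The lower end of the trail that has `q` as an interior node. -/
def low (T : Banana) (q : WithTop ℕ) : ℕ := ((T.owner? q).map lo).getD 0

/-- The upper end of the banana with lower end `p`. -/
def dth (T : Banana) (p : ℕ) : WithTop ℕ :=
  ((T.bananas.find? fun B => B.lo = p).map hi).getD ⊤

/-- The uppermost node other than `B.hi` on a trail `t` of `B`. -/
def topNode (B : Banana) (t : List Banana) : WithTop ℕ := (t.getLast?.map hi).getD B.lo

/-- The node just below `q` on a trail `t` of `B`. -/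
def belowNode (B : Banana) (t : List Banana) (q : WithTop ℕ) : WithTop ℕ :=
  B.topNode (t.takeWhile fun C => C.hi ≠ q)

/-- The node below `q` on the trail that has `q` as an interior node. -/
def dn (T : Banana) (q : WithTop ℕ) : WithTop ℕ :=
  match T.owner? q with
  | none => ⊤
  | some B => if q ∈ B.left.map hi then B.belowNode B.left q else B.belowNode B.right q

/-- The in-trail is the left trail if the lower end is to the left of the upper end, and the right
trail otherwise. -/
def inTrail (B : Banana) : List Banana := if (B.lo : WithTop ℕ) < B.hi then B.left else B.right

def midTrail (B : Banana) : List Banana := if (B.lo : WithTop ℕ) < B.hi then B.right else B.left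

/-- The first node on the in-trail that begins at the maximum `q`. -/
def inPtr (T : Banana) (q : WithTop ℕ) : WithTop ℕ :=
  ((T.at? q).map fun B => B.topNode B.inTrail).getD ⊤

/-- The first node on the mid-trail that begins at the maximum `q`. -/
def midPtr (T : Banana) (q : WithTop ℕ) : WithTop ℕ :=
  ((T.at? q).map fun B => B.topNode B.midTrail).getD ⊤

mutual
/-- The special root, and the first interior node (from above) of every left trail with upper end in
the left spine. -/
def leftSpine : Banana → List (WithTop ℕ)
  | mk _ b l _ => b :: leftSpineTrail l
def leftSpineTrail : List Banana → List (WithTop ℕ)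
  | [] => []
  | [B] => leftSpine B
  | _ :: C :: t => leftSpineTrail (C :: t)
end

mutual
def rightSpine : Banana → List (WithTop ℕ)
  | mk _ b _ r => b :: rightSpineTrail r
def rightSpineTrail : List Banana → List (WithTop ℕ)
  | [] => []
  | [B] => rightSpine B
  | _ :: C :: t => rightSpineTrail (C :: t)
end

def spine (T : Banana) : List (WithTop ℕ) := T.leftSpine ++ T.rightSpine

mutual
/-- Apply `φ` to the topmost bananas that satisfy `P`. -/
def modify (P : Banana → Prop) [DecidablePred P] (φ : Banana → Banana) : Banana → Banana
  | mk a b l r =>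
    if P (mk a b l r) then φ (mk a b l r) else mk a b (modifyTrail P φ l) (modifyTrail P φ r)
def modifyTrail (P : Banana → Prop) [DecidablePred P] (φ : Banana → Banana) :
    List Banana → List Banana
  | [] => []
  | B :: t => modify P φ B :: modifyTrail P φ t
end

/-- Apply `φ` to the banana with upper end `q`. -/
def modifyHi (q : WithTop ℕ) (φ : Banana → Banana) (T : Banana) : Banana :=
  T.modify (fun B => B.hi = q) φ

/-- Apply `φ` to the banana with lower end `p`. -/
def modifyLo (p : ℕ) (φ : Banana → Banana) (T : Banana) : Banana :=
  T.modify (fun B => B.lo = p) φ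

end Banana

/-! ### The smallest banana

The list is cut at the midpoint `x` of `ℓ` and `ℓ + 1`, so `u < x` means `u ≤ ℓ`. The value of the
map at `x` is called `y`. -/

/-- `while r ≠ last and f(x) < f(r) do q = r; r = In(r)`; returns `q`. The number `n` bounds the
number of rounds. -/
noncomputable def descend (T : Banana) (v : ℕ → ℝ) (y : ℝ) (last : WithTop ℕ) :
    ℕ → WithTop ℕ → WithTop ℕ → WithTop ℕ
  | 0, q, _ => q
  | n + 1, q, r =>
    if r ≠ last ∧ (y : WithTop ℝ) < height v r then descend T v y last n r (T.inPtr r) else q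

/-- The smallest banana with `x` between its lower and upper end or in its in-panel. Here `a < x < b`
are consecutive critical points; the second case is the mirror image of the first. -/
noncomputable def smallestBanana (T : Banana) (v : ℕ → ℝ) (s t ℓ : ℕ) (y : ℝ) : ℕ × WithTop ℕ :=
  let a := ((critPoints v s t).reverse.find? fun i => i ≤ ℓ).getD 0
  let b := ((critPoints v s t).find? fun i => ℓ < i).getD 0
  let n := T.bananas.length
  let q :=
    if IsMaxItem v b then
      if T.dn b < b then descend T v y a n (T.dth (T.low b)) (T.dn b)
      else descend T v y a n b (T.midPtr b)
    else
      if (a : WithTop ℕ) < T.dn a then descend T v y b n (T.dth (T.low a)) (T.dn a)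
      else descend T v y b n a (T.midPtr a)
  (T.birth q, q)

/-! ### The stacks -/

/-- Stacks of bananas, given by their lower and upper ends; the head of the list is the top. -/
abbrev Stack := List (ℕ × WithTop ℕ)

/-- Three stacks: both ends to the left of `x`, separated by `x`, both ends to the right of `x`. -/
structure Triple where
  L : Stack
  M : Stack
  R : Stack

def Triple.push (S : Triple) (ℓ : ℕ) (e : ℕ × WithTop ℕ) : Triple :=
  if e.1 ≤ ℓ ∧ e.2 ≤ ℓ then { S with L := e :: S.L }
  else if ℓ < e.1 ∧ ℓ < e.2 then { S with R := e :: S.R }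
  else { S with M := e :: S.M }

/-- Push bananas while walking up, until the first banana with upper end in the spine has been
pushed. The number `n` bounds the number of rounds. -/
def loadLoop (T : Banana) (ℓ : ℕ) : ℕ → ℕ × WithTop ℕ → Triple → Triple
  | 0, _, S => S
  | n + 1, e, S =>
    if e.2 ∈ T.spine then S.push ℓ e
    else loadLoop T ℓ n (T.low e.2, T.dth (T.low e.2)) (S.push ℓ e)

noncomputable def loadStacks (T : Banana) (v : ℕ → ℝ) (s t ℓ : ℕ) (y : ℝ) : Triple :=
  loadLoop T ℓ T.bananas.length (smallestBanana T v s t ℓ y) ⟨[], [], []⟩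

/-- Names of the stacks used to split the up-tree. -/
inductive StackName where
  | Lup | Rup | Mup | Ldn | Rdn

structure Stacks where
  Lup : Stack
  Rup : Stack
  Mup : Stack
  Ldn : Stack
  Rdn : Stack

def Stacks.get (S : Stacks) : StackName → Stack
  | .Lup => S.Lup
  | .Rup => S.Rup
  | .Mup => S.Mup
  | .Ldn => S.Ldn
  | .Rdn => S.Rdn

def Stacks.pop (S : Stacks) : StackName → Stacks
  | .Lup => { S with Lup := S.Lup.tail }
  | .Rup => { S with Rup := S.Rup.tail }
  | .Mup => { S with Mup := S.Mup.tail }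
  | .Ldn => { S with Ldn := S.Ldn.tail }
  | .Rdn => { S with Rdn := S.Rdn.tail }

def Stacks.size (S : Stacks) : ℕ :=
  S.Lup.length + S.Rup.length + S.Mup.length + S.Ldn.length + S.Rdn.length

/-- The banana with the highest maximum among the tops of the five stacks. -/
noncomputable def topBanana (v : ℕ → ℝ) (S : Stacks) : Option (StackName × (ℕ × WithTop ℕ)) :=
  [StackName.Lup, .Rup, .Mup, .Ldn, .Rdn].foldl
    (fun best σ =>
      match (S.get σ).head?, best with
      | none, _ => best
      | some e, none => some (σ, e)
      | some e, some (τ, e') => if height v e'.2 < height v e.2 then some (σ, e) else some (τ, e'))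
    none

/-- `e` fits strictly below `e'` in a sorted stack. -/
def Below (v : ℕ → ℝ) (e e' : ℕ × WithTop ℕ) : Prop :=
  v e'.1 < v e.1 ∧ height v e.2 < height v e'.2

noncomputable instance (v : ℕ → ℝ) (e e' : ℕ × WithTop ℕ) : Decidable (Below v e e') :=
  inferInstanceAs (Decidable (_ ∧ _))

/-- `e` can be pushed onto the stack `dn` such that `dn` remains sorted and can still be merged with
`up` into a sorted stack. -/
def Fits (v : ℕ → ℝ) (e : ℕ × WithTop ℕ) (dn up : Stack) : Prop :=
  (∀ e' ∈ dn, Below v e' e) ∧ ∀ e' ∈ up, Below v e' e ∨ Below v e e'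

noncomputable instance (v : ℕ → ℝ) (e : ℕ × WithTop ℕ) (dn up : Stack) :
    Decidable (Fits v e dn up) :=
  inferInstanceAs (Decidable (_ ∧ _))

/-- The one window that may have `x` in its out-panel without being a window of `-f`: its maximum is
in the spine of the up-tree, and then it is the first interior node of the in-trail of the top
banana, provided that `x` cuts that in-trail. The top banana may be the special banana, for which
the distinction between in- and mid-trail is void; then the trail on the side of `x` counts. -/
noncomputable def addMissing (U : Banana) (v : ℕ → ℝ) (ℓ : ℕ) (y : ℝ) (S : Stacks) : Stacks :=
  match topBanana v S with
  | none => S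
  | some (σ, (_, q)) =>
    let trail : List Banana :=
      match U.at? q, σ with
      | some B, .Rup => B.left
      | some B, .Lup => B.right
      | some B, .Mup => if q = ⊤ then B.right else []
      | _, _ => []
    match trail.getLast? with
    | none => S
    | some C =>
      if v C.lo < y ∧ (y : WithTop ℝ) < height v C.hi then
        if C.hi ≤ ℓ then
          if Fits v (C.lo, C.hi) S.Ldn (S.Lup ++ S.Mup) then
            { S with Ldn := (C.lo, C.hi) :: S.Ldn }
          else S
        else
          if Fits v (C.lo, C.hi) S.Rdn (S.Rup ++ S.Mup) then
            { S with Rdn := (C.lo, C.hi) :: S.Rdn }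
          else S
      else S

/-- The five stacks used for splitting the up-tree `U`. A banana of the down-tree is spanned by a
maximum `q` and a minimum `p` of `v`; we reverse it to `(p, q)`, after removing bananas with upper
end in the spine of the down-tree, which are not windows of `v`. -/
noncomputable def splitStacks (U D : Banana) (v : ℕ → ℝ) (s t ℓ : ℕ) : Stacks :=
  let y := (v ℓ + v (ℓ + 1)) / 2
  let up := loadStacks U v s t ℓ y
  let down := loadStacks D (fun i => -v i) s t ℓ (-y)
  let rev : Stack → Stack := fun S =>
    (S.filter fun e => e.2 ∉ D.spine).map fun e => (e.2.untopD 0, (e.1 : WithTop ℕ))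
  addMissing U v ℓ y ⟨up.L, up.R, up.M, rev down.L, rev down.R⟩

/-! ### Splitting the up-tree -/

/-- The left and the right tree, and the current values of the nodes, including the value of the
dummy leaf `α`. -/
structure State where
  leftTree : Banana
  rightTree : Banana
  val : ℕ → ℝ

/-- `u < x` for the upper end of a banana. -/
def LeftOf (ℓ : ℕ) (B : Banana) : Prop := B.hi ≤ ℓ

instance (ℓ : ℕ) : DecidablePred (LeftOf ℓ) := fun B => inferInstanceAs (Decidable (B.hi ≤ ℓ))

/-- `x < p < q`: the interior nodes to the left of `x` on the in-trail (the left trail) of the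
banana spanned by `p, q` move to the banana of `α` in the left tree. -/
def injuryRight (α ℓ : ℕ) (q : WithTop ℕ) (σ : State) : State :=
  match σ.rightTree.at? q with
  | none => σ
  | some B =>
    { σ with
      rightTree := σ.rightTree.modifyHi q fun B =>
        .mk B.lo B.hi (B.left.filter fun C => ¬ LeftOf ℓ C) B.right
      leftTree := σ.leftTree.modifyLo α fun A =>
        .mk A.lo A.hi ((B.left.filter fun C => LeftOf ℓ C) ++ A.left) A.right }

/-- `q < p < x`, the mirror image of `injuryRight`. -/
def injuryLeft (α ℓ : ℕ) (q : WithTop ℕ) (σ : State) : State :=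
  match σ.leftTree.at? q with
  | none => σ
  | some B =>
    { σ with
      leftTree := σ.leftTree.modifyHi q fun B =>
        .mk B.lo B.hi B.left (B.right.filter fun C => LeftOf ℓ C)
      rightTree := σ.rightTree.modifyLo α fun A =>
        .mk A.lo A.hi A.left ((B.right.filter fun C => ¬ LeftOf ℓ C) ++ A.right) }

/-- `p < x < q`: the minimum `p`, the entire in-trail (the left trail) and the interior nodes to the
left of `x` on the mid-trail of the banana spanned by `p, q` move to the banana of `α` in the left
tree, where `p` replaces `α`; in turn, `α` replaces `p` in the right tree and gets a value just
below that of `p`. -/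
noncomputable def fatalityRight (α ℓ : ℕ) (δ : ℝ) (p : ℕ) (q : WithTop ℕ) (σ : State) : State :=
  match σ.rightTree.at? q with
  | none => σ
  | some B =>
    { rightTree := σ.rightTree.modifyHi q fun B =>
        .mk α B.hi [] (B.right.filter fun C => ¬ LeftOf ℓ C)
      leftTree := σ.leftTree.modifyLo α fun A =>
        .mk p A.hi (B.left ++ A.left) ((B.right.filter fun C => LeftOf ℓ C) ++ A.right)
      val := Function.update σ.val α (σ.val p - δ) }

/-- `q < x < p`, the mirror image of `fatalityRight`. -/
noncomputable def fatalityLeft (α ℓ : ℕ) (δ : ℝ) (p : ℕ) (q : WithTop ℕ) (σ : State) : State :=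
  match σ.leftTree.at? q with
  | none => σ
  | some B =>
    { leftTree := σ.leftTree.modifyHi q fun B =>
        .mk α B.hi (B.left.filter fun C => LeftOf ℓ C) []
      rightTree := σ.rightTree.modifyLo α fun A =>
        .mk p A.hi ((B.left.filter fun C => ¬ LeftOf ℓ C) ++ A.left) (B.right ++ A.right)
      val := Function.update σ.val α (σ.val p - δ) }

/-- Interchange of minima. Let `j` be the lower end of a banana, `q` an interior node of one of its
trails, and `p` the lower end of the banana with upper end `q`. The trail of `q` is split into the
parts above and below `q`, the parallel trail into the parts with value above and below the value
of `q`. The upper parts are put on top of the trails from `p` to `q`, on the other side including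
`q` itself, and the lower parts become the trails from `j` to `q`. Nothing happens if `q` is not on
a trail that starts at `j`. -/
noncomputable def interchange (v : ℕ → ℝ) (j : ℕ) (q : WithTop ℕ) (T : Banana) : Banana :=
  T.modifyLo j fun A =>
    let lower : List Banana → List Banana := fun t => t.filter fun C => height v C.hi < height v q
    let upper : List Banana → List Banana := fun t => t.filter fun C => height v q < height v C.hi
    match A.left.find? fun C => C.hi = q, A.right.find? fun C => C.hi = q with
    | some P, _ =>
      .mk P.lo A.hi (P.left ++ upper A.left)
        (P.right ++ .mk j q (lower A.left) (lower A.right) :: upper A.right)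
    | none, some P =>
      .mk P.lo A.hi (P.left ++ .mk j q (lower A.left) (lower A.right) :: upper A.left)
        (P.right ++ upper A.right)
    | none, none => A

/-- `p < q < x`: `α` gets a value just above that of `p` and is interchanged with `p`. -/
noncomputable def scareLeft (α : ℕ) (δ : ℝ) (p : ℕ) (q : WithTop ℕ) (σ : State) : State :=
  { σ with
    leftTree := interchange σ.val α q σ.leftTree
    val := Function.update σ.val α (σ.val p + δ) }

/-- `x < q < p`, the mirror image of `scareLeft`. -/
noncomputable def scareRight (α : ℕ) (δ : ℝ) (p : ℕ) (q : WithTop ℕ) (σ : State) : State :=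
  { σ with
    rightTree := interchange σ.val α q σ.rightTree
    val := Function.update σ.val α (σ.val p + δ) }

noncomputable def process (α ℓ : ℕ) (δ : ℝ) : StackName × (ℕ × WithTop ℕ) → State → State
  | (.Lup, (_, q)) => injuryLeft α ℓ q
  | (.Rup, (_, q)) => injuryRight α ℓ q
  | (.Mup, (p, q)) => if p ≤ ℓ then fatalityRight α ℓ δ p q else fatalityLeft α ℓ δ p q
  | (.Ldn, (p, q)) => scareLeft α δ p q
  | (.Rdn, (p, q)) => scareRight α δ p q

/-- The main loop; each round pops one banana, so `n` rounds suffice for `n` bananas. -/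
noncomputable def splitLoop (v : ℕ → ℝ) (α ℓ : ℕ) (δ : ℝ) : ℕ → Stacks → State → State
  | 0, _, σ => σ
  | n + 1, S, σ =>
    match topBanana v S with
    | none => σ
    | some (τ, e) => splitLoop v α ℓ δ n (S.pop τ) (process α ℓ δ (τ, e) σ)

/-- The initial trees: the given up-tree, and a single banana with empty trails spanned by `α` and a
second special root. The latter is the left tree if the top banana is on the left spine (which
contains the special root), and the right tree otherwise. A special root of a left tree is thought
to be at `-∞`; since we store left and right trails, this requires no change of the tree. -/
noncomputable def initState (U : Banana) (v : ℕ → ℝ) (α : ℕ) (δ : ℝ) (S : Stacks) : State :=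
  match topBanana v S with
  | none => ⟨U, .mk α ⊤ [] [], v⟩
  | some (_, (p, q)) =>
    let v' := Function.update v α (v p - δ)
    if q ∈ U.leftSpine then ⟨.mk α ⊤ [] [], U, v'⟩ else ⟨U, .mk α ⊤ [] [], v'⟩

/-- Increase the value of the leaf `α` to `y`, interchanging it with the minima `p < y` it passes
whose banana is attached to the banana of `α`, in the order of increasing value. -/
noncomputable def raise (α : ℕ) (δ y : ℝ) : ℕ → (ℕ → ℝ) → Banana → Banana
  | 0, _, T => T
  | n + 1, v, T =>
    match T.bananas.find? fun B => B.lo = α with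
    | none => T
    | some A =>
      match ((A.left ++ A.right).filter fun C => v α < v C.lo ∧ v C.lo < y).argmin
          (fun C => v C.lo) with
      | none => T
      | some P => raise α δ y n (Function.update v α (v P.lo + δ)) (interchange v α P.hi T)

/-- Give the leaf `α` its final value `y`, and then its final label `a`. -/
noncomputable def placeAlpha (α a : ℕ) (δ y : ℝ) (v : ℕ → ℝ) (T : Banana) : Banana :=
  (raise α δ y T.bananas.length v T).modifyLo α fun A => .mk a A.hi A.left A.right

mutual
/-- Insert the new leftmost maximum `b`, spanning a banana with empty trails with the new leftmost
leaf `a`, into the left spine. -/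
noncomputable def insertLeft (v : ℕ → ℝ) (a b : ℕ) : Banana → Banana
  | .mk lo hi l r => .mk lo hi (insertLeftTrail v a b l) r
noncomputable def insertLeftTrail (v : ℕ → ℝ) (a b : ℕ) : List Banana → List Banana
  | [] => [.mk a b [] []]
  | [B] => if height v B.hi < v b then [B, .mk a b [] []] else [insertLeft v a b B]
  | B :: C :: t => B :: insertLeftTrail v a b (C :: t)
end

mutual
/-- The mirror image of `insertLeft`. -/
noncomputable def insertRight (v : ℕ → ℝ) (a b : ℕ) : Banana → Banana
  | .mk lo hi l r => .mk lo hi l (insertRightTrail v a b r)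
noncomputable def insertRightTrail (v : ℕ → ℝ) (a b : ℕ) : List Banana → List Banana
  | [] => [.mk a b [] []]
  | [B] => if height v B.hi < v b then [B, .mk a b [] []] else [insertRight v a b B]
  | B :: C :: t => B :: insertRightTrail v a b (C :: t)
end

/-- The final adjustments. If the map decreases from `ℓ` to `ℓ + 1`, then `α` is in the left tree; it
becomes the hook `ℓ + 1` at the maximum `ℓ`, or the new minimum `ℓ`. In the right tree, `ℓ + 1` is
already a minimum or becomes a new maximum with hook `ℓ`. The other case is the mirror image. -/
noncomputable def finish (v : ℕ → ℝ) (α ℓ : ℕ) (ε δ : ℝ) (σ : State) : Banana × Banana :=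
  if v (ℓ + 1) < v ℓ then
    (if IsMaxItem v ℓ then placeAlpha α (ℓ + 1) δ (v ℓ - ε) σ.val σ.leftTree
      else placeAlpha α ℓ δ (v ℓ) σ.val σ.leftTree,
     if IsMinItem v (ℓ + 1) then σ.rightTree else insertLeft v ℓ (ℓ + 1) σ.rightTree)
  else
    (if IsMinItem v ℓ then σ.leftTree else insertRight v (ℓ + 1) ℓ σ.leftTree,
     if IsMaxItem v (ℓ + 1) then placeAlpha α ℓ δ (v (ℓ + 1) - ε) σ.val σ.rightTree
      else placeAlpha α (ℓ + 1) δ (v (ℓ + 1)) σ.val σ.rightTree)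

/-- Algorithm Split: cut the up-tree `U` of the map `v` with items `s, …, t` (hooks `s - 1`, `t + 1`)
between `ℓ` and `ℓ + 1`, with the help of the down-tree `D`. The dummy leaf `α` is the unused label
`t + 2`. The number `ε` is the height of the hooks, `δ` is the offset for the value of `α`. -/
noncomputable def split (v : ℕ → ℝ) (s t ℓ : ℕ) (ε δ : ℝ) (U D : Banana) : Banana × Banana :=
  let α := t + 2
  let S := splitStacks U D v s t ℓ
  finish v α ℓ ε δ (splitLoop v α ℓ δ S.size S (initState U v α δ S))

end BananaTree

namespace BananaTree
namespace Banana

/-! ### Structural induction and in-order sequences -/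

-- Up-trees are characterised by local conditions (`Valid`): values increase up each trail, a banana
-- attached to a trail has a larger minimum than the lower end of that trail, and its own trails
-- stay below its upper end. By `FullTree.toBanana_spec` and `exists_fullTree`, a banana with upper
-- end `⊤` is an up-tree exactly if it is valid and its in-order list is the list of critical
-- points. So each output tree has to be checked for these two properties only; mostly the in-order
-- list is carried along and validity is the work.
--
-- In a valid tree every banana below the root spans a window (`LWin`): an interval of nodes with
-- values between its minimum and its maximum, delimited behind the minimum by a higher node or the
-- end of the list, and left beyond the maximum through a value below the minimum. The bananas that
-- have the cut between their ends or in their in-panel form one descending path (`IsPath`,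
-- `Good.mem_path`, `Good.path_spec`), and the up-stacks hold the part of it that starts at its
-- lowest spine banana. The windows with the cut in the out-panel (`Sc`) are found in the down-tree:
-- a window with a higher exit on one side and a lower exit on the other (`Quad`) stays one when the
-- map is turned upside down. Only a window without a higher exit escapes. Its upper end is in the
-- spine, and `Setting.missing_complete` and `Setting.missing_sound` show that the extra test of the
-- algorithm detects exactly this window.
--
-- The main loop keeps the invariant `Inv`. The tree that contains `α` (near) has only nodes on its
-- own side of the cut, with `α` as its last leaf. The other tree (far) still contains the next
-- banana of the path untouched, at the end of a spine, and all its nodes on the wrong side are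
-- interior to that banana. An injury or a fatality moves everything on the wrong side except what
-- is inside the next banana of the path. In a fatality the minimum `p` takes over the trails of
-- `α`, which is legal only if all bananas on these trails have minima above `p`. This is what
-- scares are for (`Inv.lo_lt_left`): a banana on the trail with a smaller minimum would be a window
-- with the cut in its out-panel and with a higher maximum, hence already treated, and then `α`
-- would exceed its minimum.
--
-- At the end no node is on the wrong side. The node next to `α` is an upper end, so the map
-- descends from it across the cut, and this decides in which tree `α` has to be placed
-- (`Inv.last`). Raising `α` by further interchanges (`LastLeaf.raise`) and inserting a maximum with
-- its hook into a spine (`insertLeft_spec`) give the critical points of the two shorter lists.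
-- Everything is proved for one side; `Banana.mirror` together with a change of sign of the
-- positions gives the other.

theorem ind {P : Banana → Prop}
    (h : ∀ a b l r, (∀ C ∈ l, P C) → (∀ C ∈ r, P C) → P (mk a b l r)) : ∀ B, P B
  | mk a b l r => h a b l r (fun C _ => ind h C) (fun C _ => ind h C)

@[simp] theorem eta (B : Banana) : mk B.lo B.hi B.left B.right = B := by cases B; rfl

@[simp] theorem lo_mk (a b l r) : (mk a b l r).lo = a := rfl
@[simp] theorem hi_mk (a b l r) : (mk a b l r).hi = b := rfl
@[simp] theorem left_mk (a b l r) : (mk a b l r).left = l := rfl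
@[simp] theorem right_mk (a b l r) : (mk a b l r).right = r := rfl

/-- The upper end as a number. -/
def top (B : Banana) : ℕ := B.hi.untopD 0

@[simp] theorem top_mk (a b l r) : (mk a b l r).top = b.untopD 0 := rfl

@[simp] theorem untopD_natCast (b : ℕ) : WithTop.untopD 0 (b : WithTop ℕ) = b := rfl

mutual
/-- The nodes below the upper end from left to right. -/
def ino : Banana → List ℕ
  | mk a _ l r => inoL l ++ a :: inoR r
/-- The nodes of a left trail and of the bananas it carries, from left to right. -/
def inoL : List Banana → List ℕ
  | [] => []
  | C :: t => inoL t ++ (ino C ++ [C.top])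
/-- The nodes of a right trail and of the bananas it carries, from left to right. -/
def inoR : List Banana → List ℕ
  | [] => []
  | C :: t => C.top :: (ino C ++ inoR t)
end

theorem ino_mk (a b l r) : (mk a b l r).ino = inoL l ++ a :: inoR r := by rw [ino]
theorem ino_eq (B : Banana) : B.ino = inoL B.left ++ B.lo :: inoR B.right := by cases B; rw [ino]; rfl
@[simp] theorem inoL_nil : inoL [] = [] := by rw [inoL]
@[simp] theorem inoR_nil : inoR [] = [] := by rw [inoR]
theorem inoL_cons (C t) : inoL (C :: t) = inoL t ++ (ino C ++ [C.top]) := by rw [inoL]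
theorem inoR_cons (C t) : inoR (C :: t) = C.top :: (ino C ++ inoR t) := by rw [inoR]

theorem inoL_append (s t) : inoL (s ++ t) = inoL t ++ inoL s := by
  induction s with
  | nil => simp
  | cons C s ih => simp [inoL_cons, ih]

theorem inoR_append (s t) : inoR (s ++ t) = inoR s ++ inoR t := by
  induction s with
  | nil => simp
  | cons C s ih => simp [inoR_cons, ih]

theorem mem_inoL {i : ℕ} {t : List Banana} : i ∈ inoL t ↔ ∃ C ∈ t, i ∈ C.ino ∨ i = C.top := by
  induction t with
  | nil => simp
  | cons C t ih =>
    simp only [inoL_cons, List.mem_append, ih, List.mem_cons, exists_eq_or_imp, List.not_mem_nil,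
      or_false]
    exact or_comm

theorem mem_inoR {i : ℕ} {t : List Banana} : i ∈ inoR t ↔ ∃ C ∈ t, i ∈ C.ino ∨ i = C.top := by
  induction t with
  | nil => simp
  | cons C t ih =>
    simp only [inoR_cons, List.mem_append, ih, List.mem_cons, exists_eq_or_imp]
    rw [← or_assoc, or_comm (a := i = C.top)]

theorem mem_ino {i : ℕ} {B : Banana} :
    i ∈ B.ino ↔ i = B.lo ∨ (∃ C ∈ B.left, i ∈ C.ino ∨ i = C.top) ∨
      ∃ C ∈ B.right, i ∈ C.ino ∨ i = C.top := by
  rw [ino_eq, List.mem_append, List.mem_cons, mem_inoL, mem_inoR, or_left_comm]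

theorem lo_mem_ino (B : Banana) : B.lo ∈ B.ino := mem_ino.2 (Or.inl rfl)

/-! ### Mirror images -/

mutual
/-- The mirror image of a banana. -/
def mirror : Banana → Banana
  | mk a b l r => mk a b (mirrorTrail r) (mirrorTrail l)
def mirrorTrail : List Banana → List Banana
  | [] => []
  | C :: t => mirror C :: mirrorTrail t
end

theorem mirrorTrail_eq (t : List Banana) : mirrorTrail t = t.map mirror := by
  induction t with
  | nil => rw [mirrorTrail]; rfl
  | cons C t ih => rw [mirrorTrail, ih]; rfl

theorem mirror_mk (a b l r) : (mk a b l r).mirror = mk a b (r.map mirror) (l.map mirror) := by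
  rw [mirror, mirrorTrail_eq, mirrorTrail_eq]

@[simp] theorem lo_mirror (B : Banana) : B.mirror.lo = B.lo := by cases B; rw [mirror]; rfl
@[simp] theorem hi_mirror (B : Banana) : B.mirror.hi = B.hi := by cases B; rw [mirror]; rfl
@[simp] theorem top_mirror (B : Banana) : B.mirror.top = B.top := by simp [top]
@[simp] theorem left_mirror (B : Banana) : B.mirror.left = B.right.map mirror := by
  cases B; rw [mirror_mk]; rfl
@[simp] theorem right_mirror (B : Banana) : B.mirror.right = B.left.map mirror := by
  cases B; rw [mirror_mk]; rfl

@[simp] theorem mirror_mirror (B : Banana) : B.mirror.mirror = B := by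
  induction B using ind with
  | h a b l r hl hr =>
    rw [mirror_mk, mirror_mk, List.map_map, List.map_map]
    congr 1
    · conv_rhs => rw [← List.map_id l]
      exact List.map_congr_left hl
    · conv_rhs => rw [← List.map_id r]
      exact List.map_congr_left hr

@[simp] theorem map_mirror_mirror (t : List Banana) : (t.map mirror).map mirror = t := by
  simp [List.map_map, Function.comp_def]

theorem mirror_injective : Function.Injective mirror :=
  Function.LeftInverse.injective (g := mirror) mirror_mirror

theorem inoL_map_mirror_aux (t : List Banana) (h : ∀ C ∈ t, C.mirror.ino = C.ino.reverse) :
    inoL (t.map mirror) = (inoR t).reverse ∧ inoR (t.map mirror) = (inoL t).reverse := by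
  induction t with
  | nil => simp
  | cons C t ih =>
    have hC := h C (by simp)
    have := ih fun D hD => h D (by simp [hD])
    simp [inoL_cons, inoR_cons, this.1, this.2, hC]

-- With `Good.mirror` this carries statements on left trails over to right trails: lists are
-- reversed, positions change sign, values stay.
@[simp] theorem ino_mirror (B : Banana) : B.mirror.ino = B.ino.reverse := by
  induction B using ind with
  | h a b l r hl hr =>
    rw [mirror_mk, ino_mk, ino_mk, (inoL_map_mirror_aux r hr).1, (inoL_map_mirror_aux l hl).2]
    simp

@[simp] theorem inoL_map_mirror (t : List Banana) : inoL (t.map mirror) = (inoR t).reverse :=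
  (inoL_map_mirror_aux t fun C _ => ino_mirror C).1

@[simp] theorem inoR_map_mirror (t : List Banana) : inoR (t.map mirror) = (inoL t).reverse :=
  (inoL_map_mirror_aux t fun C _ => ino_mirror C).2

/-! ### The bananas of a tree -/

theorem mem_bananasTrail {B : Banana} {t : List Banana} :
    B ∈ bananasTrail t ↔ ∃ C ∈ t, B ∈ C.bananas := by
  induction t with
  | nil => simp [bananasTrail]
  | cons C t ih => simp [bananasTrail, ih]

theorem mem_bananas {B T : Banana} :
    B ∈ T.bananas ↔ B = T ∨ (∃ C ∈ T.left, B ∈ C.bananas) ∨ ∃ C ∈ T.right, B ∈ C.bananas := by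
  cases T
  rw [bananas]
  simp [mem_bananasTrail]

theorem self_mem_bananas (T : Banana) : T ∈ T.bananas := mem_bananas.2 (Or.inl rfl)

theorem mem_bananas_of_left {B C T : Banana} (hC : C ∈ T.left) (hB : B ∈ C.bananas) :
    B ∈ T.bananas := mem_bananas.2 (Or.inr (Or.inl ⟨C, hC, hB⟩))

theorem mem_bananas_of_right {B C T : Banana} (hC : C ∈ T.right) (hB : B ∈ C.bananas) :
    B ∈ T.bananas := mem_bananas.2 (Or.inr (Or.inr ⟨C, hC, hB⟩))

theorem bananas_trans {B C T : Banana} (hB : B ∈ C.bananas) (hC : C ∈ T.bananas) :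
    B ∈ T.bananas := by
  induction T using ind with
  | h a b l r hl hr =>
    rcases mem_bananas.1 hC with rfl | ⟨D, hD, h⟩ | ⟨D, hD, h⟩
    · exact hB
    · exact mem_bananas_of_left hD (hl D hD h)
    · exact mem_bananas_of_right hD (hr D hD h)

theorem mirror_mem_bananas {B T : Banana} (h : B ∈ T.bananas) : B.mirror ∈ T.mirror.bananas := by
  induction T using ind with
  | h a b l r hl hr =>
    rcases mem_bananas.1 h with rfl | ⟨D, hD, h⟩ | ⟨D, hD, h⟩
    · exact self_mem_bananas _
    · exact mem_bananas_of_right (C := D.mirror) (by simpa using ⟨D, hD, rfl⟩) (hl D hD h)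
    · exact mem_bananas_of_left (C := D.mirror) (by simpa using ⟨D, hD, rfl⟩) (hr D hD h)

theorem mem_bananas_mirror {B T : Banana} : B ∈ T.mirror.bananas ↔ B.mirror ∈ T.bananas :=
  ⟨fun h => by simpa using mirror_mem_bananas h, fun h => by simpa using mirror_mem_bananas h⟩

theorem ino_subset {B T : Banana} (h : B ∈ T.bananas) {i : ℕ} (hi : i ∈ B.ino) : i ∈ T.ino := by
  induction T using ind with
  | h a b l r hl hr =>
    rcases mem_bananas.1 h with rfl | ⟨D, hD, h⟩ | ⟨D, hD, h⟩
    · exact hi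
    · exact mem_ino.2 (Or.inr (Or.inl ⟨D, hD, Or.inl (hl D hD h)⟩))
    · exact mem_ino.2 (Or.inr (Or.inr ⟨D, hD, Or.inl (hr D hD h)⟩))

/-- Every node is a lower end, or the upper end of a banana below the root. -/
theorem exists_lo_or_top {T : Banana} {i : ℕ} (hi : i ∈ T.ino) :
    (∃ B ∈ T.bananas, B.lo = i) ∨
      ∃ A ∈ T.bananas, ∃ B ∈ A.left ++ A.right, B.top = i := by
  induction T using ind with
  | h a b l r hl hr =>
    rcases mem_ino.1 hi with rfl | ⟨C, hC, h | rfl⟩ | ⟨C, hC, h | rfl⟩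
    · exact Or.inl ⟨_, self_mem_bananas _, rfl⟩
    · rcases hl C hC h with ⟨B, hB, rfl⟩ | ⟨A, hA, hB⟩
      · exact Or.inl ⟨B, mem_bananas_of_left hC hB, rfl⟩
      · exact Or.inr ⟨A, mem_bananas_of_left hC hA, hB⟩
    · exact Or.inr ⟨_, self_mem_bananas _, C, by simpa using Or.inl hC, rfl⟩
    · rcases hr C hC h with ⟨B, hB, rfl⟩ | ⟨A, hA, hB⟩
      · exact Or.inl ⟨B, mem_bananas_of_right hC hB, rfl⟩
      · exact Or.inr ⟨A, mem_bananas_of_right hC hA, hB⟩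
    · exact Or.inr ⟨_, self_mem_bananas _, C, by simpa using Or.inr hC, rfl⟩

theorem mem_bananas_of_child {A B T : Banana} (hA : A ∈ T.bananas) (hB : B ∈ A.left ++ A.right) :
    B ∈ T.bananas := by
  refine bananas_trans ?_ hA
  rcases List.mem_append.1 hB with h | h
  · exact mem_bananas_of_left h (self_mem_bananas B)
  · exact mem_bananas_of_right h (self_mem_bananas B)

/-! ### Validity -/

/-- `C` can be attached to a trail of a banana with lower end `a`. -/
structure Child (v : ℕ → ℝ) (a : ℕ) (C : Banana) : Prop where
  hi_eq : C.hi = (C.top : WithTop ℕ)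
  lo_lt : v a < v C.lo
  lt_top : v C.lo < v C.top
  left_lt : ∀ D ∈ C.left, v D.top < v C.top
  right_lt : ∀ D ∈ C.right, v D.top < v C.top

/-- The local conditions that characterise banana trees. -/
inductive Valid (v : ℕ → ℝ) : Banana → Prop
  | mk {a : ℕ} {b : WithTop ℕ} {l r : List Banana} :
    (∀ C ∈ l, Valid v C) → (∀ C ∈ r, Valid v C) → (∀ C ∈ l, Child v a C) →
    (∀ C ∈ r, Child v a C) → l.Pairwise (fun C D => v C.top < v D.top) →
    r.Pairwise (fun C D => v C.top < v D.top) → Valid v (mk a b l r)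

theorem Valid.valid_left {v : ℕ → ℝ} {B : Banana} (h : Valid v B) : ∀ C ∈ B.left, Valid v C := by
  cases h; assumption
theorem Valid.valid_right {v : ℕ → ℝ} {B : Banana} (h : Valid v B) : ∀ C ∈ B.right, Valid v C := by
  cases h; assumption
theorem Valid.child_left {v : ℕ → ℝ} {B : Banana} (h : Valid v B) :
    ∀ C ∈ B.left, Child v B.lo C := by
  cases h; assumption
theorem Valid.child_right {v : ℕ → ℝ} {B : Banana} (h : Valid v B) :
    ∀ C ∈ B.right, Child v B.lo C := by
  cases h; assumption
theorem Valid.pairwise_left {v : ℕ → ℝ} {B : Banana} (h : Valid v B) :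
    B.left.Pairwise (fun C D => v C.top < v D.top) := by
  cases h; assumption
theorem Valid.pairwise_right {v : ℕ → ℝ} {B : Banana} (h : Valid v B) :
    B.right.Pairwise (fun C D => v C.top < v D.top) := by
  cases h; assumption

theorem Child.mirror {v : ℕ → ℝ} {a : ℕ} {C : Banana} (h : Child v a C) : Child v a C.mirror := by
  refine ⟨by simpa using h.hi_eq, by simpa using h.lo_lt, by simpa using h.lt_top, ?_, ?_⟩
  · simpa using h.right_lt
  · simpa using h.left_lt

theorem Valid.mirror {v : ℕ → ℝ} {B : Banana} (h : Valid v B) : Valid v B.mirror := by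
  induction h with
  | mk hl hr cl cr pl pr ihl ihr =>
    rw [mirror_mk]
    refine .mk ?_ ?_ ?_ ?_ ?_ ?_
    · simpa using ihr
    · simpa using ihl
    · simpa using fun C hC => (cr C hC).mirror
    · simpa using fun C hC => (cl C hC).mirror
    · simpa [List.pairwise_map] using pr
    · simpa [List.pairwise_map] using pl

theorem Child.congr {v w : ℕ → ℝ} {a : ℕ} {C : Banana} (h : Child v a C) (ha : w a = v a)
    (ht : w C.top = v C.top) (hC : ∀ i ∈ C.ino, w i = v i) : Child w a C := by
  refine ⟨h.hi_eq, ?_, ?_, fun D hD => ?_, fun D hD => ?_⟩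
  · rw [ha, hC _ (lo_mem_ino C)]; exact h.lo_lt
  · rw [ht, hC _ (lo_mem_ino C)]; exact h.lt_top
  · rw [ht, hC _ (mem_ino.2 (Or.inr (Or.inl ⟨D, hD, Or.inr rfl⟩)))]; exact h.left_lt D hD
  · rw [ht, hC _ (mem_ino.2 (Or.inr (Or.inr ⟨D, hD, Or.inr rfl⟩)))]; exact h.right_lt D hD

/-- Only values at nodes matter, so the dummy leaf may change its value without affecting bananas
that do not contain it. -/
theorem Valid.congr {v w : ℕ → ℝ} {B : Banana} (h : Valid v B) (hw : ∀ i ∈ B.ino, w i = v i) :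
    Valid w B := by
  induction h with
  | @mk a b l r hl hr cl cr pl pr ihl ihr =>
    have HL : ∀ C ∈ l, (∀ i ∈ C.ino, w i = v i) ∧ w C.top = v C.top := fun C hC =>
      ⟨fun i hi => hw i (mem_ino.2 (Or.inr (Or.inl ⟨C, hC, Or.inl hi⟩))),
        hw _ (mem_ino.2 (Or.inr (Or.inl ⟨C, hC, Or.inr rfl⟩)))⟩
    have HR : ∀ C ∈ r, (∀ i ∈ C.ino, w i = v i) ∧ w C.top = v C.top := fun C hC =>
      ⟨fun i hi => hw i (mem_ino.2 (Or.inr (Or.inr ⟨C, hC, Or.inl hi⟩))),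
        hw _ (mem_ino.2 (Or.inr (Or.inr ⟨C, hC, Or.inr rfl⟩)))⟩
    have ha : w a = v a := hw _ (lo_mem_ino (Banana.mk a b l r))
    refine .mk (fun C hC => ihl C hC (HL C hC).1) (fun C hC => ihr C hC (HR C hC).1)
      (fun C hC => (cl C hC).congr ha (HL C hC).2 (HL C hC).1)
      (fun C hC => (cr C hC).congr ha (HR C hC).2 (HR C hC).1) ?_ ?_
    · refine pl.imp_of_mem fun {C D} hC hD h => ?_
      rw [(HL C hC).2, (HL D hD).2]; exact h
    · refine pr.imp_of_mem fun {C D} hC hD h => ?_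
      rw [(HR C hC).2, (HR D hD).2]; exact h

theorem Valid.of_mem {v : ℕ → ℝ} {B T : Banana} (h : Valid v T) (hB : B ∈ T.bananas) :
    Valid v B := by
  induction h with
  | mk hl hr cl cr pl pr ihl ihr =>
    rcases mem_bananas.1 hB with rfl | ⟨D, hD, h⟩ | ⟨D, hD, h⟩
    · exact .mk hl hr cl cr pl pr
    · exact ihl D hD h
    · exact ihr D hD h

theorem Valid.child_of_mem {v : ℕ → ℝ} {A C : Banana} (h : Valid v A)
    (hC : C ∈ A.left ++ A.right) : Child v A.lo C := by
  rcases List.mem_append.1 hC with h' | h'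
  · exact h.child_left C h'
  · exact h.child_right C h'

theorem Valid.lo_le {v : ℕ → ℝ} {B : Banana} (h : Valid v B) {i : ℕ} (hi : i ∈ B.ino) :
    v B.lo ≤ v i := by
  induction h with
  | mk hl hr cl cr pl pr ihl ihr =>
    rcases mem_ino.1 hi with rfl | ⟨C, hC, h | rfl⟩ | ⟨C, hC, h | rfl⟩
    · exact le_rfl
    · exact ((cl C hC).lo_lt.le).trans (ihl C hC h)
    · exact ((cl C hC).lo_lt.trans (cl C hC).lt_top).le
    · exact ((cr C hC).lo_lt.le).trans (ihr C hC h)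
    · exact ((cr C hC).lo_lt.trans (cr C hC).lt_top).le

theorem Valid.lo_lt {v : ℕ → ℝ} {B : Banana} (h : Valid v B) {i : ℕ} (hi : i ∈ B.ino)
    (hne : i ≠ B.lo) : v B.lo < v i := by
  rcases mem_ino.1 hi with h' | ⟨C, hC, h' | rfl⟩ | ⟨C, hC, h' | rfl⟩
  · exact absurd h' hne
  · exact (h.child_left C hC).lo_lt.trans_le ((h.valid_left C hC).lo_le h')
  · exact (h.child_left C hC).lo_lt.trans (h.child_left C hC).lt_top
  · exact (h.child_right C hC).lo_lt.trans_le ((h.valid_right C hC).lo_le h')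
  · exact (h.child_right C hC).lo_lt.trans (h.child_right C hC).lt_top

/-- A node inside an attached banana is lower than the upper end of that banana, which is on a
trail. The bound `K` stands in for the value of the upper end, which may be `⊤`. -/
theorem Valid.lt_of_trails {v : ℕ → ℝ} {B : Banana} (h : Valid v B) {K : ℝ} (h0 : v B.lo < K)
    (hl : ∀ D ∈ B.left, v D.top < K) (hr : ∀ D ∈ B.right, v D.top < K) {i : ℕ} (hi : i ∈ B.ino) :
    v i < K := by
  induction h generalizing K with
  | mk _ _ cl cr pl pr ihl ihr =>
    rcases mem_ino.1 hi with rfl | ⟨C, hC, h | rfl⟩ | ⟨C, hC, h | rfl⟩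
    · exact h0
    · exact (ihl C hC (cl C hC).lt_top (cl C hC).left_lt (cl C hC).right_lt h).trans (hl C hC)
    · exact hl C hC
    · exact (ihr C hC (cr C hC).lt_top (cr C hC).left_lt (cr C hC).right_lt h).trans (hr C hC)
    · exact hr C hC

theorem Child.lt_of_mem {v : ℕ → ℝ} {a : ℕ} {C : Banana} (h : Child v a C) (hC : Valid v C) {i : ℕ}
    (hi : i ∈ C.ino) : v i < v C.top :=
  hC.lt_of_trails h.lt_top h.left_lt h.right_lt hi

/-! ### Uniqueness of ends -/

theorem bananas_eq_cons (T : Banana) :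
    T.bananas = T :: (bananasTrail T.left ++ bananasTrail T.right) := by
  cases T; rw [bananas]; rfl

/-- The bananas below the root. -/
def proper (T : Banana) : List Banana := bananasTrail T.left ++ bananasTrail T.right

theorem bananas_eq (T : Banana) : T.bananas = T :: T.proper := bananas_eq_cons T

theorem perm_trail_aux (t : List Banana)
    (h : ∀ C ∈ t, (C.bananas.map lo ++ C.proper.map top).Perm C.ino) :
    ((bananasTrail t).map lo ++ (bananasTrail t).map top).Perm (inoL t) ∧
    ((bananasTrail t).map lo ++ (bananasTrail t).map top).Perm (inoR t) := by
  induction t with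
  | nil => simp [bananasTrail]
  | cons C t ih =>
    have hC := h C (by simp)
    obtain ⟨h1, h2⟩ := ih fun D hD => h D (by simp [hD])
    rw [bananasTrail, inoL_cons, inoR_cons, ← Multiset.coe_eq_coe, ← Multiset.coe_eq_coe]
    rw [← Multiset.coe_eq_coe] at h1 h2 hC
    simp only [bananas_eq, List.map_append, List.map_cons, ← Multiset.coe_add,
      ← Multiset.cons_coe, ← Multiset.singleton_add, List.cons_append, Multiset.coe_nil] at *
    constructor
    · rw [← h1, ← hC]; simp only [add_zero]; abel
    · rw [← h2, ← hC]; abel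

/-- Each node occurs once, either as a lower end or as the upper end of a banana below the root.
Distinctness of the in-order list thereby becomes uniqueness of the banana with a given end. -/
theorem perm_ino (T : Banana) : (T.bananas.map lo ++ T.proper.map top).Perm T.ino := by
  induction T using ind with
  | h a b l r hl hr =>
    have h1 := (perm_trail_aux l hl).1
    have h2 := (perm_trail_aux r hr).2
    rw [ino_mk, bananas_eq, proper, ← Multiset.coe_eq_coe]
    rw [← Multiset.coe_eq_coe] at h1 h2
    simp only [List.map_append, List.map_cons, ← Multiset.coe_add, left_mk, right_mk, lo_mk,
      ← Multiset.cons_coe, ← Multiset.singleton_add, List.cons_append] at *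
    rw [← h1, ← h2]; abel

theorem mem_proper {B T : Banana} (h : B ∈ T.bananas) : B = T ∨ B ∈ T.proper := by
  rw [bananas_eq] at h; simpa using h

theorem eq_of_lo_eq {T B C : Banana} (hT : T.ino.Nodup) (hB : B ∈ T.bananas) (hC : C ∈ T.bananas)
    (h : B.lo = C.lo) : B = C := by
  have := (perm_ino T).nodup_iff.2 hT
  exact List.inj_on_of_nodup_map (List.nodup_append.1 this).1 hB hC h

theorem eq_of_top_eq {T B C : Banana} (hT : T.ino.Nodup) (hB : B ∈ T.proper) (hC : C ∈ T.proper)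
    (h : B.top = C.top) : B = C := by
  have := (perm_ino T).nodup_iff.2 hT
  exact List.inj_on_of_nodup_map (List.nodup_append.1 this).2.1 hB hC h

theorem lo_ne_top {T B C : Banana} (hT : T.ino.Nodup) (hB : B ∈ T.bananas) (hC : C ∈ T.proper) :
    B.lo ≠ C.top := by
  have := (perm_ino T).nodup_iff.2 hT
  exact (List.nodup_append.1 this).2.2 _ (List.mem_map_of_mem hB) _ (List.mem_map_of_mem hC)

theorem top_mem_ino {T C : Banana} (hC : C ∈ T.proper) : C.top ∈ T.ino :=
  (perm_ino T).subset (List.mem_append_right _ (List.mem_map_of_mem hC))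

theorem Valid.hi_proper {v : ℕ → ℝ} {T : Banana} (h : Valid v T) {B : Banana} (hB : B ∈ T.proper) :
    B.hi = (B.top : WithTop ℕ) := by
  induction h with
  | mk hl hr cl cr pl pr ihl ihr =>
    rw [proper, List.mem_append, mem_bananasTrail, mem_bananasTrail] at hB
    rcases hB with ⟨C, hC, h⟩ | ⟨C, hC, h⟩
    · rcases mem_proper h with rfl | h
      · exact (cl _ hC).hi_eq
      · exact ihl C hC h
    · rcases mem_proper h with rfl | h
      · exact (cr _ hC).hi_eq
      · exact ihr C hC h

theorem proper_of_child {A C T : Banana} (hA : A ∈ T.bananas) (hC : C ∈ A.left ++ A.right) :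
    C ∈ T.proper := by
  have key : ∀ T : Banana, C ∈ T.left ++ T.right → C ∈ T.proper := fun T h => by
    rw [proper, List.mem_append, mem_bananasTrail, mem_bananasTrail]
    rcases List.mem_append.1 h with h | h
    · exact Or.inl ⟨C, h, self_mem_bananas C⟩
    · exact Or.inr ⟨C, h, self_mem_bananas C⟩
  rcases mem_proper hA with rfl | hA
  · exact key _ hC
  · rw [proper, List.mem_append, mem_bananasTrail, mem_bananasTrail] at hA ⊢
    rcases hA with ⟨D, hD, h⟩ | ⟨D, hD, h⟩
    · exact Or.inl ⟨D, hD, mem_bananas_of_child h hC⟩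
    · exact Or.inr ⟨D, hD, mem_bananas_of_child h hC⟩

theorem bananas_of_proper {B T : Banana} (h : B ∈ T.proper) : B ∈ T.bananas := by
  rw [bananas_eq]; exact List.mem_cons_of_mem _ h

/-- Each banana below the root is attached to a unique banana. -/
theorem perm_children_aux (t : List Banana)
    (h : ∀ C ∈ t, (C.bananas.flatMap fun B => B.left ++ B.right).Perm C.proper) :
    (t ++ (bananasTrail t).flatMap fun B => B.left ++ B.right).Perm (bananasTrail t) := by
  induction t with
  | nil => simp [bananasTrail]
  | cons C t ih =>
    have hC := h C (by simp)
    have h1 := ih fun D hD => h D (by simp [hD])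
    rw [bananasTrail, bananas_eq, ← Multiset.coe_eq_coe]
    rw [← Multiset.coe_eq_coe] at h1 hC
    rw [bananas_eq] at hC
    simp only [List.flatMap_append, ← Multiset.coe_add, List.flatMap_cons,
      ← Multiset.cons_coe, ← Multiset.singleton_add, List.cons_append] at *
    rw [← h1, ← hC]; abel

theorem perm_children (T : Banana) :
    (T.bananas.flatMap fun B => B.left ++ B.right).Perm T.proper := by
  induction T using ind with
  | h a b l r hl hr =>
    have h1 := perm_children_aux l hl
    have h2 := perm_children_aux r hr
    rw [bananas_eq, ← Multiset.coe_eq_coe]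
    simp only [proper, left_mk, right_mk]
    rw [← Multiset.coe_eq_coe] at h1 h2
    simp only [List.flatMap_append, ← Multiset.coe_add, List.flatMap_cons, left_mk, right_mk] at *
    rw [← h1, ← h2]; abel

/-- By `perm_children` the concatenated trails of all bananas list each proper banana once, so the
trails of different bananas are disjoint. -/
theorem parent_unique {T A A' C C' : Banana} (hT : T.ino.Nodup) (hA : A ∈ T.bananas)
    (hA' : A' ∈ T.bananas) (hC : C ∈ A.left ++ A.right) (hC' : C' ∈ A'.left ++ A'.right)
    (h : C.top = C'.top) : A = A' := by
  have hCC : C = C' := eq_of_top_eq hT (proper_of_child hA hC) (proper_of_child hA' hC') h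
  subst hCC
  have h1 : T.proper.Nodup :=
    (List.nodup_append.1 ((perm_ino T).nodup_iff.2 hT)).2.1.of_map _
  have h2 := (perm_children T).nodup_iff.2 h1
  rw [List.nodup_flatMap] at h2
  by_contra hne
  have : Std.Symm (Function.onFun List.Disjoint fun B : Banana => B.left ++ B.right) :=
    ⟨fun _ _ h => h.symm⟩
  exact h2.2.forall hA hA' hne hC hC'

end Banana
end BananaTree

namespace BananaTree
open Banana

/-! ### Banana trees and valid bananas -/

/-- At a node `b` the path with the larger minimum is closed by `b` and becomes the topmost banana
on a trail of the other path. The bounds by the value of the root say that `b` exceeds everything on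
both paths, which is what `Child` and the monotonicity of the trail require. -/
theorem FullTree.toBanana_spec (v : ℕ → ℝ) (T : FullTree) (hT : T.Increasing v)
    (hd : T.inorder.Pairwise fun i j => v i ≠ v j) :
    Valid v (T.toBanana v) ∧ (T.toBanana v).ino = T.inorder ∧ (T.toBanana v).hi = ⊤ ∧
      v (T.toBanana v).lo ≤ v T.root ∧ (∀ D ∈ (T.toBanana v).left, v D.top ≤ v T.root) ∧
      ∀ D ∈ (T.toBanana v).right, v D.top ≤ v T.root := by
  induction T with
  | leaf a =>
    refine ⟨.mk ?_ ?_ ?_ ?_ ?_ ?_, ?_⟩ <;> simp [FullTree.toBanana, FullTree.inorder, ino_mk, FullTree.root]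
  | node l b r ihl ihr =>
    obtain ⟨h1, h2, h3, h4⟩ := hT
    rw [FullTree.inorder, List.pairwise_append, List.pairwise_cons] at hd
    obtain ⟨vA, iA, tA, rA, lA, RA⟩ := ihl h3 hd.1
    obtain ⟨vC, iC, tC, rC, lC, RC⟩ := ihr h4 hd.2.1.2
    have hne : v (l.toBanana v).lo ≠ v (r.toBanana v).lo :=
      hd.2.2 _ (iA ▸ lo_mem_ino _) _ (List.mem_cons_of_mem _ (iC ▸ lo_mem_ino _))
    rw [FullTree.toBanana, FullTree.inorder, FullTree.root]
    generalize l.toBanana v = A at *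
    generalize r.toBanana v = C at *
    by_cases h : v A.lo < v C.lo
    · simp only [h, if_true]
      have hc : Child v A.lo (mk C.lo (b : WithTop ℕ) C.left C.right) :=
        ⟨by simp, h, rC.trans_lt h2, fun D hD => (lC D hD).trans_lt h2,
          fun D hD => (RC D hD).trans_lt h2⟩
      have hv : Valid v (mk C.lo (b : WithTop ℕ) C.left C.right) :=
        .mk vC.valid_left vC.valid_right vC.child_left vC.child_right vC.pairwise_left
          vC.pairwise_right
      refine ⟨.mk vA.valid_left ?_ vA.child_left ?_ vA.pairwise_left ?_, ?_, rfl, ?_, ?_, ?_⟩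
      · simpa [or_imp, forall_and] using ⟨vA.valid_right, hv⟩
      · simpa [or_imp, forall_and] using ⟨vA.child_right, hc⟩
      · rw [List.pairwise_append]
        refine ⟨vA.pairwise_right, by simp, fun D hD E hE => ?_⟩
        rw [List.mem_singleton.1 hE]
        exact (RA D hD).trans_lt h1
      · rw [ino_mk, inoR_append, inoR_cons, ino_mk, inoR_nil, ← iA, ← iC, ino_eq A, ino_eq C]
        simp
      · exact (rA.trans_lt h1).le
      · exact fun D hD => ((lA D hD).trans_lt h1).le
      · intro D hD
        rcases List.mem_append.1 hD with hD | hD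
        · exact ((RA D hD).trans_lt h1).le
        · rw [List.mem_singleton.1 hD]; exact le_rfl
    · have h' : v C.lo < v A.lo := lt_of_le_of_ne (not_lt.1 h) hne.symm
      simp only [h, if_false]
      have hc : Child v C.lo (mk A.lo (b : WithTop ℕ) A.left A.right) :=
        ⟨by simp, h', rA.trans_lt h1, fun D hD => (lA D hD).trans_lt h1,
          fun D hD => (RA D hD).trans_lt h1⟩
      have hv : Valid v (mk A.lo (b : WithTop ℕ) A.left A.right) :=
        .mk vA.valid_left vA.valid_right vA.child_left vA.child_right vA.pairwise_left
          vA.pairwise_right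
      refine ⟨.mk ?_ vC.valid_right ?_ vC.child_right ?_ vC.pairwise_right, ?_, rfl, ?_, ?_, ?_⟩
      · simpa [or_imp, forall_and] using ⟨vC.valid_left, hv⟩
      · simpa [or_imp, forall_and] using ⟨vC.child_left, hc⟩
      · rw [List.pairwise_append]
        refine ⟨vC.pairwise_left, by simp, fun D hD E hE => ?_⟩
        rw [List.mem_singleton.1 hE]
        exact (lC D hD).trans_lt h2
      · rw [ino_mk, inoL_append, inoL_cons, ino_mk, inoL_nil, ← iA, ← iC, ino_eq A, ino_eq C]
        simp
      · exact (rC.trans_lt h2).le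
      · intro D hD
        rcases List.mem_append.1 hD with hD | hD
        · exact ((lC D hD).trans_lt h2).le
        · rw [List.mem_singleton.1 hD]; exact le_rfl
      · exact fun D hD => ((RC D hD).trans_lt h2).le

theorem IsUpTree.valid {v : ℕ → ℝ} {s t : ℕ} {B : Banana} (h : IsUpTree v s t B)
    (hd : (critPoints v s t).Pairwise fun i j => v i ≠ v j) :
    Valid v B ∧ B.ino = critPoints v s t ∧ B.hi = ⊤ := by
  obtain ⟨T, h1, h2, rfl⟩ := h
  obtain ⟨a, b, c, -⟩ := T.toBanana_spec v h2 (h1 ▸ hd)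
  exact ⟨a, b.trans h1, c⟩

/-- A valid banana is the path decomposition of a full binary tree. -/
theorem exists_fullTree (v : ℕ → ℝ) (n : ℕ) (a : ℕ) (L R : List Banana)
    (hn : (mk a ⊤ L R).ino.length ≤ n) (hv : Valid v (mk a ⊤ L R))
    (hd : (mk a ⊤ L R).ino.Pairwise fun i j => v i ≠ v j) :
    ∃ T : FullTree, T.inorder = (mk a ⊤ L R).ino ∧ T.Increasing v ∧ T.toBanana v = mk a ⊤ L R ∧
      ∀ K, v a < K → (∀ C ∈ L, v C.top < K) → (∀ C ∈ R, v C.top < K) → v T.root < K := by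
  -- `n` bounds the number of nodes. Structural induction does not apply, since shortening a trail
  -- does not give a part of the banana.
  induction n generalizing a L R with
  | zero => simp [ino_mk] at hn
  | succ n ih =>
    -- The root of the full tree is the higher of the two topmost trail nodes. Here it is the top of
    -- `C`, on the right trail: the left subtree comes from the banana without `C`, the right one
    -- from the trails of `C`.
    have hR : ∀ R' C, R = R' ++ [C] → (∀ D ∈ L, v D.top < v C.top) →
      ∃ T : FullTree, T.inorder = (mk a ⊤ L R).ino ∧ T.Increasing v ∧
        T.toBanana v = mk a ⊤ L R ∧
        ∀ K, v a < K → (∀ C ∈ L, v C.top < K) → (∀ C ∈ R, v C.top < K) → v T.root < K := by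
      rintro R' ⟨c, b, l, r⟩ rfl hlt
      have hC := hv.child_right (mk c b l r) (by simp)
      have hvC := hv.valid_right (mk c b l r) (by simp)
      obtain ⟨b, rfl⟩ : ∃ b' : ℕ, b = (b' : WithTop ℕ) := ⟨_, hC.hi_eq⟩
      have hp := List.pairwise_append.1 hv.pairwise_right
      simp only [ino_mk, inoR_append, inoR_cons, inoR_nil, List.append_nil, top_mk,
        untopD_natCast] at hd hn
      simp only [List.length_append, List.length_cons] at hn
      obtain ⟨T₁, i1, m1, b1, r1⟩ := ih a L R' (by simp [ino_mk]; omega)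
        (.mk hv.valid_left (fun C hC => hv.valid_right C (by simp [hC])) hv.child_left
          (fun C hC => hv.child_right C (by simp [hC])) hv.pairwise_left hp.1)
        (by rw [ino_mk]; exact hd.sublist (by simp))
      obtain ⟨T₂, i2, m2, b2, r2⟩ := ih c l r (by simp [ino_mk]; omega)
        (.mk hvC.valid_left hvC.valid_right hvC.child_left hvC.child_right hvC.pairwise_left
          hvC.pairwise_right)
        (by
          rw [ino_mk]
          refine hd.sublist ?_
          refine List.Sublist.trans ?_ (List.sublist_append_right _ _)
          refine List.Sublist.trans ?_ (List.sublist_cons_self _ _)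
          refine List.Sublist.trans ?_ (List.sublist_append_right _ _)
          exact List.sublist_cons_self _ _)
      refine ⟨.node T₁ b T₂, ?_, ⟨?_, ?_, m1, m2⟩, ?_, ?_⟩
      · simp [FullTree.inorder, i1, i2, ino_mk, inoR_append, inoR_cons]
      · exact r1 _ (hC.lo_lt.trans hC.lt_top) hlt
          fun D hD => hp.2.2 D hD (mk c b l r) (by simp)
      · exact r2 _ hC.lt_top hC.left_lt hC.right_lt
      · have := hC.lo_lt
        simp only [lo_mk] at this
        simp [FullTree.toBanana, b1, b2, this]
      · exact fun K _ _ h => h _ (by simp : mk c (b : WithTop ℕ) l r ∈ _)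
    have hL : ∀ L' C, L = L' ++ [C] → (∀ D ∈ R, v D.top < v C.top) →
      ∃ T : FullTree, T.inorder = (mk a ⊤ L R).ino ∧ T.Increasing v ∧
        T.toBanana v = mk a ⊤ L R ∧
        ∀ K, v a < K → (∀ C ∈ L, v C.top < K) → (∀ C ∈ R, v C.top < K) → v T.root < K := by
      rintro L' ⟨c, b, l, r⟩ rfl hlt
      have hC := hv.child_left (mk c b l r) (by simp)
      have hvC := hv.valid_left (mk c b l r) (by simp)
      obtain ⟨b, rfl⟩ : ∃ b' : ℕ, b = (b' : WithTop ℕ) := ⟨_, hC.hi_eq⟩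
      have hp := List.pairwise_append.1 hv.pairwise_left
      simp only [ino_mk, inoL_append, inoL_cons, inoL_nil, List.nil_append, top_mk,
        untopD_natCast] at hd hn
      simp only [List.length_append, List.length_cons] at hn
      obtain ⟨T₁, i1, m1, b1, r1⟩ := ih a L' R (by simp [ino_mk]; omega)
        (.mk (fun C hC => hv.valid_left C (by simp [hC])) hv.valid_right
          (fun C hC => hv.child_left C (by simp [hC])) hv.child_right hp.1 hv.pairwise_right)
        (by
          rw [ino_mk]
          rw [List.append_assoc] at hd
          exact hd.sublist (List.sublist_append_right _ _))
      obtain ⟨T₂, i2, m2, b2, r2⟩ := ih c l r (by simp [ino_mk]; omega)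
        (.mk hvC.valid_left hvC.valid_right hvC.child_left hvC.child_right hvC.pairwise_left
          hvC.pairwise_right)
        (by
          rw [ino_mk]
          refine hd.sublist ?_
          refine List.Sublist.trans ?_ (List.sublist_append_left _ _)
          refine List.Sublist.trans ?_ (List.sublist_append_left _ _)
          exact List.sublist_append_left _ _)
      refine ⟨.node T₂ b T₁, ?_, ⟨?_, ?_, m2, m1⟩, ?_, ?_⟩
      · simp [FullTree.inorder, i1, i2, ino_mk, inoL_append, inoL_cons]
      · exact r2 _ hC.lt_top hC.left_lt hC.right_lt
      · exact r1 _ (hC.lo_lt.trans hC.lt_top) 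
          (fun D hD => hp.2.2 D hD (mk c b l r) (by simp)) hlt
      · have := hC.lo_lt
        simp only [lo_mk] at this
        simp [FullTree.toBanana, b1, b2, not_lt.2 this.le]
      · exact fun K _ h _ => h _ (by simp : mk c (b : WithTop ℕ) l r ∈ _)
    rcases List.eq_nil_or_concat' L with rfl | ⟨L', C, rfl⟩ <;>
      rcases List.eq_nil_or_concat' R with rfl | ⟨R', D, rfl⟩
    · exact ⟨.leaf a, by simp [FullTree.inorder, ino_mk], trivial, rfl, fun K h _ _ => h⟩
    · exact hR R' D rfl (by simp)
    · exact hL L' C rfl (by simp)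
    · have hpl := List.pairwise_append.1 hv.pairwise_left
      have hpr := List.pairwise_append.1 hv.pairwise_right
      -- With both trails nonempty, their topmost nodes compete for the root; distinct values
      -- decide.
      have hCD : v C.top ≠ v D.top := by
        rw [ino_mk, List.pairwise_append] at hd
        exact hd.2.2 _ (mem_inoL.2 ⟨C, by simp, Or.inr rfl⟩) _
          (List.mem_cons_of_mem _ (mem_inoR.2 ⟨D, by simp, Or.inr rfl⟩))
      rcases lt_or_gt_of_ne hCD with h | h
      · refine hR R' D rfl fun E hE => ?_
        rcases List.mem_append.1 hE with hE | hE
        · exact (hpl.2.2 E hE C (by simp)).trans h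
        · rw [List.mem_singleton.1 hE]; exact h
      · refine hL L' C rfl fun E hE => ?_
        rcases List.mem_append.1 hE with hE | hE
        · exact (hpr.2.2 E hE D (by simp)).trans h
        · rw [List.mem_singleton.1 hE]; exact h

/-- Converse of `IsUpTree.valid`; between the two, the argument deals with valid bananas and
in-order lists instead of full binary trees. -/
theorem isUpTree_of_valid {v : ℕ → ℝ} {s t : ℕ} {B : Banana} (hB : B.hi = ⊤) (hv : Valid v B)
    (hi : B.ino = critPoints v s t) (hd : (critPoints v s t).Pairwise fun i j => v i ≠ v j) :
    IsUpTree v s t B := by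
  obtain ⟨a, b, l, r⟩ := B
  obtain rfl : b = ⊤ := hB
  obtain ⟨T, h1, h2, h3, -⟩ := exists_fullTree v _ a l r le_rfl hv (hi ▸ hd)
  exact ⟨T, h1.trans hi, h2, h3.symm⟩

end BananaTree

namespace BananaTree
namespace Banana

/-! ### Windows -/

variable {v : ℕ → ℝ} {pos : ℕ → ℤ}

/-- A valid banana whose nodes are sorted by position. -/
structure Good (v : ℕ → ℝ) (pos : ℕ → ℤ) (T : Banana) : Prop where
  valid : Valid v T
  sorted : T.ino.Pairwise fun i j => pos i < pos j

/-- Positions are a separate integer-valued function so that mirroring can negate them; the cut will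
be at position zero. -/
theorem Good.mirror {T : Banana} (h : Good v pos T) : Good v (-pos) T.mirror :=
  ⟨h.valid.mirror, by simpa [List.pairwise_reverse] using h.sorted⟩

theorem nodup_of_sorted {l : List ℕ} (h : l.Pairwise fun i j => pos i < pos j) : l.Nodup :=
  h.imp fun h e => by simp [e] at h

theorem inj_of_sorted {l : List ℕ} (h : l.Pairwise fun i j => pos i < pos j) {i j : ℕ} (hi : i ∈ l)
    (hj : j ∈ l) (e : pos i = pos j) : i = j := by
  have : (l.map pos).Nodup := by
    rw [List.Nodup, List.pairwise_map]; exact h.imp fun h => h.ne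
  exact List.inj_on_of_nodup_map this hi hj e

theorem Good.nodup {T : Banana} (h : Good v pos T) : T.ino.Nodup := nodup_of_sorted h.sorted

theorem Good.inj {T : Banana} (h : Good v pos T) {i j : ℕ} (hi : i ∈ T.ino) (hj : j ∈ T.ino)
    (e : pos i = pos j) : i = j := inj_of_sorted h.sorted hi hj e

theorem Good.lt_of_ne {T : Banana} (h : Good v pos T) {i j : ℕ} (hi : i ∈ T.ino) (hj : j ∈ T.ino)
    (hle : pos i ≤ pos j) (hne : i ≠ j) : pos i < pos j :=
  lt_of_le_of_ne hle fun e => hne (h.inj hi hj e)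

/-- Going up a left trail means going left, and a banana attached to a left trail lies to the left
of its own upper end. -/
theorem sorted_inoL {t : List Banana} (h : (inoL t).Pairwise fun i j => pos i < pos j) :
    (∀ C ∈ t, (C.ino.Pairwise fun i j => pos i < pos j) ∧ ∀ i ∈ C.ino, pos i < pos C.top) ∧
    t.Pairwise fun C D => ∀ i, i ∈ D.ino ∨ i = D.top → ∀ j, j ∈ C.ino ∨ j = C.top →
      pos i < pos j := by
  induction t with
  | nil => simp
  | cons C t ih =>
    rw [inoL_cons, List.pairwise_append, List.pairwise_append] at h
    obtain ⟨h1, ⟨h2, -, h3⟩, h4⟩ := h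
    obtain ⟨i1, i2⟩ := ih h1
    refine ⟨?_, List.pairwise_cons.2 ⟨?_, i2⟩⟩
    · simp only [List.mem_cons, forall_eq_or_imp]
      exact ⟨⟨h2, fun i hi => h3 i hi _ (by simp)⟩, i1⟩
    · intro D hD i hi j hj
      exact h4 i (mem_inoL.2 ⟨D, hD, hi⟩) j (by simpa using hj)

/-- What the position of a banana in a tree says about the values, if the lower end is to the left
of the upper end. -/
structure LWin (v : ℕ → ℝ) (pos : ℕ → ℤ) (l : List ℕ) (B : Banana) : Prop where
  hi_eq : B.hi = (B.top : WithTop ℕ)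
  top_mem : B.top ∈ l
  sub : ∀ i ∈ B.ino, i ∈ l
  pos_lt : ∀ i ∈ B.ino, pos i < pos B.top
  lt_top : ∀ i ∈ B.ino, v i < v B.top
  lo_le : ∀ i ∈ B.ino, v B.lo ≤ v i
  conv : ∀ i ∈ B.ino, ∀ j ∈ l, pos i ≤ pos j → pos j < pos B.top → j ∈ B.ino
  border : ∀ j ∈ l, pos j < pos B.top →
    (∀ w ∈ l, pos j ≤ pos w → pos w < pos B.top → v w < v B.top) → j ∈ B.ino
  out : ∃ c ∈ l, pos B.top < pos c ∧ v c < v B.lo ∧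
    ∀ w ∈ l, pos B.top < pos w → pos w ≤ pos c → v w < v B.top

theorem Good.left {A C : Banana} (h : Good v pos A) (hC : C ∈ A.left) : Good v pos C := by
  have := h.sorted
  rw [ino_eq, List.pairwise_append] at this
  exact ⟨h.valid.valid_left C hC, ((sorted_inoL this.1).1 C hC).1⟩

theorem Good.right {A C : Banana} (h : Good v pos A) (hC : C ∈ A.right) : Good v pos C := by
  have := (h.mirror.left (C := C.mirror) (by simpa using ⟨C, hC, rfl⟩)).mirror
  simpa using this

theorem Good.of_mem {B T : Banana} (h : Good v pos T) (hB : B ∈ T.bananas) : Good v pos B := by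
  induction T using ind with
  | h a b l r hl hr =>
    rcases mem_bananas.1 hB with rfl | ⟨D, hD, hB⟩ | ⟨D, hD, hB⟩
    · exact h
    · exact hl D hD (h.left hD) hB
    · exact hr D hD (h.right hD) hB

theorem Good.pos_left {A C : Banana} (h : Good v pos A) (hC : C ∈ A.left) :
    (∀ i ∈ C.ino, pos i < pos C.top) ∧ pos C.top < pos A.lo := by
  have := h.sorted
  rw [ino_eq, List.pairwise_append] at this
  exact ⟨((sorted_inoL this.1).1 C hC).2,
    this.2.2 _ (mem_inoL.2 ⟨C, hC, Or.inr rfl⟩) _ (by simp)⟩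

theorem Good.pairwise_left {A : Banana} (h : Good v pos A) :
    A.left.Pairwise fun C D => ∀ i, i ∈ D.ino ∨ i = D.top → ∀ j, j ∈ C.ino ∨ j = C.top →
      pos i < pos j := by
  have := h.sorted
  rw [ino_eq, List.pairwise_append] at this
  exact (sorted_inoL this.1).2

/-- The window of `C` is delimited on the left by the next node up the trail, if there is one, which
is higher than `C.top`. On the right one reaches the smaller value at `A.lo` while passing only
lower trail nodes and the bananas they carry. -/
theorem Good.lwin_left {A C : Banana} (h : Good v pos A) (hC : C ∈ A.left) :
    LWin v pos A.ino C := by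
  have hc := h.valid.child_left C hC
  have hvC := h.valid.valid_left C hC
  have hvp := h.valid.pairwise_left
  have hs := h.sorted
  have hchild := h.valid.child_left
  have hval := h.valid.valid_left
  obtain ⟨L₁, L₂, hL⟩ := List.append_of_mem hC
  have hsub : ∀ i, i ∈ C.ino ∨ i = C.top → i ∈ A.ino := fun i hi =>
    mem_ino.2 (Or.inr (Or.inl ⟨C, hC, hi⟩))
  rw [hL, List.pairwise_append, List.pairwise_cons] at hvp
  obtain ⟨-, ⟨hvp2, -⟩, hvp1⟩ := hvp
  have hino : A.ino = inoL L₂ ++ (C.ino ++ C.top :: (inoL L₁ ++ A.lo :: inoR A.right)) := by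
    rw [ino_eq, hL, inoL_append, inoL_cons]; simp
  rw [hino, List.pairwise_append, List.pairwise_append, List.pairwise_cons,
    List.pairwise_append] at hs
  obtain ⟨s2, ⟨sC, ⟨st, s1, -, s1'⟩, sC'⟩, s2'⟩ := hs
  have hmem : ∀ j ∈ A.ino, j ∈ inoL L₂ ∨ j ∈ C.ino ∨ pos C.top ≤ pos j := by
    intro j hj
    rw [hino, List.mem_append, List.mem_append, List.mem_cons] at hj
    rcases hj with hj | hj | rfl | hj
    · exact Or.inl hj
    · exact Or.inr (Or.inl hj)
    · exact Or.inr (Or.inr le_rfl)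
    · exact Or.inr (Or.inr (st _ hj).le)
  refine ⟨hc.hi_eq, hsub _ (Or.inr rfl), fun i hi => hsub i (Or.inl hi),
    fun i hi => sC' i hi _ (by simp), fun i hi => hc.lt_of_mem hvC hi, fun i hi => hvC.lo_le hi,
    ?_, ?_, ?_⟩
  · intro i hi j hj hij hjt
    rcases hmem j hj with hj | hj | hj
    · have := s2' j hj i (by simp [hi]); omega
    · exact hj
    · omega
  · intro j hj hjt hw
    rcases hmem j hj with hj | hj | hj
    · exfalso
      cases L₂ with
      | nil => simp at hj
      | cons E L₂ =>
        have hE : E ∈ A.left := by rw [hL]; simp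
        have h1 : pos j ≤ pos E.top := by
          rw [inoL_cons, ← List.append_assoc, List.pairwise_append] at s2
          rw [inoL_cons, ← List.append_assoc, List.mem_append, List.mem_singleton] at hj
          rcases hj with hj | rfl
          · exact (s2.2.2 j hj _ (by simp)).le
          · exact le_rfl
        have := hw E.top (mem_ino.2 (Or.inr (Or.inl ⟨E, hE, Or.inr rfl⟩))) h1
          (s2' _ (mem_inoL.2 ⟨E, by simp, Or.inr rfl⟩) _ (by simp))
        exact absurd (hvp2 E (by simp)) this.not_gt
    · exact hj
    · omega
  · refine ⟨A.lo, lo_mem_ino A, st _ (by simp), hc.lo_lt, fun w hw h1 h2 => ?_⟩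
    rw [hino, List.mem_append, List.mem_append, List.mem_cons, List.mem_append, List.mem_cons] at hw
    rcases hw with hw | hw | rfl | hw | rfl | hw
    · have := s2' w hw C.top (by simp); omega
    · have := sC' w hw C.top (by simp); omega
    · omega
    · obtain ⟨D, hD, hw⟩ := mem_inoL.1 hw
      have hD' : D ∈ A.left := by rw [hL]; simp [hD]
      have := hvp1 D hD C (by simp)
      rcases hw with hw | rfl
      · exact ((hchild D hD').lt_of_mem (hval D hD') hw).trans this
      · exact this
    · exact hc.lo_lt.trans hc.lt_top
    · have hs := h.sorted
      rw [ino_eq, List.pairwise_append, List.pairwise_cons] at hs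
      have := hs.2.1.1 w hw
      omega

theorem LWin.of_mirror {l : List ℕ} {B : Banana} (h : LWin v pos l.reverse B.mirror) :
    LWin v pos l B := by
  obtain ⟨h1, h2, h3, h4, h5, h6, h7, h8, h9⟩ := h
  simp only [hi_mirror, top_mirror, ino_mirror, lo_mirror, List.mem_reverse] at *
  exact ⟨h1, h2, h3, h4, h5, h6, h7, h8, h9⟩

theorem LWin.mirror {l : List ℕ} {B : Banana} (h : LWin v pos l B) :
    LWin v pos l.reverse B.mirror :=
  LWin.of_mirror (by simpa using h)

theorem Good.lwin_right {A C : Banana} (h : Good v pos A) (hC : C ∈ A.right) :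
    LWin v (-pos) A.ino C := by
  have := h.mirror.lwin_left (C := C.mirror) (by simpa using ⟨C, hC, rfl⟩)
  rw [ino_mirror] at this
  exact this.of_mirror

/-- A window inside `C` stays a window in a larger list because the nodes of `C` form an interval,
and every way out of this interval to the left meets a node at least as high as `C.top`. -/
theorem LWin.extend {l l' : List ℕ} {B C : Banana} (hB : LWin v pos l' B) (hsub : ∀ i ∈ l', i ∈ l)
    (hconv : ∀ i ∈ l', ∀ k ∈ l', ∀ j ∈ l, pos i ≤ pos j → pos j ≤ pos k → j ∈ l')
    (hb : ∀ j ∈ l, j ∉ l' → ∀ i ∈ l', pos j < pos i →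
      ∃ w ∈ l, pos j ≤ pos w ∧ (∀ i ∈ l', pos w < pos i) ∧ v C.top ≤ v w)
    (hC : ∀ i ∈ l', v i < v C.top) : LWin v pos l B := by
  refine ⟨hB.hi_eq, hsub _ hB.top_mem, fun i hi => hsub i (hB.sub i hi), hB.pos_lt, hB.lt_top,
    hB.lo_le, ?_, ?_, ?_⟩
  · intro i hi j hj h1 h2
    exact hB.conv i hi j (hconv i (hB.sub i hi) _ hB.top_mem j hj h1 h2.le) h1 h2
  · intro j hj h1 h2
    by_cases hj' : j ∈ l'
    · exact hB.border j hj' h1 fun w hw => h2 w (hsub w hw)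
    · obtain ⟨w, hw, h3, h4, h5⟩ := hb j hj hj' _ hB.top_mem h1
      have h6 := h2 w hw h3 (h4 _ hB.top_mem)
      exact absurd (h6.trans (hC _ hB.top_mem)) h5.not_gt
  · obtain ⟨c, hc, h1, h2, h3⟩ := hB.out
    exact ⟨c, hsub c hc, h1, h2, fun w hw h4 h5 =>
      h3 w (hconv _ hB.top_mem c hc w hw h4.le h5) h4 h5⟩

/-- The node that shields the inside of `C` on the left comes from the `border` of the window of
`C`. -/
theorem LWin.extend_left {A B C : Banana} (h : Good v pos A) (hC : C ∈ A.left)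
    (hB : LWin v pos C.ino B) : LWin v pos A.ino B := by
  have hw := h.lwin_left hC
  refine hB.extend (C := C) hw.sub
    (fun i hi k hk j hj h1 h2 => hw.conv i hi j hj h1 (h2.trans_lt (hw.pos_lt k hk))) ?_ hw.lt_top
  intro j hj hjC i hi hji
  have := mt (hw.border j hj (hji.trans (hw.pos_lt i hi))) hjC
  push Not at this
  obtain ⟨w, h1, h2, h3, h4⟩ := this
  refine ⟨w, h1, h2, fun k hk => ?_, h4⟩
  by_contra h5
  exact absurd (hw.lt_top w (hw.conv k hk w h1 (not_lt.1 h5) h3)) h4.not_gt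

/-- On a right trail `C.top` is itself the left neighbour of the interval of `C`, and it shields the
inside. -/
theorem LWin.extend_right {A B C : Banana} (h : Good v pos A) (hC : C ∈ A.right)
    (hB : LWin v pos C.ino B) : LWin v pos A.ino B := by
  have hw := h.lwin_right hC
  have hp := hw.pos_lt
  have hc := hw.conv
  simp only [Pi.neg_apply] at hp hc
  refine hB.extend (C := C) hw.sub
    (fun i hi k hk j hj h1 h2 => hc k hk j hj (by omega) (by have := hp i hi; omega)) ?_ hw.lt_top
  intro j hj hjC i hi hji
  refine ⟨C.top, hw.top_mem, ?_, fun k hk => by have := hp k hk; omega, le_rfl⟩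
  by_contra h5
  exact hjC (hc i hi j hj (by omega) (by omega))

theorem LWin.extend_left_neg {A B C : Banana} (h : Good v pos A) (hC : C ∈ A.left)
    (hB : LWin v (-pos) C.ino B) : LWin v (-pos) A.ino B := by
  have := LWin.extend_right (B := B.mirror) h.mirror (C := C.mirror) (by simpa using ⟨C, hC, rfl⟩)
    (by rw [ino_mirror]; exact hB.mirror)
  rw [ino_mirror] at this
  exact this.of_mirror

theorem LWin.extend_right_neg {A B C : Banana} (h : Good v pos A) (hC : C ∈ A.right)
    (hB : LWin v (-pos) C.ino B) : LWin v (-pos) A.ino B := by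
  have := LWin.extend_left (B := B.mirror) h.mirror (C := C.mirror) (by simpa using ⟨C, hC, rfl⟩)
    (by rw [ino_mirror]; exact hB.mirror)
  rw [ino_mirror] at this
  exact this.of_mirror

theorem Good.win_of_proper {B T : Banana} (h : Good v pos T) (hB : B ∈ T.proper) :
    LWin v pos T.ino B ∨ LWin v (-pos) T.ino B := by
  induction T using ind with
  | h a b l r hl hr =>
    rw [proper, List.mem_append, mem_bananasTrail, mem_bananasTrail] at hB
    rcases hB with ⟨C, hC, hB⟩ | ⟨C, hC, hB⟩
    · rcases mem_proper hB with rfl | hB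
      · exact Or.inl (h.lwin_left hC)
      · exact (hl C hC (h.left hC) hB).imp (LWin.extend_left h hC) (LWin.extend_left_neg h hC)
    · rcases mem_proper hB with rfl | hB
      · exact Or.inr (h.lwin_right hC)
      · exact (hr C hC (h.right hC) hB).imp (LWin.extend_right h hC) (LWin.extend_right_neg h hC)

theorem Good.lwin {B T : Banana} (h : Good v pos T) (hB : B ∈ T.proper)
    (hlt : pos B.lo < pos B.top) : LWin v pos T.ino B := by
  rcases h.win_of_proper hB with hw | hw
  · exact hw
  · have := hw.pos_lt _ (lo_mem_ino B)
    simp only [Pi.neg_apply] at this; omega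

theorem Good.lwin_neg {B T : Banana} (h : Good v pos T) (hB : B ∈ T.proper)
    (hlt : pos B.top < pos B.lo) : LWin v (-pos) T.ino B := by
  rcases h.win_of_proper hB with hw | hw
  · have := hw.pos_lt _ (lo_mem_ino B); omega
  · exact hw

theorem mirror_proper {B T : Banana} (hT : T.ino.Nodup) (h : B ∈ T.proper) :
    B.mirror ∈ T.mirror.proper := by
  rcases mem_proper (mirror_mem_bananas (bananas_of_proper h)) with e | h'
  · have e := mirror_injective e
    subst e
    have h1 := (List.nodup_append.1 ((perm_ino B).nodup_iff.2 hT)).1.of_map _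
    rw [bananas_eq, List.nodup_cons] at h1
    exact absurd h h1.1
  · exact h'

end Banana
end BananaTree

namespace BananaTree
namespace Banana

variable {v : ℕ → ℝ} {pos : ℕ → ℤ}

/-! ### Finding bananas -/

/-- The pointers of the algorithm search the list of all bananas; by uniqueness of ends the search
can only return the intended one. -/
theorem find?_eq_some_of_unique {α : Type*} {l : List α} {P : α → Bool} {a : α} (ha : a ∈ l)
    (hP : P a) (hu : ∀ b ∈ l, P b → b = a) : l.find? P = some a := by
  cases h : l.find? P with
  | none => exact absurd hP (List.find?_eq_none.1 h a ha)
  | some b => rw [hu b (List.mem_of_find?_eq_some h) (List.find?_some h)]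

theorem hi_unique {T B C : Banana} (hT : Valid v T) (hn : T.ino.Nodup) (ht : T.hi = ⊤)
    (hB : B ∈ T.bananas) (hC : C ∈ T.bananas) (h : B.hi = C.hi) : B = C := by
  rcases mem_proper hB with rfl | hB <;> rcases mem_proper hC with rfl | hC
  · rfl
  · rw [ht, hT.hi_proper hC] at h; exact absurd h.symm (WithTop.coe_ne_top)
  · rw [ht, hT.hi_proper hB] at h; exact absurd h (WithTop.coe_ne_top)
  · exact eq_of_top_eq hn hB hC (by rw [top, h, top])

theorem at?_eq {T B : Banana} (hT : Valid v T) (hn : T.ino.Nodup) (ht : T.hi = ⊤)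
    (hB : B ∈ T.bananas) : T.at? B.hi = some B :=
  find?_eq_some_of_unique hB (by simp) fun C hC h => hi_unique hT hn ht hC hB (by simpa using h)

theorem findLo_eq {T B : Banana} (hn : T.ino.Nodup) (hB : B ∈ T.bananas) :
    (T.bananas.find? fun C => C.lo = B.lo) = some B :=
  find?_eq_some_of_unique hB (by simp) fun C hC h => eq_of_lo_eq hn hC hB (by simpa using h)

theorem owner?_eq {T A C : Banana} (hn : T.ino.Nodup) (hA : A ∈ T.bananas)
    (hC : C ∈ A.left ++ A.right) : T.owner? C.hi = some A := by
  refine find?_eq_some_of_unique hA (decide_eq_true (List.mem_map_of_mem hC)) fun B hB h => ?_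
  simp only [decide_eq_true_eq, List.mem_map] at h
  obtain ⟨D, hD, e⟩ := h
  exact parent_unique hn hB hA hD hC (by rw [top, e, top])

theorem birth_eq {T B : Banana} (hT : Valid v T) (hn : T.ino.Nodup) (ht : T.hi = ⊤)
    (hB : B ∈ T.bananas) : T.birth B.hi = B.lo := by
  rw [birth, at?_eq hT hn ht hB]; rfl

theorem low_eq {T A C : Banana} (hn : T.ino.Nodup) (hA : A ∈ T.bananas)
    (hC : C ∈ A.left ++ A.right) : T.low C.hi = A.lo := by
  rw [low, owner?_eq hn hA hC]; rfl

theorem dth_eq {T A : Banana} (hn : T.ino.Nodup) (hA : A ∈ T.bananas) : T.dth A.lo = A.hi := by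
  rw [dth, findLo_eq hn hA]; rfl

/-! ### Spines and contexts -/

/-- A banana with one interior node of one of its trails left out. -/
structure Frame where
  lo : ℕ
  hi : WithTop ℕ
  inn : List Banana
  out : List Banana

/-- The mirror image of a frame. -/
def Frame.mirror (f : Frame) : Frame := ⟨f.lo, f.hi, f.inn.map Banana.mirror, f.out.map Banana.mirror⟩

/-- Attach a banana at the end of a sequence of frames along the left spine. -/
def plugL : List Frame → Banana → Banana
  | [], B => B
  | f :: fs, B => mk f.lo f.hi (f.inn ++ [plugL fs B]) f.out

/-- Attach a banana at the end of a sequence of frames along the right spine. -/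
def plugR : List Frame → Banana → Banana
  | [], B => B
  | f :: fs, B => mk f.lo f.hi f.out (f.inn ++ [plugR fs B])

@[simp] theorem mirror_plugL (fs : List Frame) (B : Banana) :
    (plugL fs B).mirror = plugR (fs.map Frame.mirror) B.mirror := by
  induction fs with
  | nil => rfl
  | cons f fs ih => rw [plugL, mirror_mk, List.map_append, List.map_singleton, ih]; rfl

@[simp] theorem mirror_plugR (fs : List Frame) (B : Banana) :
    (plugR fs B).mirror = plugL (fs.map Frame.mirror) B.mirror := by
  induction fs with
  | nil => rfl
  | cons f fs ih => rw [plugR, mirror_mk, List.map_append, List.map_singleton, ih]; rfl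

theorem plugL_append (fs gs : List Frame) (B : Banana) :
    plugL (fs ++ gs) B = plugL fs (plugL gs B) := by
  induction fs with
  | nil => rfl
  | cons f fs ih => rw [List.cons_append, plugL, plugL, ih]

theorem plugR_append (fs gs : List Frame) (B : Banana) :
    plugR (fs ++ gs) B = plugR fs (plugR gs B) := by
  induction fs with
  | nil => rfl
  | cons f fs ih => rw [List.cons_append, plugR, plugR, ih]

theorem leftSpineTrail_append (t : List Banana) (C : Banana) :
    leftSpineTrail (t ++ [C]) = leftSpine C := by
  induction t with
  | nil => rw [List.nil_append, leftSpineTrail]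
  | cons D t ih =>
    cases t with
    | nil => rw [List.singleton_append, leftSpineTrail, leftSpineTrail]
    | cons E t => rw [List.cons_append, List.cons_append, leftSpineTrail]; exact ih

theorem rightSpineTrail_append (t : List Banana) (C : Banana) :
    rightSpineTrail (t ++ [C]) = rightSpine C := by
  induction t with
  | nil => rw [List.nil_append, rightSpineTrail]
  | cons D t ih =>
    cases t with
    | nil => rw [List.singleton_append, rightSpineTrail, rightSpineTrail]
    | cons E t => rw [List.cons_append, List.cons_append, rightSpineTrail]; exact ih

/-- Membership in the spine becomes a factorisation of the tree, which is the form needed for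
replacing the banana at the end of the spine. -/
theorem mem_leftSpine {T : Banana} {q : WithTop ℕ} :
    q ∈ T.leftSpine ↔ ∃ fs B, T = plugL fs B ∧ B.hi = q := by
  constructor
  · intro h
    induction T using ind with
    | h a b l r hl hr =>
      rw [leftSpine, List.mem_cons] at h
      rcases h with rfl | h
      · exact ⟨[], _, rfl, rfl⟩
      · rcases List.eq_nil_or_concat' l with rfl | ⟨l', C, rfl⟩
        · simp [leftSpineTrail] at h
        · rw [leftSpineTrail_append] at h
          obtain ⟨fs, B, e, h⟩ := hl C (by simp) h
          exact ⟨⟨a, b, l', r⟩ :: fs, B, by rw [plugL, ← e], h⟩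
  · rintro ⟨fs, B, rfl, rfl⟩
    induction fs with
    | nil => rw [plugL]; cases B; simp [leftSpine]
    | cons f fs ih =>
      rw [plugL, leftSpine, leftSpineTrail_append]
      exact List.mem_cons_of_mem _ ih

theorem mem_rightSpine {T : Banana} {q : WithTop ℕ} :
    q ∈ T.rightSpine ↔ ∃ fs B, T = plugR fs B ∧ B.hi = q := by
  constructor
  · intro h
    induction T using ind with
    | h a b l r hl hr =>
      rw [rightSpine, List.mem_cons] at h
      rcases h with rfl | h
      · exact ⟨[], _, rfl, rfl⟩
      · rcases List.eq_nil_or_concat' r with rfl | ⟨l', C, rfl⟩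
        · simp [rightSpineTrail] at h
        · rw [rightSpineTrail_append] at h
          obtain ⟨fs, B, e, h⟩ := hr C (by simp) h
          exact ⟨⟨a, b, l', l⟩ :: fs, B, by rw [plugR, ← e], h⟩
  · rintro ⟨fs, B, rfl, rfl⟩
    induction fs with
    | nil => rw [plugR]; cases B; simp [rightSpine]
    | cons f fs ih =>
      rw [plugR, rightSpine, rightSpineTrail_append]
      exact List.mem_cons_of_mem _ ih

theorem mem_leftSpine_mirror {T : Banana} {q : WithTop ℕ} :
    q ∈ T.mirror.leftSpine ↔ q ∈ T.rightSpine := by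
  rw [mem_leftSpine, mem_rightSpine]
  constructor
  · rintro ⟨fs, B, e, h⟩
    refine ⟨fs.map Frame.mirror, B.mirror, ?_, by simpa using h⟩
    rw [← mirror_plugL, ← e, mirror_mirror]
  · rintro ⟨fs, B, rfl, h⟩
    exact ⟨fs.map Frame.mirror, B.mirror, mirror_plugR _ _, by simpa using h⟩

theorem mem_rightSpine_mirror {T : Banana} {q : WithTop ℕ} :
    q ∈ T.mirror.rightSpine ↔ q ∈ T.leftSpine := by
  rw [← mem_leftSpine_mirror, mirror_mirror]

theorem mem_bananas_plugL (fs : List Frame) (B : Banana) : B ∈ (plugL fs B).bananas := by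
  induction fs with
  | nil => exact self_mem_bananas B
  | cons f fs ih =>
    exact mem_bananas_of_left (T := plugL (f :: fs) B) (C := plugL fs B) (by simp [plugL]) ih

theorem mem_bananas_plugR (fs : List Frame) (B : Banana) : B ∈ (plugR fs B).bananas := by
  induction fs with
  | nil => exact self_mem_bananas B
  | cons f fs ih =>
    exact mem_bananas_of_right (T := plugR (f :: fs) B) (C := plugR fs B) (by simp [plugR]) ih

/-- The upper end of the outermost banana. -/
def headTop : List Frame → ℕ → ℕ
  | [], q => q
  | f :: _, _ => f.hi.untopD 0

theorem top_plugL (fs : List Frame) (B : Banana) : (plugL fs B).top = headTop fs B.top := by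
  cases fs <;> rfl

/-- The nodes of a left spine context, where `q` is the upper end of the attached banana. -/
def tailL : List Frame → ℕ → List ℕ
  | [], _ => []
  | f :: fs, q => tailL fs q ++ headTop fs q :: (inoL f.inn ++ f.lo :: inoR f.out)

theorem ino_plugL (fs : List Frame) (B : Banana) :
    (plugL fs B).ino = B.ino ++ tailL fs B.top := by
  induction fs with
  | nil => simp [plugL, tailL]
  | cons f fs ih =>
    rw [plugL, ino_mk, inoL_append, inoL_cons, ih, top_plugL, tailL]; simp

theorem tailL_cons (f : Frame) (fs : List Frame) (q : ℕ) : ∃ t, tailL (f :: fs) q = q :: t := by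
  induction fs generalizing f with
  | nil => exact ⟨_, rfl⟩
  | cons g fs ih => obtain ⟨t, ht⟩ := ih g; rw [tailL, ht]; exact ⟨_, rfl⟩

theorem top_mem_tailL {fs : List Frame} (h : fs ≠ []) (q : ℕ) : q ∈ tailL fs q := by
  cases fs with
  | nil => exact absurd rfl h
  | cons f fs => obtain ⟨t, ht⟩ := tailL_cons f fs q; simp [ht]

/-- The nodes of a right spine context, where `q` is the upper end of the attached banana. -/
def tailR (fs : List Frame) (q : ℕ) : List ℕ := (tailL (fs.map Frame.mirror) q).reverse

theorem ino_plugR (fs : List Frame) (B : Banana) :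
    (plugR fs B).ino = tailR fs B.top ++ B.ino := by
  have := ino_mirror (plugR fs B)
  rw [mirror_plugR, ino_plugL] at this
  rw [← List.reverse_reverse (plugR fs B).ino, ← this]
  simp [tailR]

theorem proper_plugL {f : Frame} {fs : List Frame} {B : Banana} : B ∈ (plugL (f :: fs) B).proper := by
  rw [proper, List.mem_append, mem_bananasTrail]
  exact Or.inl ⟨plugL fs B, by simp [plugL], mem_bananas_plugL fs B⟩

/-- In the in-order list the nodes of `B` come first and its upper end follows immediately. -/
theorem Good.plugL_pos {fs : List Frame} {B : Banana} (h : Good v pos (plugL fs B))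
    (hfs : fs ≠ []) {z : ℕ} (hz : z ∈ (plugL fs B).ino) (hlt : pos z < pos B.top) : z ∈ B.ino := by
  cases fs with
  | nil => exact absurd rfl hfs
  | cons f fs =>
    obtain ⟨t, ht⟩ := tailL_cons f fs B.top
    have hs := h.sorted
    rw [ino_plugL, ht] at hs hz
    rw [List.mem_append, List.mem_cons] at hz
    rw [List.pairwise_append, List.pairwise_cons] at hs
    rcases hz with hz | rfl | hz
    · exact hz
    · omega
    · have := hs.2.1.1 z hz; omega

theorem Good.plugL_lo {fs : List Frame} {B : Banana} (h : Good v pos (plugL fs B))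
    (hfs : fs ≠ []) {z : ℕ} (hz : z ∈ B.ino) : pos z < pos B.top := by
  have hs := h.sorted
  rw [ino_plugL, List.pairwise_append] at hs
  exact hs.2.2 z hz _ (top_mem_tailL hfs _)

/-- A window whose maximum is larger than everything to its left belongs to the left spine. -/
theorem Good.exists_plugL {T B : Banana} (h : Good v pos T) (hB : B ∈ T.proper)
    (hlt : pos B.lo < pos B.top) (hmax : ∀ z ∈ T.ino, pos z < pos B.top → v z < v B.top) :
    ∃ f fs, T = plugL (f :: fs) B := by
  induction T using ind with
  | h a b l r hl hr =>
    have hB' := hB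
    rw [proper, List.mem_append, mem_bananasTrail, mem_bananasTrail] at hB
    rcases hB with ⟨C, hC, hB⟩ | ⟨C, hC, hB⟩
    · have hw := h.lwin_left hC
      -- A node higher on the left trail than `C.top` would be to the left of `B.top` and above it.
      have hlast : ∃ l', l = l' ++ [C] := by
        obtain ⟨l₁, l₂, e⟩ := List.append_of_mem hC
        simp only [left_mk] at e
        cases l₂ with
        | nil => exact ⟨l₁, e⟩
        | cons E l₂ =>
          exfalso
          have hp := h.pairwise_left
          have hv := h.valid.pairwise_left
          simp only [left_mk] at hp hv
          rw [e, List.pairwise_append, List.pairwise_cons] at hp hv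
          have h1 := hv.2.1.1 E (by simp)
          have hE : E.top ∈ (Banana.mk a b l r).ino :=
            mem_ino.2 (Or.inr (Or.inl ⟨E, by simp [e], Or.inr rfl⟩))
          have hBC : B.top ∈ C.ino ∨ B.top = C.top := by
            rcases mem_proper hB with rfl | hB
            · exact Or.inr rfl
            · exact Or.inl (top_mem_ino hB)
          have h2 := hmax E.top hE (hp.2.1.1 E (by simp) _ (Or.inr rfl) _ hBC)
          rcases hBC with h3 | h3
          · exact absurd ((hw.lt_top _ h3).trans h1) h2.not_gt
          · rw [h3] at h2; exact absurd h1 h2.not_gt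
      obtain ⟨l', rfl⟩ := hlast
      rcases mem_proper hB with rfl | hB
      · exact ⟨⟨a, b, l', r⟩, [], rfl⟩
      · obtain ⟨f, fs, e⟩ := hl C (by simp) (h.left hC) hB fun z hz h1 => hmax z (hw.sub z hz) h1
        exact ⟨⟨a, b, l', r⟩, f :: fs, by rw [plugL, ← e]⟩
    -- On a right trail `C.top` is to the left of all nodes of `C` and above them, and `C` itself
    -- has the wrong orientation.
    · exfalso
      have hw := h.lwin_right hC
      have hpos := hw.pos_lt
      simp only [Pi.neg_apply] at hpos
      rcases mem_proper hB with rfl | hB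
      · have := hpos _ (lo_mem_ino B); omega
      · have h1 := top_mem_ino hB
        have h2 := hpos _ h1
        exact absurd (hmax C.top hw.top_mem (by omega)) (hw.lt_top _ h1).not_gt

/-! ### Modifying a banana in its context -/

section Modify
variable {P : Banana → Prop} [DecidablePred P] {φ : Banana → Banana}

theorem modifyTrail_eq (t : List Banana) : modifyTrail P φ t = t.map (modify P φ) := by
  induction t with
  | nil => rw [modifyTrail]; rfl
  | cons C t ih => rw [modifyTrail, ih]; rfl

theorem modify_mk (a b l r) : modify P φ (mk a b l r) =
    if P (mk a b l r) then φ (mk a b l r) else mk a b (l.map (modify P φ)) (r.map (modify P φ)) := by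
  rw [modify, modifyTrail_eq, modifyTrail_eq]

theorem modify_eq_self {T : Banana} (h : ∀ D ∈ T.bananas, ¬ P D) : modify P φ T = T := by
  induction T using ind with
  | h a b l r hl hr =>
    rw [modify_mk, if_neg (h _ (self_mem_bananas _))]
    congr 1
    · conv_rhs => rw [← List.map_id l]
      exact List.map_congr_left fun C hC => hl C hC fun D hD => h D (mem_bananas_of_left hC hD)
    · conv_rhs => rw [← List.map_id r]
      exact List.map_congr_left fun C hC => hr C hC fun D hD => h D (mem_bananas_of_right hC hD)

theorem modify_self {B : Banana} (h : P B) : modify P φ B = φ B := by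
  cases B; rw [modify_mk, if_pos h]

theorem map_modify_eq_self {t : List Banana} (h : ∀ C ∈ t, ∀ D ∈ C.bananas, ¬ P D) :
    t.map (modify P φ) = t := by
  conv_rhs => rw [← List.map_id t]
  exact List.map_congr_left fun C hC => modify_eq_self (h C hC)

/-- `modify` searches the whole tree; uniqueness of the match, together with distinctness of the
nodes, confines the change to the banana at the end of the context. -/
theorem modify_plugL {fs : List Frame} {B : Banana} (hn : (plugL fs B).ino.Nodup) (hB : P B)
    (hu : ∀ D ∈ (plugL fs B).bananas, P D → D = B) :
    modify P φ (plugL fs B) = plugL fs (φ B) := by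
  induction fs with
  | nil => exact modify_self hB
  | cons f fs ih =>
    have hlo : B.lo ∈ (plugL fs B).ino := ino_subset (mem_bananas_plugL fs B) (lo_mem_ino B)
    have hmem : plugL fs B ∈ (plugL (f :: fs) B).left := by simp [plugL]
    have hn' := hn
    rw [plugL, ino_mk, inoL_append, inoL_cons, inoL_nil, List.nil_append, List.append_assoc,
      List.append_assoc, List.nodup_append] at hn'
    obtain ⟨n1, -, n2⟩ := hn'
    rw [plugL, modify_mk, if_neg, List.map_append, List.map_singleton,
      ih n1 fun D hD => hu D (mem_bananas_of_left hmem hD), map_modify_eq_self,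
      map_modify_eq_self, plugL]
    · intro C hC D hD hP
      have := hu D (mem_bananas_of_right (T := plugL (f :: fs) B) hC hD) hP
      subst this
      exact n2 _ hlo _ (by simp [mem_inoR]; exact Or.inr (Or.inr (Or.inr ⟨C, hC, Or.inl (ino_subset hD (lo_mem_ino D))⟩))) rfl
    · intro C hC D hD hP
      have := hu D (mem_bananas_of_left (T := plugL (f :: fs) B) (C := C) (by simp [plugL, hC]) hD) hP
      subst this
      exact n2 _ hlo _ (by simp [mem_inoL]; exact Or.inr (Or.inl ⟨C, hC, Or.inl (ino_subset hD (lo_mem_ino D))⟩)) rfl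
    · intro hP
      have := hu _ (self_mem_bananas (plugL (f :: fs) B)) hP
      have h1 : B.lo = f.lo := by rw [← this]; rfl
      exact n2 _ hlo _ (by simp) h1

theorem modify_plugR {fs : List Frame} {B : Banana} (hn : (plugR fs B).ino.Nodup) (hB : P B)
    (hu : ∀ D ∈ (plugR fs B).bananas, P D → D = B) :
    modify P φ (plugR fs B) = plugR fs (φ B) := by
  induction fs with
  | nil => exact modify_self hB
  | cons f fs ih =>
    have hlo : B.lo ∈ (plugR fs B).ino := ino_subset (mem_bananas_plugR fs B) (lo_mem_ino B)
    have hmem : plugR fs B ∈ (plugR (f :: fs) B).right := by simp [plugR]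
    have hn' := hn
    rw [plugR, ino_mk, inoR_append, inoR_cons, inoR_nil, List.append_nil, ← List.cons_append,
      ← List.append_assoc, List.nodup_append, List.nodup_cons] at hn'
    obtain ⟨-, ⟨-, n1⟩, n2⟩ := hn'
    have n3 : ∀ a ∈ inoL f.out ++ (f.lo :: inoR f.inn), a ≠ B.lo := fun a ha =>
      n2 a ha _ (List.mem_cons_of_mem _ hlo)
    rw [plugR, modify_mk, if_neg, List.map_append, List.map_singleton,
      ih n1 fun D hD => hu D (mem_bananas_of_right hmem hD), map_modify_eq_self,
      map_modify_eq_self, plugR]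
    · intro C hC D hD hP
      have := hu D (mem_bananas_of_right (T := plugR (f :: fs) B) (C := C) (by simp [plugR, hC]) hD) hP
      subst this
      exact n3 _ (by simp [mem_inoR]; exact Or.inr (Or.inr ⟨C, hC, Or.inl (ino_subset hD (lo_mem_ino D))⟩)) rfl
    · intro C hC D hD hP
      have := hu D (mem_bananas_of_left (T := plugR (f :: fs) B) hC hD) hP
      subst this
      exact n3 _ (by simp [mem_inoL]; exact Or.inl ⟨C, hC, Or.inl (ino_subset hD (lo_mem_ino D))⟩) rfl
    · intro hP
      have := hu _ (self_mem_bananas (plugR (f :: fs) B)) hP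
      have h1 : f.lo = B.lo := by rw [← this]; rfl
      exact n3 _ (by simp) h1

end Modify

/-! ### Replacing the banana in a context -/

/-- All surgery takes place at the end of a spine. Only the attachment to the innermost frame has to
be rechecked, since further up the ends are unchanged and the valuations agree on the context. `hch`
quantifies over all context nodes because the lower end of the innermost frame has no name in the
statement. -/
theorem Valid.replaceL {w : ℕ → ℝ} {fs : List Frame} {B B' : Banana} (h : Valid v (plugL fs B))
    (hhi : B'.hi = B.hi) (hB' : Valid w B')
    (hch : ∀ a ∈ tailL fs B.top, Child v a B → Child w a B')
    (hw : ∀ i ∈ tailL fs B.top, w i = v i) : Valid w (plugL fs B') := by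
  have htop : B'.top = B.top := by rw [top, hhi, top]
  induction fs with
  | nil => exact hB'
  | cons f fs ih =>
    have hrest : ∀ i ∈ (headTop fs B.top) :: (inoL f.inn ++ f.lo :: inoR f.out), w i = v i :=
      fun i hi => hw i (by rw [tailL]; exact List.mem_append_right _ hi)
    have hv1 := h.valid_left
    have hv2 := h.valid_right
    have hc1 := h.child_left
    have hc2 := h.child_right
    have hp1 := h.pairwise_left
    have hp2 := h.pairwise_right
    simp only [plugL, left_mk, right_mk, lo_mk, List.mem_append, List.mem_singleton] at hv1 hv2 hc1 hc2 hp1 hp2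
    have hih := ih (hv1 _ (Or.inr rfl)) (fun a ha => hch a (by rw [tailL]; simp [ha]))
      (fun i hi => hw i (by rw [tailL]; simp [hi]))
    have hlo : w f.lo = v f.lo := hrest _ (by simp)
    have hinn : ∀ C ∈ f.inn, (∀ i ∈ C.ino, w i = v i) ∧ w C.top = v C.top := fun C hC =>
      ⟨fun i hi => hrest i (by simp [mem_inoL]; exact Or.inr (Or.inl ⟨C, hC, Or.inl hi⟩)),
        hrest _ (by simp [mem_inoL]; exact Or.inr (Or.inl ⟨C, hC, Or.inr rfl⟩))⟩
    have hout : ∀ C ∈ f.out, (∀ i ∈ C.ino, w i = v i) ∧ w C.top = v C.top := fun C hC =>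
      ⟨fun i hi => hrest i (by simp [mem_inoR]; exact Or.inr (Or.inr (Or.inr ⟨C, hC, Or.inl hi⟩))),
        hrest _ (by simp [mem_inoR]; exact Or.inr (Or.inr (Or.inr ⟨C, hC, Or.inr rfl⟩)))⟩
    have htop' : (plugL fs B').top = (plugL fs B).top := by rw [top_plugL, top_plugL, htop]
    have hwtop : w (plugL fs B).top = v (plugL fs B).top := hrest _ (by rw [top_plugL]; simp)
    rw [plugL]
    refine .mk ?_ (fun C hC => (hv2 C hC).congr (hout C hC).1) ?_
      (fun C hC => (hc2 C hC).congr hlo (hout C hC).2 (hout C hC).1) ?_ ?_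
    · intro C hC
      rcases List.mem_append.1 hC with hC | hC
      · exact (hv1 C (Or.inl hC)).congr (hinn C hC).1
      · rw [List.mem_singleton.1 hC]; exact hih
    · intro C hC
      rcases List.mem_append.1 hC with hC | hC
      · exact (hc1 C (Or.inl hC)).congr hlo (hinn C hC).2 (hinn C hC).1
      · rw [List.mem_singleton.1 hC]
        have hcB := hc1 _ (Or.inr rfl)
        cases fs with
        | nil => exact hch _ (by simp [tailL]) hcB
        | cons g gs =>
          have hg : ∀ i ∈ (headTop gs B.top) :: (inoL g.inn ++ g.lo :: inoR g.out), w i = v i :=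
            fun i hi => hw i (by rw [tailL, tailL]; exact List.mem_append_left _ (List.mem_append_right _ hi))
          have hl : v (plugL gs B).top < v (plugL (g :: gs) B).top :=
            hcB.left_lt (plugL gs B) (by simp [plugL])
          refine ⟨hcB.hi_eq, ?_, ?_, ?_, ?_⟩
          · have := hcB.lo_lt
            rw [hlo]; simp only [plugL, lo_mk] at this ⊢; rw [hg g.lo (by simp)]; exact this
          · have := hcB.lt_top
            rw [htop', hwtop]; simp only [plugL, lo_mk] at this ⊢; rw [hg g.lo (by simp)]; exact this
          · intro D hD
            rw [htop', hwtop]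
            simp only [plugL, left_mk, List.mem_append, List.mem_singleton] at hD
            rcases hD with hD | rfl
            · rw [hg _ (by simp [mem_inoL]; exact Or.inr (Or.inl ⟨D, hD, Or.inr rfl⟩))]
              exact hcB.left_lt D (by simp [plugL, hD])
            · rw [show (plugL gs B').top = (plugL gs B).top by rw [top_plugL, top_plugL, htop],
                hg _ (by rw [top_plugL]; simp)]
              exact hl
          · intro D hD
            rw [htop', hwtop]
            simp only [plugL, right_mk] at hD
            rw [hg _ (by simp [mem_inoR]; exact Or.inr (Or.inr (Or.inr ⟨D, hD, Or.inr rfl⟩)))]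
            exact hcB.right_lt D (by simp [plugL, hD])
    · rw [List.pairwise_append] at hp1 ⊢
      refine ⟨hp1.1.imp_of_mem fun {C D} hC hD h => ?_, by simp, fun C hC D hD => ?_⟩
      · rw [(hinn C hC).2, (hinn D hD).2]; exact h
      · rw [List.mem_singleton.1 hD, htop', hwtop, (hinn C hC).2]
        exact hp1.2.2 C hC _ (by simp)
    · refine hp2.imp_of_mem fun {C D} hC hD h => ?_
      rw [(hout C hC).2, (hout D hD).2]; exact h

theorem Child.of_mirror {a : ℕ} {B : Banana} (h : Child v a B.mirror) : Child v a B := by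
  simpa using h.mirror

theorem Valid.replaceR {w : ℕ → ℝ} {fs : List Frame} {B B' : Banana} (h : Valid v (plugR fs B))
    (hhi : B'.hi = B.hi) (hB' : Valid w B')
    (hch : ∀ a ∈ tailR fs B.top, Child v a B → Child w a B')
    (hw : ∀ i ∈ tailR fs B.top, w i = v i) : Valid w (plugR fs B') := by
  have h1 := h.mirror
  rw [mirror_plugR] at h1
  have := h1.replaceL (B' := B'.mirror) (w := w) (by simpa using hhi) hB'.mirror
    (fun a ha hc => (hch a (by simpa [tailR] using ha) hc.of_mirror).mirror)
    (fun i hi => hw i (by simpa [tailR] using hi))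
  rw [← mirror_plugR] at this
  simpa only [mirror_mirror] using this.mirror

end Banana
end BananaTree

namespace BananaTree
namespace Banana

variable {v : ℕ → ℝ} {pos : ℕ → ℤ} {y : ℝ}

/-! ### The path of bananas around the cut -/

/-- The candidate for the next smaller banana around the cut at position zero. -/
noncomputable def nx (pos : ℕ → ℤ) (A : Banana) : Option Banana :=
  (if pos A.lo < 0 then A.right.filter fun C => pos C.top < 0
    else A.left.filter fun C => 0 < pos C.top).getLast?

/-- The next smaller banana that has the cut, at height `y`, between its ends or in its in-panel. -/
noncomputable def nxt (v : ℕ → ℝ) (pos : ℕ → ℤ) (y : ℝ) (A : Banana) : Option Banana :=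
  (nx pos A).filter fun C => y < v C.top

/-- The list of all bananas around the cut, from the largest to the smallest. -/
inductive IsPath (v : ℕ → ℝ) (pos : ℕ → ℤ) (y : ℝ) : Option Banana → List Banana → Prop
  | nil : IsPath v pos y none []
  | cons {A : Banana} {cs : List Banana} : IsPath v pos y (nxt v pos y A) cs →
      IsPath v pos y (some A) (A :: cs)

theorem nx_mirror {A : Banana} (h : pos A.lo ≠ 0) : nx (-pos) A.mirror = (nx pos A).map mirror := by
  unfold nx
  rw [← List.getLast?_map]
  congr 1
  by_cases h1 : pos A.lo < 0
  · have h2 : ¬ (-pos) A.mirror.lo < 0 := by simp; omega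
    rw [if_neg h2, if_pos h1, left_mirror, List.filter_map]
    congr 2
    funext C
    simp
  · have h2 : (-pos) A.mirror.lo < 0 := by simp; omega
    rw [if_pos h2, if_neg h1, right_mirror, List.filter_map]
    congr 2
    funext C
    simp

theorem nxt_mirror {A : Banana} (h : pos A.lo ≠ 0) :
    nxt v (-pos) y A.mirror = (nxt v pos y A).map mirror := by
  rw [nxt, nxt, nx_mirror h]
  cases nx pos A with
  | none => rfl
  | some C => by_cases h : y < v C.top <;> simp [Option.filter, h]

theorem IsPath.mirror (h0 : ∀ i, pos i ≠ 0) {o : Option Banana} {cs : List Banana}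
    (h : IsPath v pos y o cs) :
    IsPath v (-pos) y (o.map Banana.mirror) (cs.map Banana.mirror) := by
  induction h with
  | nil => exact .nil
  | cons _ ih =>
    refine .cons ?_
    rw [nxt_mirror (h0 _)]
    exact ih

/-- `p` passes from later to earlier entries, so it holds on an initial segment. This is how the cut
divides a trail. -/
theorem filter_append_of_pairwise {α : Type*} {p q : α → Bool} {l : List α}
    (h : l.Pairwise fun a b => p b → p a) (hq : ∀ a ∈ l, q a = !p a) :
    l = l.filter p ++ l.filter q := by
  induction l with
  | nil => rfl
  | cons a l ih =>
    rw [List.pairwise_cons] at h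
    have ih' := ih h.2 fun b hb => hq b (by simp [hb])
    by_cases ha : p a
    · rw [List.filter_cons_of_pos ha, List.filter_cons_of_neg (by simp [hq a, ha]),
        List.cons_append, ← ih']
    · have h1 : l.filter p = [] := List.filter_eq_nil_iff.2 fun b hb hpb => ha (h.1 b hb hpb)
      rw [List.filter_cons_of_neg ha, h1, List.nil_append, List.filter_cons_of_pos (by simp [hq a, ha])]
      rw [h1, List.nil_append] at ih'
      rw [← ih']

theorem Good.split_left (h0 : ∀ i, pos i ≠ 0) {A : Banana} (h : Good v pos A) :
    A.left = (A.left.filter fun C => 0 < pos C.top) ++ A.left.filter fun C => pos C.top < 0 := by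
  refine filter_append_of_pairwise (h.pairwise_left.imp fun {C D} h => ?_) fun C _ => ?_
  · have := h D.top (Or.inr rfl) C.top (Or.inr rfl)
    simp only [decide_eq_true_eq]; omega
  · have := h0 C.top
    rw [← decide_not, decide_eq_decide]; omega

theorem Good.pairwise_right {A : Banana} (h : Good v pos A) :
    A.right.Pairwise fun C D => ∀ i, i ∈ D.ino ∨ i = D.top → ∀ j, j ∈ C.ino ∨ j = C.top →
      pos j < pos i := by
  have := h.mirror.pairwise_left
  rw [left_mirror, List.pairwise_map] at this
  refine this.imp fun {C D} h i hi j hj => ?_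
  have := h i (by simpa using hi) j (by simpa using hj)
  simp only [Pi.neg_apply] at this; omega

theorem Good.pos_right {A C : Banana} (h : Good v pos A) (hC : C ∈ A.right) :
    (∀ i ∈ C.ino, pos C.top < pos i) ∧ pos A.lo < pos C.top := by
  have := h.mirror.pos_left (C := C.mirror) (by simpa using ⟨C, hC, rfl⟩)
  simpa using this

theorem Good.split_right (h0 : ∀ i, pos i ≠ 0) {A : Banana} (h : Good v pos A) :
    A.right = (A.right.filter fun C => pos C.top < 0) ++ A.right.filter fun C => 0 < pos C.top := by
  refine filter_append_of_pairwise (h.pairwise_right.imp fun {C D} h => ?_) fun C _ => ?_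
  · have := h D.top (Or.inr rfl) C.top (Or.inr rfl)
    simp only [decide_eq_true_eq]; omega
  · have := h0 C.top
    rw [← decide_not, decide_eq_decide]; omega

theorem nx_eq_left {A C : Banana} (h : nx pos A = some C) (hA : ¬ pos A.lo < 0) :
    ∃ L, (A.left.filter fun C => 0 < pos C.top) = L ++ [C] := by
  rw [nx, if_neg hA, List.getLast?_eq_some_iff] at h
  exact h

theorem nx_eq_right {A C : Banana} (h : nx pos A = some C) (hA : pos A.lo < 0) :
    ∃ L, (A.right.filter fun C => pos C.top < 0) = L ++ [C] := by
  rw [nx, if_pos hA, List.getLast?_eq_some_iff] at h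
  exact h

theorem nxt_eq_some {A C : Banana} : nxt v pos y A = some C ↔ nx pos A = some C ∧ y < v C.top := by
  simp [nxt]

theorem nx_left_mem {A C : Banana} (h : nx pos A = some C) (hA : ¬ pos A.lo < 0) :
    C ∈ A.left ∧ 0 < pos C.top := by
  obtain ⟨L, hL⟩ := nx_eq_left h hA
  have : C ∈ A.left.filter fun C => 0 < pos C.top := by rw [hL]; simp
  simpa using this

theorem nx_right_mem {A C : Banana} (h : nx pos A = some C) (hA : pos A.lo < 0) :
    C ∈ A.right ∧ pos C.top < 0 := by
  obtain ⟨L, hL⟩ := nx_eq_right h hA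
  have : C ∈ A.right.filter fun C => pos C.top < 0 := by rw [hL]; simp
  simpa using this

theorem nx_mem {A C : Banana} (h : nx pos A = some C) : C ∈ A.left ++ A.right := by
  by_cases hA : pos A.lo < 0
  · exact List.mem_append_right _ (nx_right_mem h hA).1
  · exact List.mem_append_left _ (nx_left_mem h hA).1

/-- The maximum is to the right of the cut, and the cut is between the ends or in the in-panel. -/
structure PanL (v : ℕ → ℝ) (pos : ℕ → ℤ) (y : ℝ) (l : List ℕ) (B : Banana) : Prop where
  lo_lt : pos B.lo < pos B.top
  top_pos : 0 < pos B.top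
  y_lt : y < v B.top
  lt : ∀ z ∈ l, 0 < pos z → pos z < pos B.top → v z < v B.top

theorem PanL.mirror {l : List ℕ} {B : Banana} (h : PanL v pos y l B) :
    PanL v pos y l.reverse B.mirror := by
  obtain ⟨h1, h2, h3, h4⟩ := h
  exact ⟨by simpa using h1, by simpa using h2, by simpa using h3, by simpa using h4⟩

/-- The banana is the whole tree, or the cut is between its ends or in the in-panel. -/
def Pan (v : ℕ → ℝ) (pos : ℕ → ℤ) (y : ℝ) (T B : Banana) : Prop :=
  B = T ∨ PanL v pos y T.ino B ∨ PanL v (-pos) y T.ino B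

theorem Pan.mirror {T B : Banana} (h : Pan v pos y T B) : Pan v (-pos) y T.mirror B.mirror := by
  rcases h with rfl | h | h
  · exact Or.inl rfl
  · right; right
    rw [neg_neg, ino_mirror]; exact h.mirror
  · right; left
    rw [ino_mirror]; exact h.mirror

theorem getLast?_eq_of_after {α : Type*} {p : α → Bool} {l₁ l₂ : List α} {a : α} (ha : p a)
    (h : ∀ b ∈ l₂, ¬ p b) : ((l₁ ++ a :: l₂).filter p).getLast? = some a := by
  rw [List.filter_append, List.filter_cons_of_pos ha, List.filter_eq_nil_iff.2 h]
  simp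

/-- Let `C` be the banana on a trail of `A` that contains `B`. On the left trail, a higher node
right of the cut would be between the cut and `B.top` and exceed `B.top`. On the right trail,
`C.top` is left of the cut for the same reason, and the nodes above it are to the right of `B.top`.
So `C` is the last trail node before the cut in both cases. -/
theorem Good.nxt_of_panL {A B : Banana} (h0 : ∀ i, pos i ≠ 0) (h : Good v pos A) (hB : B ∈ A.proper)
    (hp : PanL v pos y A.ino B) : ∃ C, nxt v pos y A = some C ∧ B ∈ C.bananas := by
  obtain ⟨p1, p2, p3, p4⟩ := hp
  rw [proper, List.mem_append, mem_bananasTrail, mem_bananasTrail] at hB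
  rcases hB with ⟨C, hC, hB⟩ | ⟨C, hC, hB⟩
  · refine ⟨C, nxt_eq_some.2 ⟨?_, ?_⟩, hB⟩
    · have hw := h.pos_left hC
      have hBC : B.top ∈ C.ino ∨ B.top = C.top := by
        rcases mem_proper hB with rfl | hB
        · exact Or.inr rfl
        · exact Or.inl (top_mem_ino hB)
      have hle : pos B.top ≤ pos C.top ∧ v B.top ≤ v C.top := by
        rcases hBC with hBC | hBC
        · exact ⟨(hw.1 _ hBC).le, ((h.lwin_left hC).lt_top _ hBC).le⟩
        · rw [hBC]; exact ⟨le_rfl, le_rfl⟩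
      rw [nx, if_neg (by omega)]
      obtain ⟨L₁, L₂, e⟩ := List.append_of_mem hC
      have hpw := h.pairwise_left
      have hvw := h.valid.pairwise_left
      rw [e] at hpw hvw ⊢
      rw [List.pairwise_append, List.pairwise_cons] at hpw hvw
      refine getLast?_eq_of_after (by simpa using by omega) fun E hE hpE => ?_
      have h1 := hpw.2.1.1 E hE E.top (Or.inr rfl) B.top hBC
      have h2 := hvw.2.1.1 E hE
      have h3 := p4 E.top (mem_ino.2 (Or.inr (Or.inl ⟨E, by simp [e, hE], Or.inr rfl⟩)))
        (by simpa using hpE) h1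
      linarith
    · rcases mem_proper hB with rfl | hB
      · exact p3
      · exact p3.trans ((h.lwin_left hC).lt_top _ (top_mem_ino hB))
  · have hw := h.pos_right hC
    rcases mem_proper hB with rfl | hB
    · have := hw.1 _ (lo_mem_ino B); omega
    · have hBC := top_mem_ino hB
      have hlt := (h.lwin_right hC).lt_top _ hBC
      refine ⟨C, nxt_eq_some.2 ⟨?_, p3.trans hlt⟩, bananas_of_proper hB⟩
      have hneg : pos C.top < 0 := by
        by_contra hcon
        have := p4 C.top (h.lwin_right hC).top_mem (by have := h0 C.top; omega) (hw.1 _ hBC)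
        linarith
      rw [nx, if_pos (by omega)]
      obtain ⟨L₁, L₂, e⟩ := List.append_of_mem hC
      have hpw := h.pairwise_right
      rw [e] at hpw ⊢
      rw [List.pairwise_append, List.pairwise_cons] at hpw
      refine getLast?_eq_of_after (by simpa using hneg) fun E hE hpE => ?_
      have h1 := hpw.2.1.1 E hE E.top (Or.inr rfl) B.top (Or.inl hBC)
      simp only [decide_eq_true_eq] at hpE
      omega

theorem proper_of_mirror {B T : Banana} (hT : T.ino.Nodup) (h : B.mirror ∈ T.mirror.proper) :
    B ∈ T.proper := by
  simpa using mirror_proper (by simpa using hT) h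

theorem Good.nxt_of_pan {A B : Banana} (h0 : ∀ i, pos i ≠ 0) (h : Good v pos A) (hB : B ∈ A.proper)
    (hp : PanL v pos y A.ino B ∨ PanL v (-pos) y A.ino B) :
    ∃ C, nxt v pos y A = some C ∧ B ∈ C.bananas := by
  rcases hp with hp | hp
  · exact h.nxt_of_panL h0 hB hp
  · obtain ⟨C, h1, h2⟩ := h.mirror.nxt_of_panL (fun i => by simpa using h0 i)
      (mirror_proper h.nodup hB) (by rw [ino_mirror]; exact hp.mirror)
    rw [nxt_mirror (h0 _)] at h1
    obtain ⟨D, h3, rfl⟩ := Option.map_eq_some_iff.1 h1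
    exact ⟨D, h3, by simpa using mirror_mem_bananas h2⟩

theorem PanL.mono {l l' : List ℕ} {B : Banana} (h : PanL v pos y l B) (hs : ∀ i ∈ l', i ∈ l) :
    PanL v pos y l' B :=
  ⟨h.lo_lt, h.top_pos, h.y_lt, fun z hz => h.lt z (hs z hz)⟩

/-- All bananas around the cut are on the path. -/
theorem Good.mem_path (h0 : ∀ i, pos i ≠ 0) {T B : Banana} {cs : List Banana} (h : Good v pos T)
    (hcs : IsPath v pos y (some T) cs) (hB : B ∈ T.bananas) (hp : Pan v pos y T B) : B ∈ cs := by
  induction T using ind generalizing cs with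
  | h a b l r hl hr =>
    cases hcs with
    | cons hcs =>
      rcases mem_proper hB with rfl | hB
      · simp
      · have hp' : PanL v pos y (Banana.mk a b l r).ino B ∨
            PanL v (-pos) y (Banana.mk a b l r).ino B := by
          rcases hp with rfl | hp
          · right
            have h1 := (List.nodup_append.1 ((perm_ino (Banana.mk a b l r)).nodup_iff.2 h.nodup)).1.of_map _
            rw [bananas_eq, List.nodup_cons] at h1
            exact absurd hB h1.1
          · exact hp
        obtain ⟨C, h1, h2⟩ := h.nxt_of_pan h0 hB hp'
        rw [h1] at hcs
        have hC := nx_mem (nxt_eq_some.1 h1).1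
        have hsub : ∀ i ∈ C.ino, i ∈ (Banana.mk a b l r).ino := fun i hi =>
          ino_subset (mem_bananas_of_child (self_mem_bananas _) hC) hi
        have hpC : Pan v pos y C B := Or.inr (hp'.imp (fun h => h.mono hsub) fun h => h.mono hsub)
        refine List.mem_cons_of_mem _ ?_
        rcases List.mem_append.1 hC with hC | hC
        · exact hl C hC (h.left hC) hcs h2 hpC
        · exact hr C hC (h.right hC) hcs h2 hpC

/-- The next banana around the cut, if the cut is to the left of the minimum. -/
theorem Good.panL_nxt (h0 : ∀ i, pos i ≠ 0) {T A C : Banana} (h : Good v pos T)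
    (hA : A ∈ T.bananas) (hp : Pan v pos y T A) (hlo : 0 < pos A.lo)
    (hC : nxt v pos y A = some C) : C ∈ A.left ∧ PanL v pos y T.ino C := by
  obtain ⟨hn, hy⟩ := nxt_eq_some.1 hC
  obtain ⟨hCl, hCp⟩ := nx_left_mem hn (by omega)
  obtain ⟨L, hL⟩ := nx_eq_left hn (by omega)
  have hgA := h.of_mem hA
  have hpl := hgA.pos_left hCl
  have hCA : C.top ∈ A.ino := mem_ino.2 (Or.inr (Or.inl ⟨C, hCl, Or.inr rfl⟩))
  refine ⟨hCl, hpl.1 _ (lo_mem_ino C), hCp, hy, fun z hz hz0 hzt => ?_⟩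
  -- The window of `A` contains all nodes between the cut and `C.top`: by its `border` if `A.top` is
  -- right of the cut, and as an interval if `A.top` is left of it.
  have hzA : z ∈ A.ino := by
    rcases mem_proper hA with rfl | hA
    · exact hz
    rcases h.win_of_proper hA with hw | hw
    · have hp : PanL v pos y T.ino A := by
        rcases hp with rfl | hp | hp
        · exact absurd (hw.lt_top _ hw.top_mem) (lt_irrefl _)
        · exact hp
        · have h1 := hp.lo_lt
          have h2 := hw.pos_lt _ (lo_mem_ino A)
          simp only [Pi.neg_apply] at h1; omega
      exact hw.border z hz (hzt.trans (hw.pos_lt _ hCA)) fun w hw1 hw2 hw3 =>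
        hp.lt w hw1 (by omega) hw3
    · have hp : PanL v (-pos) y T.ino A := by
        rcases hp with rfl | hp | hp
        · exact absurd (hw.lt_top _ hw.top_mem) (lt_irrefl _)
        · have h1 := hp.lo_lt
          have h2 := hw.pos_lt _ (lo_mem_ino A)
          simp only [Pi.neg_apply] at h2; omega
        · exact hp
      have := hp.top_pos
      refine hw.conv _ hCA z hz ?_ ?_ <;> simp only [Pi.neg_apply] at * <;> omega
  have hvC := hgA.valid.child_left C hCl
  by_cases hzC : z ∈ C.ino
  · exact hvC.lt_of_mem (hgA.valid.valid_left C hCl) hzC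
  · by_contra hv
    -- otherwise `z` belongs to a higher node of the trail
    have h1 := mt (((hgA.lwin_left hCl).border z hzA hzt)) hzC
    push Not at h1
    obtain ⟨w, w1, w2, w3, w4⟩ := h1
    have hwL : w ∈ A.ino := w1
    rw [ino_eq, hgA.split_left h0, hL, List.append_assoc, inoL_append, inoL_append, inoL_cons,
      inoL_nil, List.nil_append] at hwL
    rw [List.append_assoc, List.mem_append] at hwL
    rcases hwL with hwL | hwL
    · rw [List.mem_append] at hwL
      rcases hwL with hwL | hwL
      · obtain ⟨D, hD, hwD⟩ := mem_inoL.1 hwL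
        have hD' := List.mem_filter.1 hD
        have := (hgA.pos_left hD'.1).1
        have h3 : pos D.top < 0 := by simpa using hD'.2
        rcases hwD with hwD | rfl
        · have := this w hwD; omega
        · omega
      · rw [List.mem_append, List.mem_singleton] at hwL
        rcases hwL with hwL | rfl
        · exact absurd (hvC.lt_of_mem (hgA.valid.valid_left C hCl) hwL) w4.not_gt
        · omega
    · rw [List.mem_append] at hwL
      rcases hwL with hwL | hwL
      · have h5 : pos C.top < pos w := by
          have hs2 := hgA.sorted
          rw [ino_eq, hgA.split_left h0, hL, List.append_assoc, inoL_append, inoL_append, inoL_cons,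
            inoL_nil, List.nil_append, List.pairwise_append, List.pairwise_append] at hs2
          exact hs2.1.2.2 C.top (by simp) w hwL
        omega
      · have h5 : pos C.top < pos w := by
          have hs2 := hgA.sorted
          rw [ino_eq, List.pairwise_append] at hs2
          exact hs2.2.2 C.top (mem_inoL.2 ⟨C, hCl, Or.inr rfl⟩) w hwL
        omega

theorem Good.pan_nxt (h0 : ∀ i, pos i ≠ 0) {T A C : Banana} (h : Good v pos T)
    (hA : A ∈ T.bananas) (hp : Pan v pos y T A) (hC : nxt v pos y A = some C) :
    (0 < pos A.lo → C ∈ A.left ∧ PanL v pos y T.ino C) ∧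
    (pos A.lo < 0 → C ∈ A.right ∧ PanL v (-pos) y T.ino C) := by
  refine ⟨fun hlo => h.panL_nxt h0 hA hp hlo hC, fun hlo => ?_⟩
  have := h.mirror.panL_nxt (fun i => by simpa using h0 i) (mirror_mem_bananas hA) hp.mirror
    (C := C.mirror) (by simpa using hlo) (by rw [nxt_mirror (h0 _), hC]; rfl)
  refine ⟨?_, ?_⟩
  · simpa [mirror_injective.eq_iff] using this.1
  · have h2 := this.2.mirror
    simpa using h2

theorem Good.path_spec (h0 : ∀ i, pos i ≠ 0) {T : Banana} (h : Good v pos T) {o : Option Banana}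
    {cs : List Banana} (hcs : IsPath v pos y o cs)
    (ho : ∀ A, o = some A → A ∈ T.bananas ∧ Pan v pos y T A) :
    ∀ B ∈ cs, B ∈ T.bananas ∧ Pan v pos y T B := by
  induction hcs with
  | nil => simp
  | @cons A cs hcs ih =>
    obtain ⟨hA, hp⟩ := ho A rfl
    intro B hB
    rcases List.mem_cons.1 hB with rfl | hB
    · exact ⟨hA, hp⟩
    · refine ih (fun C hC => ?_) B hB
      refine ⟨mem_bananas_of_child hA (nx_mem (nxt_eq_some.1 hC).1), Or.inr ?_⟩
      have := h.pan_nxt h0 hA hp hC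
      rcases lt_or_gt_of_ne (h0 A.lo) with h1 | h1
      · exact Or.inr (this.2 h1).2
      · exact Or.inl (this.1 h1).2

theorem exists_path (v : ℕ → ℝ) (pos : ℕ → ℤ) (y : ℝ) (T : Banana) :
    ∃ cs, IsPath v pos y (some T) cs := by
  induction T using ind with
  | h a b l r hl hr =>
    cases hn : nxt v pos y (mk a b l r) with
    | none => exact ⟨[_], .cons (by rw [hn]; exact .nil)⟩
    | some C =>
      obtain ⟨cs, hcs⟩ : ∃ cs, IsPath v pos y (some C) cs := by
        rcases List.mem_append.1 (nx_mem (nxt_eq_some.1 hn).1) with h | h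
        · exact hl C h
        · exact hr C h
      exact ⟨_, .cons (by rw [hn]; exact hcs)⟩

theorem IsPath.isChain {o : Option Banana} {cs : List Banana} (h : IsPath v pos y o cs) :
    cs.IsChain fun A C => C ∈ A.left ++ A.right := by
  induction h with
  | nil => simp
  | @cons A cs h ih =>
    rw [List.isChain_cons]
    refine ⟨fun C hC => ?_, ih⟩
    cases h' : nxt v pos y A with
    | none => rw [h'] at h; cases h; simp at hC
    | some D =>
      rw [h'] at h
      cases h
      simp only [List.head?_cons, Option.mem_def, Option.some.injEq] at hC
      subst hC
      exact nx_mem (nxt_eq_some.1 h').1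

theorem IsPath.of_append {o : Option Banana} {cs ds : List Banana} {B : Banana}
    (h : IsPath v pos y o (cs ++ B :: ds)) : IsPath v pos y (some B) (B :: ds) := by
  induction cs generalizing o with
  | nil => cases h with | cons h => exact .cons h
  | cons C cs ih => cases h with | cons h => exact ih h

end Banana
end BananaTree

namespace BananaTree
namespace Banana

variable {v : ℕ → ℝ} {pos : ℕ → ℤ} {y : ℝ}

/-! ### The cut -/

/-- The cut at position zero and height `y` is on the edge between the consecutive nodes `a`, `b`. -/
structure Cut (v : ℕ → ℝ) (pos : ℕ → ℤ) (y : ℝ) (l : List ℕ) (a b : ℕ) : Prop where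
  a_mem : a ∈ l
  b_mem : b ∈ l
  a_neg : pos a < 0
  b_pos : 0 < pos b
  gap : ∀ z ∈ l, pos z ≤ pos a ∨ pos b ≤ pos z
  between : (v a < y ∧ y < v b) ∨ (v b < y ∧ y < v a)

theorem Cut.mirror {l : List ℕ} {a b : ℕ} (h : Cut v pos y l a b) :
    Cut v (-pos) y l.reverse b a := by
  refine ⟨by simpa using h.b_mem, by simpa using h.a_mem, by simpa using h.b_pos,
    by simpa using h.a_neg, fun z hz => ?_, h.between.symm⟩
  have := h.gap z (by simpa using hz)
  simp only [Pi.neg_apply]; omega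

theorem Cut.lt_y {l : List ℕ} {a b : ℕ} (h : Cut v pos y l a b) {K : ℝ} (ha : K ≤ v a)
    (hb : K ≤ v b) : K < y := by
  rcases h.between with h | h <;> linarith [h.1]

theorem Cut.y_lt {l : List ℕ} {a b : ℕ} (h : Cut v pos y l a b) {K : ℝ} (ha : v a ≤ K)
    (hb : v b ≤ K) : y < K := by
  rcases h.between with h | h <;> linarith [h.2]

/-- As `y` is strictly between the values of `a` and `b`, it suffices that neither is below the
minimum of `B`. This is clear for nodes of the window, and for `b` as its upper end; if `a` is
outside, then it is the delimiting node and at least as high as the maximum. -/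
theorem Good.lo_lt_y_of_panL {T B : Banana} {a b : ℕ} (h : Good v pos T)
    (hc : Cut v pos y T.ino a b) (hB : B ∈ T.proper) (hp : PanL v pos y T.ino B) : v B.lo < y := by
  have hw := h.lwin hB hp.lo_lt
  have hbt : pos b ≤ pos B.top := by
    rcases hc.gap _ hw.top_mem with h1 | h1
    · have := hc.a_neg; have := hp.top_pos; omega
    · exact h1
  have ha0 := hc.a_neg
  have hb0 := hc.b_pos
  rcases hbt.eq_or_lt with e | hlt
  · have e := h.inj hc.b_mem hw.top_mem e
    have ha : a ∈ B.ino := by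
      refine hw.conv _ (lo_mem_ino B) a hc.a_mem ?_ (by omega)
      rcases hc.gap _ (hw.sub _ (lo_mem_ino B)) with h1 | h1
      · exact h1
      · have := hp.lo_lt; rw [e] at h1; omega
    have h1 := hw.lo_le a ha
    have h2 := hw.lt_top a ha
    rw [← e] at h2
    exact hc.lt_y h1 (h1.trans h2.le)
  · have hb : b ∈ B.ino := hw.border b hc.b_mem hlt fun w hw1 hw2 hw3 =>
      hp.lt w hw1 (by omega) hw3
    have h1 := hw.lo_le b hb
    by_cases ha : a ∈ B.ino
    · exact hc.lt_y (hw.lo_le a ha) h1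
    · have h2 := mt (hw.border a hc.a_mem (by omega)) ha
      push Not at h2
      obtain ⟨w, w1, w2, w3, w4⟩ := h2
      have : w = a := by
        rcases hc.gap w w1 with h3 | h3
        · exact h.inj w1 hc.a_mem (by omega)
        · exact absurd (hp.lt w w1 (by omega) w3) w4.not_gt
      subst this
      exact hc.lt_y ((h1.trans (hw.lt_top b hb).le).trans w4) h1

theorem Good.lo_lt_y {T B : Banana} {a b : ℕ} (h : Good v pos T) (hc : Cut v pos y T.ino a b)
    (hB : B ∈ T.bananas) (hp : Pan v pos y T B) : v B.lo < y := by
  have hT : v T.lo < y := hc.lt_y (h.valid.lo_le hc.a_mem) (h.valid.lo_le hc.b_mem)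
  rcases mem_proper hB with rfl | hB
  · exact hT
  rcases hp with rfl | hp | hp
  · exact hT
  · exact h.lo_lt_y_of_panL hc hB hp
  · have := h.mirror.lo_lt_y_of_panL (B := B.mirror) (a := b) (b := a)
      (by rw [ino_mirror]; exact hc.mirror) (mirror_proper h.nodup hB)
      (by rw [ino_mirror]; exact hp.mirror)
    simpa using this

/-- A minimum is smaller than the node to its left. -/
theorem Good.lo_lt_prev {T B : Banana} {a : ℕ} (h : Good v pos T) (hB : B ∈ T.bananas)
    (ha : a ∈ T.ino) (hlt : pos a < pos B.lo)
    (hgap : ∀ z ∈ T.ino, pos z ≤ pos a ∨ pos B.lo ≤ pos z) : v B.lo < v a := by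
  have hne : a ≠ B.lo := fun e => by rw [e] at hlt; omega
  rcases mem_proper hB with rfl | hB
  · exact h.valid.lo_lt ha hne
  have hvB := h.valid.of_mem (bananas_of_proper hB)
  by_cases haB : a ∈ B.ino
  · exact hvB.lo_lt haB hne
  rcases h.win_of_proper hB with hw | hw
  · have hlo := hw.pos_lt _ (lo_mem_ino B)
    have h2 := mt (hw.border a ha (by omega)) haB
    push Not at h2
    obtain ⟨w, w1, w2, w3, w4⟩ := h2
    rcases hgap w w1 with h3 | h3
    · have := h.inj w1 ha (by omega)
      subst this
      exact (hw.lt_top _ (lo_mem_ino B)).trans_le w4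
    · exact absurd (hw.lt_top w (hw.conv _ (lo_mem_ino B) w w1 h3 w3)) w4.not_gt
  · have hlo := hw.pos_lt _ (lo_mem_ino B)
    simp only [Pi.neg_apply] at hlo
    have h3 : pos a ≤ pos B.top := by
      by_contra h3
      exact haB (hw.conv _ (lo_mem_ino B) a ha (by simp only [Pi.neg_apply]; omega)
        (by simp only [Pi.neg_apply]; omega))
    have : a = B.top := by
      rcases hgap _ hw.top_mem with h4 | h4
      · exact h.inj ha hw.top_mem (by omega)
      · omega
    subst this
    exact hw.lt_top _ (lo_mem_ino B)

theorem Good.lo_lt_next {T B : Banana} {b : ℕ} (h : Good v pos T) (hB : B ∈ T.bananas)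
    (hb : b ∈ T.ino) (hlt : pos B.lo < pos b)
    (hgap : ∀ z ∈ T.ino, pos z ≤ pos B.lo ∨ pos b ≤ pos z) : v B.lo < v b := by
  have := h.mirror.lo_lt_prev (a := b) (mirror_mem_bananas hB) (by simpa using hb)
    (by simpa using hlt) (fun z hz => by
      have := hgap z (by simpa using hz)
      simp only [Pi.neg_apply, lo_mirror]; omega)
  simpa using this

/-! ### The smallest banana -/

theorem inTrail_of_gt (hm : ∀ i j, pos i < pos j ↔ i < j) {C : Banana} (hC : C.hi = (C.top : WithTop ℕ))
    (h : pos C.top < pos C.lo) : C.inTrail = C.right := by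
  rw [inTrail, if_neg]
  rw [hC]
  exact not_lt.2 (by exact_mod_cast ((hm _ _).1 h).le)

theorem inTrail_of_lt (hm : ∀ i j, pos i < pos j ↔ i < j) {C : Banana} (hC : C.hi = (C.top : WithTop ℕ))
    (h : pos C.lo < pos C.top) : C.inTrail = C.left := by
  rw [inTrail, if_pos]
  rw [hC]
  exact_mod_cast ((hm _ _).1 h)

theorem midTrail_of_gt (hm : ∀ i j, pos i < pos j ↔ i < j) {C : Banana} (hC : C.hi = (C.top : WithTop ℕ))
    (h : pos C.top < pos C.lo) : C.midTrail = C.left := by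
  rw [midTrail, if_neg]
  rw [hC]
  exact not_lt.2 (by exact_mod_cast ((hm _ _).1 h).le)

theorem midTrail_of_lt (hm : ∀ i j, pos i < pos j ↔ i < j) {C : Banana} (hC : C.hi = (C.top : WithTop ℕ))
    (h : pos C.lo < pos C.top) : C.midTrail = C.right := by
  rw [midTrail, if_pos]
  rw [hC]
  exact_mod_cast ((hm _ _).1 h)

theorem topNode_none {B : Banana} {t : List Banana} (h : t.getLast? = none) :
    B.topNode t = B.lo := by
  rw [topNode, h]; rfl

theorem topNode_some {B C : Banana} {t : List Banana} (h : t.getLast? = some C) :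
    B.topNode t = C.hi := by
  rw [topNode, h]; rfl


/-- The first node of the trail of `A` that is followed on the way to the cut. -/
noncomputable def ptr (pos : ℕ → ℤ) (A : Banana) : WithTop ℕ := ((nx pos A).map hi).getD A.lo

theorem nxt_of_isPath {o : Option Banana} {D : Banana} {tl : List Banana}
    (h : IsPath v pos y o (D :: tl)) : o = some D := by
  cases h; rfl

/-- The loop stops exactly at the end of the path: there the next node is a lower end, below `y` by
`hlo`, or a maximum that is not above `y`. The test against `e` never stops it earlier, since `e` is
below `y` itself. -/
theorem descend_eq {T : Banana} (h : Valid v T) {e : ℕ} (he : v e < y)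
    {B : Banana} {tl : List Banana} (hpath : IsPath v pos y (some B) (B :: tl))
    (hB : B ∈ T.bananas) (hlo : ∀ E ∈ B :: tl, v E.lo < y)
    (hin : ∀ E ∈ tl, T.inPtr E.hi = ptr pos E) (n : ℕ) (hn : tl.length ≤ n) :
    descend T v y e n B.hi (ptr pos B) = ((B :: tl).getLast (List.cons_ne_nil _ _)).hi := by
  induction tl generalizing B n with
  | nil =>
    cases n with
    | zero => rfl
    | succ n =>
      rw [descend, if_neg]
      · rfl
      · rintro ⟨-, h2⟩
        cases hpath with
        | cons hp =>
        cases hx : nx pos B with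
        | none =>
          rw [ptr, hx] at h2
          exact absurd (WithTop.coe_lt_coe.1 h2) (hlo B (by simp)).not_gt
        | some C =>
          have hC := (h.of_mem hB).child_of_mem (nx_mem hx)
          rw [ptr, hx, Option.map_some, Option.getD_some, hC.hi_eq] at h2
          rw [nxt_eq_some.2 ⟨hx, WithTop.coe_lt_coe.1 h2⟩] at hp
          cases hp
  | cons D tl ih =>
    cases n with
    | zero => simp at hn
    | succ n =>
      cases hpath with
      | cons hp =>
      have hx := nxt_of_isPath hp
      rw [hx] at hp
      obtain ⟨hx1, hy⟩ := nxt_eq_some.1 hx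
      have hD := (h.of_mem hB).child_of_mem (nx_mem hx1)
      have hDT := mem_bananas_of_child hB (nx_mem hx1)
      have hptr : ptr pos B = D.hi := by rw [ptr, hx1]; rfl
      rw [descend, if_pos, hptr, hin D (by simp)]
      · rw [ih hp hDT (fun E hE => hlo E (List.mem_cons_of_mem _ hE))
          (fun E hE => hin E (List.mem_cons_of_mem _ hE)) n (by simpa using hn)]
        rfl
      · rw [hptr, hD.hi_eq]
        refine ⟨fun e' => ?_, WithTop.coe_lt_coe.2 hy⟩
        have e'' : D.top = e := by exact_mod_cast e'
        rw [e''] at hy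
        linarith

/-- Once the candidates lie entirely left of the cut, the path continues along right trails of
bananas whose maximum is to the left of their minimum. These are in-trails, as followed by the
algorithm. -/
theorem Good.clean_right {B : Banana} {tl : List Banana} (h : Good v pos B)
    (hpath : IsPath v pos y (some B) (B :: tl)) (hpos : pos B.lo < 0)
    (hclean : ∀ C ∈ B.right, pos C.top < 0 → ∀ i ∈ C.ino, pos i < 0) :
    ∀ E ∈ tl, pos E.top < pos E.lo ∧ ∀ i ∈ E.ino, pos i < 0 := by
  induction tl generalizing B with
  | nil => simp
  | cons D tl ih =>
    cases hpath with
    | cons hp =>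
    have hx := nxt_of_isPath hp
    rw [hx] at hp
    have hDr := nx_right_mem (nxt_eq_some.1 hx).1 hpos
    have hDi : ∀ i ∈ D.ino, pos i < 0 := hclean D hDr.1 hDr.2
    intro E hE
    rcases List.mem_cons.1 hE with rfl | hE
    · exact ⟨(h.pos_right hDr.1).1 _ (lo_mem_ino _), hDi⟩
    · refine ih (h.right hDr.1) hp (hDi _ (lo_mem_ino D)) (fun C hC _ i hi => ?_) E hE
      exact hDi i (mem_ino.2 (Or.inr (Or.inr ⟨C, hC, Or.inl hi⟩)))

theorem Good.clean_left (h0 : ∀ i, pos i ≠ 0) {B : Banana} {tl : List Banana} (h : Good v pos B)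
    (hpath : IsPath v pos y (some B) (B :: tl)) (hpos : 0 < pos B.lo)
    (hclean : ∀ C ∈ B.left, 0 < pos C.top → ∀ i ∈ C.ino, 0 < pos i) :
    ∀ E ∈ tl, pos E.lo < pos E.top ∧ ∀ i ∈ E.ino, 0 < pos i := by
  intro E hE
  have := h.mirror.clean_right (tl := tl.map Banana.mirror) (by simpa using hpath.mirror h0)
    (by simpa using hpos) (by
      intro C hC hlt i hi
      simp only [right_mirror, List.mem_map] at hC
      obtain ⟨C, hC, rfl⟩ := hC
      have := hclean C hC (by simpa using hlt) i (by simpa using hi)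
      simpa using this) E.mirror (List.mem_map_of_mem hE)
  simpa using this

theorem Good.inPtr_right (hm : ∀ i j, pos i < pos j ↔ i < j) {T E : Banana} (h : Good v pos T)
    (ht : T.hi = ⊤) (hE : E ∈ T.bananas) (hhi : E.hi = (E.top : WithTop ℕ))
    (hlt : pos E.top < pos E.lo) (hE' : ∀ i ∈ E.ino, pos i < 0) : T.inPtr E.hi = ptr pos E := by
  have hfil : (E.right.filter fun C => pos C.top < 0) = E.right := by
    rw [List.filter_eq_self]
    intro C hC
    simpa using hE' _ (mem_ino.2 (Or.inr (Or.inr ⟨C, hC, Or.inr rfl⟩)))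
  rw [inPtr, at?_eq h.valid h.nodup ht hE, Option.map_some, Option.getD_some,
    inTrail_of_gt hm hhi hlt, ptr, nx, if_pos (hE' _ (lo_mem_ino E)), hfil, topNode]

theorem Good.inPtr_left (hm : ∀ i j, pos i < pos j ↔ i < j) {T E : Banana} (h : Good v pos T)
    (ht : T.hi = ⊤) (hE : E ∈ T.bananas) (hhi : E.hi = (E.top : WithTop ℕ))
    (hlt : pos E.lo < pos E.top) (hE' : ∀ i ∈ E.ino, 0 < pos i) : T.inPtr E.hi = ptr pos E := by
  have hfil : (E.left.filter fun C => 0 < pos C.top) = E.left := by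
    rw [List.filter_eq_self]
    intro C hC
    simpa using hE' _ (mem_ino.2 (Or.inr (Or.inl ⟨C, hC, Or.inr rfl⟩)))
  rw [inPtr, at?_eq h.valid h.nodup ht hE, Option.map_some, Option.getD_some,
    inTrail_of_lt hm hhi hlt, ptr, nx, if_neg (not_lt.2 (hE' _ (lo_mem_ino E)).le), hfil, topNode]

theorem find?_of_sorted {l : List ℕ} (hl : l.Pairwise fun i j => pos i < pos j) {P : ℕ → Bool}
    {b : ℕ} (hb : b ∈ l) (hP : P b) (hu : ∀ z ∈ l, P z → pos b ≤ pos z) : l.find? P = some b := by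
  induction l with
  | nil => simp at hb
  | cons z l ih =>
    rw [List.pairwise_cons] at hl
    rcases List.mem_cons.1 hb with rfl | hb
    · simp [hP]
    · have hz : ¬ P z := fun hz => by
        have := hu z (by simp) hz
        have := hl.1 b hb
        omega
      rw [List.find?_cons_of_neg hz]
      exact ih hl.2 hb fun z hz => hu z (List.mem_cons_of_mem _ hz)

theorem mem_path_split {o : Option Banana} {cs : List Banana} (h : IsPath v pos y o cs) {B : Banana}
    (hB : B ∈ cs) (hcs : cs ≠ []) : ∃ tl, IsPath v pos y (some B) (B :: tl) ∧ (∀ E ∈ tl, E ∈ cs) ∧ tl.length ≤ cs.length ∧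
      (B :: tl).getLast (List.cons_ne_nil _ _) = cs.getLast hcs := by
  obtain ⟨s, t, rfl⟩ := List.append_of_mem hB
  exact ⟨t, h.of_append, fun E hE => by simp [hE], by simp; omega, by simp⟩

theorem Good.path_nodup (h0 : ∀ i, pos i ≠ 0) {T : Banana} {cs : List Banana} (h : Good v pos T)
    (hcs : IsPath v pos y (some T) cs) : cs.Nodup := by
  have hs := h.path_spec h0 hcs (fun A hA => by
    cases hA; exact ⟨self_mem_bananas _, Or.inl rfl⟩)
  have hch : cs.IsChain fun A C => v A.lo < v C.lo := by
    have h1 := hcs.isChain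
    rw [List.isChain_iff_getElem] at h1 ⊢
    intro i hi
    exact ((h.valid.of_mem (hs _ (List.getElem_mem _)).1).child_of_mem (h1 i hi)).lo_lt
  have : (cs.map fun A => v A.lo).Pairwise (· < ·) := by
    rw [← List.isChain_iff_pairwise, List.isChain_map]
    exact hch
  exact List.Nodup.of_map _ (this.imp fun h => h.ne)

/-- Justifies the number of bananas as a bound for the rounds of `descend` and `loadLoop`. -/
theorem Good.path_length (h0 : ∀ i, pos i ≠ 0) {T : Banana} {cs : List Banana} (h : Good v pos T)
    (hcs : IsPath v pos y (some T) cs) : cs.length ≤ T.bananas.length := by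
  have hs := h.path_spec h0 hcs (fun A hA => by
    cases hA; exact ⟨self_mem_bananas _, Or.inl rfl⟩)
  exact ((h.path_nodup h0 hcs).subperm fun B hB => (hs B hB).1).length_le

end Banana
end BananaTree

namespace BananaTree
namespace Banana

variable {v : ℕ → ℝ} {pos : ℕ → ℤ} {y : ℝ}

theorem takeWhile_eq_of_first {α : Type*} {p : α → Bool} {l₁ l₂ : List α} {a : α} (ha : ¬ p a)
    (h : ∀ b ∈ l₁, p b) : (l₁ ++ a :: l₂).takeWhile p = l₁ := by
  induction l₁ with
  | nil => simp [ha]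
  | cons b l ih => simp [h b (by simp), ih fun c hc => h c (by simp [hc])]

/-- A banana with nodes in its interior on both sides of the cut and above the cut is on the path. -/
theorem Good.pan_of_mem {T A : Banana} (h : Good v pos T) (hA : A ∈ T.bananas) {i j : ℕ}
    (hi : i ∈ A.ino) (hj : j ∈ A.ino) (hi0 : pos i < 0) (hj0 : 0 < pos j)
    (hy : y < v i ∨ y < v j) : Pan v pos y T A := by
  rcases mem_proper hA with rfl | hA
  · exact Or.inl rfl
  rcases h.win_of_proper hA with hw | hw
  · have h1 := hw.pos_lt j hj
    refine Or.inr (Or.inl ⟨hw.pos_lt _ (lo_mem_ino A), by omega, ?_, fun z hz hz0 hzt => ?_⟩)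
    · have := hw.lt_top i hi
      have := hw.lt_top j hj
      rcases hy with hy | hy <;> linarith
    · exact hw.lt_top z (hw.conv i hi z hz (by omega) hzt)
  · have h1 := hw.pos_lt i hi
    simp only [Pi.neg_apply] at h1
    refine Or.inr (Or.inr ⟨hw.pos_lt _ (lo_mem_ino A), by simp only [Pi.neg_apply]; omega, ?_,
      fun z hz hz0 hzt => ?_⟩)
    · have := hw.lt_top i hi
      have := hw.lt_top j hj
      rcases hy with hy | hy <;> linarith
    · exact hw.lt_top z (hw.conv j hj z hz (by simp only [Pi.neg_apply] at *; omega) hzt)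

theorem Good.not_left_and_right {A C D : Banana} (h : Good v pos A) (hC : C ∈ A.left)
    (hD : D ∈ A.right) : C.top ≠ D.top := by
  intro e
  have := (h.pos_left hC).2
  have := (h.pos_right hD).2
  rw [e] at *
  omega

section

variable (hm : ∀ i j, pos i < pos j ↔ i < j) (h0 : ∀ i, pos i ≠ 0) {T : Banana}
  (h : Good v pos T) (ht : T.hi = ⊤) {a b : ℕ} (hc : Cut v pos y T.ino a b) {cs : List Banana}
  (hcs : IsPath v pos y (some T) cs) (hne : cs ≠ [])
include hm h0 h ht hc hcs

/-- Since `b` exceeds its left neighbour, it is an upper end, of `C` attached to `A` say. If it is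
on a left trail, then `C` is around the cut and lies left of it, and the walk starts down its
mid-trail. If it is on a right trail, then `A` is around the cut and the walk starts at the node
below `b`, the last one before the cut. From there on everything is left of the cut and the
in-pointers follow the path. -/
theorem Good.smallest_rising (hab : v a < v b) :
    (if T.dn b < b then descend T v y a T.bananas.length (T.dth (T.low b)) (T.dn b)
      else descend T v y a T.bananas.length b (T.midPtr b)) = (cs.getLast hne).hi := by
  have hy : v a < y ∧ y < v b := by
    rcases hc.between with h | h
    · exact h
    · linarith [h.1, h.2]
  have hcsT := h.path_spec h0 hcs (fun A hA => by
    cases hA; exact ⟨self_mem_bananas _, Or.inl rfl⟩)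
  have hlen := h.path_length h0 hcs
  have ha0 := hc.a_neg
  have hb0 := hc.b_pos
  have hneg : ∀ z ∈ T.ino, pos z < pos b → pos z < 0 := fun z hz hz' => by
    rcases hc.gap z hz with h1 | h1 <;> omega
  rcases exists_lo_or_top hc.b_mem with ⟨B, hB, e⟩ | ⟨A, hA, C, hCA, e⟩
  · have := h.lo_lt_prev hB hc.a_mem (by rw [e]; omega) (by rw [e]; exact hc.gap)
    rw [e] at this
    linarith
  have hgA := h.of_mem hA
  have hCT := mem_bananas_of_child hA hCA
  have hCh := hgA.valid.child_of_mem hCA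
  have hb : C.hi = (b : WithTop ℕ) := by rw [hCh.hi_eq, e]
  have hbA : b ∈ A.ino := by
    rw [mem_ino]
    rcases List.mem_append.1 hCA with hC | hC
    · exact Or.inr (Or.inl ⟨C, hC, Or.inr e.symm⟩)
    · exact Or.inr (Or.inr ⟨C, hC, Or.inr e.symm⟩)
  have htop : ∀ D ∈ A.left ++ A.right, D.hi = (b : WithTop ℕ) → D.top = b := fun D _ hD => by
    rw [top, hD]; rfl
  rcases List.mem_append.1 hCA with hC | hC
  · obtain ⟨l₁, l₂, hl⟩ := List.append_of_mem hC
    have hpw := hgA.pairwise_left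
    rw [hl, List.pairwise_append] at hpw
    have hl1 : ∀ D ∈ l₁, pos b < pos D.top := fun D hD => by
      have := hpw.2.2 D hD C (by simp) C.top (Or.inr rfl) D.top (Or.inr rfl)
      rwa [e] at this
    have hdn : T.dn b = A.topNode l₁ := by
      have h1 := owner?_eq h.nodup hA hCA
      rw [hb] at h1
      rw [dn, h1]
      simp only
      rw [if_pos (List.mem_map.2 ⟨C, hC, hb⟩), belowNode, hl, takeWhile_eq_of_first]
      · simp [hb]
      · intro D hD
        have h2 := hl1 D hD
        simp only [ne_eq, decide_not, Bool.not_eq_eq_eq_not, Bool.not_true, decide_eq_false_iff_not]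
        intro h3
        rw [htop D (by simp [hl, hD]) h3] at h2
        omega
    -- On a left trail the node below `b` is to the right of `b`, so the test of the algorithm
    -- fails.
    rw [if_neg, midPtr]
    · have hCi : ∀ i ∈ C.ino, pos i < 0 := fun i hi =>
        hneg i (ino_subset hCT hi) (by have := (hgA.pos_left hC).1 i hi; rwa [e] at this)
      have hfil : (C.right.filter fun C => pos C.top < 0) = C.right := by
        rw [List.filter_eq_self]
        intro D hD
        simpa using hCi _ (mem_ino.2 (Or.inr (Or.inr ⟨D, hD, Or.inr rfl⟩)))
      have hlt := (hgA.pos_left hC).1 _ (lo_mem_ino C)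
      have hptr : C.topNode C.midTrail = ptr pos C := by
        rw [midTrail_of_lt hm hCh.hi_eq hlt, ptr, nx, if_pos (hCi _ (lo_mem_ino C)), hfil, topNode]
      have hCcs : C ∈ cs := h.mem_path h0 hcs hCT (Or.inr (Or.inl ⟨hlt, by rw [e]; omega, by
        rw [e]; exact hy.2, fun z hz hz0 hzt => by
          rw [e] at hzt; have := hneg z hz hzt; omega⟩))
      obtain ⟨tl, hp, hsub, hl', hlast⟩ := mem_path_split hcs hCcs hne
      rw [← hb, at?_eq h.valid h.nodup ht hCT, Option.map_some, Option.getD_some, hptr, ← hlast]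
      have hcl := (h.of_mem hCT).clean_right hp (hCi _ (lo_mem_ino C))
        fun D hD _ i hi => hCi i (mem_ino.2 (Or.inr (Or.inr ⟨D, hD, Or.inl hi⟩)))
      have hch := hp.isChain
      refine descend_eq h.valid hy.1 hp hCT (fun E hE => ?_) (fun E hE => ?_) _ (by omega)
      · rcases List.mem_cons.1 hE with rfl | hE
        · exact h.lo_lt_y hc hCT (hcsT _ hCcs).2
        · exact h.lo_lt_y hc (hcsT _ (hsub E hE)).1 (hcsT _ (hsub E hE)).2
      · have hET := (hcsT _ (hsub E hE)).1
        refine h.inPtr_right hm ht hET ?_ (hcl E hE).1 (hcl E hE).2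
        rcases mem_proper hET with rfl | hET
        · exact absurd ((hcl E hE).2 b hc.b_mem) (by omega)
        · exact h.valid.hi_proper hET
    · rw [hdn, not_lt]
      cases hl' : l₁.getLast? with
      | none =>
        rw [topNode_none hl']
        have := (hm _ _).1 ((hgA.pos_left hC).2)
        rw [e] at this
        exact_mod_cast this.le
      | some D =>
        have hD := List.mem_of_getLast? hl'
        rw [topNode_some hl', (hgA.valid.child_left D (by simp [hl, hD])).hi_eq]
        exact_mod_cast ((hm _ _).1 (hl1 D hD)).le
  · obtain ⟨l₁, l₂, hl⟩ := List.append_of_mem hC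
    have hpw := hgA.pairwise_right
    rw [hl, List.pairwise_append] at hpw
    have hl1 : ∀ D ∈ l₁, ∀ i, i ∈ D.ino ∨ i = D.top → pos i < pos b := fun D hD i hi => by
      have := hpw.2.2 D hD C (by simp) C.top (Or.inr rfl) i hi
      rwa [e] at this
    have hl1T : ∀ D ∈ l₁, D ∈ T.proper := fun D hD =>
      proper_of_child hA (List.mem_append_right _ (by simp [hl, hD]))
    have hl1n : ∀ D ∈ l₁, ∀ i, i ∈ D.ino ∨ i = D.top → pos i < 0 := fun D hD i hi => by
      refine hneg i ?_ (hl1 D hD i hi)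
      rcases hi with hi | rfl
      · exact ino_subset (bananas_of_proper (hl1T D hD)) hi
      · exact top_mem_ino (hl1T D hD)
    have hlpos : ∀ D ∈ C :: l₂, 0 < pos D.top := by
      intro D hD
      rcases List.mem_cons.1 hD with rfl | hD
      · rw [e]; exact hb0
      · have := (List.pairwise_cons.1 hpw.2.1).1 D hD D.top (Or.inr rfl) C.top (Or.inr rfl)
        rw [e] at this; omega
    have hfil : (A.right.filter fun D => pos D.top < 0) = l₁ := by
      rw [hl, List.filter_append, List.filter_eq_self.2, List.filter_eq_nil_iff.2,
        List.append_nil]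
      · intro D hD; have := hlpos D hD; simp; omega
      · intro D hD; simpa using hl1n D hD _ (Or.inr rfl)
    have hAlo : pos A.lo < 0 := by
      refine hneg _ (ino_subset hA (lo_mem_ino A)) ?_
      have := (hgA.pos_right hC).2
      rwa [e] at this
    have hdn : T.dn b = A.topNode l₁ := by
      have h1 := owner?_eq h.nodup hA hCA
      rw [hb] at h1
      rw [dn, h1]
      simp only
      rw [if_neg, belowNode, hl, takeWhile_eq_of_first]
      · simp [hb]
      · intro D hD
        have h2 := hl1 D hD _ (Or.inr rfl)
        simp only [ne_eq, decide_not, Bool.not_eq_eq_eq_not, Bool.not_true, decide_eq_false_iff_not]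
        intro h3
        rw [htop D (by simp [hl, hD]) h3] at h2
        omega
      · intro h2
        obtain ⟨D, hD, h3⟩ := List.mem_map.1 h2
        exact hgA.not_left_and_right hD hC ((htop D (by simp [hD]) h3).trans e.symm)
    rw [if_pos]
    · have hptr : A.topNode l₁ = ptr pos A := by
        rw [ptr, nx, if_pos hAlo, hfil, topNode]
      have hAcs : A ∈ cs := h.mem_path h0 hcs hA
        (h.pan_of_mem hA (lo_mem_ino A) hbA hAlo hb0 (Or.inr hy.2))
      obtain ⟨tl, hp, hsub, hl', hlast⟩ := mem_path_split hcs hAcs hne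
      have hlow := low_eq h.nodup hA hCA
      rw [hb] at hlow
      rw [hlow, dth_eq h.nodup hA, hdn, hptr, ← hlast]
      have hcl := hgA.clean_right hp hAlo fun D hD hD' i hi =>
        hl1n D (by rw [← hfil]; simpa using ⟨hD, hD'⟩) i (Or.inl hi)
      refine descend_eq h.valid hy.1 hp hA (fun E hE => ?_) (fun E hE => ?_) _ (by omega)
      · rcases List.mem_cons.1 hE with rfl | hE
        · exact h.lo_lt_y hc hA (hcsT _ hAcs).2
        · exact h.lo_lt_y hc (hcsT _ (hsub E hE)).1 (hcsT _ (hsub E hE)).2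
      · have hET := (hcsT _ (hsub E hE)).1
        refine h.inPtr_right hm ht hET ?_ (hcl E hE).1 (hcl E hE).2
        rcases mem_proper hET with rfl | hET
        · exact absurd ((hcl E hE).2 b hc.b_mem) (by omega)
        · exact h.valid.hi_proper hET
    · rw [hdn]
      cases hl' : l₁.getLast? with
      | none =>
        rw [topNode_none hl']
        have := (hm _ _).1 ((hgA.pos_right hC).2)
        rw [e] at this
        exact_mod_cast this
      | some D =>
        have hD := List.mem_of_getLast? hl'
        rw [topNode_some hl', (hgA.valid.child_right D (by simp [hl, hD])).hi_eq]
        exact_mod_cast ((hm _ _).1 (hl1 D hD _ (Or.inr rfl)))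

/-- Mirror image of `Good.smallest_rising`; it is not deduced by mirroring because the pointers
compare labels, whose order a mirror image does not reverse. -/
theorem Good.smallest_falling (hab : v b < v a) :
    (if (a : WithTop ℕ) < T.dn a then descend T v y b T.bananas.length (T.dth (T.low a)) (T.dn a)
      else descend T v y b T.bananas.length a (T.midPtr a)) = (cs.getLast hne).hi := by
  have hy : v b < y ∧ y < v a := by
    rcases hc.between with h | h
    · linarith [h.1, h.2]
    · exact h
  have hcsT := h.path_spec h0 hcs (fun A hA => by
    cases hA; exact ⟨self_mem_bananas _, Or.inl rfl⟩)
  have hlen := h.path_length h0 hcs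
  have hb0 := hc.b_pos
  have ha0 := hc.a_neg
  have hpos : ∀ z ∈ T.ino, pos a < pos z → 0 < pos z := fun z hz hz' => by
    rcases hc.gap z hz with h1 | h1 <;> omega
  rcases exists_lo_or_top hc.a_mem with ⟨B, hB, e⟩ | ⟨A, hA, C, hCA, e⟩
  · have := h.lo_lt_next hB hc.b_mem (by rw [e]; omega) (by rw [e]; exact hc.gap)
    rw [e] at this
    linarith
  have hgA := h.of_mem hA
  have hCT := mem_bananas_of_child hA hCA
  have hCh := hgA.valid.child_of_mem hCA
  have ha : C.hi = (a : WithTop ℕ) := by rw [hCh.hi_eq, e]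
  have haA : a ∈ A.ino := by
    rw [mem_ino]
    rcases List.mem_append.1 hCA with hC | hC
    · exact Or.inr (Or.inl ⟨C, hC, Or.inr e.symm⟩)
    · exact Or.inr (Or.inr ⟨C, hC, Or.inr e.symm⟩)
  have htop : ∀ D ∈ A.left ++ A.right, D.hi = (a : WithTop ℕ) → D.top = a := fun D _ hD => by
    rw [top, hD]; rfl
  rcases (List.mem_append.1 hCA).symm with hC | hC
  · obtain ⟨l₁, l₂, hl⟩ := List.append_of_mem hC
    have hpw := hgA.pairwise_right
    rw [hl, List.pairwise_append] at hpw
    have hl1 : ∀ D ∈ l₁, pos D.top < pos a := fun D hD => by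
      have := hpw.2.2 D hD C (by simp) C.top (Or.inr rfl) D.top (Or.inr rfl)
      rwa [e] at this
    have hdn : T.dn a = A.topNode l₁ := by
      have h1 := owner?_eq h.nodup hA hCA
      rw [ha] at h1
      rw [dn, h1]
      simp only
      rw [if_neg, belowNode, hl, takeWhile_eq_of_first]
      · simp [ha]
      · intro D hD
        have h2 := hl1 D hD
        simp only [ne_eq, decide_not, Bool.not_eq_eq_eq_not, Bool.not_true, decide_eq_false_iff_not]
        intro h3
        rw [htop D (by simp [hl, hD]) h3] at h2
        omega
      · intro h2
        obtain ⟨D, hD, h3⟩ := List.mem_map.1 h2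
        exact hgA.not_left_and_right hD hC ((htop D (by simp [hD]) h3).trans e.symm)
    rw [if_neg, midPtr]
    · have hCi : ∀ i ∈ C.ino, 0 < pos i := fun i hi =>
        hpos i (ino_subset hCT hi) (by have := (hgA.pos_right hC).1 i hi; rwa [e] at this)
      have hfil : (C.left.filter fun C => 0 < pos C.top) = C.left := by
        rw [List.filter_eq_self]
        intro D hD
        simpa using hCi _ (mem_ino.2 (Or.inr (Or.inl ⟨D, hD, Or.inr rfl⟩)))
      have hlt := (hgA.pos_right hC).1 _ (lo_mem_ino C)
      have hptr : C.topNode C.midTrail = ptr pos C := by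
        rw [midTrail_of_gt hm hCh.hi_eq hlt, ptr, nx, if_neg (not_lt.2 (hCi _ (lo_mem_ino C)).le), hfil, topNode]
      have hCcs : C ∈ cs := h.mem_path h0 hcs hCT (Or.inr (Or.inr ⟨by simpa using hlt, by simpa [e] using ha0, by
        rw [e]; exact hy.2, fun z hz hz0 hzt => by
          simp only [Pi.neg_apply, e] at hz0 hzt; have := hpos z hz (by omega); omega⟩))
      obtain ⟨tl, hp, hsub, hl', hlast⟩ := mem_path_split hcs hCcs hne
      rw [← ha, at?_eq h.valid h.nodup ht hCT, Option.map_some, Option.getD_some, hptr, ← hlast]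
      have hcl := (h.of_mem hCT).clean_left h0 hp (hCi _ (lo_mem_ino C))
        fun D hD _ i hi => hCi i (mem_ino.2 (Or.inr (Or.inl ⟨D, hD, Or.inl hi⟩)))
      have hch := hp.isChain
      refine descend_eq h.valid hy.1 hp hCT (fun E hE => ?_) (fun E hE => ?_) _ (by omega)
      · rcases List.mem_cons.1 hE with rfl | hE
        · exact h.lo_lt_y hc hCT (hcsT _ hCcs).2
        · exact h.lo_lt_y hc (hcsT _ (hsub E hE)).1 (hcsT _ (hsub E hE)).2
      · have hET := (hcsT _ (hsub E hE)).1
        refine h.inPtr_left hm ht hET ?_ (hcl E hE).1 (hcl E hE).2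
        rcases mem_proper hET with rfl | hET
        · exact absurd ((hcl E hE).2 a hc.a_mem) (by omega)
        · exact h.valid.hi_proper hET
    · rw [hdn, not_lt]
      cases hl' : l₁.getLast? with
      | none =>
        rw [topNode_none hl']
        have := (hm _ _).1 ((hgA.pos_right hC).2)
        rw [e] at this
        exact_mod_cast this.le
      | some D =>
        have hD := List.mem_of_getLast? hl'
        rw [topNode_some hl', (hgA.valid.child_right D (by simp [hl, hD])).hi_eq]
        exact_mod_cast ((hm _ _).1 (hl1 D hD)).le
  · obtain ⟨l₁, l₂, hl⟩ := List.append_of_mem hC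
    have hpw := hgA.pairwise_left
    rw [hl, List.pairwise_append] at hpw
    have hl1 : ∀ D ∈ l₁, ∀ i, i ∈ D.ino ∨ i = D.top → pos a < pos i := fun D hD i hi => by
      have := hpw.2.2 D hD C (by simp) C.top (Or.inr rfl) i hi
      rwa [e] at this
    have hl1T : ∀ D ∈ l₁, D ∈ T.proper := fun D hD =>
      proper_of_child hA (List.mem_append_left _ (by simp [hl, hD]))
    have hl1n : ∀ D ∈ l₁, ∀ i, i ∈ D.ino ∨ i = D.top → 0 < pos i := fun D hD i hi => by
      refine hpos i ?_ (hl1 D hD i hi)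
      rcases hi with hi | rfl
      · exact ino_subset (bananas_of_proper (hl1T D hD)) hi
      · exact top_mem_ino (hl1T D hD)
    have hlneg : ∀ D ∈ C :: l₂, pos D.top < 0 := by
      intro D hD
      rcases List.mem_cons.1 hD with rfl | hD
      · rw [e]; exact ha0
      · have := (List.pairwise_cons.1 hpw.2.1).1 D hD D.top (Or.inr rfl) C.top (Or.inr rfl)
        rw [e] at this; omega
    have hfil : (A.left.filter fun D => 0 < pos D.top) = l₁ := by
      rw [hl, List.filter_append, List.filter_eq_self.2, List.filter_eq_nil_iff.2,
        List.append_nil]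
      · intro D hD; have := hlneg D hD; simp; omega
      · intro D hD; simpa using hl1n D hD _ (Or.inr rfl)
    have hAlo : 0 < pos A.lo := by
      refine hpos _ (ino_subset hA (lo_mem_ino A)) ?_
      have := (hgA.pos_left hC).2
      rwa [e] at this
    have hdn : T.dn a = A.topNode l₁ := by
      have h1 := owner?_eq h.nodup hA hCA
      rw [ha] at h1
      rw [dn, h1]
      simp only
      rw [if_pos (List.mem_map.2 ⟨C, hC, ha⟩), belowNode, hl, takeWhile_eq_of_first]
      · simp [ha]
      · intro D hD
        have h2 := hl1 D hD _ (Or.inr rfl)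
        simp only [ne_eq, decide_not, Bool.not_eq_eq_eq_not, Bool.not_true, decide_eq_false_iff_not]
        intro h3
        rw [htop D (by simp [hl, hD]) h3] at h2
        omega
    rw [if_pos]
    · have hptr : A.topNode l₁ = ptr pos A := by
        rw [ptr, nx, if_neg (not_lt.2 hAlo.le), hfil, topNode]
      have hAcs : A ∈ cs := h.mem_path h0 hcs hA
        (h.pan_of_mem hA haA (lo_mem_ino A) ha0 hAlo (Or.inl hy.2))
      obtain ⟨tl, hp, hsub, hl', hlast⟩ := mem_path_split hcs hAcs hne
      have hlow := low_eq h.nodup hA hCA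
      rw [ha] at hlow
      rw [hlow, dth_eq h.nodup hA, hdn, hptr, ← hlast]
      have hcl := hgA.clean_left h0 hp hAlo fun D hD hD' i hi =>
        hl1n D (by rw [← hfil]; simpa using ⟨hD, hD'⟩) i (Or.inl hi)
      refine descend_eq h.valid hy.1 hp hA (fun E hE => ?_) (fun E hE => ?_) _ (by omega)
      · rcases List.mem_cons.1 hE with rfl | hE
        · exact h.lo_lt_y hc hA (hcsT _ hAcs).2
        · exact h.lo_lt_y hc (hcsT _ (hsub E hE)).1 (hcsT _ (hsub E hE)).2
      · have hET := (hcsT _ (hsub E hE)).1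
        refine h.inPtr_left hm ht hET ?_ (hcl E hE).1 (hcl E hE).2
        rcases mem_proper hET with rfl | hET
        · exact absurd ((hcl E hE).2 a hc.a_mem) (by omega)
        · exact h.valid.hi_proper hET
    · rw [hdn]
      cases hl' : l₁.getLast? with
      | none =>
        rw [topNode_none hl']
        have := (hm _ _).1 ((hgA.pos_left hC).2)
        rw [e] at this
        exact_mod_cast this
      | some D =>
        have hD := List.mem_of_getLast? hl'
        rw [topNode_some hl', (hgA.valid.child_left D (by simp [hl, hD])).hi_eq]
        exact_mod_cast ((hm _ _).1 (hl1 D hD _ (Or.inr rfl)))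


theorem Good.smallestBanana_eq {s t ℓ : ℕ} (hℓ : ∀ i, pos i < 0 ↔ i ≤ ℓ)
    (hino : T.ino = critPoints v s t) (hmax : IsMaxItem v b ↔ v a < v b) :
    smallestBanana T v s t ℓ y = ((cs.getLast hne).lo, (cs.getLast hne).hi) := by
  have ha0 := hc.a_neg
  have hb0 := hc.b_pos
  have hcsT := h.path_spec h0 hcs (fun A hA => by
    cases hA; exact ⟨self_mem_bananas _, Or.inl rfl⟩)
  have ha : (critPoints v s t).reverse.find? (fun i => i ≤ ℓ) = some a := by
    rw [← hino]
    refine find?_of_sorted (pos := -pos) ?_ (by simpa using hc.a_mem)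
      (by simpa using (hℓ a).1 ha0) fun z hz hz' => ?_
    · rw [List.pairwise_reverse]
      exact h.sorted.imp fun h => by simpa using h
    · have h1 := (hℓ z).2 (by simpa using hz')
      have := hc.gap z (by simpa using hz)
      simp only [Pi.neg_apply]; omega
  have hb : (critPoints v s t).find? (fun i => ℓ < i) = some b := by
    rw [← hino]
    refine find?_of_sorted h.sorted hc.b_mem
      (by simpa using (not_iff_not.2 (hℓ b)).1 (by omega)) fun z hz hz' => ?_
    have h1 := (not_iff_not.2 (hℓ z)).2 (by simpa using hz')
    have := hc.gap z hz
    omega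
  have hq : (if IsMaxItem v b then
      if T.dn b < b then descend T v y a T.bananas.length (T.dth (T.low b)) (T.dn b)
      else descend T v y a T.bananas.length b (T.midPtr b)
    else
      if (a : WithTop ℕ) < T.dn a then
        descend T v y b T.bananas.length (T.dth (T.low a)) (T.dn a)
      else descend T v y b T.bananas.length a (T.midPtr a)) = (cs.getLast hne).hi := by
    rcases lt_or_ge (v a) (v b) with hab | hab
    · rw [if_pos (hmax.2 hab)]
      exact h.smallest_rising hm h0 ht hc hcs hne hab
    · rw [if_neg (fun hh => hab.not_gt (hmax.1 hh))]
      refine h.smallest_falling hm h0 ht hc hcs hne (lt_of_le_of_ne hab fun e => ?_)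
      have := hc.between
      rw [e] at this
      rcases this with h | h <;> linarith [h.1, h.2]
  rw [smallestBanana, ha, hb]
  simp only [Option.getD_some]
  rw [hq, birth_eq h.valid h.nodup ht (hcsT _ (List.getLast_mem hne)).1]

end

/-! ### The stacks of one tree -/

/-- The ends of a banana. -/
abbrev ends (B : Banana) : ℕ × WithTop ℕ := (B.lo, B.hi)

/-- One list in place of three stacks; filtering preserves the order, so the order along the path is
not lost. -/
def stacksOf (ℓ : ℕ) (es : Stack) : Triple :=
  ⟨es.filter fun e => e.1 ≤ ℓ ∧ e.2 ≤ ℓ,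
    es.filter fun e => ¬ (e.1 ≤ ℓ ∧ e.2 ≤ ℓ) ∧ ¬ (ℓ < e.1 ∧ ℓ < e.2),
    es.filter fun e => ℓ < e.1 ∧ ℓ < e.2⟩

theorem stacksOf_push (ℓ : ℕ) (es : Stack) (e : ℕ × WithTop ℕ) :
    (stacksOf ℓ es).push ℓ e = stacksOf ℓ (e :: es) := by
  unfold Triple.push stacksOf
  by_cases h1 : e.1 ≤ ℓ ∧ e.2 ≤ ℓ
  · simp [h1]
  · by_cases h2 : ℓ < e.1 ∧ ℓ < e.2
    · simp [h1, h2]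
    · simp only [if_neg h1, if_neg h2]
      congr 1
      · rw [List.filter_cons_of_neg (by simpa using h1)]
      · rw [List.filter_cons, if_pos]
        exact decide_eq_true (And.intro h1 h2)
      · rw [List.filter_cons_of_neg (by simpa using h2)]

/-- Walking up retraces the path backwards, because `low` and `dth` lead to the unique banana that
carries the current upper end. Hence the induction on the path from its lower end. -/
theorem loadLoop_eq {T : Banana} (hn : T.ino.Nodup) {ℓ : ℕ}
    (pre : List Banana) : ∀ (E : Banana) (acc : Stack) (n : ℕ),
    (pre ++ [E]).IsChain (fun A C => C ∈ A.left ++ A.right) → (∀ D ∈ pre ++ [E], D ∈ T.bananas) →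
    (∃ D ∈ pre ++ [E], D.hi ∈ T.spine) → pre.length < n →
    ∃ pre' B mid, pre ++ [E] = pre' ++ B :: mid ∧ B.hi ∈ T.spine ∧ (∀ D ∈ mid, D.hi ∉ T.spine) ∧
      loadLoop T ℓ n E.ends (stacksOf ℓ acc) = stacksOf ℓ ((B :: mid).map ends ++ acc) := by
  induction pre using List.reverseRecOn with
  | nil =>
    intro E acc n _ _ hs hlt
    cases n with
    | zero => simp at hlt
    | succ n =>
      refine ⟨[], E, [], rfl, by simpa using hs, by simp, ?_⟩
      rw [loadLoop, if_pos (by simpa [ends] using hs), stacksOf_push]; rfl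
  | append_singleton pre A ih =>
    intro E acc n hch hmem hs hlt
    cases n with
    | zero => simp at hlt
    | succ n =>
      by_cases hE : E.hi ∈ T.spine
      · refine ⟨pre ++ [A], E, [], rfl, hE, by simp, ?_⟩
        rw [loadLoop, if_pos hE, stacksOf_push]; rfl
      · have hA : A ∈ T.bananas := hmem A (by simp)
        have hEA : E ∈ A.left ++ A.right := by
          rw [List.append_assoc, List.isChain_append] at hch
          simpa using hch.2.1
        rw [loadLoop, if_neg hE, stacksOf_push]
        have h1 : (T.low E.ends.2, T.dth (T.low E.ends.2)) = A.ends := by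
          rw [ends, low_eq hn hA hEA, dth_eq hn hA]
        rw [h1]
        obtain ⟨pre', B, mid, e, hB, hmid, hl⟩ := ih A (E.ends :: acc) n
          (List.isChain_append.1 hch).1 (fun D hD => hmem D (by simp at hD ⊢; tauto)) (by
            obtain ⟨D, hD, hs⟩ := hs
            rcases List.mem_append.1 hD with hD | hD
            · exact ⟨D, hD, hs⟩
            · rw [List.mem_singleton.1 hD] at hs; exact absurd hs hE) (by simpa using hlt)
        refine ⟨pre', B, mid ++ [E], by rw [e]; simp, hB, fun D hD => ?_, ?_⟩
        · rcases List.mem_append.1 hD with hD | hD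
          · exact hmid D hD
          · rw [List.mem_singleton.1 hD]; exact hE
        · rw [hl]; simp

theorem hi_mem_spine (T : Banana) : T.hi ∈ T.spine :=
  List.mem_append_left _ (mem_leftSpine.2 ⟨[], T, rfl, rfl⟩)

theorem Good.loadStacks_eq (hm : ∀ i j, pos i < pos j ↔ i < j) (h0 : ∀ i, pos i ≠ 0) {T : Banana}
    (h : Good v pos T) (ht : T.hi = ⊤) {a b : ℕ} (hc : Cut v pos y T.ino a b) {cs : List Banana}
    (hcs : IsPath v pos y (some T) cs) {s t ℓ : ℕ} (hℓ : ∀ i, pos i < 0 ↔ i ≤ ℓ)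
    (hino : T.ino = critPoints v s t) (hmax : IsMaxItem v b ↔ v a < v b) :
    ∃ pre B tl, cs = pre ++ B :: tl ∧ B.hi ∈ T.spine ∧ (∀ D ∈ tl, D.hi ∉ T.spine) ∧
      loadStacks T v s t ℓ y = stacksOf ℓ ((B :: tl).map ends) := by
  have hne : cs ≠ [] := by cases hcs; simp
  have hcsT := h.path_spec h0 hcs (fun A hA => by
    cases hA; exact ⟨self_mem_bananas _, Or.inl rfl⟩)
  have hT : T ∈ cs := by cases hcs; simp
  have hlast := List.dropLast_append_getLast hne
  obtain ⟨pre', B, mid, e, hB, hmid, hl⟩ := loadLoop_eq h.nodup (ℓ := ℓ) cs.dropLast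
    (cs.getLast hne) [] T.bananas.length (by rw [hlast]; exact hcs.isChain)
    (by rw [hlast]; exact fun D hD => (hcsT D hD).1)
    (by rw [hlast]; exact ⟨T, hT, hi_mem_spine T⟩) (by
      have := h.path_length h0 hcs
      have := List.length_pos_iff.2 hne
      rw [List.length_dropLast]; omega)
  refine ⟨pre', B, mid, by rw [← e, hlast], hB, hmid, ?_⟩
  rw [loadStacks, h.smallestBanana_eq hm h0 ht hc hcs hne hℓ hino hmax]
  rw [List.append_nil] at hl
  exact hl

end Banana
end BananaTree

namespace BananaTree
namespace Banana

variable {v : ℕ → ℝ} {pos : ℕ → ℤ} {y : ℝ}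

/-! ### Windows with an exit on both sides -/

/-- The minimum `n` and the maximum `w` span a window that can be left upwards at `z` and downwards
at `c`. This notion is invariant under turning the map upside down. -/
structure Quad (v : ℕ → ℝ) (pos : ℕ → ℤ) (l : List ℕ) (z n w c : ℕ) : Prop where
  z_mem : z ∈ l
  n_mem : n ∈ l
  w_mem : w ∈ l
  c_mem : c ∈ l
  zn : pos z < pos n
  nw : pos n < pos w
  wc : pos w < pos c
  vcn : v c < v n
  vnw : v n < v w
  vwz : v w < v z
  between : ∀ i ∈ l, pos z < pos i → pos i < pos c → (v n ≤ v i ∧ v i ≤ v w)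

theorem Quad.dual {l : List ℕ} {z n w c : ℕ} (h : Quad v pos l z n w c) :
    Quad (fun i => -v i) (-pos) l c w n z := by
  refine ⟨h.c_mem, h.w_mem, h.n_mem, h.z_mem, ?_, ?_, ?_, ?_, ?_, ?_, fun i hi h1 h2 => ?_⟩
  · simpa using h.wc
  · simpa using h.nw
  · simpa using h.zn
  · simpa using h.vwz
  · simpa using h.vnw
  · simpa using h.vcn
  · have := h.between i hi (by simpa using h2) (by simpa using h1)
    constructor <;> linarith [this.1, this.2]

/-- `l` and `l'` agree up to end points that compare with all other points like their neighbours. -/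
structure EndsAgree (v : ℕ → ℝ) (pos : ℕ → ℤ) (l l' : List ℕ) : Prop where
  left : ∀ i ∈ l, i ∉ l' →
    (∃ j ∈ l, pos i < pos j ∧ (∀ k ∈ l, k ≠ i → pos j ≤ pos k) ∧
      ∀ k ∈ l, k ≠ i → k ≠ j → ((v k < v i ↔ v k < v j) ∧ (v i < v k ↔ v j < v k))) ∨
    ∃ j ∈ l, pos j < pos i ∧ (∀ k ∈ l, k ≠ i → pos k ≤ pos j) ∧
      ∀ k ∈ l, k ≠ i → k ≠ j → ((v k < v i ↔ v k < v j) ∧ (v i < v k ↔ v j < v k))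
  right : ∀ i ∈ l', i ∉ l → (∀ k ∈ l', pos i ≤ pos k) ∨ ∀ k ∈ l', pos k ≤ pos i

/-- Only end points of the lists can differ. If the exit `z` were missing in `l'`, its neighbour
would compare with `w` in the same way, although it lies inside the window; similarly for `c` and
`n`. All nodes strictly between the exits are common to both lists. -/
theorem Quad.transfer {l l' : List ℕ} {z n w c : ℕ} (h : Quad v pos l z n w c)
    (he : EndsAgree v pos l l') : Quad v pos l' z n w c := by
  obtain ⟨hz, hn, hw, hc, h1, h2, h3, h4, h5, h6, h7⟩ := h
  have ne : ∀ {i j : ℕ}, pos i < pos j → i ≠ j := fun h e => by rw [e] at h; omega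
  have hz' : z ∈ l' := by
    by_contra hcon
    rcases he.left z hz hcon with ⟨j, hj, e1, e2, e3⟩ | ⟨j, hj, e1, e2, e3⟩
    · have hjn := e2 n hn (ne h1).symm
      have hjw : w ≠ j := (ne (by omega : pos j < pos w)).symm
      have := (e3 w hw (ne (by omega : pos z < pos w)).symm hjw).1.1 h6
      have := (h7 j hj e1 (by omega)).2
      linarith
    · have := e2 n hn (ne h1).symm; omega
  have hc' : c ∈ l' := by
    by_contra hcon
    rcases he.left c hc hcon with ⟨j, hj, e1, e2, e3⟩ | ⟨j, hj, e1, e2, e3⟩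
    · have := e2 n hn (ne (by omega)); omega
    · have hjn := e2 w hw (ne h3)
      have hjw : n ≠ j := ne (by omega)
      have h8 := (h7 j hj (by omega) e1).1
      have h9 := (e3 n hn (ne (by omega)) hjw).2.1 h4
      linarith
  have hl : ∀ i, pos z < pos i → pos i < pos c → (i ∈ l ↔ i ∈ l') := fun i i1 i2 => by
    constructor
    · intro hi
      by_contra hcon
      rcases he.left i hi hcon with ⟨j, hj, e1, e2, -⟩ | ⟨j, hj, e1, e2, -⟩
      · have := e2 z hz (ne i1); omega
      · have := e2 c hc (ne i2).symm; omega
    · intro hi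
      by_contra hcon
      rcases he.right i hi hcon with h | h
      · have := h z hz'; omega
      · have := h c hc'; omega
  exact ⟨hz', (hl n h1 (by omega)).1 hn, (hl w (by omega) h3).1 hw, hc', h1, h2, h3, h4, h5, h6,
    fun i hi i1 i2 => h7 i ((hl i i1 i2).2 hi) i1 i2⟩

theorem exists_nearest {l : List ℕ} {P : ℕ → Prop} (h : ∃ i ∈ l, P i) :
    ∃ i ∈ l, P i ∧ ∀ j ∈ l, P j → pos i ≤ pos j := by
  classical
  obtain ⟨i, hi, hP⟩ := h
  obtain ⟨k, hk, hk'⟩ := (l.toFinset.filter P).exists_min_image pos ⟨i, by simp [hi, hP]⟩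
  simp only [Finset.mem_filter, List.mem_toFinset] at hk hk'
  exact ⟨k, hk.1, hk.2, fun j hj hPj => hk' j ⟨hj, hPj⟩⟩

theorem exists_nearest_neg {l : List ℕ} {P : ℕ → Prop} (h : ∃ i ∈ l, P i) :
    ∃ i ∈ l, P i ∧ ∀ j ∈ l, P j → pos j ≤ pos i := by
  obtain ⟨i, hi, hP, h⟩ := exists_nearest (pos := -pos) h
  exact ⟨i, hi, hP, fun j hj hPj => by simpa using h j hj hPj⟩

/-- A banana whose upper end is not on the left spine spans a window with exits on both sides. -/
theorem Good.quad_of_lwin {T C : Banana} (h : Good v pos T)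
    (hd : ∀ i ∈ T.ino, ∀ j ∈ T.ino, v i = v j → i = j)
    (hw : LWin v pos T.ino C) (hz : ∃ z ∈ T.ino, pos z < pos C.top ∧ v C.top < v z) :
    ∃ z c, Quad v pos T.ino z C.lo C.top c ∧ ∀ i ∈ T.ino, pos C.top < pos i → v i < v C.lo →
      pos c ≤ pos i := by
  -- `z` is the nearest higher node on the left, and `c` below is the nearest node to the right of
  -- the maximum that is lower than the minimum.
  obtain ⟨z, hz, ⟨z1, z2⟩, z3⟩ := exists_nearest_neg (pos := pos) hz
  obtain ⟨c₀, c1, c2, c3, c4⟩ := hw.out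
  obtain ⟨c, hc, ⟨c5, c6⟩, c7⟩ := exists_nearest (pos := pos)
    (P := fun i => pos C.top < pos i ∧ v i < v C.lo) ⟨c₀, c1, c2, c3⟩
  have hcc := c7 c₀ c1 ⟨c2, c3⟩
  have hlo := hw.pos_lt _ (lo_mem_ino C)
  have hin : ∀ i ∈ T.ino, pos z < pos i → pos i < pos C.top → i ∈ C.ino := by
    intro i hi i1 i2
    refine hw.border i hi i2 fun k hk k1 k2 => ?_
    by_contra hcon
    rcases (not_lt.1 hcon).eq_or_lt with e | hlt
    · rw [hd _ hw.top_mem _ hk e] at k2; omega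
    · have := z3 k hk ⟨k2, hlt⟩; omega
  have hzC : z ∉ C.ino := fun hzC => absurd (hw.lt_top z hzC) z2.not_gt
  have hzn : pos z < pos C.lo := by
    by_contra hcon
    exact hzC (hw.conv _ (lo_mem_ino C) z hz (by omega) z1)
  refine ⟨z, c, ⟨hz, hw.sub _ (lo_mem_ino C), hw.top_mem, hc, hzn, hlo, c5, c6,
    hw.lt_top _ (lo_mem_ino C), z2, fun i hi i1 i2 => ?_⟩, fun i hi i1 i2 => c7 i hi ⟨i1, i2⟩⟩
  rcases lt_trichotomy (pos i) (pos C.top) with hlt | e | hlt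
  · have := hin i hi i1 hlt
    exact ⟨hw.lo_le i this, (hw.lt_top i this).le⟩
  · rw [h.inj hi hw.top_mem e]
    exact ⟨(hw.lt_top _ (lo_mem_ino C)).le, le_rfl⟩
  · refine ⟨?_, (c4 i hi hlt (by omega)).le⟩
    by_contra hcon
    have := c7 i hi ⟨hlt, not_le.1 hcon⟩
    omega

/-- The ends of a window with exits on both sides span a banana. -/
theorem Good.exists_of_quad {T : Banana} {z n w c : ℕ} (h : Good v pos T)
    (hd : ∀ i ∈ T.ino, ∀ j ∈ T.ino, v i = v j → i = j) (hq : Quad v pos T.ino z n w c) :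
    ∃ C ∈ T.proper, C.lo = n ∧ C.top = w := by
  obtain ⟨hz, hn, hw, hc, h1, h2, h3, h4, h5, h6, h7⟩ := hq
  have hlt : ∀ i ∈ T.ino, pos z < pos i → pos i < pos c → i ≠ w → v i < v w :=
    fun i hi i1 i2 hne => lt_of_le_of_ne (h7 i hi i1 i2).2 fun e => hne (hd i hi w hw e)
  -- A lower end is smaller than its left neighbour, but the left neighbour of `w` is in the window
  -- and lower than `w`.
  have key : ∃ C ∈ T.proper, C.top = w := by
    rcases exists_lo_or_top hw with ⟨B, hB, e⟩ | ⟨A, hA, C, hC, e⟩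
    · obtain ⟨p, hp, p1, p2⟩ := exists_nearest_neg (pos := pos) (P := fun i => pos i < pos w)
        ⟨n, hn, h2⟩
      have h8 := h.lo_lt_prev hB hp (by rw [e]; exact p1) fun k hk => by
        rw [e]
        rcases lt_or_ge (pos k) (pos w) with h | h
        · exact Or.inl (p2 k hk h)
        · exact Or.inr h
      have := p2 n hn h2
      have := hlt p hp (by omega) (by omega) (fun e => by rw [e] at p1; omega)
      rw [e] at h8
      linarith
    · exact ⟨C, proper_of_child hA hC, e⟩
  obtain ⟨C, hC, rfl⟩ := key
  refine ⟨C, hC, ?_, rfl⟩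
  have hne : ∀ {i j : ℕ}, pos i < pos j → i ≠ j := fun h e => by rw [e] at h; omega
  -- With the right orientation, the banana contains `n` and cannot extend to `z`, so its minimum is
  -- `n`. With the opposite one it would contain `c`, so its exit on the left would be below the
  -- value of `c`, although this exit has to be reached before `z`.
  rcases h.win_of_proper hC with hw' | hw'
  · have hnC : n ∈ C.ino := hw'.border n hn h2 fun k hk k1 k2 =>
      hlt k hk (by omega) (by omega) (hne k2)
    by_contra hcon
    have h8 := (h.of_mem (bananas_of_proper hC)).valid.lo_lt hnC (Ne.symm hcon)
    have h9 := hw'.pos_lt _ (lo_mem_ino C)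
    have h10 : pos C.lo ≤ pos z := by
      by_contra h10
      have := (h7 _ (hw'.sub _ (lo_mem_ino C)) (by omega) (by omega)).1
      linarith
    have := hw'.lt_top z (hw'.conv _ (lo_mem_ino C) z hz h10 (by omega))
    linarith
  · obtain ⟨c', c1, c2, c3, c4⟩ := hw'.out
    simp only [Pi.neg_apply, neg_lt_neg_iff, neg_le_neg_iff] at c2 c4
    have h8 : v n ≤ v c' := by
      refine (h7 c' c1 ?_ (by omega)).1
      by_contra hcon
      have := c4 z hz (by omega) (by omega)
      linarith
    have hcC : c ∈ C.ino := hw'.border c hc (by simpa using h3) fun k hk k1 k2 => by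
      simp only [Pi.neg_apply, neg_lt_neg_iff, neg_le_neg_iff] at k1 k2
      rcases k1.eq_or_lt with e | k1
      · rw [h.inj hk hc e]; linarith
      · exact hlt k hk (by omega) k1 (hne k2).symm
    have := hw'.lo_le c hcC
    linarith

theorem Quad.congr {l l' : List ℕ} {z n w c : ℕ} (h : Quad v pos l z n w c)
    (hl : ∀ i, i ∈ l ↔ i ∈ l') : Quad v pos l' z n w c := by
  obtain ⟨hz, hn, hw, hc, h1, h2, h3, h4, h5, h6, h7⟩ := h
  exact ⟨(hl _).1 hz, (hl _).1 hn, (hl _).1 hw, (hl _).1 hc, h1, h2, h3, h4, h5, h6,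
    fun i hi => h7 i ((hl i).2 hi)⟩

/-! ### Up-tree and down-tree of the same map -/

/-- `U` and `D` are the up-tree and the down-tree of the same map, to be cut between `a` and `b`. -/
structure Setting (v : ℕ → ℝ) (pos : ℕ → ℤ) (y : ℝ) (U D : Banana) (a b : ℕ) : Prop where
  pos_ne : ∀ i, pos i ≠ 0
  up : Good v pos U
  dn : Good (fun i => -v i) pos D
  up_hi : U.hi = ⊤
  dn_hi : D.hi = ⊤
  inj : ∀ i ∈ U.ino, ∀ j ∈ U.ino, v i = v j → i = j
  inj_dn : ∀ i ∈ D.ino, ∀ j ∈ D.ino, v i = v j → i = j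
  cut : Cut v pos y U.ino a b
  agree : EndsAgree v pos U.ino D.ino
  agree' : EndsAgree v pos D.ino U.ino

theorem EndsAgree.mirror {l l' : List ℕ} (h : EndsAgree v pos l l') :
    EndsAgree v (-pos) l.reverse l'.reverse := by
  refine ⟨fun i hi hi' => ?_, fun i hi hi' => ?_⟩
  · simp only [List.mem_reverse] at hi hi'
    rcases h.left i hi hi' with ⟨j, hj, e1, e2, e3⟩ | ⟨j, hj, e1, e2, e3⟩
    · exact Or.inr ⟨j, by simpa using hj, by simpa using e1, by simpa using e2, by simpa using e3⟩
    · exact Or.inl ⟨j, by simpa using hj, by simpa using e1, by simpa using e2, by simpa using e3⟩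
  · simp only [List.mem_reverse] at hi hi'
    rcases h.right i hi hi' with e | e
    · exact Or.inr (by simpa using e)
    · exact Or.inl (by simpa using e)

theorem Setting.mirror {U D : Banana} {a b : ℕ} (h : Setting v pos y U D a b) :
    Setting v (-pos) y U.mirror D.mirror b a where
  pos_ne i := by simpa using h.pos_ne i
  up := h.up.mirror
  dn := h.dn.mirror
  up_hi := by simpa using h.up_hi
  dn_hi := by simpa using h.dn_hi
  inj := by simpa using h.inj
  inj_dn := by simpa using h.inj_dn
  cut := by simpa using h.cut.mirror
  agree := by simpa using h.agree.mirror
  agree' := by simpa using h.agree'.mirror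

/-- The cut is in the out-panel of the window of `C`, on the right. -/
structure Sc (v : ℕ → ℝ) (pos : ℕ → ℤ) (y : ℝ) (U C : Banana) : Prop where
  mem : C ∈ U.proper
  lo_lt : pos C.lo < pos C.top
  top_neg : pos C.top < 0
  between : ∀ z ∈ U.ino, pos C.top < pos z → pos z < 0 → v C.lo < v z ∧ v z < v C.top
  lt_y : v C.lo < y

/-- There is a higher node to the left of the upper end. -/
def High (v : ℕ → ℝ) (pos : ℕ → ℤ) (U C : Banana) : Prop :=
  ∃ z ∈ U.ino, pos z < pos C.top ∧ v C.top < v z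

/-- Off the right spine of the down-tree the window has exits on both sides. Turned upside down it
is again such a window, hence a banana of the up-tree with the ends interchanged, and the in-panel
with the cut becomes the out-panel. -/
theorem Setting.exists_sc_of_dn {U D E : Banana} {a b : ℕ} (h : Setting v pos y U D a b)
    (hE : E ∈ D.proper) (hp : PanL (fun i => -v i) (-pos) (-y) D.ino E) (hlo : pos E.lo < 0)
    (hs : E.hi ∉ D.rightSpine) :
    ∃ C, Sc v pos y U C ∧ C.lo = E.top ∧ C.top = E.lo ∧ High v pos U C := by
  have hE' := mirror_proper h.dn.nodup hE
  have hw := h.dn.mirror.lwin hE' (by simpa using hp.lo_lt)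
  have hd' : ∀ i ∈ D.mirror.ino, ∀ j ∈ D.mirror.ino, -v i = -v j → i = j := by
    simpa using h.inj_dn
  have hz : ∃ z ∈ D.mirror.ino, (-pos) z < (-pos) E.mirror.top ∧ -v E.mirror.top < -v z := by
    by_contra hcon
    push Not at hcon
    obtain ⟨f, fs, e⟩ := h.dn.mirror.exists_plugL hE' (by simpa using hp.lo_lt) fun z hz hz' =>
      lt_of_le_of_ne (hcon z hz hz') fun e => by
        rw [hd' z hz _ hw.top_mem e] at hz'; omega
    exact hs (mem_leftSpine_mirror.1 (mem_leftSpine.2 ⟨_, _, e, by simp⟩))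
  obtain ⟨z, c, hq, -⟩ := h.dn.mirror.quad_of_lwin hd' hw hz
  have hq' := (hq.dual.congr (l' := D.ino) (by simp)).transfer (by simpa using h.agree')
  simp only [neg_neg, lo_mirror, top_mirror] at hq'
  -- Before the cut, the in-panel contains only values of `-v` below the maximum, so the exit lies
  -- beyond the cut.
  have hzpos : 0 < pos z := by
    by_contra hcon
    have hz0 := h.pos_ne z
    have h1 := hp.lt z (by simpa using hq.z_mem) (by simp only [Pi.neg_apply]; omega)
      (by simpa using hq.zn.trans hq.nw)
    have := hq'.vcn
    linarith
  obtain ⟨C, hC, e1, e2⟩ := h.up.exists_of_quad h.inj hq'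
  refine ⟨C, ⟨hC, by rw [e1, e2]; exact hq'.nw, by rw [e2]; exact hlo, fun i hi i1 i2 => ?_,
    by rw [e1]; simpa using hp.y_lt⟩, e1, e2, c, hq'.z_mem, ?_, by rw [e2]; exact hq'.vwz⟩
  · rw [e2] at i1 ⊢
    rw [e1]
    have h1 := hq'.zn
    have h2 := hq'.nw
    have h3 := hq'.between i hi (by omega) (by omega)
    refine ⟨lt_of_le_of_ne h3.1 fun e => ?_, lt_of_le_of_ne h3.2 fun e => ?_⟩
    · rw [h.inj _ hq'.n_mem _ hi e] at h2; omega
    · rw [h.inj _ hi _ hq'.w_mem e] at i1; omega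
  · rw [e2]; exact hq'.zn.trans hq'.nw

theorem Setting.exit {U D C : Banana} {a b : ℕ} (h : Setting v pos y U D a b)
    (hC : Sc v pos y U C) : ∃ c ∈ U.ino, 0 < pos c ∧ v c < v C.lo ∧
      ∀ w ∈ U.ino, pos C.top < pos w → pos w ≤ pos c → v w < v C.top := by
  obtain ⟨c, c1, c2, c3, c4⟩ := (h.up.lwin hC.mem hC.lo_lt).out
  refine ⟨c, c1, ?_, c3, c4⟩
  have := h.pos_ne c
  by_contra hcon
  have := (hC.between c c1 c2 (by omega)).1
  linarith

/-- Neither `a` nor `b` exceeds the maximum: they are on the way from `C.top` to the exit beyond the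
cut, or `a` is `C.top` itself. -/
theorem Setting.y_lt {U D C : Banana} {a b : ℕ} (h : Setting v pos y U D a b)
    (hC : Sc v pos y U C) : y < v C.top := by
  obtain ⟨c, c1, c2, c3, c4⟩ := h.exit hC
  have ha := h.cut.a_neg
  have hb := h.cut.b_pos
  have hn := hC.top_neg
  refine h.cut.y_lt ?_ ?_
  · rcases h.cut.gap _ (top_mem_ino hC.mem) with h1 | h1
    · rcases h1.eq_or_lt with e | h1
      · rw [h.up.inj (top_mem_ino hC.mem) h.cut.a_mem e]
      · exact (hC.between a h.cut.a_mem h1 ha).2.le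
    · omega
  · refine (c4 b h.cut.b_mem (by omega) ?_).le
    rcases h.cut.gap c c1 with h1 | h1 <;> omega

theorem lo_lt_top_of_leftSpine {T C : Banana} (h : Good v pos T) (ht : T.hi = ⊤)
    (hC : C ∈ T.proper) (hs : C.hi ∈ T.leftSpine) : ∃ f fs, T = plugL (f :: fs) C := by
  obtain ⟨fs, B, e, hB⟩ := mem_leftSpine.1 hs
  have hBT : B ∈ T.bananas := by rw [e]; exact mem_bananas_plugL _ _
  have : B = C := hi_unique h.valid h.nodup ht hBT (bananas_of_proper hC) hB
  subst this
  cases fs with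
  | nil =>
    have h1 : T.hi = B.hi := by rw [e]; rfl
    rw [ht, h.valid.hi_proper hC] at h1
    exact absurd h1 (WithTop.top_ne_coe)
  | cons f fs => exact ⟨f, fs, e⟩

/-- Converse of `Setting.exists_sc_of_dn`. The banana found in the down-tree is not on the left
spine because of its orientation, and not on the right spine because the exit `c` would have to be
one of its nodes. -/
theorem Setting.exists_dn_of_sc {U D C : Banana} {a b : ℕ} (h : Setting v pos y U D a b)
    (hC : Sc v pos y U C) (hz : High v pos U C) : ∃ E ∈ D.proper, E.lo = C.top ∧ E.top = C.lo ∧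
      PanL (fun i => -v i) (-pos) (-y) D.ino E ∧ E.hi ∉ D.spine := by
  have hw := h.up.lwin hC.mem hC.lo_lt
  obtain ⟨z, c, hq, hc⟩ := h.up.quad_of_lwin h.inj hw hz
  have hcpos : 0 < pos c := by
    have := h.pos_ne c
    by_contra hcon
    have := (hC.between c hq.c_mem hq.wc (by omega)).1
    have := hq.vcn
    linarith
  have hqD := hq.transfer h.agree
  obtain ⟨E', hE', e1, e2⟩ := h.dn.mirror.exists_of_quad (by simpa using h.inj_dn)
    (hqD.dual.congr (l' := D.mirror.ino) (by simp))
  have hE : E'.mirror ∈ D.proper := proper_of_mirror h.dn.nodup (by simpa using hE')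
  have e1' : E'.mirror.lo = C.top := by simpa using e1
  have e2' : E'.mirror.top = C.lo := by simpa using e2
  have hlt := hC.lo_lt
  have hneg := hC.top_neg
  have hwD := h.dn.lwin_neg hE (by rw [e1', e2']; exact hlt)
  refine ⟨E'.mirror, hE, e1', e2', ⟨by simpa [e1, e2] using hlt, ?_, by simpa [e2] using hC.lt_y,
    fun i hi i1 i2 => ?_⟩, fun hs => ?_⟩
  · simp only [Pi.neg_apply, e2']; omega
  · simp only [Pi.neg_apply, e2', neg_lt_neg_iff] at i1 i2 ⊢
    have h3 := hqD.between i hi (hqD.zn.trans i2) (by omega)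
    refine lt_of_le_of_ne h3.1 fun e => ?_
    rw [h.inj_dn _ hqD.n_mem _ hi e] at i2; omega
  · rcases List.mem_append.1 hs with hs | hs
    · obtain ⟨f, fs, e⟩ := lo_lt_top_of_leftSpine h.dn h.dn_hi hE hs
      have hg := h.dn
      rw [e] at hg
      have := hg.plugL_lo (by simp) (lo_mem_ino _)
      rw [e1', e2'] at this; omega
    · obtain ⟨f, fs, e⟩ := lo_lt_top_of_leftSpine h.dn.mirror (by simpa using h.dn_hi) hE'
        (mem_leftSpine_mirror.2 (by simpa using hs))
      have hg := h.dn.mirror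
      rw [e] at hg
      have := hg.plugL_pos (by simp) (z := c) (by rw [← e]; simpa using hqD.c_mem)
        (by rw [e2]; simpa using hqD.nw.trans hqD.wc)
      have := hwD.lt_top c (by simpa using this)
      rw [e2'] at this
      linarith [hq.vcn]

end Banana
end BananaTree

namespace BananaTree
namespace Banana

variable {v : ℕ → ℝ} {pos : ℕ → ℤ} {y : ℝ}

-- Spine bananas, the loaded part of the path, and the missing window.

theorem parent_of_plugL {T A C : Banana} (h : Good v pos T) {f : Frame} {fs : List Frame}
    (e : T = plugL (f :: fs) C) (hA : A ∈ T.bananas) (hC : C ∈ A.left ++ A.right) :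
    ∃ gs, T = plugL gs A ∧ A.left.getLast? = some C := by
  obtain ⟨gs, g, hg⟩ : ∃ gs g, f :: fs = gs ++ [g] :=
    ⟨_, _, (List.dropLast_append_getLast (List.cons_ne_nil f fs)).symm⟩
  rw [hg, plugL_append] at e
  have : A = plugL [g] C := by
    refine parent_unique h.nodup hA (by rw [e]; exact mem_bananas_plugL _ _) hC ?_ rfl
    simp [plugL]
  subst this
  exact ⟨gs, e, by simp [plugL]⟩

theorem leftSpine_parent {T A C : Banana} (h : Good v pos T) (ht : T.hi = ⊤)
    (hA : A ∈ T.bananas) (hC : C ∈ A.left ++ A.right) (hs : C.hi ∈ T.leftSpine) :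
    A.hi ∈ T.leftSpine ∧ A.left.getLast? = some C := by
  obtain ⟨f, fs, e⟩ := lo_lt_top_of_leftSpine h ht (proper_of_child hA hC) hs
  obtain ⟨gs, e', hl⟩ := parent_of_plugL h e hA hC
  exact ⟨mem_leftSpine.2 ⟨gs, A, e', rfl⟩, hl⟩

theorem rightSpine_parent {T A C : Banana} (h : Good v pos T) (ht : T.hi = ⊤)
    (hA : A ∈ T.bananas) (hC : C ∈ A.left ++ A.right) (hs : C.hi ∈ T.rightSpine) :
    A.hi ∈ T.rightSpine ∧ A.right.getLast? = some C := by
  have := leftSpine_parent (C := C.mirror) h.mirror (by simpa using ht) (mirror_mem_bananas hA)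
    (by simpa [mirror_injective.eq_iff, or_comm] using hC)
    (mem_leftSpine_mirror.2 (by simpa using hs))
  refine ⟨by simpa [mem_leftSpine_mirror] using this.1, ?_⟩
  have h2 := this.2
  rw [left_mirror, List.getLast?_map] at h2
  obtain ⟨D, hD, e⟩ := Option.map_eq_some_iff.1 h2
  rw [hD, mirror_injective e]

theorem mem_spine_mirror {T : Banana} {q : WithTop ℕ} : q ∈ T.mirror.spine ↔ q ∈ T.spine := by
  simp only [spine, List.mem_append, mem_leftSpine_mirror, mem_rightSpine_mirror, or_comm]

theorem spine_parent {T A C : Banana} (h : Good v pos T) (ht : T.hi = ⊤)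
    (hA : A ∈ T.bananas) (hC : C ∈ A.left ++ A.right) (hs : C.hi ∈ T.spine) : A.hi ∈ T.spine := by
  rcases List.mem_append.1 hs with hs | hs
  · exact List.mem_append_left _ (leftSpine_parent h ht hA hC hs).1
  · exact List.mem_append_right _ (rightSpine_parent h ht hA hC hs).1

/-- The part of the path from the lowest banana on the spine. -/
structure Tail (v : ℕ → ℝ) (pos : ℕ → ℤ) (y : ℝ) (T B : Banana) (pre tl : List Banana) : Prop where
  path : IsPath v pos y (some T) (pre ++ B :: tl)
  spine : B.hi ∈ T.spine
  not_spine : ∀ E ∈ tl, E.hi ∉ T.spine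

theorem Tail.mirror (h0 : ∀ i, pos i ≠ 0) {T B : Banana} {pre tl : List Banana}
    (h : Tail v pos y T B pre tl) :
    Tail v (-pos) y T.mirror B.mirror (pre.map Banana.mirror) (tl.map Banana.mirror) where
  path := by simpa using h.path.mirror h0
  spine := by rw [mem_spine_mirror]; simpa using h.spine
  not_spine E hE := by
    obtain ⟨E', hE', rfl⟩ := List.mem_map.1 hE
    rw [mem_spine_mirror]; simpa using h.not_spine E' hE'

theorem Tail.mem_bananas (h0 : ∀ i, pos i ≠ 0) {T B : Banana} {pre tl : List Banana}
    (h : Tail v pos y T B pre tl) (hT : Good v pos T) :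
    ∀ E ∈ pre ++ B :: tl, E ∈ T.bananas ∧ Pan v pos y T E :=
  hT.path_spec h0 h.path fun A hA => by cases hA; exact ⟨self_mem_bananas _, Or.inl rfl⟩

theorem Tail.pre_spine (h0 : ∀ i, pos i ≠ 0) {T B : Banana} {pre tl : List Banana}
    (h : Tail v pos y T B pre tl) (hT : Good v pos T) (ht : T.hi = ⊤) :
    ∀ E ∈ pre, E.hi ∈ T.spine := by
  have hm := fun E hE => (h.mem_bananas h0 hT E hE).1
  have hch := h.path.isChain
  have hB := h.spine
  clear h
  induction pre using List.reverseRecOn generalizing B tl with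
  | nil => simp
  | append_singleton pre A ih =>
    have hAB : B ∈ A.left ++ A.right := by
      rw [List.append_assoc, List.isChain_append] at hch
      exact (List.isChain_cons_cons.1 hch.2.1).1
    have hA : A.hi ∈ T.spine := spine_parent hT ht (hm A (by simp)) hAB hB
    intro E hE
    rcases List.mem_append.1 hE with hE | hE
    · exact ih (tl := B :: tl) (by simpa using hm) (by simpa using hch) hA E hE
    · rw [List.mem_singleton.1 hE]; exact hA

theorem Good.path_pairwise_lo (h0 : ∀ i, pos i ≠ 0) {T : Banana} {cs : List Banana}
    (h : Good v pos T) (hcs : IsPath v pos y (some T) cs) :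
    cs.Pairwise fun A C => v A.lo < v C.lo := by
  have hs := h.path_spec h0 hcs (fun A hA => by
    cases hA; exact ⟨self_mem_bananas _, Or.inl rfl⟩)
  have hch : cs.IsChain fun A C => v A.lo < v C.lo := by
    have h1 := hcs.isChain
    rw [List.isChain_iff_getElem] at h1 ⊢
    intro i hi
    exact ((h.valid.of_mem (hs _ (List.getElem_mem _)).1).child_of_mem (h1 i hi)).lo_lt
  have : (cs.map fun A => v A.lo).Pairwise (· < ·) := by
    rw [← List.isChain_iff_pairwise, List.isChain_map]
    exact hch
  exact List.pairwise_map.1 this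

/-- The bananas of the down-tree left of the cut are the turned windows with the cut in the
out-panel, except possibly for one with upper end in the left spine. -/
theorem Setting.dn_list {U D B : Banana} {a b : ℕ} {pre tl : List Banana}
    (h : Setting v pos y U D a b) (ht : Tail (fun i => -v i) pos (-y) D B pre tl) :
    ∃ sc : List Banana, (tl.filter fun E => pos E.lo < 0 ∧ pos E.top < 0).map
        (fun E => (E.top, (E.lo : WithTop ℕ))) = sc.map ends ∧
      (∀ C, C ∈ sc ↔ Sc v pos y U C ∧ High v pos U C) ∧ sc.Pairwise fun C C' => v C'.top < v C.top := by
  have hmem := ht.mem_bananas h.pos_ne h.dn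
  have key : ∀ E, ∃ C, E ∈ (tl.filter fun E => pos E.lo < 0 ∧ pos E.top < 0) →
      Sc v pos y U C ∧ C.lo = E.top ∧ C.top = E.lo ∧ High v pos U C := by
    intro E
    by_cases hE : E ∈ (tl.filter fun E => pos E.lo < 0 ∧ pos E.top < 0)
    · simp only [List.mem_filter, decide_eq_true_eq] at hE
      obtain ⟨hE, h1, h2⟩ := hE
      have hns := ht.not_spine E hE
      obtain ⟨h3, h4⟩ := hmem E (by simp [hE])
      have hED : E ≠ D := fun e => hns (by rw [e]; exact hi_mem_spine D)
      have hEp : E ∈ D.proper := (mem_proper h3).resolve_left hED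
      rcases h4 with e | hp | hp
      · exact absurd e hED
      · have := hp.top_pos; omega
      · obtain ⟨C, hC⟩ := h.exists_sc_of_dn hEp hp h1 fun hs => hns (List.mem_append_right _ hs)
        exact ⟨C, fun _ => hC⟩
    · exact ⟨E, fun hE' => absurd hE' hE⟩
  -- `φ` sends a banana of the down-tree to its reversed window in the up-tree; its values off the
  -- filtered list are irrelevant.
  choose φ hφ using key
  refine ⟨(tl.filter fun E => pos E.lo < 0 ∧ pos E.top < 0).map φ, ?_, fun C => ⟨fun hC => ?_,
    fun hC => ?_⟩, ?_⟩
  · rw [List.map_map]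
    refine List.map_congr_left fun E hE => ?_
    obtain ⟨h1, h2, h3, -⟩ := hφ E hE
    simp only [Function.comp_apply, ends, h2, h.up.valid.hi_proper h1.mem, h3]
  · obtain ⟨E, hE, rfl⟩ := List.mem_map.1 hC
    exact ⟨(hφ E hE).1, (hφ E hE).2.2.2⟩
  · obtain ⟨E, hE, e1, e2, hp, hs⟩ := h.exists_dn_of_sc hC.1 hC.2
    have h1 := h.dn.mem_path h.pos_ne ht.path (bananas_of_proper hE) (Or.inr (Or.inr hp))
    have hlt := hC.1.lo_lt
    have hneg := hC.1.top_neg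
    have hE' : E ∈ tl := by
      rcases List.mem_append.1 h1 with h1 | h1
      · exact absurd (ht.pre_spine h.pos_ne h.dn h.dn_hi E h1) hs
      · rcases List.mem_cons.1 h1 with rfl | h1
        · exact absurd ht.spine hs
        · exact h1
    have hE'' : E ∈ (tl.filter fun E => pos E.lo < 0 ∧ pos E.top < 0) := by
      simp only [List.mem_filter, decide_eq_true_eq]
      exact ⟨hE', by rw [e1]; omega, by rw [e2]; omega⟩
    obtain ⟨h3, h4, h5, -⟩ := hφ E hE''
    refine List.mem_map.2 ⟨E, hE'', ?_⟩
    exact eq_of_lo_eq h.up.nodup (bananas_of_proper h3.mem) (bananas_of_proper hC.1.mem)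
      (by rw [h4, e2])
  · rw [List.pairwise_map]
    -- The minima of the down-tree are the maxima of the reversed windows, so increasing order
    -- becomes decreasing order.
    have h1 := h.dn.path_pairwise_lo h.pos_ne ht.path
    have h2 := ((List.pairwise_cons.1 (List.pairwise_append.1 h1).2.1).2).filter
      (fun E => pos E.lo < 0 ∧ pos E.top < 0)
    refine h2.imp_of_mem fun {E F} hE hF hlt => ?_
    rw [(hφ E hE).2.2.1, (hφ F hF).2.2.1]
    simpa using hlt

theorem rel_getLast {α : Type*} {R : α → α → Prop} {l : List α} (h : l.Pairwise R) {c d : α}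
    (hc : l.getLast? = some c) (hd : d ∈ l) (hne : d ≠ c) : R d c := by
  obtain ⟨l', rfl⟩ := List.getLast?_eq_some_iff.1 hc
  rcases List.mem_append.1 hd with hd | hd
  · exact (List.pairwise_append.1 h).2.2 d hd c (by simp)
  · exact absurd (List.mem_singleton.1 hd) hne

theorem mem_bananas_of_isChain {C : Banana} {tl : List Banana}
    (h : (C :: tl).IsChain fun A C => C ∈ A.left ++ A.right) : ∀ E ∈ C :: tl, E ∈ C.bananas := by
  induction tl generalizing C with
  | nil => intro E hE; rw [List.mem_singleton.1 hE]; exact self_mem_bananas _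
  | cons D tl ih =>
    intro E hE
    rcases List.mem_cons.1 hE with rfl | hE
    · exact self_mem_bananas _
    · rw [List.isChain_cons_cons] at h
      exact bananas_trans (ih h.2 E hE) (mem_bananas_of_child (self_mem_bananas _) h.1)

theorem Tail.tail_path {T B : Banana} {pre tl : List Banana} (h : Tail v pos y T B pre tl) :
    IsPath v pos y (nxt v pos y B) tl := by
  have := h.path.of_append
  cases this; assumption

theorem Tail.mem_left {T B E : Banana} {pre tl : List Banana} (h : Tail v pos y T B pre tl)
    (hlo : 0 < pos B.lo) (hE : E ∈ tl) : ∃ C ∈ B.left, 0 < pos C.top ∧ E ∈ C.bananas := by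
  have hp := h.tail_path
  cases tl with
  | nil => simp at hE
  | cons C tl =>
    have h1 := nxt_of_isPath hp
    have h2 := nx_left_mem (nxt_eq_some.1 h1).1 (by omega)
    exact ⟨C, h2.1, h2.2, mem_bananas_of_isChain hp.isChain E hE⟩

theorem Valid.top_le {T C E : Banana} (h : Valid v T) (hC : C ∈ T.left ++ T.right)
    (hE : E ∈ C.bananas) : v E.top ≤ v C.top := by
  rcases mem_proper hE with rfl | hE
  · exact le_rfl
  · exact ((h.child_of_mem hC).lt_of_mem (h.of_mem (mem_bananas_of_child (self_mem_bananas _) hC))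
      (top_mem_ino hE)).le

section

variable {U D B C : Banana} {a b : ℕ} {pre tl : List Banana} (h : Setting v pos y U D a b)
  (ht : Tail v pos y U B pre tl)
include h ht

/-- Without a higher node on its left, `C` is on the left spine, topmost on the left trail of some
`A` on that spine. The minimum of `A` is below that of `C`, hence beyond the cut, so `A` is on the
path. If `A` came before `B`, its successor would also be on the spine and topmost on the same
trail, hence equal to `C`, which ends on the wrong side of the cut. After `B` the path has left the
spine. -/
theorem Setting.missing_complete (hC : Sc v pos y U C) (hh : ¬ High v pos U C) :
    0 < pos B.lo ∧ B.left.getLast? = some C ∧ B.hi ∈ U.leftSpine := by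
  have hmem := ht.mem_bananas h.pos_ne h.up
  have hneg := hC.top_neg
  obtain ⟨f, fs, e⟩ := h.up.exists_plugL hC.mem hC.lo_lt fun z hz hz' => by
    by_contra hcon
    rcases (not_lt.1 hcon).eq_or_lt with e | hlt
    · rw [h.inj _ (top_mem_ino hC.mem) _ hz e] at hz'; omega
    · exact hh ⟨z, hz, hz', hlt⟩
  obtain ⟨gs, g, hg⟩ : ∃ gs g, f :: fs = gs ++ [g] :=
    ⟨_, _, (List.dropLast_append_getLast (List.cons_ne_nil f fs)).symm⟩
  have e' := e
  rw [hg, plugL_append] at e'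
  set A := plugL [g] C with hAdef
  have hAU : A ∈ U.bananas := by rw [e']; exact mem_bananas_plugL _ _
  have hCA : A.left.getLast? = some C := by simp [hAdef, plugL]
  have hCA' : C ∈ A.left := List.mem_of_getLast? hCA
  have hgA := h.up.of_mem hAU
  have hch := hgA.valid.child_left C hCA'
  have hlo := (hgA.pos_left hCA').2
  have hAlo : 0 < pos A.lo := by
    by_contra hcon
    have := h.pos_ne A.lo
    have := (hC.between A.lo (ino_subset hAU (lo_mem_ino A)) hlo (by omega)).1
    linarith [hch.lo_lt]
  have hAs : A.hi ∈ U.leftSpine := mem_leftSpine.2 ⟨gs, A, e', rfl⟩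
  have hCi : C.top ∈ A.ino := mem_ino.2 (Or.inr (Or.inl ⟨C, hCA', Or.inr rfl⟩))
  have hApath : A ∈ pre ++ B :: tl := h.up.mem_path h.pos_ne ht.path hAU
    (h.up.pan_of_mem hAU hCi (lo_mem_ino A) hneg hAlo (Or.inl (h.y_lt hC)))
  have hAB : A = B := by
    rcases List.mem_append.1 hApath with h1 | h1
    · exfalso
      obtain ⟨s, t, rfl⟩ := List.append_of_mem h1
      have hp := ht.path
      rw [List.append_assoc, List.cons_append] at hp
      have hp' := hp.of_append
      cases hp' with
      | cons hp' =>
      obtain ⟨E, t', ht'⟩ : ∃ E t', t ++ B :: tl = E :: t' := by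
        cases t with
        | nil => exact ⟨_, _, rfl⟩
        | cons x t => exact ⟨_, _, rfl⟩
      have hEs : E.hi ∈ U.spine := by
        cases t with
        | nil => simp only [List.nil_append, List.cons.injEq] at ht'; rw [← ht'.1]; exact ht.spine
        | cons x t =>
          simp only [List.cons_append, List.cons.injEq] at ht'
          exact ht.pre_spine h.pos_ne h.up h.up_hi E (by simp [ht'.1])
      rw [ht'] at hp'
      have h2 := nx_left_mem (nxt_eq_some.1 (nxt_of_isPath hp')).1 (by omega)
      rcases List.mem_append.1 hEs with hs | hs
      · have h3 := (leftSpine_parent h.up h.up_hi hAU (List.mem_append_left _ h2.1) hs).2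
        rw [hCA, Option.some_inj] at h3
        rw [h3] at hneg
        omega
      · have h3 := (rightSpine_parent h.up h.up_hi hAU (List.mem_append_left _ h2.1) hs).2
        exact hgA.not_left_and_right h2.1 (List.mem_of_getLast? h3) rfl
    · rcases List.mem_cons.1 h1 with h1 | h1
      · exact h1
      · exact absurd (List.mem_append_left _ hAs) (ht.not_spine A h1)
  rw [← hAB]
  exact ⟨hAlo, hCA, hAs⟩

/-- Below `B` the path stays inside a banana on the left trail that ends right of the cut, hence
below and to the right of the topmost node `C.top`. -/
theorem Setting.tail_bounds (hlo : 0 < pos B.lo) (hl : B.left.getLast? = some C)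
    (hneg : pos C.top < 0) {E : Banana} (hE : E ∈ tl) :
    v E.top < v C.top ∧ (∀ i ∈ E.ino, pos C.top < pos i) ∧ pos C.top < pos E.top := by
  have hBU := (ht.mem_bananas h.pos_ne h.up B (by simp)).1
  have hgB := h.up.of_mem hBU
  obtain ⟨F, hF, hF0, hEF⟩ := ht.mem_left hlo hE
  have hne : F ≠ C := fun e => by rw [e] at hF0; omega
  have h1 := rel_getLast hgB.valid.pairwise_left hl hF hne
  have h2 := rel_getLast hgB.pairwise_left hl hF hne C.top (Or.inr rfl)
  refine ⟨(hgB.valid.top_le (List.mem_append_left _ hF) hEF).trans_lt h1,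
    fun i hi => h2 i (Or.inl (ino_subset hEF hi)), h2 _ ?_⟩
  rcases mem_proper hEF with rfl | hEF
  · exact Or.inr rfl
  · exact Or.inl (top_mem_ino hEF)

/-- A genuine missing window passes the test. If `E.lo` is left of the cut, it lies in the out-panel
of `C`, where values exceed the minimum. Otherwise `E.top` is left of the cut, and the exit of `E`,
lower than `E.lo`, is found before the higher node `C.top`, hence again in the out-panel. -/
theorem Setting.missing_fits (hC : Sc v pos y U C) (hlo : 0 < pos B.lo)
    (hl : B.left.getLast? = some C) {E : Banana} (hE : E ∈ tl)
    (hR : ¬ (0 < pos E.lo ∧ 0 < pos E.top)) : v C.lo < v E.lo ∧ v E.top < v C.top := by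
  obtain ⟨h1, h2, h3⟩ := h.tail_bounds ht hlo hl hC.top_neg hE
  have hEU := (ht.mem_bananas h.pos_ne h.up E (by simp [hE])).1
  refine ⟨?_, h1⟩
  have hElo := h2 _ (lo_mem_ino E)
  have hElo' := ino_subset hEU (lo_mem_ino E)
  have hp0 := h.pos_ne E.lo
  have hq0 := h.pos_ne E.top
  rcases lt_or_ge (pos E.lo) 0 with hneg | hpos
  · exact (hC.between E.lo hElo' hElo hneg).1
  · have hEp : E ∈ U.proper := (mem_proper hEU).resolve_left fun e =>
      ht.not_spine E hE (by rw [e]; exact hi_mem_spine U)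
    obtain ⟨c, c1, c2, c3, c4⟩ := (h.up.lwin_neg hEp (by omega)).out
    simp only [Pi.neg_apply, neg_lt_neg_iff, neg_le_neg_iff] at c2 c4
    refine lt_trans (hC.between c c1 ?_ (by omega)).1 c3
    by_contra hcon
    have := c4 C.top (top_mem_ino hC.mem) (by omega) (by omega)
    linarith

/-- A candidate that passes the test is genuine. Otherwise a node between `C.top` and the cut is
lower than `C.lo`; the lowest such node is the minimum of some banana `E`. If `E.top` is to the
right of this node, then `E` either has the cut in its out-panel, against `hf1`, or is on the path
below `B`, against `hf2`. An upper end to the left is incompatible with the height of `C.top`. -/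
theorem Setting.missing_sound (hlo : 0 < pos B.lo) (hl : B.left.getLast? = some C)
    (hBs : B.hi ∈ U.leftSpine) (hneg : pos C.top < 0) (hy : v C.lo < y)
    (hf1 : ∀ E, Sc v pos y U E → High v pos U E → v C.lo < v E.lo)
    (hf2 : ∀ E ∈ tl, pos E.lo < 0 → 0 < pos E.top → v C.lo < v E.lo ∨ v C.top < v E.top) :
    Sc v pos y U C ∧ ¬ High v pos U C := by
  have hBU := (ht.mem_bananas h.pos_ne h.up B (by simp)).1
  have hgB := h.up.of_mem hBU
  have hCB := List.mem_of_getLast? hl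
  have hCU := proper_of_child hBU (List.mem_append_left _ hCB)
  have hlt := (hgB.pos_left hCB).1 _ (lo_mem_ino C)
  have hCt : C.top ∈ B.ino := mem_ino.2 (Or.inr (Or.inl ⟨C, hCB, Or.inr rfl⟩))
  have hch := hgB.valid.child_left C hCB
  have hleft : ∀ i ∈ U.ino, pos i < pos C.top → i ∈ C.ino := by
    obtain ⟨gs, B', e, hB'⟩ := mem_leftSpine.1 hBs
    have : B' = B := hi_unique h.up.valid h.up.nodup h.up_hi
      (by rw [e]; exact mem_bananas_plugL _ _) hBU hB'
    subst this
    obtain ⟨l', hl'⟩ := List.getLast?_eq_some_iff.1 hl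
    have e2 : U = plugL (gs ++ [⟨B'.lo, B'.hi, l', B'.right⟩]) C := by
      rw [plugL_append, e]
      congr 1
      conv_lhs => rw [← eta B', hl']
      rfl
    intro i hi hi'
    have hg := h.up
    rw [e2] at hg hi
    exact hg.plugL_pos (by simp) hi hi'
  have hmid : ∀ i ∈ U.ino, pos C.top < pos i → pos i < 0 → v B.lo < v i ∧ v i < v C.top := by
    intro i hi i1 i2
    have hiB : i ∈ B.ino := by
      rcases mem_proper hBU with rfl | hBp
      · exact hi
      · have hBlt : pos B.lo < pos B.top := by
          obtain ⟨f, fs, e⟩ := lo_lt_top_of_leftSpine h.up h.up_hi hBp hBs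
          have hg := h.up
          rw [e] at hg
          exact hg.plugL_lo (by simp) (lo_mem_ino B)
        exact (h.up.lwin hBp hBlt).conv _ hCt i hi i1.le (by omega)
    refine ⟨hgB.valid.lo_lt hiB fun e => by rw [e] at i2; omega, ?_⟩
    rcases mem_ino.1 hiB with rfl | ⟨F, hF, hiF⟩ | ⟨F, hF, hiF⟩
    · omega
    · have hne : F ≠ C := fun e => by
        rw [e] at hiF
        rcases hiF with hiF | hiF
        · have := (hgB.pos_left hCB).1 i hiF; omega
        · rw [hiF] at i1; omega
      have h1 := rel_getLast hgB.valid.pairwise_left hl hF hne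
      rcases hiF with hiF | rfl
      · exact ((hgB.valid.child_left F hF).lt_of_mem (hgB.valid.valid_left F hF) hiF).trans h1
      · exact h1
    · have h1 := hgB.pos_right hF
      rcases hiF with hiF | rfl
      · have := h1.1 i hiF; omega
      · have := h1.2; omega
  refine ⟨⟨hCU, hlt, hneg, fun i hi i1 i2 => ⟨?_, (hmid i hi i1 i2).2⟩, hy⟩, ?_⟩
  swap
  · rintro ⟨z, hz, z1, z2⟩
    have := hch.lt_of_mem (h.up.valid.of_mem (bananas_of_proper hCU)) (hleft z hz z1)
    linarith
  by_contra hcon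
  have hvi : v i < v C.lo := lt_of_le_of_ne (not_lt.1 hcon) fun e => by
    rw [h.inj _ hi _ (ino_subset (bananas_of_proper hCU) (lo_mem_ino C)) e] at i1; omega
  clear hcon
  obtain ⟨c, ⟨c1, c2, c3⟩, c4⟩ : ∃ c, (c ∈ U.ino ∧ pos C.top < pos c ∧ pos c < 0) ∧
      ∀ j, (j ∈ U.ino ∧ pos C.top < pos j ∧ pos j < 0) → v c ≤ v j := by
    classical
    obtain ⟨c, hc, hc'⟩ := (U.ino.toFinset.filter fun j =>
      pos C.top < pos j ∧ pos j < 0).exists_min_image v ⟨i, by simp [hi, i1, i2]⟩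
    simp only [Finset.mem_filter, List.mem_toFinset] at hc hc'
    exact ⟨c, hc, hc'⟩
  have hc : v c < v C.lo := (c4 i ⟨hi, i1, i2⟩).trans_lt hvi
  have hct := (hmid c c1 c2 c3).2
  have hCtU := top_mem_ino hCU
  have hnot : ∀ k ∈ U.ino, v k < v c → pos k ≤ pos C.top ∨ 0 < pos k := fun k hk hkc => by
    have := h.pos_ne k
    by_contra hcon
    have := c4 k ⟨hk, by omega, by omega⟩
    linarith
  -- If `c` were an upper end, then its window or the way to its exit would extend to the left
  -- across `C.top`, which is higher.
  obtain ⟨E, hEU, hElo⟩ : ∃ E ∈ U.bananas, E.lo = c := by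
    rcases exists_lo_or_top c1 with hE | ⟨A, hA, E, hE, e⟩
    · exact hE
    exfalso
    have hEp := proper_of_child hA hE
    rcases h.up.win_of_proper hEp with hw | hw
    · have h1 := hw.lt_top _ (lo_mem_ino E)
      have h2 := hw.pos_lt _ (lo_mem_ino E)
      rw [e] at h1 h2
      rcases hnot _ (hw.sub _ (lo_mem_ino E)) h1 with h3 | h3
      · have := hw.lt_top _ (hw.conv _ (lo_mem_ino E) _ hCtU h3 (by rw [e]; exact c2))
        rw [e] at this
        linarith
      · omega
    · obtain ⟨d, d1, d2, d3, d4⟩ := hw.out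
      have h1 := hw.lt_top _ (lo_mem_ino E)
      simp only [Pi.neg_apply, neg_lt_neg_iff, neg_le_neg_iff, e] at d2 d4 h1
      rcases hnot d d1 (by linarith) with h3 | h3
      · have := d4 _ hCtU (by omega) h3
        linarith
      · omega
  have hEp : E ∈ U.proper := by
    refine (mem_proper hEU).resolve_left fun e => ?_
    have h1 := h.up.valid.lo_le (ino_subset hBU (lo_mem_ino B))
    rw [← e, hElo] at h1
    have := (hmid c c1 c2 c3).1
    linarith
  have hEne : E ≠ C := fun e => by rw [← hElo, e] at hc; exact lt_irrefl _ hc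
  rcases h.up.win_of_proper hEp with hw | hw
  · have h1 := hw.pos_lt _ (lo_mem_ino E)
    rw [hElo] at h1
    have hcE : c ∈ E.ino := by rw [← hElo]; exact lo_mem_ino E
    have ht0 := h.pos_ne E.top
    rcases lt_or_ge (pos E.top) 0 with hEt | hEt
    · have hsc : Sc v pos y U E := by
        refine ⟨hEp, by rw [hElo]; exact h1, hEt, fun k hk k1 k2 => ⟨?_, ?_⟩, by
          rw [hElo]; linarith⟩
        · rw [hElo]
          refine lt_of_le_of_ne (c4 k ⟨hk, by omega, k2⟩) fun e => ?_
          rw [h.inj _ c1 _ hk e] at h1; omega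
        · obtain ⟨d, d1, d2, d3, d4⟩ := hw.out
          refine d4 k hk k1 ?_
          rw [hElo] at d3
          rcases hnot d d1 d3 with h3 | h3 <;> omega
      have := hf1 E hsc ⟨C.top, hCtU, by omega, (hmid _ hw.top_mem (by omega) hEt).2⟩
      rw [hElo] at this
      linarith
    · have hpan : Pan v pos y U E := by
        refine Or.inr (Or.inl ⟨by rw [hElo]; exact h1, by omega, ?_, fun k hk k1 k2 =>
          hw.lt_top k (hw.conv c hcE k hk (by omega) k2)⟩)
        have ha := h.cut.a_neg
        have hb := h.cut.b_pos
        have h2 := h.cut.gap c c1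
        have h3 := h.cut.gap _ hw.top_mem
        refine h.cut.y_lt (hw.lt_top a (hw.conv c hcE a h.cut.a_mem (by omega) (by omega))).le ?_
        rcases (show pos b ≤ pos E.top by omega).eq_or_lt with e | h4
        · rw [h.up.inj h.cut.b_mem hw.top_mem e]
        · exact (hw.lt_top b (hw.conv c hcE b h.cut.b_mem (by omega) h4)).le
      have hE : E ∈ tl := by
        have hpw := h.up.path_pairwise_lo h.pos_ne ht.path
        rcases List.mem_append.1 (h.up.mem_path h.pos_ne ht.path hEU hpan) with h5 | h5
        · have := (List.pairwise_append.1 hpw).2.2 E h5 B (by simp)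
          rw [hElo] at this
          linarith [(hmid c c1 c2 c3).1]
        · rcases List.mem_cons.1 h5 with rfl | h5
          · rw [hElo] at hlo; omega
          · exact h5
      rcases hf2 E hE (by rw [hElo]; exact c3) (by omega) with h6 | h6
      · rw [hElo] at h6; linarith
      · linarith [(h.tail_bounds ht hlo hl hneg hE).1]
  · have h1 := hw.pos_lt _ (lo_mem_ino E)
    simp only [Pi.neg_apply, neg_lt_neg_iff, hElo] at h1
    rcases lt_trichotomy (pos E.top) (pos C.top) with h2 | h2 | h2
    · have h3 := hch.lt_of_mem (h.up.valid.of_mem (bananas_of_proper hCU))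
        (hleft _ hw.top_mem h2)
      have h4 := hw.lt_top _ (hw.conv _ (lo_mem_ino E) _ hCtU (by
        simp only [Pi.neg_apply, neg_le_neg_iff, hElo]; omega) (by simpa using h2))
      linarith
    · exact hEne (eq_of_top_eq h.up.nodup hEp hCU (h.up.inj hw.top_mem hCtU h2))
    · obtain ⟨d, d1, d2, d3, d4⟩ := hw.out
      simp only [Pi.neg_apply, neg_lt_neg_iff, neg_le_neg_iff, hElo] at d2 d3 d4
      have h5 := (hmid _ hw.top_mem h2 (by omega)).2
      rcases hnot d d1 d3 with h3 | h3
      · have := d4 _ hCtU h2 h3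
        linarith
      · omega

end

end Banana
end BananaTree

namespace BananaTree

/-! ### The highest of the five stacks -/

/-- Compare the best candidate so far with the top of one more stack. -/
noncomputable def better (v : ℕ → ℝ) (S : Stacks) (best : Option (StackName × (ℕ × WithTop ℕ)))
    (σ : StackName) : Option (StackName × (ℕ × WithTop ℕ)) :=
  match (S.get σ).head?, best with
  | none, _ => best
  | some e, none => some (σ, e)
  | some e, some (τ, e') => if height v e'.2 < height v e.2 then some (σ, e) else some (τ, e')

/-- `topBanana` is this fold over all five names; a general list allows induction from its end. -/
theorem foldl_better_spec (v : ℕ → ℝ) (S : Stacks) (l : List StackName) :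
    (l.foldl (better v S) none = none → ∀ σ ∈ l, S.get σ = []) ∧
    ∀ τ e, l.foldl (better v S) none = some (τ, e) → (S.get τ).head? = some e ∧
      ∀ σ ∈ l, ∀ e', (S.get σ).head? = some e' → height v e'.2 ≤ height v e.2 := by
  induction l using List.reverseRecOn with
  | nil => simp
  | append_singleton l σ ih =>
    rw [List.foldl_append, List.foldl_cons, List.foldl_nil]
    generalize l.foldl (better v S) none = best at ih
    cases h1 : (S.get σ).head? with
    | none =>
      rw [show better v S best σ = best by simp only [better, h1]]
      have hσ : S.get σ = [] := List.head?_eq_none_iff.1 h1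
      refine ⟨fun h τ hτ => ?_, fun τ e h => ?_⟩
      · rcases List.mem_append.1 hτ with hτ | hτ
        · exact ih.1 h τ hτ
        · rw [List.mem_singleton.1 hτ]; exact hσ
      · refine ⟨(ih.2 τ e h).1, fun ρ hρ e' he' => ?_⟩
        rcases List.mem_append.1 hρ with hρ | hρ
        · exact (ih.2 τ e h).2 ρ hρ e' he'
        · rw [List.mem_singleton.1 hρ, h1] at he'; cases he'
    | some e₀ =>
      cases best with
      | none =>
        rw [show better v S none σ = some (σ, e₀) by simp only [better, h1]]
        refine ⟨fun h => (by cases h), fun τ e h => ?_⟩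
        cases h
        refine ⟨h1, fun ρ hρ e' he' => ?_⟩
        rcases List.mem_append.1 hρ with hρ | hρ
        · rw [ih.1 rfl ρ hρ] at he'; cases he'
        · rw [List.mem_singleton.1 hρ, h1] at he'; cases he'; exact le_rfl
      | some b =>
        obtain ⟨τ₀, e₁⟩ := b
        have ih2 := ih.2 τ₀ e₁ rfl
        rw [show better v S (some (τ₀, e₁)) σ =
          if height v e₁.2 < height v e₀.2 then some (σ, e₀) else some (τ₀, e₁) by
            simp only [better, h1]]
        split_ifs with hlt
        · refine ⟨fun h => (by cases h), fun τ e h => ?_⟩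
          cases h
          refine ⟨h1, fun ρ hρ e' he' => ?_⟩
          rcases List.mem_append.1 hρ with hρ | hρ
          · exact (ih2.2 ρ hρ e' he').trans hlt.le
          · rw [List.mem_singleton.1 hρ, h1] at he'; cases he'; exact le_rfl
        · refine ⟨fun h => (by cases h), fun τ e h => ?_⟩
          cases h
          refine ⟨ih2.1, fun ρ hρ e' he' => ?_⟩
          rcases List.mem_append.1 hρ with hρ | hρ
          · exact ih2.2 ρ hρ e' he'
          · rw [List.mem_singleton.1 hρ, h1] at he'; cases he'; exact not_lt.1 hlt

theorem topBanana_none {v : ℕ → ℝ} {S : Stacks} (h : topBanana v S = none) (σ : StackName) :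
    S.get σ = [] :=
  (foldl_better_spec v S _).1 h σ (by cases σ <;> simp)

theorem topBanana_some {v : ℕ → ℝ} {S : Stacks} {τ : StackName} {e : ℕ × WithTop ℕ}
    (h : topBanana v S = some (τ, e)) : (S.get τ).head? = some e ∧
      ∀ σ e', (S.get σ).head? = some e' → height v e'.2 ≤ height v e.2 :=
  ⟨((foldl_better_spec v S _).2 τ e h).1, fun σ =>
    ((foldl_better_spec v S _).2 τ e h).2 σ (by cases σ <;> simp)⟩

/-- If the highest top belongs to a single stack, it is found. -/
theorem topBanana_of_unique {v : ℕ → ℝ} {S : Stacks} {τ : StackName} {e : ℕ × WithTop ℕ}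
    (he : (S.get τ).head? = some e)
    (h : ∀ σ e', (S.get σ).head? = some e' → σ = τ ∨ height v e'.2 < height v e.2) :
    topBanana v S = some (τ, e) := by
  cases hb : topBanana v S with
  | none =>
    rw [topBanana_none hb τ] at he; cases he
  | some b =>
    obtain ⟨σ, e'⟩ := b
    obtain ⟨h1, h2⟩ := topBanana_some hb
    rcases h σ e' h1 with rfl | h3
    · rw [he] at h1; cases h1; rfl
    · exact absurd (h2 τ e he) h3.not_ge

namespace Banana

variable {v : ℕ → ℝ} {pos : ℕ → ℤ} {y : ℝ}

-- Heights of bananas and windows on the stacks, and completion of the down-stacks.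

theorem Good.height_child {T A C : Banana} (h : Good v pos T) (ht : T.hi = ⊤)
    (hA : A ∈ T.bananas) (hC : C ∈ A.left ++ A.right) : height v C.hi < height v A.hi := by
  have hC' := (h.valid.of_mem hA).child_of_mem hC
  have hCi : C.top ∈ A.ino := by
    rw [mem_ino]
    rcases List.mem_append.1 hC with hC | hC
    · exact Or.inr (Or.inl ⟨C, hC, Or.inr rfl⟩)
    · exact Or.inr (Or.inr ⟨C, hC, Or.inr rfl⟩)
  rw [hC'.hi_eq]
  rcases mem_proper hA with rfl | hA
  · rw [ht]; exact WithTop.coe_lt_top _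
  · rw [h.valid.hi_proper hA]
    refine WithTop.coe_lt_coe.2 ?_
    rcases h.win_of_proper hA with hw | hw
    · exact hw.lt_top _ hCi
    · exact hw.lt_top _ hCi

theorem Good.path_pairwise_hi (h0 : ∀ i, pos i ≠ 0) {T : Banana} {o : Option Banana}
    {cs : List Banana} (h : Good v pos T) (ht : T.hi = ⊤) (hcs : IsPath v pos y o cs)
    (ho : ∀ A, o = some A → A ∈ T.bananas ∧ Pan v pos y T A) :
    cs.Pairwise fun A C => height v C.hi < height v A.hi := by
  have hs := h.path_spec h0 hcs ho
  have hch : cs.IsChain fun A C => height v C.hi < height v A.hi := by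
    have h1 := hcs.isChain
    rw [List.isChain_iff_getElem] at h1 ⊢
    intro i hi
    exact h.height_child ht (hs _ (List.getElem_mem _)).1 (h1 i hi)
  have : (cs.map fun A => height v A.hi).Pairwise (· > ·) := by
    rw [← List.isChain_iff_pairwise, List.isChain_map]
    exact hch
  exact List.pairwise_map.1 this

section

variable {U D B C : Banana} {a b : ℕ} {pre tl : List Banana} (h : Setting v pos y U D a b)
include h

/-- Two windows with the cut in the out-panel on the same side are nested. -/
theorem Setting.sc_pair {C' : Banana} (hC : Sc v pos y U C) (hC' : Sc v pos y U C')
    (hlt : v C'.top < v C.top) : pos C.top < pos C'.lo ∧ v C.lo < v C'.lo := by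
  have hne : C'.top ≠ C.top := fun e => by rw [e] at hlt; exact lt_irrefl _ hlt
  have h1 := top_mem_ino hC.mem
  have h2 := top_mem_ino hC'.mem
  have h3 : pos C.top < pos C'.top := by
    by_contra hcon
    have := (hC'.between _ h1 (h.up.lt_of_ne h2 h1 (by omega) hne) hC.top_neg).2
    linarith
  have hw := h.up.lwin hC'.mem hC'.lo_lt
  have h4 : pos C.top < pos C'.lo := by
    by_contra hcon
    have := hw.lt_top _ (hw.conv _ (lo_mem_ino _) _ h1 (by omega) h3)
    linarith
  have := hC'.lo_lt
  have := hC'.top_neg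
  exact ⟨h4, (hC.between _ (hw.sub _ (lo_mem_ino _)) h4 (by omega)).1⟩

/-- The loop therefore starts with `B`. The delicate case is that of `B` on the right spine with
`C.top` to the left of `B.top`. The exit of `C` beyond the cut is then interior to `B`, so the exit
of `B` is lower than `C.lo` and lies beyond `C.top`; on the way to it values stay below `B.top`. -/
theorem Setting.sc_lt_top (ht : Tail v pos y U B pre tl) (hC : Sc v pos y U C) :
    height v C.hi < height v B.hi := by
  obtain ⟨hB, hp⟩ := ht.mem_bananas h.pos_ne h.up B (by simp)
  have hCt := top_mem_ino hC.mem
  have hneg := hC.top_neg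
  have hClt := hC.lo_lt
  rw [h.up.valid.hi_proper hC.mem]
  rcases mem_proper hB with rfl | hBp
  · rw [h.up_hi]; exact WithTop.coe_lt_top _
  rw [h.up.valid.hi_proper hBp]
  refine WithTop.coe_lt_coe.2 (show v C.top < v B.top from ?_)
  have hBU : B ≠ U := fun e => by
    have := h.up.valid.hi_proper hBp
    rw [e, h.up_hi] at this
    exact absurd this WithTop.top_ne_coe
  have hs := ht.spine
  rcases List.mem_append.1 hs with hs | hs
  · obtain ⟨f, fs, e⟩ := lo_lt_top_of_leftSpine h.up h.up_hi hBp hs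
    have hg := h.up
    rw [e] at hg
    have h1 := hg.plugL_lo (by simp) (lo_mem_ino B)
    have h2 : 0 < pos B.top := by
      rcases hp with hp | hp | hp
      · exact absurd hp hBU
      · exact hp.top_pos
      · have := hp.lo_lt; simp only [Pi.neg_apply] at this; omega
    exact (h.up.lwin hBp h1).lt_top _ (hg.plugL_pos (by simp) (by rw [← e]; exact hCt) (by omega))
  · obtain ⟨f, fs, e⟩ := lo_lt_top_of_leftSpine h.up.mirror (by simpa using h.up_hi)
      (mirror_proper h.up.nodup hBp) (mem_leftSpine_mirror.2 (by simpa using hs))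
    have hg := h.up.mirror
    rw [e] at hg
    have hin : ∀ i ∈ U.ino, pos B.top < pos i → i ∈ B.ino := fun i hi hi' => by
      have := hg.plugL_pos (by simp) (z := i) (by rw [← e]; simpa using hi) (by simpa using hi')
      simpa using this
    have h1 := hg.plugL_lo (by simp) (lo_mem_ino B.mirror)
    simp only [Pi.neg_apply, neg_lt_neg_iff, lo_mirror, top_mirror] at h1
    have hw := h.up.lwin_neg hBp h1
    have h2 : pos B.top < 0 := by
      rcases hp with hp | hp | hp
      · exact absurd hp hBU
      · have := hp.lo_lt; omega
      · simpa using hp.top_pos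
    rcases lt_trichotomy (pos C.top) (pos B.top) with h3 | h3 | h3
    · obtain ⟨c, c1, c2, c3, -⟩ := h.exit hC
      have h4 := hw.lo_le c (hin c c1 (by omega))
      obtain ⟨d, d1, d2, d3, d4⟩ := hw.out
      simp only [Pi.neg_apply, neg_lt_neg_iff, neg_le_neg_iff] at d2 d4
      refine d4 _ hCt h3 ?_
      by_contra hcon
      have := (hC.between d d1 (by omega) (by omega)).1
      linarith
    · have := eq_of_top_eq h.up.nodup hC.mem hBp (h.up.inj hCt hw.top_mem h3)
      rw [this] at hClt; omega
    · exact hw.lt_top _ (hin _ hCt h3)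

/-- `sc` is the stack of windows with the cut in the out-panel. -/
structure ScStack (v : ℕ → ℝ) (pos : ℕ → ℤ) (y : ℝ) (U : Banana) (sc : List Banana) : Prop where
  mem : ∀ C, C ∈ sc ↔ Sc v pos y U C
  sorted : sc.Pairwise fun C C' => v C'.top < v C.top

/-- Whatever the outcome of the test, the resulting stack is complete: a candidate that is accepted
is genuine by `Setting.missing_sound`, and a genuine one is never refused, by `Setting.missing_fits`
and `Setting.sc_pair`. Bananas with both ends right of the cut are exempted, as the algorithm does
not compare with `Rup` here. -/
theorem Setting.missing_step (ht : Tail v pos y U B pre tl) (hlo : 0 < pos B.lo)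
    (hBs : B.hi ∈ U.leftSpine) {sc : List Banana}
    (hsc : ∀ C, C ∈ sc ↔ Sc v pos y U C ∧ High v pos U C)
    (hsort : sc.Pairwise fun C C' => v C'.top < v C.top) :
    (B.left.getLast? = none → ScStack v pos y U sc) ∧
    ∀ C, B.left.getLast? = some C →
      if v C.lo < y ∧ (y : WithTop ℝ) < height v C.hi then
        pos C.top < 0 ∧
          if (∀ E ∈ sc, Below v E.ends C.ends) ∧ (∀ E ∈ tl, ¬ (0 < pos E.lo ∧ 0 < pos E.top) →
            Below v E.ends C.ends ∨ Below v C.ends E.ends) then ScStack v pos y U (C :: sc)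
          else ScStack v pos y U sc
      else ScStack v pos y U sc := by
  obtain ⟨hB, -⟩ := ht.mem_bananas h.pos_ne h.up B (by simp)
  have hgB := h.up.of_mem hB
  have base : (∀ C, Sc v pos y U C → High v pos U C) → ScStack v pos y U sc := fun hall =>
    ⟨fun C => (hsc C).trans ⟨fun h => h.1, fun h => ⟨h, hall C h⟩⟩, hsort⟩
  have below : ∀ {E C : Banana}, E ∈ U.proper → C ∈ U.proper →
      (Below v E.ends C.ends ↔ v C.lo < v E.lo ∧ v E.top < v C.top) := fun {E C} hE hC => by
    simp only [Below, h.up.valid.hi_proper hE, h.up.valid.hi_proper hC]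
    exact and_congr_right fun _ => WithTop.coe_lt_coe
  have htl : ∀ E ∈ tl, E ∈ U.proper := fun E hE =>
    (mem_proper (ht.mem_bananas h.pos_ne h.up E (by simp [hE])).1).resolve_left fun e =>
      ht.not_spine E hE (by rw [e]; exact hi_mem_spine U)
  refine ⟨fun hnone => base fun C hC => ?_, fun C hC => ?_⟩
  · by_contra hh
    have := (h.missing_complete ht hC hh).2.1
    rw [hnone] at this; cases this
  have hCB := List.mem_of_getLast? hC
  have hCU := proper_of_child hB (List.mem_append_left _ hCB)
  have huniq : ∀ C', Sc v pos y U C' → ¬ High v pos U C' → C' = C := fun C' h1 h2 => by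
    have := (h.missing_complete ht h1 h2).2.1
    rw [hC] at this; cases this; rfl
  have hy : (y : WithTop ℝ) < height v C.hi ↔ y < v C.top := by
    rw [h.up.valid.hi_proper hCU]; exact WithTop.coe_lt_coe
  have hCs : C.hi ∈ U.leftSpine := by
    obtain ⟨gs, B', e, hB'⟩ := mem_leftSpine.1 hBs
    have : B' = B := hi_unique h.up.valid h.up.nodup h.up_hi
      (by rw [e]; exact mem_bananas_plugL _ _) hB hB'
    subst this
    obtain ⟨l', hl'⟩ := List.getLast?_eq_some_iff.1 hC
    refine mem_leftSpine.2 ⟨gs ++ [⟨B'.lo, B'.hi, l', B'.right⟩], C, ?_, rfl⟩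
    rw [plugL_append, e]
    congr 1
    conv_lhs => rw [← eta B', hl']
    rfl
  -- A topmost trail node right of the cut and above `y` would continue the path, but after `B` the
  -- path is off the spine.
  have hneg : y < v C.top → pos C.top < 0 := fun t2 => by
    by_contra hcon
    have hpos : 0 < pos C.top := by have := h.pos_ne C.top; omega
    have hn : nxt v pos y B = some C := by
      refine nxt_eq_some.2 ⟨?_, t2⟩
      rw [nx, if_neg (by omega)]
      obtain ⟨l', hl'⟩ := List.getLast?_eq_some_iff.1 hC
      rw [hl', List.filter_append, List.filter_cons_of_pos (by simpa using hpos)]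
      simp
    have hp := ht.tail_path
    rw [hn] at hp
    cases hp
    exact ht.not_spine C (by simp) (List.mem_append_left _ hCs)
  split_ifs with htest hfit
  · obtain ⟨t1, t2⟩ := htest
    rw [hy] at t2
    have hneg := hneg t2
    have hs := h.missing_sound ht hlo hC hBs hneg t1
      (fun E h1 h2 => ((below h1.mem hCU).1 (hfit.1 E ((hsc E).2 ⟨h1, h2⟩))).1)
      (fun E hE e1 e2 => by
        rcases hfit.2 E hE (by omega) with h3 | h3
        · exact Or.inl ((below (htl E hE) hCU).1 h3).1
        · exact Or.inr ((below hCU (htl E hE)).1 h3).2)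
    refine ⟨hneg, fun C' => ⟨fun h1 => ?_, fun h1 => ?_⟩, ?_⟩
    · rcases List.mem_cons.1 h1 with rfl | h1
      · exact hs.1
      · exact ((hsc _).1 h1).1
    · by_cases hh : High v pos U C'
      · exact List.mem_cons_of_mem _ ((hsc _).2 ⟨h1, hh⟩)
      · rw [huniq C' h1 hh]; exact List.mem_cons_self
    · exact List.pairwise_cons.2 ⟨fun E hE =>
        ((below ((hsc E).1 hE).1.mem hCU).1 (hfit.1 E hE)).2, hsort⟩
  · have hnot : ∀ C', Sc v pos y U C' → High v pos U C' := fun C' h1 => by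
      by_contra h2
      have := huniq C' h1 h2
      subst this
      refine hfit ⟨fun E hE => ?_, fun E hE hE' => ?_⟩
      · obtain ⟨e1, e2⟩ := (hsc E).1 hE
        rw [below e1.mem hCU]
        have hlt : v E.top < v C'.top := by
          by_contra hcon
          have hne : C'.top ≠ E.top := fun e => by
            have := eq_of_top_eq h.up.nodup hCU e1.mem e
            rw [this] at h2; exact h2 e2
          have h3 : v C'.top < v E.top := lt_of_le_of_ne (not_lt.1 hcon) fun e =>
            hne (h.inj _ (top_mem_ino hCU) _ (top_mem_ino e1.mem) e)
          have h4 := (h.sc_pair e1 h1 h3).1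
          have := h1.lo_lt
          exact h2 ⟨E.top, top_mem_ino e1.mem, by omega, h3⟩
        exact ⟨(h.sc_pair h1 e1 hlt).2, hlt⟩
      · exact Or.inl ((below (htl E hE) hCU).2 (h.missing_fits ht h1 hlo hC hE hE'))
    exact ⟨hneg (hy.1 htest.2), base hnot⟩
  · refine base fun C' h1 => ?_
    by_contra h2
    have := huniq C' h1 h2
    subst this
    exact htest ⟨h1.lt_y, hy.2 (h.y_lt h1)⟩

end

end Banana
end BananaTree

namespace BananaTree
namespace Banana

variable {v : ℕ → ℝ} {pos : ℕ → ℤ} {y : ℝ} {ℓ : ℕ}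

/-! ### The five stacks -/

/-- The stacks that hold the bananas `cs` of the up-tree and the windows `scL`, `scR`. -/
def loaded (ℓ : ℕ) (cs scL scR : List Banana) : Stacks :=
  ⟨(stacksOf ℓ (cs.map ends)).L, (stacksOf ℓ (cs.map ends)).R, (stacksOf ℓ (cs.map ends)).M,
    scL.map ends, scR.map ends⟩

/-- The stack to which a banana of the up-tree belongs. -/
def kind (ℓ : ℕ) (e : ℕ × WithTop ℕ) : StackName :=
  if e.1 ≤ ℓ ∧ e.2 ≤ ℓ then .Lup else if ℓ < e.1 ∧ ℓ < e.2 then .Rup else .Mup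

theorem kind_Lup {e : ℕ × WithTop ℕ} (h : e.1 ≤ ℓ ∧ e.2 ≤ ℓ) : kind ℓ e = .Lup := if_pos h

theorem kind_Rup {e : ℕ × WithTop ℕ} (h : ℓ < e.1 ∧ ℓ < e.2) : kind ℓ e = .Rup := by
  rw [kind, if_neg (fun h' => by omega), if_pos h]

theorem kind_Mup {e : ℕ × WithTop ℕ} (h : ¬ (e.1 ≤ ℓ ∧ e.2 ≤ ℓ) ∧ ¬ (ℓ < e.1 ∧ ℓ < e.2)) :
    kind ℓ e = .Mup := by
  rw [kind, if_neg h.1, if_neg h.2]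

theorem loaded_get {cs scL scR : List Banana} {σ : StackName} {e : ℕ × WithTop ℕ}
    (h : e ∈ (loaded ℓ cs scL scR).get σ) :
    (∃ B ∈ cs, e = B.ends ∧ σ = kind ℓ e) ∨ (∃ C ∈ scL, e = C.ends ∧ σ = .Ldn) ∨
      ∃ C ∈ scR, e = C.ends ∧ σ = .Rdn := by
  cases σ with
  | Lup =>
    obtain ⟨h1, h2⟩ := List.mem_filter.1 h
    obtain ⟨B, hB, rfl⟩ := List.mem_map.1 h1
    exact Or.inl ⟨B, hB, rfl, (kind_Lup (by simpa using h2)).symm⟩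
  | Rup =>
    obtain ⟨h1, h2⟩ := List.mem_filter.1 h
    obtain ⟨B, hB, rfl⟩ := List.mem_map.1 h1
    exact Or.inl ⟨B, hB, rfl, (kind_Rup (by simpa using h2)).symm⟩
  | Mup =>
    obtain ⟨h1, h2⟩ := List.mem_filter.1 h
    obtain ⟨B, hB, rfl⟩ := List.mem_map.1 h1
    exact Or.inl ⟨B, hB, rfl, (kind_Mup (by exact of_decide_eq_true h2)).symm⟩
  | Ldn =>
    obtain ⟨C, hC, rfl⟩ := List.mem_map.1 h
    exact Or.inr (Or.inl ⟨C, hC, rfl, rfl⟩)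
  | Rdn =>
    obtain ⟨C, hC, rfl⟩ := List.mem_map.1 h
    exact Or.inr (Or.inr ⟨C, hC, rfl, rfl⟩)

theorem loaded_cons (B : Banana) (cs scL scR : List Banana) :
    (loaded ℓ (B :: cs) scL scR).get (kind ℓ B.ends) =
      B.ends :: (loaded ℓ cs scL scR).get (kind ℓ B.ends) ∧
    (loaded ℓ (B :: cs) scL scR).pop (kind ℓ B.ends) = loaded ℓ cs scL scR := by
  by_cases h1 : B.ends.1 ≤ ℓ ∧ B.ends.2 ≤ ℓ
  · rw [kind_Lup h1, loaded, List.map_cons, ← stacksOf_push, Triple.push, if_pos h1]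
    exact ⟨rfl, rfl⟩
  · by_cases h2 : ℓ < B.ends.1 ∧ ℓ < B.ends.2
    · rw [kind_Rup h2, loaded, List.map_cons, ← stacksOf_push, Triple.push, if_neg h1, if_pos h2]
      exact ⟨rfl, rfl⟩
    · rw [kind_Mup ⟨h1, h2⟩, loaded, List.map_cons, ← stacksOf_push, Triple.push, if_neg h1,
        if_neg h2]
      exact ⟨rfl, rfl⟩

theorem loaded_size (cs scL scR : List Banana) :
    (loaded ℓ cs scL scR).size = cs.length + scL.length + scR.length := by
  induction cs with
  | nil => simp [Stacks.size, loaded, stacksOf]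
  | cons B cs ih =>
    have h : ∀ (S : Stacks) (σ : StackName) (e : ℕ × WithTop ℕ) (l : Stack), S.get σ = e :: l →
        S.size = (S.pop σ).size + 1 := by
      rintro ⟨L, R, M, Ld, Rd⟩ σ e l h
      cases σ <;> simp only [Stacks.get] at h <;> subst h <;>
        simp [Stacks.size, Stacks.pop] <;> omega
    obtain ⟨h1, h2⟩ := loaded_cons (ℓ := ℓ) B cs scL scR
    rw [h _ _ _ _ h1, h2, ih, List.length_cons]
    omega

theorem topBanana_up {B : Banana} {cs scL scR : List Banana}
    (h1 : ∀ E ∈ cs, height v E.hi < height v B.hi) (h2 : ∀ E ∈ scL, height v E.hi < height v B.hi)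
    (h3 : ∀ E ∈ scR, height v E.hi < height v B.hi) :
    topBanana v (loaded ℓ (B :: cs) scL scR) = some (kind ℓ B.ends, B.ends) := by
  refine topBanana_of_unique (by rw [(loaded_cons B cs scL scR).1]; rfl) fun σ e' he' => ?_
  rcases loaded_get (List.mem_of_mem_head? he') with ⟨E, hE, rfl, e⟩ | ⟨E, hE, rfl, -⟩ |
    ⟨E, hE, rfl, -⟩
  · rcases List.mem_cons.1 hE with rfl | hE
    · exact Or.inl e
    · exact Or.inr (h1 E hE)
  · exact Or.inr (h2 E hE)
  · exact Or.inr (h3 E hE)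

theorem topBanana_Ldn {C : Banana} {cs scL scR : List Banana}
    (h1 : ∀ E ∈ cs, height v E.hi < height v C.hi)
    (h3 : ∀ E ∈ scR, height v E.hi < height v C.hi) :
    topBanana v (loaded ℓ cs (C :: scL) scR) = some (.Ldn, C.ends) := by
  refine topBanana_of_unique rfl fun σ e' he' => ?_
  rcases loaded_get (List.mem_of_mem_head? he') with ⟨E, hE, rfl, -⟩ | ⟨E, hE, rfl, e⟩ |
    ⟨E, hE, rfl, -⟩
  · exact Or.inr (h1 E hE)
  · exact Or.inl e
  · exact Or.inr (h3 E hE)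

theorem topBanana_Rdn {C : Banana} {cs scL scR : List Banana}
    (h1 : ∀ E ∈ cs, height v E.hi < height v C.hi) (h2 : ∀ E ∈ scL, height v E.hi < height v C.hi) :
    topBanana v (loaded ℓ cs scL (C :: scR)) = some (.Rdn, C.ends) := by
  refine topBanana_of_unique rfl fun σ e' he' => ?_
  rcases loaded_get (List.mem_of_mem_head? he') with ⟨E, hE, rfl, -⟩ | ⟨E, hE, rfl, -⟩ |
    ⟨E, hE, rfl, e⟩
  · exact Or.inr (h1 E hE)
  · exact Or.inr (h2 E hE)
  · exact Or.inl e

/-- Of the loaded bananas only `B` has its upper end in the spine, and this is the one that is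
dropped. -/
theorem rev_filter {D B : Banana} {tl : List Banana} {p : ℕ × WithTop ℕ → Bool} {q : Banana → Bool}
    (hB : B.hi ∈ D.spine) (htl : ∀ E ∈ tl, E.hi ∉ D.spine) (hpq : ∀ E ∈ tl, p E.ends = q E) :
    (((((B :: tl).map ends).filter p).filter fun e => e.2 ∉ D.spine).map
      fun e => (e.2.untopD 0, (e.1 : WithTop ℕ))) =
      (tl.filter q).map fun E => (E.top, (E.lo : WithTop ℕ)) := by
  rw [List.filter_filter, List.map_cons, List.filter_cons_of_neg (by simp [hB]), List.filter_map,
    List.map_map]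
  have : tl.filter ((fun e => decide (e.2 ∉ D.spine) && p e) ∘ ends) = tl.filter q :=
    List.filter_congr fun E hE => by
      have := htl E hE
      simp only [Function.comp_apply, hpq E hE]
      simp [this]
  rw [this]
  rfl

theorem le_iff_of_hi (hℓ : ∀ i, pos i < 0 ↔ i ≤ ℓ) {E : Banana} (hE : E.hi = (E.top : WithTop ℕ)) :
    E.hi ≤ ℓ ↔ pos E.top < 0 := by
  rw [hE, hℓ]; exact Nat.cast_le

theorem lt_iff_of_hi (h0 : ∀ i, pos i ≠ 0) (hℓ : ∀ i, pos i < 0 ↔ i ≤ ℓ) {E : Banana}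
    (hE : E.hi = (E.top : WithTop ℕ)) : ℓ < E.hi ↔ 0 < pos E.top := by
  have := h0 E.top
  have h1 := le_iff_of_hi hℓ hE
  rw [← not_le, h1]; omega

theorem lt_iff_pos (h0 : ∀ i, pos i ≠ 0) (hℓ : ∀ i, pos i < 0 ↔ i ≤ ℓ) (i : ℕ) :
    ℓ < i ↔ 0 < pos i := by
  have := h0 i
  have := hℓ i
  omega

section

variable {U D B : Banana} {a b : ℕ} {pre tl scL scR : List Banana} (h : Setting v pos y U D a b)
  (hℓ : ∀ i, pos i < 0 ↔ i ≤ ℓ) (ht : Tail v pos y U B pre tl)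
include h

theorem Setting.tail_proper (ht : Tail v pos y U B pre tl) : ∀ E ∈ tl, E ∈ U.proper := fun E hE =>
  (mem_proper (ht.mem_bananas h.pos_ne h.up E (by simp [hE])).1).resolve_left fun e =>
    ht.not_spine E hE (by rw [e]; exact hi_mem_spine U)

include ht

theorem Setting.top_tail : ∀ E ∈ tl, height v E.hi < height v B.hi :=
  (List.pairwise_cons.1 (List.pairwise_append.1
    (h.up.path_pairwise_hi h.pos_ne h.up_hi ht.path fun A hA => by
      cases hA; exact ⟨self_mem_bananas _, Or.inl rfl⟩)).2.1).1

theorem Setting.leftSpine_of_pos (hhi : B.hi = ⊤ ∨ 0 < pos B.top) :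
    B.hi ∈ U.leftSpine := by
  rcases hhi with hhi | hhi
  · rw [hhi, ← h.up_hi]; exact mem_leftSpine.2 ⟨[], U, rfl, rfl⟩
  obtain ⟨hB, hp⟩ := ht.mem_bananas h.pos_ne h.up B (by simp)
  rcases mem_proper hB with rfl | hBp
  · exact mem_leftSpine.2 ⟨[], B, rfl, rfl⟩
  rcases List.mem_append.1 ht.spine with hs | hs
  · exact hs
  obtain ⟨f, fs, e⟩ := lo_lt_top_of_leftSpine h.up.mirror (by simpa using h.up_hi)
      (mirror_proper h.up.nodup hBp) (mem_leftSpine_mirror.2 (by simpa using hs))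
  have hg := h.up.mirror
  rw [e] at hg
  have h1 := hg.plugL_lo (by simp) (lo_mem_ino B.mirror)
  simp only [Pi.neg_apply, neg_lt_neg_iff, lo_mirror, top_mirror] at h1
  rcases hp with rfl | hp | hp
  · exact mem_leftSpine.2 ⟨[], B, rfl, rfl⟩
  · have := hp.lo_lt; omega
  · have := hp.top_pos; simp only [Pi.neg_apply] at this; omega

/-- There is a missing window on the left only if both ends of the top banana are on the right. -/
theorem Setting.no_missing (hno : ¬ (0 < pos B.lo ∧ (B.hi = ⊤ ∨ 0 < pos B.top)))
    (hsc : ∀ C, C ∈ scL ↔ Sc v pos y U C ∧ High v pos U C)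
    (hsort : scL.Pairwise fun C C' => v C'.top < v C.top) : ScStack v pos y U scL := by
  refine ⟨fun C => (hsc C).trans ⟨fun h => h.1, fun hC => ⟨hC, ?_⟩⟩, hsort⟩
  by_contra hh
  obtain ⟨h1, h2, h3⟩ := h.missing_complete ht hC hh
  refine hno ⟨h1, ?_⟩
  obtain ⟨hB, -⟩ := ht.mem_bananas h.pos_ne h.up B (by simp)
  rcases mem_proper hB with rfl | hBp
  · exact Or.inl h.up_hi
  · obtain ⟨f, fs, e⟩ := lo_lt_top_of_leftSpine h.up h.up_hi hBp h3
    have hg := h.up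
    rw [e] at hg
    have := hg.plugL_lo (by simp) (lo_mem_ino B)
    exact Or.inr (by omega)

include hℓ

/-- Three cases: `B` has both ends right of the cut, both left of it, or is separated by it, where
`⊤` counts for the side of the minimum. In the third case there is no missing window, and the
algorithm looks for none. -/
theorem Setting.addMissing_spec
    (hL : ∀ C, C ∈ scL ↔ Sc v pos y U C ∧ High v pos U C)
    (hL' : scL.Pairwise fun C C' => v C'.top < v C.top)
    (hR : ∀ C, C ∈ scR ↔ Sc v (-pos) y U.mirror C ∧ High v (-pos) U.mirror C)
    (hR' : scR.Pairwise fun C C' => v C'.top < v C.top) :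
    ∃ scL' scR', addMissing U v ℓ y (loaded ℓ (B :: tl) scL scR) = loaded ℓ (B :: tl) scL' scR' ∧
      ScStack v pos y U scL' ∧ ScStack v (-pos) y U.mirror scR' := by
  have hB := (ht.mem_bananas h.pos_ne h.up B (by simp)).1
  have htop := topBanana_up (v := v) (ℓ := ℓ) (B := B) (cs := tl) (scL := scL) (scR := scR)
    (h.top_tail ht) (fun E hE => h.sc_lt_top ht ((hL E).1 hE).1) (fun E hE => by
      simpa using h.mirror.sc_lt_top (ht.mirror h.pos_ne) ((hR E).1 hE).1)
  have hat := at?_eq h.up.valid h.up.nodup h.up_hi hB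
  have hlo0 := h.pos_ne B.lo
  have htl := h.tail_proper ht
  have htl1 : ∀ E ∈ tl, (E.hi ≤ ℓ ↔ pos E.top < 0) := fun E hE =>
    le_iff_of_hi hℓ (h.up.valid.hi_proper (htl E hE))
  have htl2 : ∀ E ∈ tl, (ℓ < E.hi ↔ 0 < pos E.top) := fun E hE =>
    lt_iff_of_hi h.pos_ne hℓ (h.up.valid.hi_proper (htl E hE))
  have hBhi : ¬ (B.hi = ⊤) → B.hi = (B.top : WithTop ℕ) := fun hne =>
    h.up.valid.hi_proper ((mem_proper hB).resolve_left fun e => hne (by rw [e]; exact h.up_hi))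
  have hBm : ∀ C ∈ B.left ++ B.right, Below v C.ends B.ends := fun C hC =>
    ⟨((h.up.valid.of_mem hB).child_of_mem hC).lo_lt, h.up.height_child h.up_hi hB hC⟩
  by_cases h1 : 0 < pos B.lo ∧ (B.hi = ⊤ ∨ 0 < pos B.top)
  · have hRR := h.mirror.no_missing (scL := scR) (ht.mirror h.pos_ne)
      (by simp only [Pi.neg_apply, lo_mirror]; omega) hR hR'
    obtain ⟨hn, hs⟩ := h.missing_step ht h1.1 (h.leftSpine_of_pos ht h1.2) hL hL'
    have hk : kind ℓ B.ends = .Rup := by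
      refine kind_Rup ⟨(lt_iff_pos h.pos_ne hℓ _).2 h1.1, ?_⟩
      rcases h1.2 with e | e
      · show (ℓ : WithTop ℕ) < B.hi
        rw [e]; exact WithTop.coe_lt_top _
      · by_cases e' : B.hi = ⊤
        · show (ℓ : WithTop ℕ) < B.hi
          rw [e']; exact WithTop.coe_lt_top _
        · exact (lt_iff_of_hi h.pos_ne hℓ (hBhi e')).2 e
    rw [hk] at htop
    simp only [addMissing, htop, hat]
    cases hl : B.left.getLast? with
    | none => exact ⟨scL, scR, rfl, hn hl, hRR⟩
    | some C =>
      have hC := hs C hl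
      have hCB := List.mem_of_getLast? hl
      have hChi := ((h.up.valid.of_mem hB).child_left C hCB).hi_eq
      simp only
      by_cases ht1 : v C.lo < y ∧ (y : WithTop ℝ) < height v C.hi
      · rw [if_pos ht1] at hC ⊢
        rw [if_pos ((le_iff_of_hi hℓ hChi).2 hC.1)]
        -- The entries tested are those not on `Rup`. A comparison with `B` would succeed anyway,
        -- since `C` is attached to `B`.
        have hfit : Fits v (C.lo, C.hi) (loaded ℓ (B :: tl) scL scR).Ldn
              ((loaded ℓ (B :: tl) scL scR).Lup ++ (loaded ℓ (B :: tl) scL scR).Mup) ↔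
            (∀ E ∈ scL, Below v E.ends C.ends) ∧ (∀ E ∈ tl, ¬ (0 < pos E.lo ∧ 0 < pos E.top) →
            Below v E.ends C.ends ∨ Below v C.ends E.ends) := by
          refine and_congr ⟨fun h E hE => h _ (List.mem_map_of_mem hE), fun h e he => ?_⟩
            ⟨fun hf E hE hE' => hf _ ?_, fun hf e he => ?_⟩
          · obtain ⟨E, hE, rfl⟩ := List.mem_map.1 he
            exact h E hE
          · have hm : E.ends ∈ (B :: tl).map ends := List.mem_map_of_mem (by simp [hE])
            rw [← htl2 E hE, ← lt_iff_pos h.pos_ne hℓ] at hE'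
            by_cases h3 : E.ends.1 ≤ ℓ ∧ E.ends.2 ≤ ℓ
            · exact List.mem_append_left _ (List.mem_filter.2 ⟨hm, decide_eq_true h3⟩)
            · refine List.mem_append_right _ (List.mem_filter.2 ⟨hm, ?_⟩)
              exact decide_eq_true (And.intro h3 hE')
          · have : ∃ E ∈ B :: tl, e = E.ends ∧ ¬ (ℓ < e.1 ∧ ℓ < e.2) := by
              rcases List.mem_append.1 he with he | he
              · obtain ⟨e1, e2⟩ := List.mem_filter.1 he
                obtain ⟨E, hE, rfl⟩ := List.mem_map.1 e1
                have e3 := of_decide_eq_true e2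
                exact ⟨E, hE, rfl, fun h => by omega⟩
              · obtain ⟨e1, e2⟩ := List.mem_filter.1 he
                obtain ⟨E, hE, rfl⟩ := List.mem_map.1 e1
                exact ⟨E, hE, rfl, (of_decide_eq_true e2).2⟩
            obtain ⟨E, hE, rfl, hE'⟩ := this
            rcases List.mem_cons.1 hE with rfl | hE
            · exact Or.inr (hBm C (List.mem_append_left _ hCB))
            · refine hf E hE fun h5 => hE' ⟨(lt_iff_pos h.pos_ne hℓ _).2 h5.1, (htl2 E hE).2 h5.2⟩
        have hC2 := hC.2
        by_cases hf : Fits v (C.lo, C.hi) (loaded ℓ (B :: tl) scL scR).Ldn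
              ((loaded ℓ (B :: tl) scL scR).Lup ++ (loaded ℓ (B :: tl) scL scR).Mup)
        · rw [if_pos hf]
          rw [if_pos (hfit.1 hf)] at hC2
          exact ⟨C :: scL, scR, rfl, hC2, hRR⟩
        · rw [if_neg hf]
          rw [if_neg (mt hfit.2 hf)] at hC2
          exact ⟨scL, scR, rfl, hC2, hRR⟩
      · rw [if_neg ht1] at hC ⊢
        exact ⟨scL, scR, rfl, hC, hRR⟩
  have hLL := h.no_missing ht h1 hL hL'
  by_cases h2 : pos B.lo < 0 ∧ (B.hi = ⊤ ∨ pos B.top < 0)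
  · have h2' : 0 < (-pos) B.mirror.lo ∧ (B.mirror.hi = ⊤ ∨ 0 < (-pos) B.mirror.top) := by
      simpa using h2
    obtain ⟨hn, hs⟩ := h.mirror.missing_step (ht.mirror h.pos_ne) h2'.1
      (h.mirror.leftSpine_of_pos (ht.mirror h.pos_ne) h2'.2) hR hR'
    -- The right trail is chosen for two stack names: `Lup`, and `Mup` if `B` is the special banana
    -- with its minimum left of the cut.
    have hadd : addMissing U v ℓ y (loaded ℓ (B :: tl) scL scR) =
        match B.right.getLast? with
        | none => loaded ℓ (B :: tl) scL scR
        | some C =>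
          if v C.lo < y ∧ (y : WithTop ℝ) < height v C.hi then
            if C.hi ≤ ℓ then
              if Fits v (C.lo, C.hi) (loaded ℓ (B :: tl) scL scR).Ldn
                ((loaded ℓ (B :: tl) scL scR).Lup ++ (loaded ℓ (B :: tl) scL scR).Mup) then
                { loaded ℓ (B :: tl) scL scR with
                  Ldn := (C.lo, C.hi) :: (loaded ℓ (B :: tl) scL scR).Ldn }
              else loaded ℓ (B :: tl) scL scR
            else
              if Fits v (C.lo, C.hi) (loaded ℓ (B :: tl) scL scR).Rdn
                ((loaded ℓ (B :: tl) scL scR).Rup ++ (loaded ℓ (B :: tl) scL scR).Mup) then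
                { loaded ℓ (B :: tl) scL scR with
                  Rdn := (C.lo, C.hi) :: (loaded ℓ (B :: tl) scL scR).Rdn }
              else loaded ℓ (B :: tl) scL scR
          else loaded ℓ (B :: tl) scL scR := by
      by_cases e : B.hi = ⊤
      · have hk : kind ℓ B.ends = .Mup := by
          refine kind_Mup ⟨fun h3 => ?_, fun h3 => ?_⟩
          · have := h3.2
            simp only [e] at this
            exact absurd this (not_le.2 (WithTop.coe_lt_top ℓ))
          · have := (hℓ _).1 h2.1
            have := h3.1
            simp only at this
            omega
        rw [hk] at htop
        simp only [addMissing, htop, hat, if_pos e]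
      · have hk : kind ℓ B.ends = .Lup :=
          kind_Lup ⟨(hℓ _).1 h2.1, (le_iff_of_hi hℓ (hBhi e)).2 (h2.2.resolve_left e)⟩
        rw [hk] at htop
        simp only [addMissing, htop, hat]
    rw [hadd]
    cases hl : B.right.getLast? with
    | none => exact ⟨scL, scR, rfl, hLL, hn (by simp [hl])⟩
    | some C =>
      have hC := hs C.mirror (by simp [hl])
      have hCB := List.mem_of_getLast? hl
      have hChi := ((h.up.valid.of_mem hB).child_right C hCB).hi_eq
      simp only [lo_mirror, hi_mirror, top_mirror, Pi.neg_apply, Left.neg_neg_iff] at hC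
      simp only
      by_cases ht1 : v C.lo < y ∧ (y : WithTop ℝ) < height v C.hi
      · rw [if_pos ht1] at hC ⊢
        rw [if_neg (fun h3 => by have := (le_iff_of_hi hℓ hChi).1 h3; omega)]
        have hfit : Fits v (C.lo, C.hi) (loaded ℓ (B :: tl) scL scR).Rdn
              ((loaded ℓ (B :: tl) scL scR).Rup ++ (loaded ℓ (B :: tl) scL scR).Mup) ↔
            (∀ E ∈ scR, Below v E.ends C.mirror.ends) ∧ (∀ E ∈ tl.map Banana.mirror,
              ¬ (0 < -pos E.lo ∧ 0 < -pos E.top) →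
              Below v E.ends C.mirror.ends ∨ Below v C.mirror.ends E.ends) := by
          have hCe : C.mirror.ends = C.ends := by simp [ends]
          rw [hCe]
          refine and_congr ⟨fun h E hE => h _ (List.mem_map_of_mem hE), fun h e he => ?_⟩
            ⟨fun hf E hE hE' => ?_, fun hf e he => ?_⟩
          · obtain ⟨E, hE, rfl⟩ := List.mem_map.1 he
            exact h E hE
          · obtain ⟨E, hEt, rfl⟩ := List.mem_map.1 hE
            have hEe : E.mirror.ends = E.ends := by simp [ends]
            rw [hEe]
            simp only [lo_mirror, top_mirror, Left.neg_pos_iff] at hE'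
            refine hf _ ?_
            have hm : E.ends ∈ (B :: tl).map ends := List.mem_map_of_mem (by simp [hEt])
            rw [← htl1 E hEt, hℓ] at hE'
            by_cases h3 : ℓ < E.ends.1 ∧ ℓ < E.ends.2
            · exact List.mem_append_left _ (List.mem_filter.2 ⟨hm, decide_eq_true h3⟩)
            · refine List.mem_append_right _ (List.mem_filter.2 ⟨hm, ?_⟩)
              exact decide_eq_true (And.intro hE' h3)
          · have : ∃ E ∈ B :: tl, e = E.ends ∧ ¬ (e.1 ≤ ℓ ∧ e.2 ≤ ℓ) := by
              rcases List.mem_append.1 he with he | he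
              · obtain ⟨e1, e2⟩ := List.mem_filter.1 he
                obtain ⟨E, hE, rfl⟩ := List.mem_map.1 e1
                have e3 := of_decide_eq_true e2
                exact ⟨E, hE, rfl, fun h => by omega⟩
              · obtain ⟨e1, e2⟩ := List.mem_filter.1 he
                obtain ⟨E, hE, rfl⟩ := List.mem_map.1 e1
                exact ⟨E, hE, rfl, (of_decide_eq_true e2).1⟩
            obtain ⟨E, hE, rfl, hE'⟩ := this
            rcases List.mem_cons.1 hE with rfl | hE
            · exact Or.inr (hBm C (List.mem_append_right _ hCB))
            · have := hf E.mirror (List.mem_map_of_mem hE) fun h5 => hE' (by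
                simp only [lo_mirror, top_mirror, Left.neg_pos_iff] at h5
                exact ⟨(hℓ _).1 h5.1, (htl1 E hE).2 h5.2⟩)
              simpa [ends] using this
        have hC2 := hC.2
        by_cases hf : Fits v (C.lo, C.hi) (loaded ℓ (B :: tl) scL scR).Rdn
              ((loaded ℓ (B :: tl) scL scR).Rup ++ (loaded ℓ (B :: tl) scL scR).Mup)
        · rw [if_pos hf]
          rw [if_pos (by simpa [ends] using hfit.1 hf)] at hC2
          exact ⟨scL, C.mirror :: scR, by simp [loaded, ends], hLL, hC2⟩
        · rw [if_neg hf]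
          rw [if_neg (by simpa [ends] using mt hfit.2 hf)] at hC2
          exact ⟨scL, scR, rfl, hLL, hC2⟩
      · rw [if_neg ht1] at hC ⊢
        exact ⟨scL, scR, rfl, hLL, hC⟩
  have hRR := h.mirror.no_missing (scL := scR) (ht.mirror h.pos_ne) (by simpa using h2) hR hR'
  refine ⟨scL, scR, ?_, hLL, hRR⟩
  have hne : B.hi ≠ ⊤ := fun e => by
    simp only [e, true_or, and_true] at h1 h2; omega
  have hk : kind ℓ B.ends = .Mup := by
    refine kind_Mup ⟨fun h3 => ?_, fun h3 => ?_⟩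
    · exact h2 ⟨(hℓ _).2 h3.1, Or.inr ((le_iff_of_hi hℓ (hBhi hne)).1 h3.2)⟩
    · exact h1 ⟨(lt_iff_pos h.pos_ne hℓ _).1 h3.1,
        Or.inr ((lt_iff_of_hi h.pos_ne hℓ (hBhi hne)).1 h3.2)⟩
  rw [hk] at htop
  simp only [addMissing, htop, hat, if_neg hne, List.getLast?_nil]

end

theorem Setting.splitStacks_spec {U D : Banana} {a b s t : ℕ} (h : Setting v pos y U D a b)
    (hm : ∀ i j, pos i < pos j ↔ i < j) (hℓ : ∀ i, pos i < 0 ↔ i ≤ ℓ)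
    (hy : y = (v ℓ + v (ℓ + 1)) / 2) (hU : U.ino = critPoints v s t)
    (hD : D.ino = critPoints (fun i => -v i) s t) (hmax : IsMaxItem v b ↔ v a < v b)
    (hmin : IsMaxItem (fun i => -v i) b ↔ -v a < -v b)
    (hcD : Cut (fun i => -v i) pos (-y) D.ino a b) :
    ∃ pre B tl scL scR, Tail v pos y U B pre tl ∧ ScStack v pos y U scL ∧
      ScStack v (-pos) y U.mirror scR ∧
      splitStacks U D v s t ℓ = loaded ℓ (B :: tl) scL scR := by
  obtain ⟨cs, hcs⟩ := exists_path v pos y U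
  obtain ⟨pre, B, tl, rfl, hB, htl, hup⟩ :=
    h.up.loadStacks_eq hm h.pos_ne h.up_hi h.cut hcs hℓ hU hmax
  obtain ⟨csD, hcsD⟩ := exists_path (fun i => -v i) pos (-y) D
  obtain ⟨preD, BD, tlD, rfl, hBD, htlD, hdn⟩ :=
    h.dn.loadStacks_eq hm h.pos_ne h.dn_hi hcD hcsD hℓ hD hmin
  have ht : Tail v pos y U B pre tl := ⟨hcs, hB, htl⟩
  have htD : Tail (fun i => -v i) pos (-y) D BD preD tlD := ⟨hcsD, hBD, htlD⟩
  have hpD : ∀ E ∈ tlD, E ∈ D.proper := fun E hE =>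
    (mem_proper (htD.mem_bananas h.pos_ne h.dn E (by simp [hE])).1).resolve_left fun e =>
      htlD E hE (by rw [e]; exact hi_mem_spine D)
  obtain ⟨scL, hL, hL1, hL2⟩ := h.dn_list htD
  obtain ⟨scR, hR, hR1, hR2⟩ := h.mirror.dn_list (htD.mirror h.pos_ne)
  obtain ⟨scL', scR', hadd, h1, h2⟩ := h.addMissing_spec hℓ ht hL1 hL2 hR1 hR2
  refine ⟨pre, B, tl, scL', scR', ht, h1, h2, ?_⟩
  rw [← hadd, splitStacks]
  simp only [← hy, hup, hdn]
  congr 1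
  rw [loaded, ← hL, ← hR]
  congr 1
  · refine rev_filter (p := fun e => e.1 ≤ ℓ ∧ e.2 ≤ ℓ) (q := fun E => pos E.lo < 0 ∧ pos E.top < 0)
      hBD htlD fun E hE => decide_eq_decide.2 ?_
    rw [hℓ]
    exact and_congr_right fun _ => le_iff_of_hi hℓ (h.dn.valid.hi_proper (hpD E hE))
  · refine (rev_filter (p := fun e => ℓ < e.1 ∧ ℓ < e.2)
      (q := fun E => 0 < pos E.lo ∧ 0 < pos E.top) hBD htlD
      fun E hE => decide_eq_decide.2 ?_).trans ?_
    rotate_left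
    · rw [List.filter_map, List.map_map]
      simp [Function.comp_def]
    · rw [← lt_iff_pos h.pos_ne hℓ]
      exact and_congr_right fun _ => lt_iff_of_hi h.pos_ne hℓ (h.dn.valid.hi_proper (hpD E hE))

end Banana
end BananaTree

namespace BananaTree
namespace Banana

variable {v : ℕ → ℝ} {pos : ℕ → ℤ} {y : ℝ}

/-! ### The invariant of the main loop -/

/-- The state of the main loop when the dummy leaf `α` is in the left tree, which is `plugR gs A`
where `A` is the banana of `α`; the right tree is `F`. The nodes left and right are `P` and `Q`, the
value of `α` is `z`, and `cs`, `scN`, `scF` are the bananas on the stacks. -/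
structure Inv (v : ℕ → ℝ) (pos : ℕ → ℤ) (y : ℝ) (U : Banana) (α : ℕ) (gs : List Frame)
    (A F : Banana) (z : ℝ) (P Q : List ℕ) (cs scN scF : List Banana) : Prop where
  up : Good v pos U
  fresh : α ∉ U.ino
  near_lo : A.lo = α
  near_right : A.right = []
  near_ino : (plugR gs A).ino = P ++ [α]
  near_valid : Valid (Function.update v α z) (plugR gs A)
  near_hi : (plugR gs A).hi = ⊤
  far_ino : F.ino = Q
  far_valid : Valid v F
  far_hi : F.hi = ⊤
  append : P ++ Q = U.ino
  neg : ∀ i ∈ P, pos i < 0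
  path : IsPath v pos y cs.head? cs
  head_mem : ∀ B ∈ cs.head?, B ∈ U.bananas ∧ Pan v pos y U B
  head_side : ∀ B ∈ cs.head?, B.hi = ⊤ ∨ 0 < pos B.top
  -- The next banana of the path is still as it was in `U`, so it can be taken apart using what is
  -- known about `U`.
  head_far : ∀ B ∈ cs.head?, ∃ fs, F = plugL fs B
  head_ino : ∀ B ∈ cs.head?, ∀ i ∈ Q, pos i < 0 → i ∈ B.ino
  head_lt : ∀ B ∈ cs.head?, ∀ C ∈ A.left, height v B.hi < height v C.hi
  head_lt' : ∀ B ∈ cs.head?, gs = [] ∨ height v B.hi < height v A.hi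
  nil : cs = [] → ∀ i ∈ Q, 0 < pos i
  -- Nodes on the wrong side that are still to be moved may be hung above `α`.
  z_lt : ∀ i ∈ Q, pos i < 0 → z < v i
  left_mem : ∀ C ∈ A.left, C ∈ U.proper
  top_mem : gs = [] ∨ ∃ E ∈ U.proper, A.hi = E.hi
  scN_sorted : scN.Pairwise fun C C' => v C'.top < v C.top
  scF_sorted : scF.Pairwise fun C C' => v C'.top < v C.top
  scN_sc : ∀ C ∈ scN, Sc v pos y U C
  scF_sc : ∀ C ∈ scF, Sc v (-pos) y U.mirror C
  -- A window with the cut in its out-panel is waiting, or `α` has already passed its minimum.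
  scN_done : ∀ C, Sc v pos y U C → C ∈ scN ∨ v C.lo < z
  scF_done : ∀ C, Sc v (-pos) y U.mirror C → C ∈ scF ∨ v C.lo < z
  scN_lt : gs = [] ∨ ∀ C ∈ scN, height v C.hi < height v A.hi
  scF_lt : ∀ C ∈ scF, ∃ B ∈ cs.head?, height v C.hi < height v B.hi
  -- Relative to the nodes, `α` has not risen above `y`, so its final placement is a further rise.
  rank : ∀ i ∈ U.ino, v i < z → v i < y

theorem Child.update {C : Banana} {a α : ℕ} {z : ℝ} (h : Child v a C) (hα : α ∉ C.ino)
    (hα' : α ≠ C.top) {a' : ℕ} (ha : Function.update v α z a' < v C.lo) :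
    Child (Function.update v α z) a' C := by
  have hi : ∀ i ∈ C.ino, Function.update v α z i = v i := fun i hi =>
    Function.update_of_ne (fun e => hα (by rw [← e]; exact hi)) _ _
  have ht : Function.update v α z C.top = v C.top := Function.update_of_ne hα'.symm _ _
  refine ⟨h.hi_eq, by rwa [hi _ (lo_mem_ino C)], by rw [hi _ (lo_mem_ino C), ht]; exact h.lt_top,
    fun D hD => ?_, fun D hD => ?_⟩
  · rw [ht, hi _ (mem_ino.2 (Or.inr (Or.inl ⟨D, hD, Or.inr rfl⟩)))]; exact h.left_lt D hD
  · rw [ht, hi _ (mem_ino.2 (Or.inr (Or.inr ⟨D, hD, Or.inr rfl⟩)))]; exact h.right_lt D hD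

theorem Valid.update {C : Banana} {α : ℕ} {z : ℝ} (h : Valid v C) (hα : α ∉ C.ino) :
    Valid (Function.update v α z) C :=
  h.congr fun i hi => Function.update_of_ne (fun e => hα (by rw [← e]; exact hi)) _ _

theorem height_coe_lt {C E : Banana} (hC : C.hi = (C.top : WithTop ℕ))
    (hE : E.hi = (E.top : WithTop ℕ)) : height v C.hi < height v E.hi ↔ v C.top < v E.top := by
  rw [hC, hE]; exact WithTop.coe_lt_coe

section

variable {U A F : Banana} {α : ℕ} {gs : List Frame} {z : ℝ} {P Q : List ℕ}
  {cs scN scF : List Banana}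

theorem Inv.upd (I : Inv v pos y U α gs A F z P Q cs scN scF) (z' : ℝ) {i : ℕ} (hi : i ∈ U.ino) :
    Function.update v α z' i = v i :=
  Function.update_of_ne (fun e => I.fresh (by rw [← e]; exact hi)) _ _

theorem Inv.mem_P (I : Inv v pos y U α gs A F z P Q cs scN scF) {i : ℕ} (hi : i ∈ P) :
    i ∈ U.ino := by
  rw [← I.append]; exact List.mem_append_left _ hi

theorem Inv.mem_Q (I : Inv v pos y U α gs A F z P Q cs scN scF) {i : ℕ} (hi : i ∈ Q) :
    i ∈ U.ino := by
  rw [← I.append]; exact List.mem_append_right _ hi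

theorem Inv.lt_of_mem (I : Inv v pos y U α gs A F z P Q cs scN scF) {i j : ℕ} (hi : i ∈ P)
    (hj : j ∈ Q) : pos i < pos j := by
  have := I.up.sorted
  rw [← I.append] at this
  exact (List.pairwise_append.1 this).2.2 i hi j hj

theorem Inv.near_mem (I : Inv v pos y U α gs A F z P Q cs scN scF) {i : ℕ} (hi : i ∈ A.ino)
    (hne : i ≠ α) : i ∈ P := by
  have : i ∈ P ++ [α] := by rw [← I.near_ino, ino_plugR]; exact List.mem_append_right _ hi
  rcases List.mem_append.1 this with h | h
  · exact h
  · exact absurd (List.mem_singleton.1 h) hne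

theorem Inv.left_top_mem (I : Inv v pos y U α gs A F z P Q cs scN scF) {C : Banana}
    (hC : C ∈ A.left) : C.top ∈ P ∧ ∀ i ∈ C.ino, i ∈ P := by
  have hCU := I.left_mem C hC
  have key : ∀ i ∈ U.ino, i ∈ C.ino ∨ i = C.top → i ∈ P := fun i hiU hi => by
    refine I.near_mem (mem_ino.2 (Or.inr (Or.inl ⟨C, hC, hi⟩))) fun e => ?_
    rw [e] at hiU; exact I.fresh hiU
  exact ⟨key _ (top_mem_ino hCU) (Or.inr rfl), fun i hi =>
    key i (ino_subset (bananas_of_proper hCU) hi) (Or.inl hi)⟩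

theorem Inv.valid_near (I : Inv v pos y U α gs A F z P Q cs scN scF) :
    Valid (Function.update v α z) A := I.near_valid.of_mem (mem_bananas_plugR _ _)

theorem Inv.z_lt_left (I : Inv v pos y U α gs A F z P Q cs scN scF) {C : Banana}
    (hC : C ∈ A.left) : z < v C.lo := by
  have h1 := (I.valid_near.child_left C hC).lo_lt
  rwa [I.near_lo, Function.update_self,
    I.upd _ (I.mem_P ((I.left_top_mem hC).2 _ (lo_mem_ino C)))] at h1

/-- With an empty right trail, `α` is the last leaf; before it come the context and the left trail.
-/
theorem Inv.P_eq (I : Inv v pos y U α gs A F z P Q cs scN scF) :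
    P = tailR gs A.top ++ inoL A.left := by
  have h1 : (P ++ [α]) = tailR gs A.top ++ (inoL A.left ++ [α]) := by
    rw [← I.near_ino, ino_plugR, ino_eq, I.near_right, I.near_lo]; rfl
  rw [← List.append_assoc] at h1
  exact List.append_inj_left' h1 rfl

theorem Inv.sorted_P (I : Inv v pos y U α gs A F z P Q cs scN scF) :
    P.Pairwise fun i j => pos i < pos j := by
  have h3 := I.up.sorted
  rw [← I.append] at h3
  exact (List.pairwise_append.1 h3).1

theorem Inv.sorted_near (I : Inv v pos y U α gs A F z P Q cs scN scF) :
    (inoL A.left).Pairwise fun i j => pos i < pos j := by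
  have h3 := I.sorted_P
  rw [I.P_eq] at h3
  exact (List.pairwise_append.1 h3).2.1

end

section

-- Comparison of the waiting windows with the next banana of the path.

variable {U D B C : Banana} {a b : ℕ}

/-- After an injury, the windows on the far side that remain are lower than the next banana. -/
theorem Setting.far_lt_next (h : Setting v pos y U D a b) (hB : B ∈ U.bananas)
    (hp : Pan v pos y U B) (hside : B.hi = ⊤ ∨ 0 < pos B.top) (hlo : 0 < pos B.lo)
    (hC : Sc v (-pos) y U.mirror C) (hlt : height v C.hi < height v B.hi) :
    ∃ E, nxt v pos y B = some E ∧ height v C.hi < height v E.hi := by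
  have hgB := h.up.of_mem hB
  obtain ⟨c, c1, c2, c3, c4⟩ := h.mirror.exit hC
  have hy := h.mirror.y_lt hC
  have hCU : C.mirror ∈ U.proper := proper_of_mirror h.up.nodup (by simpa using hC.mem)
  have hw0 : 0 < pos C.top := by simpa using hC.top_neg
  have hwn : pos C.top < pos C.lo := by simpa using hC.lo_lt
  have hwU : C.top ∈ U.ino := by simpa using top_mem_ino hCU
  have hbet : ∀ i ∈ U.ino, 0 < pos i → pos i < pos C.top → v C.lo < v i ∧ v i < v C.top :=
    fun i hi i1 i2 => hC.between i (by simpa using hi) (by simpa using i2) (by simpa using i1)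
  have hChi : C.hi = (C.top : WithTop ℕ) := h.up.mirror.valid.hi_proper hC.mem
  simp only [ino_mirror, List.mem_reverse, Pi.neg_apply, neg_lt_neg_iff, neg_le_neg_iff] at c1 c2 c4
  -- either `B` is the whole tree or its window ends on the right of the cut
  have hBp : B = U ∨ B ∈ U.proper ∧ PanL v pos y U.ino B := by
    rcases mem_proper hB with e | hBp
    · exact Or.inl e
    rcases hp with e | hp | hp
    · exact Or.inl e
    · exact Or.inr ⟨hBp, hp⟩
    · rcases hside with e | e
      · rw [h.up.valid.hi_proper hBp] at e
        exact absurd e WithTop.coe_ne_top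
      · have := hp.top_pos; simp only [Pi.neg_apply] at this; omega
  have hltB : ∀ hb : B ∈ U.proper, v C.top < v B.top := fun hb =>
    (height_coe_lt hChi (h.up.valid.hi_proper hb)).1 hlt
  -- If `C.top` is before the minimum of `B`, it lies inside a banana on the left trail of `B` that
  -- ends right of the cut, and the last such banana is next. If it is behind it, then `B.lo`
  -- exceeds `C.lo` and the exit of `C` across the cut is outside `B`; the node delimiting `B` on
  -- that side would violate one of the two windows.
  rcases lt_trichotomy (pos C.top) (pos B.lo) with h1 | h1 | h1
  · have hwB : C.top ∈ B.ino := by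
      rcases hBp with rfl | ⟨hBp, hp⟩
      · exact hwU
      · have hw := h.up.lwin hBp hp.lo_lt
        have := hp.lo_lt
        exact hw.border _ hwU (by omega) fun k hk k1 k2 => hp.lt k hk (by omega) k2
    obtain ⟨E, hE, hE0, hvE⟩ : ∃ E ∈ B.left, 0 < pos E.top ∧ v C.top < v E.top := by
      rcases mem_ino.1 hwB with e | ⟨E, hE, hwE⟩ | ⟨E, hE, hwE⟩
      · rw [e] at h1; omega
      · have h2 := hgB.pos_left hE
        rcases hwE with hwE | e
        · have := h2.1 _ hwE
          exact ⟨E, hE, by omega,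
            (hgB.valid.child_left E hE).lt_of_mem (hgB.valid.valid_left E hE) hwE⟩
        · exfalso
          have hEU := proper_of_child hB (List.mem_append_left _ hE)
          have h3 := eq_of_top_eq h.up.nodup hCU hEU (by simpa using e)
          have h4 := h2.1 _ (lo_mem_ino E)
          rw [← h3] at h4
          simp only [lo_mirror, top_mirror] at h4
          omega
      · have h2 := hgB.pos_right hE
        rcases hwE with hwE | e
        · have := h2.1 _ hwE; omega
        · rw [e] at h1; omega
    have hEf : E ∈ B.left.filter fun C => 0 < pos C.top := by simpa using ⟨hE, hE0⟩
    obtain ⟨E', hE'⟩ : ∃ E', (B.left.filter fun C => 0 < pos C.top).getLast? = some E' :=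
      ⟨_, List.getLast?_eq_some_getLast (List.ne_nil_of_mem hEf)⟩
    have hE'm := List.mem_filter.1 (List.mem_of_getLast? hE')
    have hle : v E.top ≤ v E'.top := by
      by_cases e : E = E'
      · rw [e]
      · exact (rel_getLast (hgB.valid.pairwise_left.filter _) hE' hEf e).le
    refine ⟨E', nxt_eq_some.2 ⟨by rw [nx, if_neg (by omega)]; exact hE', by linarith⟩, ?_⟩
    exact (height_coe_lt hChi (hgB.valid.child_left E' hE'm.1).hi_eq).2 (by linarith)
  · exfalso
    have := h.up.inj hwU (ino_subset hB (lo_mem_ino B)) h1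
    exact lo_ne_top h.up.nodup hB hCU (by simpa using this.symm)
  · exfalso
    have h2 := hbet B.lo (ino_subset hB (lo_mem_ino B)) hlo h1
    rcases hBp with rfl | ⟨hBp, hp⟩
    · have := h.up.valid.lo_le c1
      linarith
    · have hw := h.up.lwin hBp hp.lo_lt
      have hlt' := hltB hBp
      have hBlt := hp.lo_lt
      have hc : c ∉ B.ino := fun hc => by
        have := hw.lo_le c hc
        linarith
      have h3 := mt (hw.border c c1 (by omega)) hc
      push Not at h3
      obtain ⟨k, k1, k2, k3, k4⟩ := h3
      rcases lt_or_ge 0 (pos k) with h5 | h5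
      · exact absurd (hp.lt k k1 h5 k3) k4.not_gt
      · have := c4 k k1 (by omega) k2
        linarith

/-- After a fatality, the windows on the near side that remain are lower than the next banana. -/
theorem Setting.near_lt_next (h : Setting v pos y U D a b) (hB : B ∈ U.bananas)
    (hp : Pan v pos y U B) (hside : B.hi = ⊤ ∨ 0 < pos B.top) (hlo : pos B.lo < 0)
    (hC : Sc v pos y U C) (hlt : height v C.hi < height v B.hi) :
    ∃ E, nxt v pos y B = some E ∧ height v C.hi < height v E.hi := by
  have hgB := h.up.of_mem hB
  obtain ⟨c, c1, c2, c3, c4⟩ := h.exit hC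
  have hy := h.y_lt hC
  have hwU := top_mem_ino hC.mem
  have hw0 := hC.top_neg
  have hwn := hC.lo_lt
  have hChi := h.up.valid.hi_proper hC.mem
  have hBp : B = U ∨ B ∈ U.proper ∧ PanL v pos y U.ino B := by
    rcases mem_proper hB with e | hBp
    · exact Or.inl e
    rcases hp with e | hp | hp
    · exact Or.inl e
    · exact Or.inr ⟨hBp, hp⟩
    · rcases hside with e | e
      · rw [h.up.valid.hi_proper hBp] at e
        exact absurd e WithTop.coe_ne_top
      · have := hp.top_pos; simp only [Pi.neg_apply] at this; omega
  have hltB : ∀ hb : B ∈ U.proper, v C.top < v B.top := fun hb =>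
    (height_coe_lt hChi (h.up.valid.hi_proper hb)).1 hlt
  -- Now the cut is to the right of the minimum. If `C.top` is to the left of it, then `B.lo` is in
  -- the out-panel of `C`, and the exit of `C` cannot be reached inside `B` nor beyond `B.top`. If
  -- it is to the right, it lies inside a banana on the right trail that ends left of the cut.
  rcases lt_trichotomy (pos C.top) (pos B.lo) with h1 | h1 | h1
  · exfalso
    have h2 := hC.between B.lo (ino_subset hB (lo_mem_ino B)) h1 hlo
    rcases hBp with rfl | ⟨hBp, hp⟩
    · have := h.up.valid.lo_le c1
      linarith
    · have hw := h.up.lwin hBp hp.lo_lt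
      have hlt' := hltB hBp
      have htop := hp.top_pos
      rcases lt_or_ge (pos c) (pos B.top) with h3 | h3
      · have := hw.lo_le c (hw.conv _ (lo_mem_ino B) c c1 (by omega) h3)
        linarith
      · have := c4 _ hw.top_mem (by omega) h3
        linarith
  · exfalso
    have := h.up.inj hwU (ino_subset hB (lo_mem_ino B)) h1
    exact lo_ne_top h.up.nodup hB hC.mem this.symm
  · have hwB : C.top ∈ B.ino := by
      rcases hBp with rfl | ⟨hBp, hp⟩
      · exact hwU
      · have hw := h.up.lwin hBp hp.lo_lt
        have htop := hp.top_pos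
        exact hw.conv _ (lo_mem_ino B) _ hwU h1.le (by omega)
    obtain ⟨E, hE, hE0, hvE⟩ : ∃ E ∈ B.right, pos E.top < 0 ∧ v C.top < v E.top := by
      rcases mem_ino.1 hwB with e | ⟨E, hE, hwE⟩ | ⟨E, hE, hwE⟩
      · rw [e] at h1; omega
      · have h2 := hgB.pos_left hE
        rcases hwE with hwE | e
        · have := h2.1 _ hwE; omega
        · rw [e] at h1; omega
      · have h2 := hgB.pos_right hE
        rcases hwE with hwE | e
        · have := h2.1 _ hwE
          exact ⟨E, hE, by omega,
            (hgB.valid.child_right E hE).lt_of_mem (hgB.valid.valid_right E hE) hwE⟩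
        · exfalso
          have hEU := proper_of_child hB (List.mem_append_right _ hE)
          have h3 := eq_of_top_eq h.up.nodup hC.mem hEU e
          have h4 := h2.1 _ (lo_mem_ino E)
          rw [← h3] at h4
          omega
    have hEf : E ∈ B.right.filter fun C => pos C.top < 0 := by simpa using ⟨hE, hE0⟩
    obtain ⟨E', hE'⟩ : ∃ E', (B.right.filter fun C => pos C.top < 0).getLast? = some E' :=
      ⟨_, List.getLast?_eq_some_getLast (List.ne_nil_of_mem hEf)⟩
    have hE'm := List.mem_filter.1 (List.mem_of_getLast? hE')
    have hle : v E.top ≤ v E'.top := by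
      by_cases e : E = E'
      · rw [e]
      · exact (rel_getLast (hgB.valid.pairwise_right.filter _) hE' hEf e).le
    refine ⟨E', nxt_eq_some.2 ⟨by rw [nx, if_pos hlo]; exact hE', by linarith⟩, ?_⟩
    exact (height_coe_lt hChi (hgB.valid.child_right E' hE'm.1).hi_eq).2 (by linarith)

end

end Banana
end BananaTree

namespace BananaTree
namespace Banana

variable {v : ℕ → ℝ} {pos : ℕ → ℤ} {y : ℝ}

/-! ### Injuries -/

/-- Among the trail nodes right of the cut only the topmost can carry nodes left of it, as all lower
ones and their bananas are to its right. -/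
theorem Good.mem_last {B C : Banana} {L : List Banana} (h : Good v pos B)
    (hL : (B.left.filter fun C => 0 < pos C.top) = L ++ [C]) {i : ℕ}
    (hi : i ∈ inoL (B.left.filter fun C => 0 < pos C.top)) (hneg : pos i < 0) : i ∈ C.ino := by
  obtain ⟨E, hE, hiE⟩ := mem_inoL.1 hi
  have hE0 : 0 < pos E.top := by simpa using (List.mem_filter.1 hE).2
  have hC0 : 0 < pos C.top := by
    have : C ∈ B.left.filter fun C => 0 < pos C.top := by rw [hL]; simp
    simpa using (List.mem_filter.1 this).2
  have hp := h.pairwise_left.filter fun C => decide (0 < pos C.top)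
  rw [hL] at hE hp
  rcases List.mem_append.1 hE with hE | hE
  · have := (List.pairwise_append.1 hp).2.2 E hE C (by simp) C.top (Or.inr rfl) i hiE
    omega
  · rw [List.mem_singleton] at hE; subst hE
    rcases hiE with hiE | hiE
    · exact hiE
    · rw [hiE] at hneg; omega

/-- The interval from `i` to `C.top` contains both ends of the edge that is cut. So a banana with
nodes on the wrong side is above `y`, and the path does not end before it. -/
theorem Setting.y_lt_of_mem {U D C : Banana} {a b : ℕ} (h : Setting v pos y U D a b)
    (hC : C ∈ U.proper) (hlt : pos C.lo < pos C.top) (htop : 0 < pos C.top) {i : ℕ}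
    (hi : i ∈ C.ino) (hneg : pos i < 0) : y < v C.top := by
  have hw := h.up.lwin hC hlt
  have key : ∀ j ∈ U.ino, pos i ≤ pos j → pos j ≤ pos C.top → v j ≤ v C.top := fun j hj h1 h2 => by
    by_cases e : j = C.top
    · rw [e]
    · exact (hw.lt_top j (hw.conv i hi j hj h1 (h.up.lt_of_ne hj hw.top_mem h2 e))).le
  have ga := h.cut.gap _ (hw.sub i hi)
  have gb := h.cut.gap _ hw.top_mem
  have := h.cut.a_neg
  have := h.cut.b_pos
  exact h.cut.y_lt (key _ h.cut.a_mem (by omega) (by omega))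
    (key _ h.cut.b_mem (by omega) (by omega))

section

variable {U D A B F : Banana} {a b α : ℕ} {gs fs : List Frame} {z : ℝ} {P Q : List ℕ}
  {tl scN scF : List Banana}

theorem Inv.head_tail (I : Inv v pos y U α gs A F z P Q (B :: tl) scN scF) :
    IsPath v pos y (nxt v pos y B) tl := by
  have := I.path
  simp only [List.head?_cons] at this
  cases this; assumption

theorem Inv.move_left (I : Inv v pos y U α gs A (plugL fs B) z P Q (B :: tl) scN scF)
    {C : Banana} (hC : C ∈ B.left ++ B.right) (hneg : pos C.lo < 0) :
    Child (Function.update v α z) α C ∧ Valid (Function.update v α z) C := by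
  have hB := (I.head_mem B rfl).1
  have hCU := proper_of_child hB hC
  have hv := I.up.of_mem hB
  have hα : α ∉ C.ino := fun e => I.fresh (ino_subset (bananas_of_proper hCU) e)
  have hlQ : C.lo ∈ Q := by
    rw [← I.far_ino, ino_plugL]
    refine List.mem_append_left _ (mem_ino.2 (Or.inr ?_))
    rcases List.mem_append.1 hC with hC | hC
    · exact Or.inl ⟨C, hC, Or.inl (lo_mem_ino C)⟩
    · exact Or.inr ⟨C, hC, Or.inl (lo_mem_ino C)⟩
  refine ⟨(hv.valid.child_of_mem hC).update hα ?_ ?_, ((I.up.valid).of_mem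
    (bananas_of_proper hCU)).update hα⟩
  · intro e; exact I.fresh (by rw [e]; exact top_mem_ino hCU)
  · rw [Function.update_self]; exact I.z_lt _ hlQ hneg

/-- The nodes that move are lower than `B`, which is lower than the trail of `α`, so they go to the
bottom of this trail; they fit there by `z_lt`. All wrong-sided nodes were inside `B`, and those
that remain are carried by the topmost remaining node of its left trail, which belongs to the next
banana of the path. -/
theorem Inv.injury (h : Setting v pos y U D a b)
    (I : Inv v pos y U α gs A (plugL fs B) z P Q (B :: tl) scN scF) (hlo : 0 < pos B.lo)
    (hF : ∀ C ∈ scF, height v C.hi < height v B.hi) :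
    ∃ P' Q', Inv v pos y U α gs
      (Banana.mk α A.hi ((B.left.filter fun C => pos C.top < 0) ++ A.left) [])
      (plugL fs (Banana.mk B.lo B.hi (B.left.filter fun C => 0 < pos C.top) B.right))
      z P' Q' tl scN scF := by
  obtain ⟨hB, hpan⟩ := I.head_mem B rfl
  have hgB := h.up.of_mem hB
  have hsplit := hgB.split_left h.pos_ne
  set S := B.left.filter fun C => decide (pos C.top < 0) with hS
  set S' := B.left.filter fun C => decide (0 < pos C.top) with hS'
  have hSm : ∀ C ∈ S, C ∈ B.left ∧ pos C.top < 0 := fun C hC => by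
    simpa [hS] using hC
  have hSl : ∀ C ∈ S, C ∈ B.left ++ B.right := fun C hC => List.mem_append_left _ (hSm C hC).1
  have hSn : ∀ C ∈ S, ∀ i ∈ C.ino, pos i < 0 := fun C hC i hi => by
    have := (hgB.pos_left (hSm C hC).1).1 i hi
    have := (hSm C hC).2
    omega
  have hSU : ∀ C ∈ S, C ∈ U.proper := fun C hC => proper_of_child hB (hSl C hC)
  have hSt : ∀ C ∈ S, height v C.hi < height v B.hi := fun C hC =>
    h.up.height_child h.up_hi hB (hSl C hC)
  have hhi : ∀ C ∈ U.proper, C.hi = (C.top : WithTop ℕ) := fun C hC => h.up.valid.hi_proper hC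
  have hpw := hgB.valid.pairwise_left
  rw [hsplit] at hpw
  obtain ⟨hpw1, hpw2, hpw3⟩ := List.pairwise_append.1 hpw
  have hQ : Q = inoL S ++ (inoL S' ++ B.lo :: inoR B.right ++ tailL fs B.top) := by
    rw [← I.far_ino, ino_plugL, ino_eq]
    conv_lhs => rw [hsplit]
    rw [inoL_append]; simp
  have hsort : (plugL fs B).ino.Pairwise fun i j => pos i < pos j := by
    have := I.up.sorted
    rw [← I.append, ← I.far_ino] at this
    exact (List.pairwise_append.1 this).2.1
  have hQ' : ∀ i ∈ inoL S' ++ B.lo :: inoR B.right ++ tailL fs B.top, i ∈ Q := fun i hi => by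
    rw [hQ]; exact List.mem_append_right _ hi
  have hneg : ∀ i ∈ inoL S' ++ B.lo :: inoR B.right ++ tailL fs B.top, pos i < 0 → i ∈ inoL S' := by
    intro i hi hi0
    rw [List.append_assoc] at hi
    rcases List.mem_append.1 hi with hi | hi
    · exact hi
    exfalso
    rcases List.mem_append.1 hi with hi | hi
    · rcases List.mem_cons.1 hi with rfl | hi
      · omega
      · obtain ⟨E, hE, hiE⟩ := mem_inoR.1 hi
        have h1 := hgB.pos_right hE
        rcases hiE with hiE | rfl
        · have := h1.1 i hiE; omega
        · omega
    · rw [ino_plugL] at hsort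
      have := (List.pairwise_append.1 hsort).2.2 _ (lo_mem_ino B) i hi
      omega
  have hpath := I.head_tail
  have hnx : ∀ E, nx pos B = some E → ∃ L, S' = L ++ [E] := fun E hE => nx_eq_left hE (by omega)
  have hhead : ∀ E ∈ tl.head?, nxt v pos y B = some E := fun E hE => by
    cases tl with
    | nil => simp at hE
    | cons E' tl => simp at hE; subst hE; exact nxt_of_isPath hpath
  have hE : ∀ E ∈ tl.head?, E ∈ B.left ∧ PanL v pos y U.ino E := fun E hE =>
    (h.up.pan_nxt h.pos_ne hB hpan (hhead E hE)).1 hlo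
  have hEU : ∀ E ∈ tl.head?, E ∈ U.proper := fun E hE' =>
    proper_of_child hB (List.mem_append_left _ (hE E hE').1)
  have hEB : ∀ E ∈ tl.head?, height v E.hi < height v B.hi := fun E hE' =>
    h.up.height_child h.up_hi hB (List.mem_append_left _ (hE E hE').1)
  refine ⟨P ++ inoL S, inoL S' ++ B.lo :: inoR B.right ++ tailL fs B.top,
    I.up, I.fresh, rfl, rfl, ?_, ?_, ?_, ?_, ?_, ?_, ?_, ?_, ?_, ?_, ?_, ?_, ?_, ?_, ?_, ?_, ?_, ?_,
    I.top_mem, I.scN_sorted, I.scF_sorted, I.scN_sc, I.scF_sc, I.scN_done, I.scF_done, I.scN_lt, ?_,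
    I.rank⟩
  · rw [ino_plugR, I.P_eq, ino_mk, inoL_append]; simp [top]
  · refine I.near_valid.replaceR rfl (.mk ?_ (by simp) ?_ (by simp) ?_ (by simp)) ?_ fun _ _ => rfl
    · intro C hC
      rcases List.mem_append.1 hC with hC | hC
      · exact (I.move_left (hSl C hC) (hSn C hC _ (lo_mem_ino C))).2
      · exact I.valid_near.valid_left C hC
    · intro C hC
      rcases List.mem_append.1 hC with hC | hC
      · exact (I.move_left (hSl C hC) (hSn C hC _ (lo_mem_ino C))).1
      · rw [← I.near_lo]
        have := I.valid_near.child_left C hC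
        rwa [I.near_lo] at this ⊢
    · refine List.pairwise_append.2 ⟨?_, I.valid_near.pairwise_left, ?_⟩
      · refine hpw2.imp_of_mem fun hC hC' hlt => ?_
        rwa [I.upd _ (top_mem_ino (hSU _ hC)), I.upd _ (top_mem_ino (hSU _ hC'))]
      · intro C hC E hE
        have hEU := I.left_mem E hE
        rw [I.upd _ (top_mem_ino (hSU _ hC)), I.upd _ (top_mem_ino hEU)]
        exact (height_coe_lt (hhi _ (hSU _ hC)) (hhi _ hEU)).1
          ((hSt C hC).trans (I.head_lt B rfl E hE))
    · intro i hi hch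
      refine ⟨hch.hi_eq, by simpa [I.near_lo] using hch.lo_lt, ?_,
        fun C hC => ?_, by simp⟩
      · have := hch.lt_top
        rwa [I.near_lo] at this
      rcases List.mem_append.1 hC with hC | hC
      · rcases I.top_mem with hg | ⟨E, hEU, hE⟩
        · simp [hg, tailR, tailL] at hi
        rcases I.head_lt' B rfl with hg | hg
        · simp [hg, tailR, tailL] at hi
        have h1 := (hSt C hC).trans hg
        rw [hE] at h1
        have h2 := (height_coe_lt (hhi _ (hSU _ hC)) (hhi _ hEU)).1 h1
        have h3 : A.top = E.top := by simp [top, hE]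
        change _ < Function.update v α z A.top
        rw [I.upd _ (top_mem_ino (hSU _ hC)), h3, I.upd _ (top_mem_ino hEU)]
        exact h2
      · exact hch.left_lt C hC
  · have := I.near_hi
    cases gs <;> simpa [plugR] using this
  · rw [ino_plugL, ino_mk]; rfl
  · refine I.far_valid.replaceL rfl (.mk ?_ hgB.valid.valid_right ?_ hgB.valid.child_right hpw1
      hgB.valid.pairwise_right) ?_ fun _ _ => rfl
    · exact fun C hC => hgB.valid.valid_left C (List.mem_of_mem_filter hC)
    · exact fun C hC => hgB.valid.child_left C (List.mem_of_mem_filter hC)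
    · exact fun i _ hch => ⟨hch.hi_eq, hch.lo_lt, hch.lt_top,
        fun C hC => hch.left_lt C (List.mem_of_mem_filter hC), hch.right_lt⟩
  · have := I.far_hi
    cases fs <;> simpa [plugL] using this
  · rw [← I.append, hQ]; simp
  · intro i hi
    rcases List.mem_append.1 hi with hi | hi
    · exact I.neg i hi
    · obtain ⟨C, hC, hiC⟩ := mem_inoL.1 hi
      rcases hiC with hiC | rfl
      · exact hSn C hC i hiC
      · exact (hSm C hC).2
  · cases tl with
    | nil => exact IsPath.nil
    | cons E tl =>
      have := nxt_of_isPath hpath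
      rw [this] at hpath; exact hpath
  · exact fun E hE' => ⟨bananas_of_proper (hEU E hE'), Or.inr (Or.inl (hE E hE').2)⟩
  · exact fun E hE' => Or.inr (hE E hE').2.top_pos
  · intro E hE'
    obtain ⟨L, hL⟩ := hnx E (nxt_eq_some.1 (hhead E hE')).1
    exact ⟨fs ++ [⟨B.lo, B.hi, L, B.right⟩], by rw [plugL_append]; simp [plugL, hL]⟩
  · intro E hE' i hi hi0
    obtain ⟨L, hL⟩ := hnx E (nxt_eq_some.1 (hhead E hE')).1
    exact hgB.mem_last hL (hneg i hi hi0) hi0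
  · intro E hE' C hC
    rcases List.mem_append.1 hC with hC | hC
    · refine (height_coe_lt (hhi _ (hEU E hE')) (hhi _ (hSU C hC))).2 (hpw3 E ?_ C hC)
      obtain ⟨L, hL⟩ := hnx E (nxt_eq_some.1 (hhead E hE')).1
      rw [hL]; simp
    · exact (hEB E hE').trans (I.head_lt B rfl C hC)
  · exact fun E hE' => (I.head_lt' B rfl).imp_right (hEB E hE').trans
  -- A remaining node on the wrong side would be carried by the last trail node before the cut,
  -- which is then above `y` and would continue the path.
  · intro e i hi
    by_contra hi0
    have hi0 : pos i < 0 := by have := h.pos_ne i; omega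
    have hiS := hneg i hi hi0
    obtain ⟨C, hC, -⟩ := mem_inoL.1 hiS
    obtain ⟨E, hE⟩ : ∃ E, S'.getLast? = some E :=
      ⟨_, List.getLast?_eq_some_getLast (List.ne_nil_of_mem hC)⟩
    have hnxE : nx pos B = some E := by rw [nx, if_neg (by omega)]; exact hE
    obtain ⟨L, hL⟩ := hnx E hnxE
    have hEm := nx_left_mem hnxE (by omega)
    have := h.y_lt_of_mem (proper_of_child hB (List.mem_append_left _ hEm.1))
      ((hgB.pos_left hEm.1).1 _ (lo_mem_ino E)) hEm.2 (hgB.mem_last hL hiS hi0) hi0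
    rw [e, nxt_eq_some.2 ⟨hnxE, this⟩] at hpath
    cases hpath
  · exact fun i hi => I.z_lt i (hQ' i hi)
  · intro C hC
    rcases List.mem_append.1 hC with hC | hC
    · exact hSU C hC
    · exact I.left_mem C hC
  · intro C hC
    obtain ⟨E, hE, hlt⟩ := h.far_lt_next hB hpan (I.head_side B rfl) hlo (I.scF_sc C hC) (hF C hC)
    rw [hE] at hpath
    cases hpath
    exact ⟨E, rfl, hlt⟩

end

end Banana
end BananaTree

namespace BananaTree
namespace Banana

variable {v : ℕ → ℝ} {pos : ℕ → ℤ} {y : ℝ}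

/-! ### Fatalities -/

theorem exists_parent {T C : Banana} (hC : C ∈ T.proper) : ∃ A ∈ T.bananas, C ∈ A.left ++ A.right := by
  have := (perm_children T).symm.subset hC
  simpa only [List.mem_flatMap] using this

/-- When a banana is attached elsewhere, only the comparison of the minima has to be redone. -/
theorem Valid.child_proper {T C : Banana} (h : Valid v T) (hC : C ∈ T.proper) {a : ℕ}
    (ha : v a < v C.lo) : Child v a C := by
  obtain ⟨A, hA, hCA⟩ := exists_parent hC
  have := (h.of_mem hA).child_of_mem hCA
  exact ⟨this.hi_eq, ha, this.lt_top, this.left_lt, this.right_lt⟩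

theorem hi_plugL (fs : List Frame) {B B' : Banana} (h : B'.hi = B.hi) :
    (plugL fs B').hi = (plugL fs B).hi := by
  cases fs <;> simp [plugL, h]

theorem hi_plugR (fs : List Frame) {B B' : Banana} (h : B'.hi = B.hi) :
    (plugR fs B').hi = (plugR fs B).hi := by
  cases fs <;> simp [plugR, h]

theorem exists_min_lo (v : ℕ → ℝ) {t : List Banana} {C : Banana} (hC : C ∈ t) :
    ∃ E ∈ t, ∀ E' ∈ t, v E.lo ≤ v E'.lo := by
  classical
  obtain ⟨E, hE, hmin⟩ := t.toFinset.exists_min_image (fun E => v E.lo) ⟨C, by simpa using hC⟩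
  exact ⟨E, by simpa using hE, fun E' hE' => hmin E' (by simpa using hE')⟩

section

variable {U D A B F : Banana} {a b α : ℕ} {gs fs : List Frame} {z δ : ℝ} {P Q : List ℕ}
  {cs tl scN scF : List Banana}

/-- Between `C.top` and the cut there are only the lower bananas on the trail of `α` and the
wrong-sided nodes of the far tree. If none of these violates the bounds given by `C`, the cut is in
its out-panel. -/
theorem Inv.sc_left (I : Inv v pos y U α gs A F z P Q cs scN scF)
    (hd : ∀ i ∈ U.ino, ∀ j ∈ U.ino, v i = v j → i = j) {C : Banana} (hC : C ∈ A.left)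
    (hy : v C.lo < y)
    (hb : ∀ E ∈ A.left, v E.top < v C.top → (∀ i, i ∈ E.ino ∨ i = E.top → pos C.top < pos i) →
      v C.lo ≤ v E.lo ∨ ∀ i, i ∈ E.ino ∨ i = E.top → v C.lo < v i)
    (hQ : ∀ i ∈ Q, pos i < 0 → v C.lo < v i ∧ v i < v C.top) : Sc v pos y U C := by
  have hCU := I.left_mem C hC
  obtain ⟨h1, h2⟩ := sorted_inoL I.sorted_near
  refine ⟨hCU, (h1 C hC).2 _ (lo_mem_ino C), I.neg _ (I.left_top_mem hC).1, fun i hi hlt hi0 => ?_,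
    hy⟩
  have hCl := ino_subset (bananas_of_proper hCU) (lo_mem_ino C)
  rw [← I.append] at hi
  rcases List.mem_append.1 hi with hiP | hiQ
  · have hiP' := hiP
    rw [I.P_eq] at hiP'
    rcases List.mem_append.1 hiP' with hiP' | hiP'
    · exfalso
      have := I.sorted_P
      rw [I.P_eq] at this
      have := (List.pairwise_append.1 this).2.2 i hiP' C.top (mem_inoL.2 ⟨C, hC, Or.inr rfl⟩)
      omega
    obtain ⟨E, hE, hiE⟩ := mem_inoL.1 hiP'
    have hEU := I.left_mem E hE
    have hEv := I.up.valid.of_mem (bananas_of_proper hEU)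
    have hne : E ≠ C := by
      rintro rfl
      rcases hiE with hiE | rfl
      · have := (h1 E hE).2 i hiE; omega
      · omega
    have hord : v E.top < v C.top ∧ ∀ i, i ∈ E.ino ∨ i = E.top → pos C.top < pos i := by
      obtain ⟨l₁, l₂, e⟩ := List.append_of_mem hC
      have hpw := I.valid_near.pairwise_left
      rw [e] at hE h2 hpw
      rcases List.mem_append.1 hE with hE | hE
      · have := (List.pairwise_append.1 hpw).2.2 E hE C (by simp)
        rw [I.upd _ (top_mem_ino hEU), I.upd _ (top_mem_ino hCU)] at this
        exact ⟨this, fun i hi =>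
          (List.pairwise_append.1 h2).2.2 E hE C (by simp) C.top (Or.inr rfl) i hi⟩
      · exfalso
        rcases List.mem_cons.1 hE with hE | hE
        · exact hne hE
        · have := (List.pairwise_cons.1 (List.pairwise_append.1 h2).2.1).1 E hE i hiE C.top
            (Or.inr rfl)
          omega
    obtain ⟨E', hE', hEE'⟩ := exists_parent hEU
    have hch := (I.up.valid.of_mem hE').child_of_mem hEE'
    have hle : v i ≤ v E.top := by
      rcases hiE with hiE | rfl
      · exact (hch.lt_of_mem hEv hiE).le
      · exact le_rfl
    have hge : v E.lo ≤ v i := by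
      rcases hiE with hiE | rfl
      · exact hEv.lo_le hiE
      · exact hch.lt_top.le
    refine ⟨?_, by linarith [hord.1]⟩
    rcases hb E hE hord.1 hord.2 with h3 | h3
    · refine lt_of_le_of_ne (h3.trans hge) fun e => ?_
      have := hd _ hCl _ (I.mem_P hiP) e
      have h4 := (h1 C hC).2 _ (lo_mem_ino C)
      rw [this] at h4; omega
    · exact h3 i hiE
  · exact hQ i hiQ hi0

/-- The bananas on the trail of `α` have larger minima than the banana of a fatality. -/
theorem Inv.lo_lt_left (h : Setting v pos y U D a b)
    (I : Inv v pos y U α gs A F z P Q (B :: tl) scN scF)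
    (hN : ∀ C ∈ scN, height v C.hi < height v B.hi) {C : Banana} (hC : C ∈ A.left) :
    v B.lo < v C.lo := by
  obtain ⟨hB, hpan⟩ := I.head_mem B rfl
  -- It is enough to treat the least minimum on the trail. If it were below `B.lo`, then `E` would
  -- be a window with the cut in its out-panel and higher than `B`. By `hN` it is not waiting, so
  -- `α` has passed its minimum, which contradicts the validity of the trail.
  obtain ⟨E, hE, hmin⟩ := exists_min_lo v hC
  refine lt_of_lt_of_le ?_ (hmin C hC)
  have hEU := I.left_mem E hE
  have hEl := (I.left_top_mem hE).2 _ (lo_mem_ino E)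
  obtain ⟨fs, hfs⟩ := I.head_far B rfl
  have hBl : B.lo ∈ Q := by
    rw [← I.far_ino, hfs]
    exact ino_subset (mem_bananas_plugL fs B) (lo_mem_ino B)
  by_contra hlt
  have hlt : v E.lo < v B.lo := by
    refine lt_of_le_of_ne (not_lt.1 hlt) fun e => ?_
    have := h.inj _ (I.mem_P hEl) _ (I.mem_Q hBl) e
    have h2 := I.lt_of_mem hEl hBl
    rw [this] at h2; exact lt_irrefl _ h2
  have hBE := I.head_lt B rfl E hE
  have hEhi := h.up.valid.hi_proper hEU
  have hBp : B ∈ U.proper := by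
    rcases mem_proper hB with e | e
    · rw [e, h.up_hi] at hBE
      exact absurd hBE (by simp [height])
    · exact e
  have hBt := (height_coe_lt (h.up.valid.hi_proper hBp) hEhi).1 hBE
  have hsc := I.sc_left h.inj hE (hlt.trans (h.up.lo_lt_y h.cut hB hpan))
    (fun E' hE' _ _ => Or.inl (hmin E' hE')) fun i hi hi0 => by
      have hiB := I.head_ino B rfl i hi hi0
      have hvB := h.up.valid.of_mem hB
      obtain ⟨E', hE', hEE'⟩ := exists_parent hBp
      have hch := (h.up.valid.of_mem hE').child_of_mem hEE'
      have := hvB.lo_le hiB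
      have := hch.lt_of_mem hvB hiB
      constructor <;> linarith
  rcases I.scN_done E hsc with h3 | h3
  · exact lt_asymm (hN E h3) hBE
  · exact lt_asymm h3 (I.z_lt_left hE)

/-- The trees exchange roles, whence the mirrored conclusion. `B.lo` takes over the trails of `α` by
`Inv.lo_lt_left`. In the other tree `α` is put just below `B.lo`, and since values of nodes differ
by more than `δ`, it compares with all of them as `B.lo` did. -/
theorem Inv.fatality (h : Setting v pos y U D a b)
    (I : Inv v pos y U α gs A (plugL fs B) z P Q (B :: tl) scN scF) (hlo : pos B.lo < 0)
    (hN : ∀ C ∈ scN, height v C.hi < height v B.hi) (hδ : 0 < δ)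
    (hgap : ∀ i ∈ U.ino, ∀ j ∈ U.ino, v i < v j → v i + δ < v j) :
    ∃ P' Q', Inv v (-pos) y U.mirror α (fs.map Frame.mirror)
      (Banana.mk α B.hi ((B.right.filter fun C => 0 < pos C.top).map Banana.mirror) [])
      (plugR gs (Banana.mk B.lo A.hi (B.left ++ A.left)
        (B.right.filter fun C => pos C.top < 0))).mirror
      (v B.lo - δ) P' Q' (tl.map Banana.mirror) scF scN := by
  obtain ⟨hB, hpan⟩ := I.head_mem B rfl
  have hgB := h.up.of_mem hB
  have hsplit := hgB.split_right h.pos_ne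
  set S := B.right.filter fun C => decide (pos C.top < 0) with hS
  set S' := B.right.filter fun C => decide (0 < pos C.top) with hS'
  have hSl : ∀ C ∈ S, C ∈ B.right := fun C hC => List.mem_of_mem_filter hC
  have hSl' : ∀ C ∈ S', C ∈ B.right ∧ 0 < pos C.top := fun C hC => by simpa [hS'] using hC
  have hrU : ∀ C ∈ B.left ++ B.right, C ∈ U.proper := fun C hC => proper_of_child hB hC
  have hhi : ∀ C ∈ U.proper, C.hi = (C.top : WithTop ℕ) := fun C hC => h.up.valid.hi_proper hC
  have hpw := hgB.valid.pairwise_right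
  rw [hsplit] at hpw
  obtain ⟨hpw1, hpw2, hpw3⟩ := List.pairwise_append.1 hpw
  have hBU : B.lo ∈ U.ino := ino_subset hB (lo_mem_ino B)
  have hQ : Q = inoL B.left ++ B.lo :: inoR S ++ (inoR S' ++ tailL fs B.top) := by
    rw [← I.far_ino, ino_plugL, ino_eq]
    conv_lhs => rw [hsplit]
    rw [inoR_append]; simp
  have hsort : (plugL fs B).ino.Pairwise fun i j => pos i < pos j := by
    have := I.up.sorted
    rw [← I.append, ← I.far_ino] at this
    exact (List.pairwise_append.1 this).2.1
  have htU : ∀ i ∈ tailL fs B.top, i ∈ U.ino := fun i hi => I.mem_Q (by rw [hQ]; simp [hi])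
  have hzB : z < v B.lo := I.z_lt _ (by rw [hQ]; simp) hlo
  have hBfs : fs = [] ∨ B ∈ U.proper := by
    cases fs with
    | nil => exact Or.inl rfl
    | cons f fs =>
      right
      have h1 := I.far_valid.hi_proper (proper_plugL (f := f) (fs := fs) (B := B))
      rcases mem_proper hB with e | e
      · rw [e, h.up_hi] at h1; exact absurd h1 (by simp)
      · exact e
  have hBtop : B ∈ U.proper → v B.lo < v B.top := fun hBp => by
    obtain ⟨E', hE', hEE'⟩ := exists_parent hBp
    exact ((h.up.valid.of_mem hE').child_of_mem hEE').lt_top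
  have hpath := I.head_tail
  have hnx : ∀ E, nx pos B = some E → ∃ L, S = L ++ [E] := fun E hE => nx_eq_right hE hlo
  have hhead : ∀ E ∈ (tl.map Banana.mirror).head?, nxt v pos y B = some E.mirror := fun E hE => by
    cases tl with
    | nil => simp at hE
    | cons E' tl => simp at hE; subst hE; simpa using nxt_of_isPath hpath
  have hE : ∀ E ∈ (tl.map Banana.mirror).head?, E.mirror ∈ B.right ∧ PanL v (-pos) y U.ino E.mirror :=
    fun E hE => (h.up.pan_nxt h.pos_ne hB hpan (hhead E hE)).2 hlo
  have hEr : ∀ E ∈ (tl.map Banana.mirror).head?, E.mirror ∈ B.left ++ B.right := fun E hE' =>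
    List.mem_append_right _ (hE E hE').1
  have hEB : ∀ E ∈ (tl.map Banana.mirror).head?, height v E.hi < height v B.hi := fun E hE' => by
    simpa using h.up.height_child h.up_hi hB (hEr E hE')
  have hneg : ∀ i ∈ (P ++ (inoL B.left ++ B.lo :: inoR S)).reverse, 0 < pos i → i ∈ inoR S := by
    intro i hi hi0
    rw [List.mem_reverse] at hi
    rcases List.mem_append.1 hi with hi | hi
    · have := I.neg i hi; omega
    rcases List.mem_append.1 hi with hi | hi
    · obtain ⟨C, hC, hiC⟩ := mem_inoL.1 hi
      have h1 := hgB.pos_left hC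
      rcases hiC with hiC | rfl
      · have := h1.1 i hiC; omega
      · omega
    · rcases List.mem_cons.1 hi with rfl | hi
      · omega
      · exact hi
  -- Mirror image of `Good.mem_last`: of the right trail nodes left of the cut, only the last
  -- carries nodes right of it.
  have hmem_last : ∀ E L, S = L ++ [E] → ∀ i ∈ inoR S, 0 < pos i → i ∈ E.ino := by
    intro E L hL i hi hi0
    have := hgB.mirror.mem_last (C := E.mirror) (L := L.map Banana.mirror) (i := i) ?_ ?_ (by simpa)
    · simpa using this
    · simpa [List.filter_map, Function.comp_def, ← hS] using congrArg (List.map Banana.mirror) hL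
    · simpa [List.filter_map, Function.comp_def, ← hS, inoL_map_mirror] using hi
  have hSB : ∀ i ∈ inoR S, v B.lo ≤ v i := fun i hi => by
    refine hgB.valid.lo_le ?_
    rw [ino_eq, hsplit, inoR_append]; simp [hi]
  -- Now `α` is the leftmost leaf of the right tree; mirroring makes it the last leaf, as the
  -- invariant requires.
  have hmir : Banana.mk α B.hi (S'.map Banana.mirror) [] = (Banana.mk α B.hi [] S').mirror := by
    rw [mirror_mk]; rfl
  refine ⟨(inoR S' ++ tailL fs B.top).reverse, (P ++ (inoL B.left ++ B.lo :: inoR S)).reverse,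
    h.up.mirror, by simpa using I.fresh, rfl, rfl, ?_, ?_, ?_, ?_, ?_, ?_, ?_, ?_, ?_, ?_, ?_, ?_, ?_,
    ?_, ?_, ?_, ?_, ?_, ?_, I.scF_sorted, I.scN_sorted, I.scF_sc, by simpa using I.scN_sc,
    ?_, ?_, ?_, ?_, ?_⟩
  · rw [hmir, ← mirror_plugL, ino_mirror, ino_plugL, ino_mk]; simp [top]
  · rw [hmir, ← mirror_plugL]
    refine (I.far_valid.replaceL (B' := Banana.mk α B.hi [] S') rfl (.mk (by simp) ?_ (by simp) ?_ (by simp) ?_) ?_ ?_).mirror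
    · exact fun C hC => (hgB.valid.valid_right C (hSl' C hC).1).update fun e => I.fresh
        (ino_subset (bananas_of_proper (hrU C (List.mem_append_right _ (hSl' C hC).1))) e)
    · intro C hC
      have hCU := hrU C (List.mem_append_right _ (hSl' C hC).1)
      have hch := hgB.valid.child_right C (hSl' C hC).1
      refine hch.update (fun e => I.fresh (ino_subset (bananas_of_proper hCU) e)) (fun e => I.fresh
        (by rw [e]; exact top_mem_ino hCU)) ?_
      rw [Function.update_self]; linarith [hch.lo_lt]
    · refine hpw2.imp_of_mem fun hC hC' hlt => ?_
      rwa [I.upd _ (top_mem_ino (hrU _ (List.mem_append_right _ (hSl' _ hC).1))),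
        I.upd _ (top_mem_ino (hrU _ (List.mem_append_right _ (hSl' _ hC').1)))]
    · intro i hi hch
      have hBp : B ∈ U.proper := hBfs.resolve_left fun e => by simp [e, tailL] at hi
      have hT : Function.update v α (v B.lo - δ) B.top = v B.top := I.upd _ (top_mem_ino hBp)
      refine ⟨hch.hi_eq, ?_, ?_, by simp, fun C hC => ?_⟩
      · rw [I.upd _ (htU i hi), lo_mk, Function.update_self]
        linarith [hgap i (htU i hi) _ hBU hch.lo_lt]
      · change Function.update v α (v B.lo - δ) α < Function.update v α (v B.lo - δ) B.top
        rw [hT, Function.update_self]; linarith [hch.lt_top]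
      · change _ < Function.update v α (v B.lo - δ) B.top
        rw [hT, I.upd _ (top_mem_ino (hrU _ (List.mem_append_right _ (hSl' _ hC).1)))]
        exact hch.right_lt C (hSl' C hC).1
    · exact fun i hi => I.upd _ (htU i hi)
  · rw [hmir, ← mirror_plugL, hi_mirror, ← I.far_hi]
    exact hi_plugL _ rfl
  · rw [ino_mirror, ino_plugR, ino_mk, I.P_eq, inoL_append]; simp [top]
  · have hcross : ∀ C ∈ B.left ++ B.right, ∀ E ∈ U.proper, height v B.hi < height v E.hi →
        v C.top < v E.top := fun C hC E hE hlt =>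
      (height_coe_lt (hhi _ (hrU _ hC)) (hhi _ hE)).1
        ((h.up.height_child h.up_hi hB hC).trans hlt)
    refine (I.near_valid.replaceR (B' := Banana.mk B.lo A.hi (B.left ++ A.left) S) rfl
      (.mk ?_ ?_ ?_ ?_ ?_ hpw1) ?_ ?_).mirror
    · intro C hC
      rcases List.mem_append.1 hC with hC | hC
      · exact hgB.valid.valid_left C hC
      · exact h.up.valid.of_mem (bananas_of_proper (I.left_mem C hC))
    · exact fun C hC => hgB.valid.valid_right C (hSl C hC)
    · intro C hC
      rcases List.mem_append.1 hC with hC | hC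
      · exact hgB.valid.child_left C hC
      · exact h.up.valid.child_proper (I.left_mem C hC) (I.lo_lt_left h hN hC)
    · exact fun C hC => hgB.valid.child_right C (hSl C hC)
    · refine List.pairwise_append.2 ⟨hgB.valid.pairwise_left, ?_, ?_⟩
      · refine I.valid_near.pairwise_left.imp_of_mem fun hC hC' hlt => ?_
        rwa [I.upd _ (top_mem_ino (I.left_mem _ hC)), I.upd _ (top_mem_ino (I.left_mem _ hC'))] at hlt
      · exact fun C hC E hE => hcross C (List.mem_append_left _ hC) E (I.left_mem E hE)
          (I.head_lt B rfl E hE)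
    · intro i hi hch
      have hgs : gs ≠ [] := by rintro rfl; simp [tailR, tailL] at hi
      obtain ⟨E, hEU, hE⟩ := I.top_mem.resolve_left hgs
      have hBA := (I.head_lt' B rfl).resolve_left hgs
      rw [hE] at hBA
      have hAE : A.top = E.top := by simp [top, hE]
      have hBp : B ∈ U.proper := by
        rcases mem_proper hB with e | e
        · rw [e, h.up_hi, hhi E hEU] at hBA
          exact absurd hBA (by simp [height])
        · exact e
      have hBE := (height_coe_lt (hhi _ hBp) (hhi _ hEU)).1 hBA
      have hiU : i ∈ U.ino := I.mem_P (by rw [I.P_eq]; exact List.mem_append_left _ hi)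
      have h1 := hch.lo_lt
      rw [I.near_lo, Function.update_self, I.upd _ hiU] at h1
      refine ⟨hch.hi_eq, h1.trans hzB, ?_, fun C hC => ?_, fun C hC => ?_⟩
      · change _ < v A.top
        rw [hAE]; exact (hBtop hBp).trans hBE
      · change _ < v A.top
        rcases List.mem_append.1 hC with hC | hC
        · rw [hAE]; exact hcross C (List.mem_append_left _ hC) E hEU hBA
        · have := hch.left_lt C hC
          rw [hAE] at this ⊢
          rwa [I.upd _ (top_mem_ino (I.left_mem _ hC)), I.upd _ (top_mem_ino hEU)] at this
      · change _ < v A.top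
        rw [hAE]; exact hcross C (List.mem_append_right _ (hSl C hC)) E hEU hBA
    · exact fun i hi => (I.upd _ (I.mem_P (by rw [I.P_eq]; exact List.mem_append_left _ hi))).symm
  · rw [hi_mirror, ← I.near_hi]; exact hi_plugR _ rfl
  · rw [← List.reverse_append, ino_mirror, ← I.append, hQ]; simp
  · intro i hi
    simp only [Pi.neg_apply, Left.neg_neg_iff]
    rw [List.mem_reverse] at hi
    rcases List.mem_append.1 hi with hi | hi
    · obtain ⟨C, hC, hiC⟩ := mem_inoR.1 hi
      rcases hiC with hiC | rfl
      · have := (hgB.pos_right (hSl' C hC).1).1 i hiC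
        have := (hSl' C hC).2
        omega
      · exact (hSl' C hC).2
    · have hfs : fs ≠ [] := by rintro rfl; simp [tailL] at hi
      have hBp := hBfs.resolve_left hfs
      have h0 : 0 < pos B.top := (I.head_side B rfl).resolve_left fun e => by
        rw [hhi B hBp] at e; exact absurd e (by simp)
      obtain ⟨f, fs, rfl⟩ := List.exists_cons_of_ne_nil hfs
      obtain ⟨t, ht⟩ := tailL_cons f fs B.top
      rw [ino_plugL, ht] at hsort
      rw [ht] at hi
      rcases List.mem_cons.1 hi with rfl | hi
      · exact h0
      · have := (List.pairwise_cons.1 (List.pairwise_append.1 hsort).2.1).1 i hi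
        omega
  · have := hpath.mirror h.pos_ne
    rw [← nxt_mirror (h.pos_ne _)] at this
    revert this
    cases tl with
    | nil => intro; exact IsPath.nil
    | cons E tl => intro h2; have := nxt_of_isPath h2; rw [this] at h2; simpa using h2
  · intro E hE'
    refine ⟨mem_bananas_mirror.2 (bananas_of_proper (hrU _ (hEr E hE'))), ?_⟩
    have : Pan v pos y U E.mirror := Or.inr (Or.inr (hE E hE').2)
    simpa using this.mirror
  · exact fun E hE' => Or.inr (by simpa using (hE E hE').2.top_pos)
  · intro E hE'
    obtain ⟨L, hL⟩ := hnx _ (nxt_eq_some.1 (hhead E hE')).1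
    refine ⟨(gs ++ [(⟨B.lo, A.hi, L, B.left ++ A.left⟩ : Frame)]).map Frame.mirror, ?_⟩
    rw [← mirror_mirror E, ← mirror_plugR, plugR_append, hL]; simp [plugR]
  · intro E hE' i hi hi0
    obtain ⟨L, hL⟩ := hnx _ (nxt_eq_some.1 (hhead E hE')).1
    have hi0 : 0 < pos i := by simpa using hi0
    simpa using hmem_last _ L hL i (hneg i hi hi0) hi0
  · intro E hE' C hC
    obtain ⟨C, hCS, rfl⟩ := List.mem_map.1 hC
    have := (height_coe_lt (hhi _ (hrU _ (hEr E hE')))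
      (hhi C (hrU _ (List.mem_append_right _ (hSl' C hCS).1)))).2 (hpw3 E.mirror ?_ C hCS)
    · simpa using this
    · obtain ⟨L, hL⟩ := hnx _ (nxt_eq_some.1 (hhead E hE')).1
      rw [hL]; simp
  · exact fun E hE' => Or.inr (hEB E hE')
  · intro e i hi
    by_contra hi0
    have hi0 : 0 < pos i := by
      have := h.pos_ne i; simp only [Pi.neg_apply] at hi0; omega
    have hiS := hneg i hi hi0
    obtain ⟨C, hC, -⟩ := mem_inoR.1 hiS
    obtain ⟨E, hE⟩ : ∃ E, S.getLast? = some E :=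
      ⟨_, List.getLast?_eq_some_getLast (List.ne_nil_of_mem hC)⟩
    have hnxE : nx pos B = some E := by rw [nx, if_pos hlo]; exact hE
    obtain ⟨L, hL⟩ := hnx E hnxE
    have hEm := nx_right_mem hnxE hlo
    have := h.mirror.y_lt_of_mem (C := E.mirror) (mirror_proper h.up.nodup
      (hrU _ (List.mem_append_right _ hEm.1)))
      (by simpa using (hgB.pos_right hEm.1).1 _ (lo_mem_ino E)) (by simpa using hEm.2)
      (i := i) (by simpa using hmem_last E L hL i hiS hi0) (by simpa using hi0)
    rw [List.map_eq_nil_iff.1 e, nxt_eq_some.2 ⟨hnxE, by simpa using this⟩] at hpath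
    cases hpath
  · intro i hi hi0
    have := hSB i (hneg i hi (by simpa using hi0))
    linarith
  · intro C hC
    obtain ⟨C, hCS, rfl⟩ := List.mem_map.1 hC
    exact mirror_proper h.up.nodup (hrU _ (List.mem_append_right _ (hSl' C hCS).1))
  · rcases hBfs with rfl | hBp
    · exact Or.inl rfl
    · exact Or.inr ⟨B.mirror, mirror_proper h.up.nodup hBp, by simp⟩
  · intro C hC
    -- A minimum below the old `α` is below `B.lo`, hence by the gap also below the new value of
    -- `α`.
    refine (I.scF_done C hC).imp_right fun hlt => ?_
    have hCU : C.lo ∈ U.ino := by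
      simpa using ino_subset (bananas_of_proper hC.mem) (lo_mem_ino C)
    linarith [hgap _ hCU _ hBU (hlt.trans hzB)]
  · intro C hC
    rw [neg_neg, mirror_mirror] at hC
    refine (I.scN_done C hC).imp_right fun hlt => ?_
    linarith [hgap _ (ino_subset (bananas_of_proper hC.mem) (lo_mem_ino C)) _ hBU (hlt.trans hzB)]
  · right
    intro C hC
    obtain ⟨B', hB', hlt⟩ := I.scF_lt C hC
    simp only [List.head?_cons, Option.mem_some_iff] at hB'
    subst hB'; exact hlt
  · intro C hC
    obtain ⟨E, hE, hlt⟩ := h.near_lt_next hB hpan (I.head_side B rfl) hlo (I.scN_sc C hC) (hN C hC)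
    rw [hE] at hpath
    cases hpath
    exact ⟨E.mirror, by simp, by simpa using hlt⟩
  · intro i hi hlt
    linarith [h.up.lo_lt_y h.cut hB hpan]

end

end Banana
end BananaTree

namespace BananaTree
namespace Banana

variable {v : ℕ → ℝ} {pos : ℕ → ℤ} {y : ℝ}

/-! ### Interchanges of minima -/

theorem tailR_cons (f : Frame) (fs : List Frame) (q : ℕ) : ∃ t, tailR (f :: fs) q = t ++ [q] := by
  obtain ⟨t, ht⟩ := tailL_cons f.mirror (fs.map Frame.mirror) q
  exact ⟨t.reverse, by rw [tailR, List.map_cons, ht, List.reverse_cons]⟩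

section

variable {A C : Banana} {α : ℕ} {gs : List Frame} {lower upper : List Banana}

/-- Before and after, the order is: context, upper part of the trail, nodes of `C`, its upper end,
lower part, `α`. -/
theorem ino_interchange (hα : A.lo = α) (hr : A.right = []) (hl : A.left = lower ++ C :: upper) :
    (plugR (gs ++ [⟨C.lo, A.hi, C.right, C.left ++ upper⟩]) (mk α C.hi lower [])).ino =
      (plugR gs A).ino := by
  rw [plugR_append, ino_plugR gs, ino_plugR gs, ino_eq A, hr, hl, hα]
  simp only [plugR, ino_mk, top_mk, inoL_append, inoL_cons, inoR_append, inoR_cons, inoR_nil]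
  rw [ino_eq C]
  simp [top]

/-- After the interchange `C.lo` carries the upper part of the trail, and `α` the lower part up to
`C.top`. It needs the new value of `α` strictly between the ends of `C`, below the minima of the
lower part, and the minima of the upper part above `C.lo`. -/
theorem Valid.interchange {w w' : ℕ → ℝ} (hw : ∀ i, i ≠ α → w' i = w i)
    (h : Valid w (plugR gs A)) (hn : (plugR gs A).ino.Nodup) (hα : A.lo = α) (hr : A.right = [])
    (hl : A.left = lower ++ C :: upper) (h1 : w C.lo < w' α) (h2 : w' α < w C.top)
    (hlow : ∀ E ∈ lower, w' α < w E.lo) (hupp : ∀ E ∈ upper, w C.lo < w E.lo) :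
    Valid w' (plugR (gs ++ [⟨C.lo, A.hi, C.right, C.left ++ upper⟩])
      (Banana.mk α C.hi lower [])) := by
  have hA : Valid w A := h.of_mem (mem_bananas_plugR gs A)
  rw [ino_plugR, ino_eq, hr, hα, inoR_nil, ← List.append_assoc, List.nodup_append] at hn
  have hnα : ∀ i, i ∈ tailR gs A.top ∨ i ∈ inoL A.left → w' i = w i := fun i hi => hw i fun e =>
    hn.2.2 i (List.mem_append.2 hi) α (by simp) e
  have hin : ∀ E ∈ A.left, ∀ i, i ∈ E.ino ∨ i = E.top → w' i = w i := fun E hE i hi =>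
    hnα i (Or.inr (mem_inoL.2 ⟨E, hE, hi⟩))
  have hCA : C ∈ A.left := by rw [hl]; simp
  have hlA : ∀ E ∈ lower, E ∈ A.left := fun E hE => by rw [hl]; simp [hE]
  have huA : ∀ E ∈ upper, E ∈ A.left := fun E hE => by rw [hl]; simp [hE]
  have hval : ∀ E ∈ A.left, Valid w' E := fun E hE =>
    (hA.valid_left E hE).congr fun i hi => hin E hE i (Or.inl hi)
  have hchild : ∀ E ∈ A.left, ∀ i, w' i < w E.lo → Child w' i E := fun E hE i hi => by
    have := hA.child_left E hE
    have ht := hin E hE _ (Or.inr rfl)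
    have hm : ∀ j ∈ E.ino, w' j = w j := fun j hj => hin E hE j (Or.inl hj)
    refine ⟨this.hi_eq, by rwa [hm _ (lo_mem_ino E)], by rw [ht, hm _ (lo_mem_ino E)]; exact this.lt_top,
      fun D hD => ?_, fun D hD => ?_⟩
    · rw [ht, hm _ (mem_ino.2 (Or.inr (Or.inl ⟨D, hD, Or.inr rfl⟩)))]; exact this.left_lt D hD
    · rw [ht, hm _ (mem_ino.2 (Or.inr (Or.inr ⟨D, hD, Or.inr rfl⟩)))]; exact this.right_lt D hD
  have hch := hA.child_left C hCA
  have hCv := hval C hCA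
  have hClo : w' C.lo = w C.lo := hin C hCA _ (Or.inl (lo_mem_ino C))
  have hCt : w' C.top = w C.top := hin C hCA _ (Or.inr rfl)
  have hpw : A.left.Pairwise fun E E' => w' E.top < w' E'.top :=
    hA.pairwise_left.imp_of_mem fun {E E'} hE hE' hlt => by
      rwa [hin E hE _ (Or.inr rfl), hin E' hE' _ (Or.inr rfl)]
  rw [hl] at hpw
  obtain ⟨p1, p2, p3⟩ := List.pairwise_append.1 hpw
  obtain ⟨p4, p5⟩ := List.pairwise_cons.1 p2
  have hlt : ∀ E, E ∈ C.left ∨ E ∈ C.right → w' E.top < w' C.top := fun E hE => by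
    rcases hE with hE | hE
    · rw [hCt, hin C hCA E.top (Or.inl (mem_ino.2 (Or.inr (Or.inl ⟨E, hE, Or.inr rfl⟩))))]
      exact hch.left_lt E hE
    · rw [hCt, hin C hCA E.top (Or.inl (mem_ino.2 (Or.inr (Or.inr ⟨E, hE, Or.inr rfl⟩))))]
      exact hch.right_lt E hE
  have hα' : Child w' C.lo (Banana.mk α C.hi lower []) := by
    refine ⟨hch.hi_eq, by rwa [hClo], ?_, fun E hE => p3 E hE C (by simp), by simp⟩
    change w' α < w' C.top
    rwa [hCt]
  rw [plugR_append]
  refine h.replaceR (B' := Banana.mk C.lo A.hi (C.left ++ upper)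
    (C.right ++ [Banana.mk α C.hi lower []])) rfl (.mk ?_ ?_ ?_ ?_ ?_ ?_) ?_
    fun i hi => hnα i (Or.inl hi)
  · intro E hE
    rcases List.mem_append.1 hE with hE | hE
    · exact hCv.valid_left E hE
    · exact hval E (huA E hE)
  · intro E hE
    rcases List.mem_append.1 hE with hE | hE
    · exact hCv.valid_right E hE
    · rw [List.mem_singleton.1 hE]
      exact .mk (fun E hE => hval E (hlA E hE)) (by simp)
        (fun E hE => hchild E (hlA E hE) α (hlow E hE)) (by simp) p1 (by simp)
  · intro E hE
    rcases List.mem_append.1 hE with hE | hE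
    · exact hCv.child_left E hE
    · exact hchild E (huA E hE) _ (by rw [hClo]; exact hupp E hE)
  · intro E hE
    rcases List.mem_append.1 hE with hE | hE
    · exact hCv.child_right E hE
    · rw [List.mem_singleton.1 hE]; exact hα'
  · exact List.pairwise_append.2 ⟨hCv.pairwise_left, p5, fun E hE E' hE' =>
      (hlt E (Or.inl hE)).trans (p4 E' hE')⟩
  · refine List.pairwise_append.2 ⟨hCv.pairwise_right, by simp, fun E hE E' hE' => ?_⟩
    rw [List.mem_singleton.1 hE']
    exact hlt E (Or.inr hE)
  · intro i hi hchA
    have hgs : gs ≠ [] := by rintro rfl; simp [tailR, tailL] at hi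
    obtain ⟨f, fs, rfl⟩ := List.exists_cons_of_ne_nil hgs
    have hAt : w' A.top = w A.top := hnα _ (Or.inl (by
      obtain ⟨t, ht⟩ := tailR_cons f fs A.top
      rw [ht]; simp))
    have hCA' : w' C.top < w' A.top := by rw [hCt, hAt]; exact hchA.left_lt C hCA
    refine ⟨hchA.hi_eq, ?_, ?_, fun E hE => ?_, fun E hE => ?_⟩
    · rw [hnα i (Or.inl hi), lo_mk, hClo]; exact hchA.lo_lt.trans hch.lo_lt
    · change w' C.lo < w' A.top
      rw [hClo]; exact (hch.lt_top.trans_eq hCt.symm).trans hCA'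
    · change _ < w' A.top
      rcases List.mem_append.1 hE with hE | hE
      · exact (hlt E (Or.inl hE)).trans hCA'
      · rw [hAt, hin E (huA E hE) _ (Or.inr rfl)]
        exact hchA.left_lt E (huA E hE)
    · change _ < w' A.top
      rcases List.mem_append.1 hE with hE | hE
      · exact (hlt E (Or.inr hE)).trans hCA'
      · rw [List.mem_singleton.1 hE]; exact hCA'

end

section

variable {U D A C F : Banana} {a b α : ℕ} {gs : List Frame} {z δ : ℝ} {P Q : List ℕ}
  {cs scN scF : List Banana}

theorem Inv.near_nodup (I : Inv v pos y U α gs A F z P Q cs scN scF) :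
    (plugR gs A).ino.Nodup := by
  rw [I.near_ino]
  exact List.nodup_append.2 ⟨nodup_of_sorted I.sorted_P, by simp, fun i hi j hj e => I.fresh (by
    rw [List.mem_singleton.1 hj] at e; rw [← e]; exact I.mem_P hi)⟩

/-- The first waiting window is on the trail of `α`, provided that it is higher than the next banana
of the path. In the far tree its top would be interior to that banana. In the context it would have
`A.top` in its out-panel, which is higher, and inside a banana on the trail the same holds for the
upper end of that banana. -/
theorem Inv.scare_mem (h : Setting v pos y U D a b)
    (I : Inv v pos y U α gs A F z P Q cs (C :: scN) scF)
    (hcs : ∀ B ∈ cs.head?, height v B.hi < height v C.hi) : C ∈ A.left := by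
  have hC := I.scN_sc C (by simp)
  have hCt := top_mem_ino hC.mem
  have hCh := h.up.valid.hi_proper hC.mem
  have hCt' := hCt
  have hin : ∀ B ∈ U.proper, C.top ∈ B.ino → v C.top < v B.top := fun B hBp hCB => by
    obtain ⟨E, hE, hEB⟩ := exists_parent hBp
    exact ((h.up.valid.of_mem hE).child_of_mem hEB).lt_of_mem
      (h.up.valid.of_mem (bananas_of_proper hBp)) hCB
  rw [← I.append] at hCt'
  rcases List.mem_append.1 hCt' with hP | hQ
  · rw [I.P_eq] at hP
    rcases List.mem_append.1 hP with hP | hP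
    · exfalso
      have hgs : gs ≠ [] := by rintro rfl; simp [tailR, tailL] at hP
      have hlt := (I.scN_lt.resolve_left hgs) C (by simp)
      obtain ⟨E, hEU, hE⟩ := I.top_mem.resolve_left hgs
      have hAE : A.top = E.top := by simp [top, hE]
      rw [hE] at hlt
      have hlt := (height_coe_lt hCh (h.up.valid.hi_proper hEU)).1 hlt
      obtain ⟨f, fs, rfl⟩ := List.exists_cons_of_ne_nil hgs
      obtain ⟨t, ht⟩ := tailR_cons f fs A.top
      have hAP : A.top ∈ P := by rw [I.P_eq, ht]; simp
      rw [ht] at hP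
      rcases List.mem_append.1 hP with hP | hP
      · have hs := I.sorted_P
        rw [I.P_eq, ht] at hs
        have := (List.pairwise_append.1 (List.pairwise_append.1 hs).1).2.2 _ hP A.top (by simp)
        have := (hC.between A.top (I.mem_P hAP) this (I.neg _ hAP)).2
        rw [hAE] at this
        linarith
      · rw [List.mem_singleton.1 hP, hAE] at hlt
        exact lt_irrefl _ hlt
    · obtain ⟨E, hE, hCE⟩ := mem_inoL.1 hP
      have hEU := I.left_mem E hE
      rcases hCE with hCE | hCE
      · exfalso
        have h1 := ((sorted_inoL I.sorted_near).1 E hE).2 _ hCE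
        have h2 := (hC.between _ (top_mem_ino hEU) h1 (I.neg _ (I.left_top_mem hE).1)).2
        linarith [hin E hEU hCE]
      · rw [eq_of_top_eq h.up.nodup hC.mem hEU hCE]; exact hE
  · exfalso
    cases cs with
    | nil => have := I.nil rfl _ hQ; have := hC.top_neg; omega
    | cons B tl =>
      have hB := (I.head_mem B rfl).1
      have hCB := I.head_ino B rfl _ hQ hC.top_neg
      have hlt := hcs B rfl
      rcases mem_proper hB with e | hBp
      · rw [e, h.up_hi] at hlt
        exact absurd hlt (by simp [height])
      · have h1 := (height_coe_lt (h.up.valid.hi_proper hBp) hCh).1 hlt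
        linarith [hin B hBp hCB]

/-- The conditions of `Valid.interchange` hold with `α` at `v C.lo + δ`: the minima of the lower
part are in the out-panel of `C`, so they exceed `C.lo` and by the gap also `α`; for the upper part
see `hupp`. -/
theorem Inv.scare (h : Setting v pos y U D a b)
    (I : Inv v pos y U α gs A F z P Q cs (C :: scN) scF)
    (hcs : ∀ B ∈ cs.head?, height v B.hi < height v C.hi) (hδ : 0 < δ)
    (hgap : ∀ i ∈ U.ino, ∀ j ∈ U.ino, v i < v j → v i + δ < v j) :
    ∃ lower upper, A.left = lower ++ C :: upper ∧
      Inv v pos y U α (gs ++ [⟨C.lo, A.hi, C.right, C.left ++ upper⟩]) (Banana.mk α C.hi lower []) F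
        (v C.lo + δ) P Q cs scN scF := by
  have hCA := I.scare_mem h hcs
  have hC := I.scN_sc C (by simp)
  have hCl : C.lo ∈ U.ino := ino_subset (bananas_of_proper hC.mem) (lo_mem_ino C)
  have hCt := top_mem_ino hC.mem
  have hzC := I.z_lt_left hCA
  obtain ⟨lower, upper, hl⟩ := List.append_of_mem hCA
  have hlA : ∀ E ∈ lower, E ∈ A.left := fun E hE => by rw [hl]; simp [hE]
  have huA : ∀ E ∈ upper, E ∈ A.left := fun E hE => by rw [hl]; simp [hE]
  have hElo : ∀ E ∈ A.left, E.lo ∈ U.ino := fun E hE => I.mem_P ((I.left_top_mem hE).2 _ (lo_mem_ino E))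
  have hord := (sorted_inoL I.sorted_near).2
  have hpw := I.valid_near.pairwise_left
  rw [hl] at hord hpw
  have hbet : ∀ i ∈ Q, pos i < 0 → v C.lo < v i ∧ v i < v C.top := fun i hi hi0 =>
    hC.between i (I.mem_Q hi) (I.lt_of_mem (I.left_top_mem hCA).1 hi) hi0
  have hlow : ∀ E ∈ lower, v C.lo + δ < v E.lo := fun E hE => by
    have hEP := (I.left_top_mem (hlA E hE)).2 _ (lo_mem_ino E)
    refine hgap _ hCl _ (I.mem_P hEP) (hC.between _ (I.mem_P hEP) ?_ (I.neg _ hEP)).1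
    exact (List.pairwise_append.1 hord).2.2 E hE C (by simp) C.top (Or.inr rfl) _
      (Or.inl (lo_mem_ino E))
  have hut : ∀ E ∈ upper, v C.top < v E.top := fun E hE => by
    have := (List.pairwise_cons.1 (List.pairwise_append.1 hpw).2.1).1 E hE
    rwa [I.upd _ hCt, I.upd _ (top_mem_ino (I.left_mem E (huA E hE)))] at this
  have hupp : ∀ E ∈ upper, v C.lo < v E.lo := fun E hE => by
    obtain ⟨E₀, hE₀, hmin⟩ := exists_min_lo v hE
    refine lt_of_lt_of_le ?_ (hmin E hE)
    by_contra hlt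
    have hlt : v E₀.lo < v C.lo := by
      refine lt_of_le_of_ne (not_lt.1 hlt) fun e => ?_
      have h1 := h.inj _ (hElo _ (huA _ hE₀)) _ hCl e
      have h2 := (List.pairwise_cons.1 (List.pairwise_append.1 hord).2.1).1 E₀ hE₀ E₀.lo
        (Or.inl (lo_mem_ino _)) C.lo (Or.inl (lo_mem_ino _))
      rw [h1] at h2; exact lt_irrefl _ h2
    have hsc := I.sc_left h.inj (huA E₀ hE₀) (hlt.trans hC.lt_y) (fun E' hE' ht hp => ?_)
      fun i hi hi0 => ⟨hlt.trans (hbet i hi hi0).1, (hbet i hi hi0).2.trans (hut E₀ hE₀)⟩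
    · rcases I.scN_done E₀ hsc with h3 | h3
      · rcases List.mem_cons.1 h3 with e | h3
        · rw [e] at hlt; exact lt_irrefl _ hlt
        · have := (List.pairwise_cons.1 I.scN_sorted).1 E₀ h3
          linarith [hut E₀ hE₀]
      · linarith [I.z_lt_left (huA E₀ hE₀)]
    · rw [hl] at hE'
      rcases List.mem_append.1 hE' with hE' | hE'
      · exact Or.inl (by linarith [hlow E' hE'])
      · rcases List.mem_cons.1 hE' with e | hE'
        · rw [e]; exact Or.inl hlt.le
        · exact Or.inl (hmin E' hE')
  have hgap' : ∀ i ∈ U.ino, v i < v C.lo + δ → v i ≤ v C.lo := fun i hi hlt => by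
    by_contra hlt'
    linarith [hgap _ hCl _ hi (not_le.1 hlt')]
  have hCtop : v C.lo < v C.top := by
    obtain ⟨E, hE, hEB⟩ := exists_parent hC.mem
    exact ((h.up.valid.of_mem hE).child_of_mem hEB).lt_top
  refine ⟨lower, upper, hl, I.up, I.fresh, rfl, rfl, ?_, ?_, ?_, I.far_ino, I.far_valid, I.far_hi,
    I.append, I.neg, I.path, I.head_mem, I.head_side, I.head_far, I.head_ino,
    fun B hB E hE => I.head_lt B hB E (hlA E hE), fun B hB => Or.inr (hcs B hB), I.nil,
    fun i hi hi0 => hgap _ hCl _ (I.mem_Q hi) (hbet i hi hi0).1, fun E hE => I.left_mem E (hlA E hE),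
    Or.inr ⟨C, hC.mem, rfl⟩, (List.pairwise_cons.1 I.scN_sorted).2, I.scF_sorted,
    fun E hE => I.scN_sc E (List.mem_cons_of_mem _ hE), I.scF_sc, fun E hE => ?_, fun E hE => ?_,
    Or.inr fun E hE => ?_, I.scF_lt, fun i hi hlt => (hgap' i hi hlt).trans_lt hC.lt_y⟩
  · rw [ino_interchange I.near_lo I.near_right hl, I.near_ino]
  · refine I.near_valid.interchange (fun i hi => ?_) I.near_nodup I.near_lo I.near_right hl ?_ ?_ ?_ ?_
    · rw [Function.update_of_ne hi, Function.update_of_ne hi]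
    · rw [I.upd _ hCl, Function.update_self]; linarith
    · rw [I.upd _ hCt, Function.update_self]; exact hgap _ hCl _ hCt hCtop
    · intro E hE
      rw [I.upd _ (hElo E (hlA E hE)), Function.update_self]; exact hlow E hE
    · intro E hE
      rw [I.upd _ (hElo E (huA E hE)), I.upd _ hCl]; exact hupp E hE
  · rw [plugR_append, ← I.near_hi]; exact hi_plugR _ rfl
  · rcases I.scN_done E hE with h1 | h1
    · rcases List.mem_cons.1 h1 with rfl | h1
      · right; linarith
      · exact Or.inl h1
    · right; linarith
  · exact (I.scF_done E hE).imp_right fun h1 => by linarith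
  · exact (height_coe_lt (h.up.valid.hi_proper (I.scN_sc E (List.mem_cons_of_mem _ hE)).mem)
      (h.up.valid.hi_proper hC.mem)).2 ((List.pairwise_cons.1 I.scN_sorted).1 E hE)

end

end Banana
end BananaTree

namespace BananaTree
namespace Banana

variable {v : ℕ → ℝ} {pos : ℕ → ℤ} {y : ℝ} {ℓ : ℕ}

/-! ### Evaluation of the three operations -/

theorem leftOf_mirror {C : Banana} : LeftOf ℓ C.mirror ↔ LeftOf ℓ C := by simp [LeftOf]

section

variable {A B C : Banana} {fs gs : List Frame} {φ : Banana → Banana} {w : ℕ → ℝ} {δ : ℝ} {α p : ℕ}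
  {lower upper : List Banana}

theorem modifyHi_plugL (hv : Valid v (plugL fs B)) (hn : (plugL fs B).ino.Nodup)
    (ht : (plugL fs B).hi = ⊤) : (plugL fs B).modifyHi B.hi φ = plugL fs (φ B) :=
  modify_plugL hn rfl fun _ hD e => hi_unique hv hn ht hD (mem_bananas_plugL fs B) e

/-- With `α` in the right tree, both trees are mirror images of those in the invariant. Writing the
result as a mirror image makes the invariant for `U.mirror` applicable. -/
theorem modifyHi_plugL_mirror (hv : Valid v (plugL fs B)) (hn : (plugL fs B).ino.Nodup)
    (ht : (plugL fs B).hi = ⊤) :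
    (plugL fs B).mirror.modifyHi B.hi φ = (plugL fs (φ B.mirror).mirror).mirror := by
  have hv' := hv.mirror
  have hn' : (plugL fs B).mirror.ino.Nodup := by
    rw [ino_mirror]; exact List.nodup_reverse.2 hn
  have ht' : (plugL fs B).mirror.hi = ⊤ := by rw [hi_mirror]; exact ht
  rw [mirror_plugL] at hv' hn' ht'
  rw [mirror_plugL, mirror_plugL, mirror_mirror]
  exact modify_plugR hn' (by simp) fun D hD e =>
    hi_unique hv' hn' ht' hD (mem_bananas_plugR _ _) (by simpa using e)

theorem modifyLo_plugR (hn : (plugR gs A).ino.Nodup) :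
    (plugR gs A).modifyLo A.lo φ = plugR gs (φ A) :=
  modify_plugR hn rfl fun _ hD e => eq_of_lo_eq hn hD (mem_bananas_plugR gs A) e

theorem modifyLo_plugR_mirror (hn : (plugR gs A).ino.Nodup) :
    (plugR gs A).mirror.modifyLo A.lo φ = (plugR gs (φ A.mirror).mirror).mirror := by
  have hn' : (plugR gs A).mirror.ino.Nodup := by
    rw [ino_mirror]; exact List.nodup_reverse.2 hn
  rw [mirror_plugR] at hn'
  rw [mirror_plugR, mirror_plugR, mirror_mirror]
  exact modify_plugL hn' (by simp) fun D hD e =>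
    eq_of_lo_eq hn' hD (mem_bananas_plugL _ _) (by simpa using e)

theorem at?_plugL_mirror (hv : Valid v (plugL fs B)) (hn : (plugL fs B).ino.Nodup)
    (ht : (plugL fs B).hi = ⊤) : (plugL fs B).mirror.at? B.hi = some B.mirror := by
  rw [← hi_mirror B]
  exact at?_eq hv.mirror (by rw [ino_mirror]; exact List.nodup_reverse.2 hn) (by rw [hi_mirror]; exact ht)
    (mirror_mem_bananas (mem_bananas_plugL fs B))

theorem map_filter_mirror {t : List Banana} {p : Banana → Bool} (hp : ∀ C, p C.mirror = p C) :
    (t.map mirror).filter p = (t.filter p).map mirror := by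
  rw [List.filter_map]
  congr 1
  exact List.filter_congr fun C _ => hp C

section

variable (hv : Valid v (plugL fs B)) (hn : (plugL fs B).ino.Nodup) (ht : (plugL fs B).hi = ⊤)
  (hn' : (plugR gs A).ino.Nodup) (hα : A.lo = α)

include hv hn ht hn' hα

theorem injuryRight_plug : injuryRight α ℓ B.hi ⟨plugR gs A, plugL fs B, w⟩ =
    ⟨plugR gs (mk A.lo A.hi ((B.left.filter fun C => LeftOf ℓ C) ++ A.left) A.right),
      plugL fs (mk B.lo B.hi (B.left.filter fun C => ¬ LeftOf ℓ C) B.right), w⟩ := by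
  subst hα
  simp only [injuryRight, at?_eq hv hn ht (mem_bananas_plugL fs B), modifyHi_plugL hv hn ht,
    modifyLo_plugR hn']

theorem injuryLeft_plug :
    injuryLeft α ℓ B.hi ⟨(plugL fs B).mirror, (plugR gs A).mirror, w⟩ =
    ⟨(plugL fs (mk B.lo B.hi (B.left.filter fun C => LeftOf ℓ C) B.right)).mirror,
      (plugR gs (mk A.lo A.hi ((B.left.filter fun C => ¬ LeftOf ℓ C) ++ A.left) A.right)).mirror,
      w⟩ := by
  subst hα
  simp only [injuryLeft, at?_plugL_mirror hv hn ht, modifyHi_plugL_mirror hv hn ht,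
    modifyLo_plugR_mirror hn']
  simp only [right_mirror, left_mirror, mirror_mk, lo_mirror, hi_mirror, map_mirror_mirror,
    List.map_append, map_filter_mirror (p := fun C => decide (LeftOf ℓ C))
      (fun C => by simp only [leftOf_mirror]),
    map_filter_mirror (p := fun C => decide (¬ LeftOf ℓ C)) (fun C => by simp only [leftOf_mirror])]

theorem fatalityRight_plug : fatalityRight α ℓ δ p B.hi ⟨plugR gs A, plugL fs B, w⟩ =
    ⟨plugR gs (mk p A.hi (B.left ++ A.left) ((B.right.filter fun C => LeftOf ℓ C) ++ A.right)),
      plugL fs (mk α B.hi [] (B.right.filter fun C => ¬ LeftOf ℓ C)),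
      Function.update w α (w p - δ)⟩ := by
  subst hα
  simp only [fatalityRight, at?_eq hv hn ht (mem_bananas_plugL fs B), modifyHi_plugL hv hn ht,
    modifyLo_plugR hn']

theorem fatalityLeft_plug :
    fatalityLeft α ℓ δ p B.hi ⟨(plugL fs B).mirror, (plugR gs A).mirror, w⟩ =
    ⟨(plugL fs (mk α B.hi [] (B.right.filter fun C => LeftOf ℓ C))).mirror,
      (plugR gs (mk p A.hi (B.left ++ A.left)
        ((B.right.filter fun C => ¬ LeftOf ℓ C) ++ A.right))).mirror,
      Function.update w α (w p - δ)⟩ := by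
  subst hα
  simp only [fatalityLeft, at?_plugL_mirror hv hn ht, modifyHi_plugL_mirror hv hn ht,
    modifyLo_plugR_mirror hn']
  simp only [right_mirror, left_mirror, mirror_mk, hi_mirror, map_mirror_mirror,
    List.map_append, List.map_nil, map_filter_mirror (p := fun C => decide (LeftOf ℓ C))
      (fun C => by simp only [leftOf_mirror]),
    map_filter_mirror (p := fun C => decide (¬ LeftOf ℓ C)) (fun C => by simp only [leftOf_mirror])]

end

/-- Values increase along the trail, so the comparisons with the height of `C` in `interchange` cut
it at `C`. -/
theorem trail_split (hA : Valid w A) (hl : A.left = lower ++ C :: upper) :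
    (A.left.find? fun E => E.hi = C.hi) = some C ∧
    (A.left.filter fun E => height w E.hi < height w C.hi) = lower ∧
    (A.left.filter fun E => height w C.hi < height w E.hi) = upper := by
  have hpw := hA.pairwise_left
  have hhi : ∀ E ∈ A.left, E.hi = (E.top : WithTop ℕ) := fun E hE => (hA.child_left E hE).hi_eq
  rw [hl] at hpw hhi ⊢
  obtain ⟨p1, p2, p3⟩ := List.pairwise_append.1 hpw
  have p4 := (List.pairwise_cons.1 p2).1
  have hC := hhi C (by simp)
  have l1 : ∀ E ∈ lower, height w E.hi < height w C.hi := fun E hE =>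
    (height_coe_lt (hhi E (by simp [hE])) hC).2 (p3 E hE C (by simp))
  have l2 : ∀ E ∈ upper, height w C.hi < height w E.hi := fun E hE =>
    (height_coe_lt hC (hhi E (by simp [hE]))).2 (p4 E hE)
  refine ⟨?_, ?_, ?_⟩
  · rw [List.find?_append, List.find?_eq_none.2]
    · simp
    · intro E hE e
      have := l1 E hE
      rw [of_decide_eq_true e] at this
      exact lt_irrefl _ this
  · rw [List.filter_append, List.filter_eq_self.2 (fun E hE => by simpa using l1 E hE),
      List.filter_eq_nil_iff.2, List.append_nil]
    intro E hE
    rcases List.mem_cons.1 hE with rfl | hE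
    · simp
    · simpa using (l2 E hE).le
  · rw [List.filter_append, List.filter_eq_nil_iff.2 (fun E hE => by simpa using (l1 E hE).le),
      List.nil_append, List.filter_cons_of_neg (by simp),
      List.filter_eq_self.2 fun E hE => by simpa using l2 E hE]

section

variable (hA : Valid w A) (hn : (plugR gs A).ino.Nodup) (hα : A.lo = α) (hr : A.right = [])
  (hl : A.left = lower ++ C :: upper)

include hA hn hα hr hl

theorem interchange_plug : interchange w α C.hi (plugR gs A) =
    plugR (gs ++ [⟨C.lo, A.hi, C.right, C.left ++ upper⟩]) (mk α C.hi lower []) := by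
  obtain ⟨h1, h2, h3⟩ := trail_split hA hl
  subst hα
  rw [interchange, modifyLo_plugR hn, h1, plugR_append]
  simp only [h2, h3, hr, List.filter_nil, plugR]

theorem interchange_plug_mirror : interchange w α C.hi (plugR gs A).mirror =
    (plugR (gs ++ [⟨C.lo, A.hi, C.right, C.left ++ upper⟩]) (mk α C.hi lower [])).mirror := by
  obtain ⟨h1, h2, h3⟩ := trail_split hA hl
  subst hα
  have h1' : ((A.left.map mirror).find? fun E => E.hi = C.hi) = some C.mirror := by
    rw [List.find?_map]
    simpa [Function.comp_def] using congrArg (Option.map mirror) h1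
  rw [interchange, modifyLo_plugR_mirror hn, plugR_append]
  simp only [left_mirror, right_mirror, hr, List.map_nil, List.find?_nil, h1', h2, h3,
    map_filter_mirror (p := fun E => decide (height w E.hi < height w C.hi)) (fun C => by simp),
    map_filter_mirror (p := fun E => decide (height w C.hi < height w E.hi)) (fun C => by simp),
    List.filter_nil, plugR, lo_mirror, hi_mirror, mirror_mk, List.map_append, List.map_cons,
    map_mirror_mirror]

end

end

/-! ### The main loop -/

/-- The state of the main loop with the bananas `cs`, `scL`, `scR` on the stacks. -/
def Rep (v : ℕ → ℝ) (pos : ℕ → ℤ) (y : ℝ) (U : Banana) (α : ℕ) (σ : State)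
    (cs scL scR : List Banana) : Prop :=
  (∃ gs A F z P Q, Inv v pos y U α gs A F z P Q cs scL scR ∧
    σ = ⟨plugR gs A, F, Function.update v α z⟩) ∨
  -- A banana with upper end `⊤` is treated as ending right of the cut, so it occurs only in the
  -- first alternative.
  ((∀ B ∈ cs, B ∈ U.proper) ∧ ∃ gs A F z P Q,
    Inv v (-pos) y U.mirror α gs A F z P Q (cs.map mirror) scR scL ∧
    σ = ⟨F.mirror, (plugR gs A).mirror, Function.update v α z⟩)

section

variable {U D A B C F : Banana} {a b α : ℕ} {gs : List Frame} {z δ : ℝ} {P Q : List ℕ}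
  {cs tl scN scF scL scR : List Banana} {σ : State}

theorem Inv.path_lt (h : Setting v pos y U D a b)
    (I : Inv v pos y U α gs A F z P Q (B :: tl) scN scF) {E : Banana} (hE : E ∈ tl) :
    height v E.hi < height v B.hi ∧ E ∈ U.proper := by
  have ho : ∀ A, (B :: tl).head? = some A → A ∈ U.bananas ∧ Pan v pos y U A := fun A hA =>
    I.head_mem A hA
  have h1 := (List.pairwise_cons.1 (h.up.path_pairwise_hi h.pos_ne h.up_hi I.path ho)).1 E hE
  refine ⟨h1, ?_⟩
  rcases mem_proper (h.up.path_spec h.pos_ne I.path ho E (List.mem_cons_of_mem _ hE)).1 with e | e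
  · rw [e, h.up_hi] at h1; exact absurd h1 (by simp [height])
  · exact e

/-- The windows on the far side are lower than the next banana of the path, so the maximum is
attained by this banana or by the first window on the near side. These are never equally high: their
upper ends are on different sides of the cut. -/
theorem Inv.top_cases (h : Setting v pos y U D a b)
    (I : Inv v pos y U α gs A F z P Q cs scN scF) :
    (cs = [] ∧ scN = [] ∧ scF = []) ∨
    (∃ B tl, cs = B :: tl ∧ (∀ E ∈ scN, height v E.hi < height v B.hi) ∧
      ∀ E ∈ scF, height v E.hi < height v B.hi) ∨
    ∃ C s, scN = C :: s ∧ (∀ E ∈ cs, height v E.hi < height v C.hi) ∧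
      ∀ E ∈ scF, height v E.hi < height v C.hi := by
  have hsc : ∀ C s, scN = C :: s → ∀ E ∈ s, height v E.hi < height v C.hi := by
    rintro C s rfl E hE
    exact (height_coe_lt (h.up.valid.hi_proper (I.scN_sc E (by simp [hE])).mem)
      (h.up.valid.hi_proper (I.scN_sc C (by simp)).mem)).2 ((List.pairwise_cons.1 I.scN_sorted).1 E hE)
  cases cs with
  | nil =>
    have hF : ∀ E, E ∉ scF := fun E hE => by obtain ⟨B, hB, -⟩ := I.scF_lt E hE; simp at hB
    cases scN with
    | nil => exact Or.inl ⟨rfl, rfl, List.eq_nil_iff_forall_not_mem.2 hF⟩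
    | cons C s => exact Or.inr (Or.inr ⟨C, s, rfl, by simp, fun E hE => absurd hE (hF E)⟩)
  | cons B tl =>
    have hF : ∀ E ∈ scF, height v E.hi < height v B.hi := fun E hE => by
      obtain ⟨B', hB', hlt⟩ := I.scF_lt E hE
      simp only [List.head?_cons, Option.mem_some_iff] at hB'
      subst hB'; exact hlt
    cases scN with
    | nil => exact Or.inr (Or.inl ⟨B, tl, rfl, by simp, hF⟩)
    | cons C s =>
      have hC := I.scN_sc C (by simp)
      rcases lt_trichotomy (height v C.hi) (height v B.hi) with h1 | h1 | h1
      · refine Or.inr (Or.inl ⟨B, tl, rfl, fun E hE => ?_, hF⟩)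
        rcases List.mem_cons.1 hE with rfl | hE
        · exact h1
        · exact (hsc C s rfl E hE).trans h1
      · exfalso
        have hCh := h.up.valid.hi_proper hC.mem
        rcases mem_proper (I.head_mem B rfl).1 with e | hBp
        · rw [e, h.up_hi, hCh] at h1
          exact absurd h1 (by simp [height])
        · have hBh := h.up.valid.hi_proper hBp
          rw [hCh, hBh] at h1
          have := h.inj _ (top_mem_ino hC.mem) _ (top_mem_ino hBp) (WithTop.coe_injective h1)
          rcases I.head_side B rfl with e | e
          · rw [hBh] at e; exact absurd e (by simp)
          · have := hC.top_neg
            simp_all only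
            omega
      · refine Or.inr (Or.inr ⟨C, s, rfl, fun E hE => ?_, fun E hE => (hF E hE).trans h1⟩)
        rcases List.mem_cons.1 hE with rfl | hE
        · exact h1
        · exact (I.path_lt h hE).1.trans h1

theorem Inv.far_nodup (I : Inv v pos y U α gs A F z P Q cs scN scF) : F.ino.Nodup := by
  have := nodup_of_sorted I.up.sorted
  rw [← I.append] at this
  rw [I.far_ino]; exact (List.nodup_append.1 this).2.1

theorem filter_leftOf (hℓ : ∀ i, pos i < 0 ↔ i ≤ ℓ) {t : List Banana}
    (ht : ∀ C ∈ t, C.hi = (C.top : WithTop ℕ)) :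
    (t.filter fun C => LeftOf ℓ C) = t.filter fun C => pos C.top < 0 :=
  List.filter_congr fun C hC => by simp only [LeftOf, le_iff_of_hi hℓ (ht C hC)]

theorem filter_not_leftOf (h0 : ∀ i, pos i ≠ 0) (hℓ : ∀ i, pos i < 0 ↔ i ≤ ℓ) {t : List Banana}
    (ht : ∀ C ∈ t, C.hi = (C.top : WithTop ℕ)) :
    (t.filter fun C => ¬ LeftOf ℓ C) = t.filter fun C => 0 < pos C.top :=
  List.filter_congr fun C hC => by
    simp only [LeftOf, le_iff_of_hi hℓ (ht C hC), decide_eq_decide]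
    have := h0 C.top
    omega

/-- The next banana of the path ends on the side of the far tree, so the side of its minimum decides
between injury and fatality. Only a fatality switches to the other alternative of `Rep`. -/
theorem Rep.step (h : Setting v pos y U D a b) (hℓ : ∀ i, pos i < 0 ↔ i ≤ ℓ) (hδ : 0 < δ)
    (hgap : ∀ i ∈ U.ino, ∀ j ∈ U.ino, v i < v j → v i + δ < v j)
    (hr : Rep v pos y U α σ cs scL scR) :
    (cs = [] ∧ scL = [] ∧ scR = []) ∨ ∃ τ e cs' scL' scR',
      topBanana v (loaded ℓ cs scL scR) = some (τ, e) ∧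
      (loaded ℓ cs scL scR).pop τ = loaded ℓ cs' scL' scR' ∧
      cs.length + scL.length + scR.length = cs'.length + scL'.length + scR'.length + 1 ∧
      Rep v pos y U α (process α ℓ δ (τ, e) σ) cs' scL' scR' := by
  have hhi : ∀ B ∈ U.bananas, ∀ C ∈ B.left ++ B.right, C.hi = (C.top : WithTop ℕ) :=
    fun B hB C hC => h.up.valid.hi_proper (proper_of_child hB hC)
  rcases hr with ⟨gs, A, F, z, P, Q, I, rfl⟩ | ⟨hcs, gs, A, F, z, P, Q, I, rfl⟩
  · rcases I.top_cases h with h1 | ⟨B, tl, rfl, hN, hF⟩ | ⟨C, s, rfl, hc, hF⟩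
    · exact Or.inl h1
    · right
      obtain ⟨fs, rfl⟩ := I.head_far B rfl
      have hB := (I.head_mem B rfl).1
      have hl := hhi B hB
      have hBhi : ¬ B.hi ≤ ℓ ∧ ℓ < B.hi := by
        rcases I.head_side B rfl with e | e
        · rw [e]; exact ⟨by simp, WithTop.coe_lt_top ℓ⟩
        · rcases mem_proper hB with e' | e'
          · rw [e', h.up_hi]; exact ⟨by simp, WithTop.coe_lt_top ℓ⟩
          · have := h.up.valid.hi_proper e'
            rw [le_iff_of_hi hℓ this, lt_iff_of_hi h.pos_ne hℓ this]
            omega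
      refine ⟨kind ℓ B.ends, B.ends, tl, scL, scR, topBanana_up (fun E hE => (I.path_lt h hE).1) hN hF,
        (loaded_cons B tl scL scR).2, by simp; omega, ?_⟩
      rcases lt_or_gt_of_ne (h.pos_ne B.lo) with hlo | hlo
      · have hlo' := (hℓ B.lo).1 hlo
        rw [kind_Mup ⟨fun e => hBhi.1 e.2, fun e => absurd hlo' (not_le.2 e.1)⟩]
        simp only [process, if_pos hlo']
        rw [fatalityRight_plug I.far_valid I.far_nodup I.far_hi I.near_nodup I.near_lo,
          filter_leftOf hℓ fun C hC => hl C (List.mem_append_right _ hC),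
          filter_not_leftOf h.pos_ne hℓ fun C hC => hl C (List.mem_append_right _ hC),
          Function.update_idem, I.upd _ (ino_subset hB (lo_mem_ino B)), I.near_right, List.append_nil]
        obtain ⟨P', Q', I'⟩ := I.fatality h hlo hN hδ hgap
        refine Or.inr ⟨fun E hE => (I.path_lt h hE).2, _, _, _, _, _, _, I', ?_⟩
        rw [mirror_mirror, mirror_plugR]
        simp [Function.comp_def, Frame.mirror, mirror_mk]
      · have hlo' := (lt_iff_pos h.pos_ne hℓ B.lo).2 hlo
        rw [kind_Rup ⟨hlo', hBhi.2⟩]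
        simp only [process]
        rw [injuryRight_plug I.far_valid I.far_nodup I.far_hi I.near_nodup I.near_lo,
          filter_leftOf hℓ fun C hC => hl C (List.mem_append_left _ hC),
          filter_not_leftOf h.pos_ne hℓ fun C hC => hl C (List.mem_append_left _ hC),
          I.near_lo, I.near_right]
        obtain ⟨P', Q', I'⟩ := I.injury h hlo hF
        exact Or.inl ⟨_, _, _, _, _, _, I', rfl⟩
    · right
      refine ⟨.Ldn, C.ends, cs, s, scR, topBanana_Ldn hc hF, rfl, by simp; omega, ?_⟩
      obtain ⟨lower, upper, hl, I'⟩ := I.scare h (fun B hB => hc B (List.mem_of_mem_head? hB)) hδ hgap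
      simp only [process, scareLeft]
      rw [interchange_plug I.valid_near I.near_nodup I.near_lo I.near_right hl, Function.update_idem,
        I.upd _ (ino_subset (bananas_of_proper (I.scN_sc C (by simp)).mem) (lo_mem_ino C))]
      exact Or.inl ⟨_, _, _, _, _, _, I', rfl⟩
  · have hgap' : ∀ i ∈ U.mirror.ino, ∀ j ∈ U.mirror.ino, v i < v j → v i + δ < v j := by
      simpa using hgap
    rcases I.top_cases h.mirror with h1 | ⟨B, tl, e, hN, hF⟩ | ⟨C, s, rfl, hc, hF⟩
    · left; simpa [and_comm] using h1
    · right
      obtain ⟨B, tl, rfl, rfl, rfl⟩ : ∃ B' tl', cs = B' :: tl' ∧ B'.mirror = B ∧ tl'.map mirror = tl := by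
        simpa [List.map_eq_cons_iff] using e
      simp only [List.map_cons] at I
      obtain ⟨fs, rfl⟩ := I.head_far B.mirror rfl
      have hBp := hcs B (by simp)
      have hB := bananas_of_proper hBp
      have hBh := h.up.valid.hi_proper hBp
      have hl : ∀ C ∈ B.mirror.left ++ B.mirror.right, C.hi = (C.top : WithTop ℕ) := by
        intro C hC
        have := hhi B hB C.mirror (by
          rcases List.mem_append.1 hC with hC | hC
          · rw [left_mirror] at hC
            obtain ⟨C, hC', rfl⟩ := List.mem_map.1 hC
            rw [mirror_mirror]; exact List.mem_append_right _ hC'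
          · rw [right_mirror] at hC
            obtain ⟨C, hC', rfl⟩ := List.mem_map.1 hC
            rw [mirror_mirror]; exact List.mem_append_left _ hC')
        simpa using this
      have hBtop : pos B.top < 0 := by
        rcases I.head_side B.mirror rfl with e | e
        · rw [hi_mirror, hBh] at e; exact absurd e (by simp)
        · simpa using e
      have hBhi : B.hi ≤ ℓ ∧ ¬ ℓ < B.hi := by
        rw [le_iff_of_hi hℓ hBh, lt_iff_of_hi h.pos_ne hℓ hBh]; omega
      have htl : ∀ E ∈ tl, height v E.hi < height v B.hi ∧ E ∈ U.proper := fun E hE =>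
        ⟨by simpa using (I.path_lt h.mirror (List.mem_map_of_mem hE)).1, hcs E (by simp [hE])⟩
      have hlneg : ∀ t : List Banana, (t.filter fun C => 0 < pos C.top) =
          t.filter fun C => (-pos) C.top < 0 := fun t =>
        List.filter_congr fun C _ => by simp
      have hlpos : ∀ t : List Banana, (t.filter fun C => pos C.top < 0) =
          t.filter fun C => 0 < (-pos) C.top := fun t =>
        List.filter_congr fun C _ => by simp
      refine ⟨kind ℓ B.ends, B.ends, tl, scL, scR, topBanana_up (fun E hE => (htl E hE).1)
        (fun E hE => by simpa using hF E hE) (fun E hE => by simpa using hN E hE),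
        (loaded_cons B tl scL scR).2, by simp; omega, ?_⟩
      rcases lt_or_gt_of_ne (h.pos_ne B.lo) with hlo | hlo
      · have hlo' := (hℓ B.lo).1 hlo
        rw [kind_Lup ⟨hlo', hBhi.1⟩]
        simp only [process]
        rw [← hi_mirror B, injuryLeft_plug I.far_valid I.far_nodup I.far_hi I.near_nodup I.near_lo,
          filter_leftOf hℓ fun C hC => hl C (List.mem_append_left _ hC),
          filter_not_leftOf h.pos_ne hℓ fun C hC => hl C (List.mem_append_left _ hC),
          I.near_lo, I.near_right, hlneg, hlpos]
        obtain ⟨P', Q', I'⟩ := I.injury h.mirror (by simpa using hlo) (by simpa using hF)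
        exact Or.inr ⟨fun E hE => (htl E hE).2, _, _, _, _, _, _, I', rfl⟩
      · have hlo' := (lt_iff_pos h.pos_ne hℓ B.lo).2 hlo
        rw [kind_Mup ⟨fun e => absurd hlo' (not_lt.2 e.1), fun e => hBhi.2 e.2⟩]
        simp only [process, if_neg (not_le.2 hlo')]
        have hBm : B.mirror.lo ∈ U.mirror.ino := by
          simpa using ino_subset hB (lo_mem_ino B)
        rw [← hi_mirror B, ← lo_mirror B,
          fatalityLeft_plug I.far_valid I.far_nodup I.far_hi I.near_nodup I.near_lo,
          filter_leftOf hℓ fun C hC => hl C (List.mem_append_right _ hC),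
          filter_not_leftOf h.pos_ne hℓ fun C hC => hl C (List.mem_append_right _ hC),
          Function.update_idem, I.upd _ hBm, I.near_right, List.append_nil, hlneg, hlpos]
        obtain ⟨P', Q', I'⟩ := I.fatality h.mirror (by simpa using hlo) hN hδ hgap'
        rw [neg_neg, mirror_mirror, map_mirror_mirror] at I'
        refine Or.inl ⟨_, _, _, _, _, _, I', ?_⟩
        rw [mirror_plugL, mirror_mk, List.map_nil]
    · right
      refine ⟨.Rdn, C.ends, cs, scL, s, topBanana_Rdn (fun E hE => ?_) hF, rfl, by simp; omega, ?_⟩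
      · simpa using hc _ (List.mem_map_of_mem hE)
      obtain ⟨lower, upper, hl, I'⟩ := I.scare h.mirror (fun B hB => hc B (List.mem_of_mem_head? hB))
        hδ hgap'
      simp only [process, scareRight]
      rw [interchange_plug_mirror I.valid_near I.near_nodup I.near_lo I.near_right hl,
        Function.update_idem,
        I.upd _ (ino_subset (bananas_of_proper (I.scN_sc C (by simp)).mem) (lo_mem_ino C))]
      exact Or.inr ⟨hcs, _, _, _, _, _, _, I', rfl⟩

theorem Rep.splitLoop (h : Setting v pos y U D a b) (hℓ : ∀ i, pos i < 0 ↔ i ≤ ℓ) (hδ : 0 < δ)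
    (hgap : ∀ i ∈ U.ino, ∀ j ∈ U.ino, v i < v j → v i + δ < v j) (n : ℕ) :
    ∀ {σ : State} {cs scL scR : List Banana}, Rep v pos y U α σ cs scL scR →
      n = cs.length + scL.length + scR.length →
      Rep v pos y U α (splitLoop v α ℓ δ n (loaded ℓ cs scL scR) σ) [] [] [] := by
  induction n with
  | zero =>
    intro σ cs scL scR hr hn
    have h1 : cs = [] := List.eq_nil_of_length_eq_zero (by omega)
    have h2 : scL = [] := List.eq_nil_of_length_eq_zero (by omega)
    have h3 : scR = [] := List.eq_nil_of_length_eq_zero (by omega)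
    subst h1 h2 h3
    exact hr
  | succ n ih =>
    intro σ cs scL scR hr hn
    rcases hr.step h hℓ hδ hgap with ⟨rfl, rfl, rfl⟩ | ⟨τ, e, cs', scL', scR', h1, h2, h3, h4⟩
    · simp at hn
    · rw [BananaTree.splitLoop, h1]
      simp only [h2]
      exact ih h4 (by omega)

end

end Banana
end BananaTree

namespace BananaTree
namespace Banana

variable {v : ℕ → ℝ} {pos : ℕ → ℤ} {y : ℝ} {ℓ : ℕ}

/-! ### Beginning and end of the main loop -/

section

variable {U D A B F : Banana} {a b α : ℕ} {gs : List Frame} {z δ : ℝ} {P Q : List ℕ}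
  {pre tl scN scF scL scR : List Banana}

/-- On the left spine nothing lies to the left of `B`, so all wrong-sided nodes are inside `B` and
above its minimum, hence above `α`. All windows are still waiting. -/
theorem Inv.start (h : Setting v pos y U D a b) (ht : Tail v pos y U B pre tl)
    (hsN : ScStack v pos y U scN) (hsF : ScStack v (-pos) y U.mirror scF)
    (hs : B.hi ∈ U.leftSpine) (hδ : 0 < δ) (hα : α ∉ U.ino) :
    Inv v pos y U α [] (Banana.mk α ⊤ [] []) U (v B.lo - δ) [] U.ino (B :: tl) scN scF := by
  obtain ⟨hB, hp⟩ := ht.mem_bananas h.pos_ne h.up B (by simp)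
  obtain ⟨fs, B', hfs, hB'⟩ := mem_leftSpine.1 hs
  have e : B' = B := hi_unique h.up.valid h.up.nodup h.up_hi
    (by rw [hfs]; exact mem_bananas_plugL fs B') hB hB'
  subst e
  have hg := h.up
  rw [hfs] at hg
  have hBU : B' = U ∨ fs ≠ [] ∧ 0 < pos B'.top := by
    by_cases hn : fs = []
    · left; rw [hfs, hn]; rfl
    · have h1 := hg.plugL_lo hn (lo_mem_ino B')
      rcases hp with e | hp | hp
      · exact Or.inl e
      · exact Or.inr ⟨hn, hp.top_pos⟩
      · have := hp.lo_lt
        simp only [Pi.neg_apply] at this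
        omega
  have hin : ∀ i ∈ U.ino, pos i < 0 → i ∈ B'.ino := fun i hi hi0 => by
    rcases hBU with e | ⟨hn, h0⟩
    · rwa [e]
    · exact hg.plugL_pos hn (by rwa [← hfs]) (by omega)
  have hlo := h.up.lo_lt_y h.cut hB hp
  refine ⟨h.up, hα, rfl, rfl, by simp [plugR, ino_mk], .mk (by simp) (by simp) (by simp) (by simp)
    (by simp) (by simp), rfl, rfl, h.up.valid, h.up_hi, by simp, by simp, ?_, ?_, ?_, ?_, ?_, by simp,
    fun _ _ => Or.inl rfl, by simp, ?_, by simp, Or.inl rfl, hsN.sorted, hsF.sorted,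
    fun C hC => (hsN.mem C).1 hC, fun C hC => (hsF.mem C).1 hC, fun C hC => Or.inl ((hsN.mem C).2 hC),
    fun C hC => Or.inl ((hsF.mem C).2 hC), Or.inl rfl, ?_, ?_⟩
  · exact ht.path.of_append
  · intro E hE; cases hE; exact ⟨hB, hp⟩
  · intro E hE; cases hE
    rcases hBU with e | h1
    · left; rw [e, h.up_hi]
    · exact Or.inr h1.2
  · intro E hE; cases hE; exact ⟨fs, hfs⟩
  · intro E hE; cases hE; exact hin
  · intro i hi hi0
    have := (h.up.valid.of_mem hB).lo_le (hin i hi hi0)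
    linarith
  · intro C hC
    refine ⟨B', rfl, ?_⟩
    simpa using h.mirror.sc_lt_top (ht.mirror h.pos_ne) ((hsF.mem C).1 hC)
  · intro i _ hi; linarith

theorem Rep.start (h : Setting v pos y U D a b) (ht : Tail v pos y U B pre tl)
    (hsL : ScStack v pos y U scL) (hsR : ScStack v (-pos) y U.mirror scR) (hδ : 0 < δ)
    (hα : α ∉ U.ino) :
    Rep v pos y U α (initState U v α δ (loaded ℓ (B :: tl) scL scR)) (B :: tl) scL scR := by
  have htop : topBanana v (loaded ℓ (B :: tl) scL scR) = some (kind ℓ B.ends, B.ends) :=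
    topBanana_up (h.top_tail ht) (fun E hE => h.sc_lt_top ht ((hsL.mem E).1 hE)) fun E hE => by
      simpa using h.mirror.sc_lt_top (ht.mirror h.pos_ne) ((hsR.mem E).1 hE)
  rw [initState, htop]
  simp only
  split_ifs with hs
  · exact Or.inl ⟨_, _, _, _, _, _, Inv.start h ht hsL hsR hs hδ hα, rfl⟩
  · right
    have hB := (ht.mem_bananas h.pos_ne h.up B (by simp)).1
    refine ⟨fun E hE => ?_, [], Banana.mk α ⊤ [] [], U.mirror, v B.mirror.lo - δ, [], U.mirror.ino, ?_, ?_⟩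
    · rcases List.mem_cons.1 hE with rfl | hE
      · refine (mem_proper hB).resolve_left fun e => hs ?_
        exact mem_leftSpine.2 ⟨[], E, e.symm, rfl⟩
      · exact h.tail_proper ht E hE
    · refine Inv.start h.mirror (ht.mirror h.pos_ne) hsR (by simpa using hsL) ?_ hδ (by simpa using hα)
      rw [mem_leftSpine_mirror, hi_mirror]
      exact (List.mem_append.1 ht.spine).resolve_left hs
    · simp [plugR, mirror_mk]

/-- The right neighbour of an upper end is interior to its window or on the way to its exit, hence
lower. -/
theorem Setting.falling_of_top (h : Setting v pos y U D a b) {E : Banana} (hE : E ∈ U.proper)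
    (e : E.top = a) : v b < v a := by
  have ha := h.cut.a_neg
  have hb := h.cut.b_pos
  subst e
  have hne := lo_ne_top h.up.nodup (bananas_of_proper hE) hE
  rcases lt_trichotomy (pos E.lo) (pos E.top) with h1 | h1 | h1
  · obtain ⟨c, c1, c2, -, c4⟩ := (h.up.lwin hE h1).out
    exact c4 b h.cut.b_mem (by omega) (by have := h.cut.gap c c1; omega)
  · exact absurd (h.up.inj (ino_subset (bananas_of_proper hE) (lo_mem_ino E)) (top_mem_ino hE) h1) hne
  · have hw := h.up.lwin_neg hE h1
    have hlo := hw.sub _ (lo_mem_ino E)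
    have := h.cut.gap _ hlo
    exact hw.lt_top b (hw.conv _ (lo_mem_ino E) b h.cut.b_mem (by simp; omega) (by simp; omega))

/-- The node before `α` is the lowest node of its trail or, if the trail is empty, the upper end of
its banana. In both cases it is an upper end of `U`; it is `a`, since all nodes of the far tree are
now beyond the cut. -/
theorem Inv.last (I : Inv v pos y U α gs A F z P Q [] [] []) (h : Setting v pos y U D a b) :
    v b < v a ∧ (∃ P', P = P' ++ [a]) ∧ ∀ i ∈ Q, 0 < pos i := by
  have hQ := I.nil rfl
  have ha : a ∈ P := by
    have := h.cut.a_mem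
    rw [← I.append] at this
    refine (List.mem_append.1 this).resolve_right fun h1 => ?_
    have := hQ a h1; have := h.cut.a_neg; omega
  obtain ⟨P', a', e, E, hE, hEa⟩ : ∃ P' a', P = P' ++ [a'] ∧ ∃ E ∈ U.proper, E.top = a' := by
    rw [I.P_eq]
    have hl := I.left_mem
    cases hA : A.left with
    | nil =>
      cases gs with
      | nil => rw [I.P_eq, hA] at ha; simp [tailR, tailL] at ha
      | cons f fs =>
        obtain ⟨t, ht⟩ := tailR_cons f fs A.top
        obtain ⟨E, hE, hEA⟩ := I.top_mem.resolve_left (by simp)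
        exact ⟨t, A.top, by simp [ht], E, hE, by simp [top, hEA]⟩
    | cons C t =>
      exact ⟨tailR gs A.top ++ (inoL t ++ C.ino), C.top, by rw [inoL_cons]; simp, C, hl C (by simp [hA]), rfl⟩
  have haa : a = a' := by
    have hs := I.sorted_P
    rw [e] at hs ha
    rcases List.mem_append.1 ha with h1 | h1
    · have h2 := (List.pairwise_append.1 hs).2.2 a h1 a' (by simp)
      have h3 := h.cut.gap a' (I.mem_P (by rw [e]; simp))
      have h4 := I.neg a' (by rw [e]; simp)
      have := h.cut.b_pos
      omega
    · exact List.mem_singleton.1 h1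
  subst haa
  exact ⟨h.falling_of_top hE hEa, ⟨P', e⟩, hQ⟩

end

end Banana
end BananaTree

namespace BananaTree
namespace Banana

variable {v : ℕ → ℝ}

/-! ### The final value of the dummy leaf -/

/-- The tree itself or its mirror image. -/
def flip (o : Bool) (T : Banana) : Banana := if o then T.mirror else T

section

variable {A C : Banana} {gs : List Frame} {w : ℕ → ℝ} {α : ℕ} {lower upper : List Banana} (o : Bool)

@[simp] theorem lo_flip (T : Banana) : (flip o T).lo = T.lo := by cases o <;> simp [flip]

@[simp] theorem hi_flip (T : Banana) : (flip o T).hi = T.hi := by cases o <;> simp [flip]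

theorem flip_flip (T : Banana) : flip o (flip o T) = T := by cases o <;> simp [flip]

theorem mem_trails_flip (hr : A.right = []) :
    C ∈ (flip o A).left ++ (flip o A).right ↔ flip o C ∈ A.left := by
  cases o
  · simp [flip, hr]
  · simp only [flip, if_true, left_mirror, right_mirror, hr, List.map_nil, List.nil_append,
      List.mem_map]
    exact ⟨fun ⟨E, hE, e⟩ => by rw [← e, mirror_mirror]; exact hE,
      fun h => ⟨_, h, mirror_mirror C⟩⟩

theorem interchange_flip (hA : Valid w A) (hn : (plugR gs A).ino.Nodup) (hα : A.lo = α)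
    (hr : A.right = []) (hl : A.left = lower ++ C :: upper) :
    interchange w α C.hi (flip o (plugR gs A)) =
      flip o (plugR (gs ++ [⟨C.lo, A.hi, C.right, C.left ++ upper⟩]) (mk α C.hi lower [])) := by
  cases o
  · exact interchange_plug hA hn hα hr hl
  · exact interchange_plug_mirror hA hn hα hr hl

theorem findLo_flip (hn : (plugR gs A).ino.Nodup) (hα : A.lo = α) :
    ((flip o (plugR gs A)).bananas.find? fun B => B.lo = α) = some (flip o A) := by
  subst hα
  have := findLo_eq (T := flip o (plugR gs A)) (B := flip o A)
    (by cases o <;> simp only [flip, if_true, Bool.false_eq_true, if_false, ino_mirror,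
          List.nodup_reverse] <;> exact hn)
    (by cases o
        · exact mem_bananas_plugR gs A
        · exact mirror_mem_bananas (mem_bananas_plugR gs A))
  rwa [lo_flip] at this

theorem modifyLo_flip {φ : Banana → Banana} (hn : (plugR gs A).ino.Nodup) (hα : A.lo = α) :
    (flip o (plugR gs A)).modifyLo α φ = flip o (plugR gs (flip o (φ (flip o A)))) := by
  subst hα
  cases o
  · exact modifyLo_plugR hn
  · exact modifyLo_plugR_mirror hn

theorem relabel_flip {a : ℕ} (hr : A.right = []) :
    flip o (mk a (flip o A).hi (flip o A).left (flip o A).right) = mk a A.hi A.left [] := by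
  cases o
  · simp [flip, hr]
  · simp only [flip, if_true, hi_mirror, left_mirror, right_mirror, mirror_mk, map_mirror_mirror, hr,
      List.map_nil]

end

/-- The tree `plugR gs A` has the nodes `P` and its last leaf is `α`, the lower end of `A`. -/
structure LastLeaf (w : ℕ → ℝ) (P : List ℕ) (α : ℕ) (gs : List Frame) (A : Banana) : Prop where
  lo_eq : A.lo = α
  right_eq : A.right = []
  ino_eq : (plugR gs A).ino = P ++ [α]
  valid : Valid w (plugR gs A)
  hi_eq : (plugR gs A).hi = ⊤
  nodup : (P ++ [α]).Nodup

section

variable {A : Banana} {gs : List Frame} {α : ℕ} {P : List ℕ} {z δ Y : ℝ}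

theorem LastLeaf.P_eq {w : ℕ → ℝ} (h : LastLeaf w P α gs A) :
    P = tailR gs A.top ++ inoL A.left := by
  have h1 : (P ++ [α]) = tailR gs A.top ++ (inoL A.left ++ [α]) := by
    rw [← h.ino_eq, ino_plugR, Banana.ino_eq A, h.right_eq, h.lo_eq]; rfl
  rw [← List.append_assoc] at h1
  exact List.append_inj_left' h1 rfl

theorem LastLeaf.ne {w : ℕ → ℝ} (h : LastLeaf w P α gs A) {i : ℕ} (hi : i ∈ P) : i ≠ α :=
  (List.nodup_append.1 h.nodup).2.2 i hi α (by simp)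

theorem LastLeaf.mem_left {w : ℕ → ℝ} (h : LastLeaf w P α gs A) {C : Banana} (hC : C ∈ A.left)
    {i : ℕ} (hi : i ∈ C.ino ∨ i = C.top) : i ∈ P := by
  rw [h.P_eq]; exact List.mem_append_right _ (mem_inoL.2 ⟨C, hC, hi⟩)

/-- Passing the smallest minimum first guarantees that all others on the trail are larger, as
`Valid.interchange` requires. Each round leaves `α` with a strictly shorter trail, which bounds the
number of rounds. -/
theorem LastLeaf.raise (o : Bool) (hδ : 0 < δ)
    (hgap : ∀ i ∈ P, ∀ j ∈ P, v i < v j → v i + δ < v j)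
    (hinj : ∀ i ∈ P, ∀ j ∈ P, v i = v j → i = j) (n : ℕ) :
    ∀ {gs : List Frame} {A : Banana} {z : ℝ}, LastLeaf (Function.update v α z) P α gs A →
      (∀ i ∈ P, v i < z → v i < Y) → A.left.length ≤ n →
      ∃ gs' A' z', LastLeaf (Function.update v α z') P α gs' A' ∧ (∀ i ∈ P, v i < z' → v i < Y) ∧
        (∀ C ∈ A'.left, Y ≤ v C.lo) ∧
        raise α δ Y n (Function.update v α z) (flip o (plugR gs A)) = flip o (plugR gs' A') := by
  induction n with
  | zero =>
    intro gs A z h hY hn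
    have : A.left = [] := List.eq_nil_of_length_eq_zero (by omega)
    exact ⟨gs, A, z, h, hY, by simp [this], rfl⟩
  | succ n ih =>
    intro gs A z h hY hn
    have hA : Valid (Function.update v α z) A := h.valid.of_mem (mem_bananas_plugR gs A)
    have hnd : (plugR gs A).ino.Nodup := by rw [h.ino_eq]; exact h.nodup
    have hupd : ∀ x, ∀ i ∈ P, Function.update v α x i = v i := fun x i hi =>
      Function.update_of_ne (h.ne hi) _ _
    have hlo : ∀ C ∈ A.left, C.lo ∈ P := fun C hC => h.mem_left hC (Or.inl (lo_mem_ino C))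
    have hz : ∀ C ∈ A.left, z < v C.lo := fun C hC => by
      have := (hA.child_left C hC).lo_lt
      rwa [h.lo_eq, Function.update_self, hupd _ _ (hlo C hC)] at this
    -- One of the two trails is empty, and on the other all minima exceed `α` already, so only the
    -- bound by `Y` selects.
    have hcand : ∀ C, C ∈ ((flip o A).left ++ (flip o A).right).filter (fun C =>
        Function.update v α z α < Function.update v α z C.lo ∧ Function.update v α z C.lo < Y) ↔
        flip o C ∈ A.left ∧ v C.lo < Y := fun C => by
      rw [List.mem_filter, mem_trails_flip o h.right_eq]
      refine and_congr_right fun hC => ?_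
      have h1 := hlo _ hC
      have h2 := hz _ hC
      rw [lo_flip] at h1 h2
      simp [hupd z _ h1, h2]
    rw [BananaTree.raise, findLo_flip o hnd h.lo_eq]
    simp only
    cases harg : List.argmin (fun C : Banana => Function.update v α z C.lo)
        (((flip o A).left ++ (flip o A).right).filter (fun C =>
        Function.update v α z α < Function.update v α z C.lo ∧ Function.update v α z C.lo < Y)) with
    | none =>
      refine ⟨gs, A, z, h, hY, fun C hC => ?_, rfl⟩
      have hnil := List.argmin_eq_none.1 harg
      by_contra hlt
      have := (hcand (flip o C)).2 ⟨by rwa [flip_flip], by simpa using hlt⟩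
      rw [hnil] at this
      simp at this
    | some M =>
      obtain ⟨hMA, hMY⟩ := (hcand M).1 (List.argmin_mem harg)
      obtain ⟨C, hC, rfl⟩ : ∃ C ∈ A.left, flip o C = M := ⟨_, hMA, flip_flip o M⟩
      have hmin : ∀ E ∈ A.left, v C.lo ≤ v E.lo := fun E hE => by
        rw [lo_flip] at hMY
        by_cases hEY : v E.lo < Y
        · have h1 := List.le_of_mem_argmin ((hcand (flip o E)).2 ⟨by rwa [flip_flip], by simpa⟩) harg
          simpa [hupd z _ (hlo C hC), hupd z _ (hlo E hE)] using h1
        · linarith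
      rw [lo_flip] at hMY
      simp only [lo_flip, hi_flip]
      obtain ⟨lower, upper, hl⟩ := List.append_of_mem hC
      have hlA : ∀ E ∈ lower, E ∈ A.left := fun E hE => by rw [hl]; simp [hE]
      have huA : ∀ E ∈ upper, E ∈ A.left := fun E hE => by rw [hl]; simp [hE]
      have hdisj : ∀ E, E ∈ lower ∨ E ∈ upper → E.lo ≠ C.lo := by
        have h1 : (inoL A.left).Nodup := by
          have := (List.nodup_append.1 h.nodup).1
          rw [h.P_eq] at this; exact (List.nodup_append.1 this).2.1
        rw [hl, inoL_append, inoL_cons] at h1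
        obtain ⟨h1, h2, h3⟩ := List.nodup_append.1 h1
        rintro E (hE | hE) e
        · exact h3 C.lo (by simp [lo_mem_ino]) E.lo
            (mem_inoL.2 ⟨E, hE, Or.inl (lo_mem_ino E)⟩) e.symm
        · exact (List.nodup_append.1 h1).2.2 E.lo (mem_inoL.2 ⟨E, hE, Or.inl (lo_mem_ino E)⟩) C.lo
            (by simp [lo_mem_ino]) e
      have hlt : ∀ E, E ∈ lower ∨ E ∈ upper → v C.lo < v E.lo := fun E hE => by
        have hEA : E ∈ A.left := hE.elim (hlA E) (huA E)
        exact lt_of_le_of_ne (hmin E hEA) fun e =>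
          hdisj E hE (hinj _ (hlo E hEA) _ (hlo C hC) e.symm)
      have hCt := h.mem_left hC (Or.inr rfl)
      have hch := (hA.child_left C hC).lt_top
      rw [hupd _ _ (hlo C hC), hupd _ _ hCt] at hch
      rw [interchange_flip o hA hnd h.lo_eq h.right_eq hl, Function.update_idem, hupd _ _ (hlo C hC)]
      have hlen := congrArg List.length hl
      simp only [List.length_append, List.length_cons] at hlen
      refine ih (z := v C.lo + δ) ⟨rfl, rfl, ?_, ?_, ?_, h.nodup⟩ (fun i hi hlt' => ?_) ?_
      · rw [ino_interchange h.lo_eq h.right_eq hl, h.ino_eq]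
      · refine h.valid.interchange (fun i hi => ?_) hnd h.lo_eq h.right_eq hl ?_ ?_ ?_ ?_
        · rw [Function.update_of_ne hi, Function.update_of_ne hi]
        · rw [hupd _ _ (hlo C hC), Function.update_self]; linarith
        · rw [hupd _ _ hCt, Function.update_self]; exact hgap _ (hlo C hC) _ hCt hch
        · intro E hE
          rw [hupd _ _ (hlo E (hlA E hE)), Function.update_self]
          exact hgap _ (hlo C hC) _ (hlo E (hlA E hE)) (hlt E (Or.inl hE))
        · intro E hE
          rw [hupd _ _ (hlo E (huA E hE)), hupd _ _ (hlo C hC)]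
          exact hlt E (Or.inr hE)
      · rw [plugR_append, ← h.hi_eq]; exact hi_plugR _ rfl
      · by_contra hge
        have := hgap _ (hlo C hC) i hi (by linarith)
        linarith
      · simp only [left_mk]; omega

/-- Shows, with the next two lemmas, that the number of bananas of the whole tree suffices as a
bound for the rounds of `raise`. -/
theorem length_le_bananas (T : Banana) : T.left.length ≤ T.bananas.length := by
  rw [bananas_eq_cons, List.length_cons, List.length_append]
  have : ∀ t : List Banana, t.length ≤ (bananasTrail t).length := fun t => by
    induction t with
    | nil => simp
    | cons C t ih => rw [bananasTrail, bananas_eq_cons]; simp; omega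
  have := this T.left
  omega

theorem length_bananas_plugR (gs : List Frame) (A : Banana) :
    A.bananas.length ≤ (plugR gs A).bananas.length := by
  induction gs with
  | nil => exact le_rfl
  | cons f gs ih =>
    refine ih.trans ?_
    rw [bananas_eq_cons (plugR (f :: gs) A)]
    have : ∀ (t : List Banana) (C : Banana), C.bananas.length ≤ (bananasTrail (t ++ [C])).length :=
      fun t C => by
        induction t with
        | nil => simp [bananasTrail]
        | cons E t ih => rw [List.cons_append, bananasTrail]; simp; omega
    have := this f.inn (plugR gs A)
    simp only [plugR, right_mk, left_mk, List.length_cons, List.length_append] at this ⊢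
    omega

theorem length_bananas_mirror (T : Banana) : T.mirror.bananas.length = T.bananas.length := by
  refine ind (P := fun T => T.mirror.bananas.length = T.bananas.length) (fun a b l r hl hr => ?_) T
  have : ∀ t : List Banana, (∀ C ∈ t, C.mirror.bananas.length = C.bananas.length) →
      (bananasTrail (t.map mirror)).length = (bananasTrail t).length := fun t ht => by
    induction t with
    | nil => rfl
    | cons C t ih =>
      rw [List.map_cons, bananasTrail, bananasTrail, List.length_append, List.length_append,
        ht C (by simp), ih fun E hE => ht E (by simp [hE])]
  rw [mirror_mk, bananas_eq_cons, bananas_eq_cons]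
  simp [this l hl, this r hr]; omega

/-- After raising, the minima left on the trail exceed `Y`, and the minimum of the carrying banana,
if any, is below `Y` by `hz`. The upper end is above `Y` because it is at least as high as `a`, the
node just before the leaf. So the leaf can take the value `Y` and its final label. -/
theorem LastLeaf.placeAlpha (o : Bool) (hδ : 0 < δ)
    (hgap : ∀ i ∈ P, ∀ j ∈ P, v i < v j → v i + δ < v j)
    (hinj : ∀ i ∈ P, ∀ j ∈ P, v i = v j → i = j) (h : LastLeaf (Function.update v α z) P α gs A)
    (hz : ∀ i ∈ P, v i < z → v i < Y) {P' : List ℕ} {a lab : ℕ} (hP : P = P' ++ [a])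
    (ha : Y < v a) (hne : ∀ i ∈ P, v i ≠ Y) {w : ℕ → ℝ} (hw : ∀ i ∈ P, w i = v i)
    (hlab : w lab = Y) :
    ∃ T, placeAlpha α lab δ Y (Function.update v α z) (flip o (plugR gs A)) = flip o T ∧
      Valid w T ∧ T.ino = P ++ [lab] ∧ T.hi = ⊤ := by
  have hlen : A.left.length ≤ (flip o (plugR gs A)).bananas.length := by
    have h1 := (length_le_bananas A).trans (length_bananas_plugR gs A)
    cases o
    · exact h1
    · simpa only [flip, if_true, length_bananas_mirror] using h1
  obtain ⟨gs', A', z', h', hz', hA', e⟩ := LastLeaf.raise o hδ hgap hinj _ h hz hlen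
  have hnd : (plugR gs' A').ino.Nodup := by rw [h'.ino_eq]; exact h'.nodup
  refine ⟨plugR gs' (Banana.mk lab A'.hi A'.left []), ?_, ?_, ?_, ?_⟩
  · rw [BananaTree.placeAlpha, e, modifyLo_flip o hnd h'.lo_eq, relabel_flip o h'.right_eq]
  · have hvA : Valid (Function.update v α z') A' := h'.valid.of_mem (mem_bananas_plugR _ _)
    have hupd : ∀ i ∈ P, Function.update v α z' i = v i := fun i hi =>
      Function.update_of_ne (h'.ne hi) _ _
    have hwu : ∀ i ∈ P, w i = Function.update v α z' i := fun i hi => (hw i hi).trans (hupd i hi).symm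
    have hin : ∀ C ∈ A'.left, ∀ i, i ∈ C.ino ∨ i = C.top → i ∈ P := fun C hC i hi =>
      h'.mem_left hC hi
    refine h'.valid.replaceR (B' := Banana.mk lab A'.hi A'.left []) rfl
      (.mk (fun C hC => ?_) (by simp) (fun C hC => ?_) (by simp) ?_ (by simp)) ?_ ?_
    · exact (hvA.valid_left C hC).congr fun i hi => hwu i (hin C hC i (Or.inl hi))
    · have hch := hvA.child_left C hC
      have hlo := hin C hC _ (Or.inl (lo_mem_ino C))
      refine ⟨hch.hi_eq, ?_, ?_, fun E hE => ?_, fun E hE => ?_⟩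
      · rw [hlab, hw _ hlo]
        exact lt_of_le_of_ne (hA' C hC) (hne _ hlo).symm
      · rw [hwu _ hlo, hwu _ (hin C hC _ (Or.inr rfl))]; exact hch.lt_top
      · rw [hwu _ (hin C hC _ (Or.inl (mem_ino.2 (Or.inr (Or.inl ⟨E, hE, Or.inr rfl⟩))))),
          hwu _ (hin C hC _ (Or.inr rfl))]
        exact hch.left_lt E hE
      · rw [hwu _ (hin C hC _ (Or.inl (mem_ino.2 (Or.inr (Or.inr ⟨E, hE, Or.inr rfl⟩))))),
          hwu _ (hin C hC _ (Or.inr rfl))]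
        exact hch.right_lt E hE
    · refine hvA.pairwise_left.imp_of_mem fun {E E'} hE hE' hlt => ?_
      rwa [hwu _ (hin E hE _ (Or.inr rfl)), hwu _ (hin E' hE' _ (Or.inr rfl))]
    · intro i hi hch
      have hgs : gs' ≠ [] := by rintro rfl; simp [tailR, tailL] at hi
      obtain ⟨f, fs, rfl⟩ := List.exists_cons_of_ne_nil hgs
      obtain ⟨t, ht⟩ := tailR_cons f fs A'.top
      have hiP : i ∈ P := by rw [h'.P_eq]; exact List.mem_append_left _ hi
      have hAP : A'.top ∈ P := by rw [h'.P_eq, ht]; simp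
      have h1 := hch.lo_lt
      rw [h'.lo_eq, Function.update_self, hupd i hiP] at h1
      -- The last element of `P` is `A'.top` if the trail is empty, and its lowest node otherwise.
      have haA : v a ≤ v A'.top := by
        have h2 := h'.P_eq
        rw [hP, ht] at h2
        cases hl : A'.left with
        | nil =>
          rw [hl, inoL_nil, List.append_nil] at h2
          have := List.append_inj_right' h2 rfl
          simp only [List.cons.injEq, and_true] at this
          rw [this]
        | cons C t' =>
          rw [hl, inoL_cons, ← List.append_assoc, ← List.append_assoc] at h2
          have := List.append_inj_right' h2 rfl
          simp only [List.cons.injEq, and_true] at this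
          have h3 := hch.left_lt C (by simp [hl])
          rw [hupd _ hAP, hupd _ (hin C (by simp [hl]) _ (Or.inr rfl)), ← this] at h3
          exact h3.le
      refine ⟨hch.hi_eq, ?_, ?_, fun C hC => ?_, by simp⟩
      · rw [lo_mk, hlab, hw i hiP]; exact hz' i hiP h1
      · change w lab < w A'.top
        rw [hlab, hw _ hAP]; linarith
      · change _ < w A'.top
        rw [hwu _ hAP, hwu _ (hin C hC _ (Or.inr rfl))]; exact hch.left_lt C hC
    · exact fun i hi => hwu i (by rw [h'.P_eq]; exact List.mem_append_left _ hi)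
  · rw [ino_plugR, ino_mk, h'.P_eq]; simp [top]
  · rw [← h'.hi_eq]; exact hi_plugR _ rfl

end

end Banana
end BananaTree

namespace BananaTree
namespace Banana

variable {v w : ℕ → ℝ}

/-! ### Insertion of a new leftmost or rightmost maximum -/

theorem insertLeft_eq (v : ℕ → ℝ) (a b : ℕ) (T : Banana) :
    insertLeft v a b T = mk T.lo T.hi (insertLeftTrail v a b T.left) T.right := by
  cases T; rw [insertLeft]; rfl

theorem insertLeftTrail_append (v : ℕ → ℝ) (a b : ℕ) (t : List Banana) (C : Banana) :
    insertLeftTrail v a b (t ++ [C]) = t ++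
      if height v C.hi < v b then [C, mk a b [] []] else [insertLeft v a b C] := by
  induction t with
  | nil => simp [insertLeftTrail]
  | cons E t ih =>
    cases t with
    | nil => simp [insertLeftTrail]
    | cons E' t => rw [List.cons_append, List.cons_append, insertLeftTrail, ← List.cons_append, ih]; simp

theorem insertRight_eq (v : ℕ → ℝ) (a b : ℕ) (T : Banana) :
    insertRight v a b T = (insertLeft v a b T.mirror).mirror := by
  refine ind (P := fun T => insertRight v a b T = (insertLeft v a b T.mirror).mirror)
    (fun lo hi l r _ hr => ?_) T
  have : ∀ t : List Banana, (∀ C ∈ t, insertRight v a b C = (insertLeft v a b C.mirror).mirror) →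
      insertRightTrail v a b t = (insertLeftTrail v a b (t.map mirror)).map mirror := fun t ht => by
    induction t with
    | nil => simp [insertLeftTrail, insertRightTrail, mirror_mk]
    | cons C t ih =>
      cases t with
      | nil =>
        simp only [insertRightTrail, List.map_cons, List.map_nil, insertLeftTrail, hi_mirror,
          ht C (by simp)]
        split_ifs <;> simp [mirror_mk]
      | cons E t =>
        rw [insertRightTrail, ih fun C hC => ht C (List.mem_cons_of_mem _ hC)]
        simp [insertLeftTrail]
  rw [insertRight, mirror_mk, insertLeft, mirror_mk, map_mirror_mirror, this r hr]

/-- The new maximum is inserted where the left spine passes its value. By `hhead` it exceeds the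
leftmost node, so it can be attached even where a left trail is empty; by `hgap` its hook exceeds
the minimum to which it is attached. The clause with `K` supplies the bound needed one level up. The
search uses `v`, whose value at `a` plays no role. -/
theorem insertLeft_spec {a b : ℕ} (hab : w a < w b) (T : Banana) (hT : Valid w T)
    (hv : ∀ i ∈ T.ino, v i = w i) (hvb : v b = w b) (hne : ∀ i ∈ T.ino, w i ≠ w b)
    (hgap : ∀ i ∈ T.ino, w i < w b → w i < w a) (hhead : ∀ i ∈ T.ino.head?, w i < w b) :
    Valid w (insertLeft v a b T) ∧ (insertLeft v a b T).ino = a :: b :: T.ino ∧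
      ∀ K, w b < K → (∀ C ∈ T.left, w C.top < K) → ∀ C ∈ (insertLeft v a b T).left, w C.top < K := by
  revert hT hv hne hgap hhead
  refine ind (P := fun T => Valid w T → (∀ i ∈ T.ino, v i = w i) → (∀ i ∈ T.ino, w i ≠ w b) →
    (∀ i ∈ T.ino, w i < w b → w i < w a) → (∀ i ∈ T.ino.head?, w i < w b) →
    Valid w (insertLeft v a b T) ∧ (insertLeft v a b T).ino = a :: b :: T.ino ∧
      ∀ K, w b < K → (∀ C ∈ T.left, w C.top < K) → ∀ C ∈ (insertLeft v a b T).left, w C.top < K)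
    (fun lo hi l r hl _ hT hv hne hgap hhead => ?_) T
  have vN : Valid w (mk a b [] []) := .mk (by simp) (by simp) (by simp) (by simp) (by simp) (by simp)
  have cN : w lo < w b → Child w lo (mk a b [] []) := fun h =>
    ⟨rfl, hgap lo (by simp [ino_mk]) h, hab, by simp, by simp⟩
  rcases List.eq_nil_or_concat l with rfl | ⟨t, C, rfl⟩
  · have hlo : w lo < w b := hhead lo (by simp [ino_mk])
    rw [insertLeft_eq]
    simp only [left_mk, lo_mk, hi_mk, right_mk, insertLeftTrail]
    refine ⟨.mk (by simpa using vN) hT.valid_right (by simpa using cN hlo) hT.child_right (by simp)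
      hT.pairwise_right, by simp [ino_mk, inoL_cons], fun K hK _ C hC => ?_⟩
    rw [List.mem_singleton.1 hC]; exact hK
  · rw [List.concat_eq_append] at *
    have hC : C ∈ (mk lo hi (t ++ [C]) r).left := by simp
    have hch := hT.child_left C hC
    have hCv := hT.valid_left C hC
    have hCi : ∀ i, i ∈ C.ino ∨ i = C.top → i ∈ (mk lo hi (t ++ [C]) r).ino := fun i hi =>
      mem_ino.2 (Or.inr (Or.inl ⟨C, hC, hi⟩))
    have hCt := hCi _ (Or.inr rfl)
    obtain ⟨p1, -, p3⟩ := List.pairwise_append.1 hT.pairwise_left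
    have hheight : height v C.hi < v b ↔ w C.top < w b := by
      rw [hch.hi_eq]
      change ((v C.top : ℝ) : WithTop ℝ) < _ ↔ _
      rw [WithTop.coe_lt_coe, hv _ hCt, hvb]
    rw [insertLeft_eq]
    simp only [left_mk, lo_mk, hi_mk, right_mk, insertLeftTrail_append, hheight]
    split_ifs with hlt
    · have hlo : w lo < w b := (hch.lo_lt.trans hch.lt_top).trans hlt
      have hall : ∀ E ∈ t ++ [C], w E.top < w b := fun E hE => by
        rcases List.mem_append.1 hE with hE | hE
        · exact (p3 E hE C (by simp)).trans hlt
        · rw [List.mem_singleton.1 hE]; exact hlt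
      have e : t ++ [C, mk a b [] []] = (t ++ [C]) ++ [mk a b [] []] := by simp
      rw [e]
      refine ⟨.mk ?_ hT.valid_right ?_ hT.child_right ?_ hT.pairwise_right, ?_, ?_⟩
      · intro E hE
        rcases List.mem_append.1 hE with hE | hE
        · exact hT.valid_left E hE
        · rw [List.mem_singleton.1 hE]; exact vN
      · intro E hE
        rcases List.mem_append.1 hE with hE | hE
        · exact hT.child_left E hE
        · rw [List.mem_singleton.1 hE]; exact cN hlo
      · exact List.pairwise_append.2 ⟨hT.pairwise_left, by simp, fun E hE E' hE' => by
          rw [List.mem_singleton.1 hE']; exact hall E hE⟩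
      · rw [ino_mk, ino_mk, inoL_append]; simp [inoL_cons, ino_mk]
      · intro K hK h1 E hE
        rcases List.mem_append.1 hE with hE | hE
        · exact h1 E hE
        · rw [List.mem_singleton.1 hE]; exact hK
    · have hbC : w b < w C.top := lt_of_le_of_ne (not_lt.1 hlt) (hne _ hCt).symm
      obtain ⟨i1, i2, i3⟩ := hl C (by simp) hCv (fun i hi => hv i (hCi i (Or.inl hi)))
        (fun i hi => hne i (hCi i (Or.inl hi))) (fun i hi => hgap i (hCi i (Or.inl hi)))
        (fun i hi => hhead i (by
          rw [ino_mk, inoL_append, inoL_cons, inoL_nil, List.nil_append]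
          have : C.ino ≠ [] := List.ne_nil_of_mem (lo_mem_ino C)
          obtain ⟨c, s, e⟩ := List.exists_cons_of_ne_nil this
          rw [e] at hi ⊢
          simpa using hi))
      have hIlo : (insertLeft v a b C).lo = C.lo := by rw [insertLeft_eq]; rfl
      have hIhi : (insertLeft v a b C).hi = C.hi := by rw [insertLeft_eq]; rfl
      have hIr : (insertLeft v a b C).right = C.right := by rw [insertLeft_eq]; rfl
      have hIt : (insertLeft v a b C).top = C.top := by rw [top, top, hIhi]
      have hIc : Child w lo (insertLeft v a b C) := by
        refine ⟨by rw [hIhi, hIt]; exact hch.hi_eq, by rw [hIlo]; exact hch.lo_lt,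
          by rw [hIlo, hIt]; exact hch.lt_top, fun E hE => ?_, fun E hE => ?_⟩
        · rw [hIt]; exact i3 _ hbC hch.left_lt E hE
        · rw [hIt]; rw [hIr] at hE; exact hch.right_lt E hE
      refine ⟨.mk ?_ hT.valid_right ?_ hT.child_right ?_ hT.pairwise_right, ?_, ?_⟩
      · intro E hE
        rcases List.mem_append.1 hE with hE | hE
        · exact hT.valid_left E (by simp [hE])
        · rw [List.mem_singleton.1 hE]; exact i1
      · intro E hE
        rcases List.mem_append.1 hE with hE | hE
        · exact hT.child_left E (by simp [hE])
        · rw [List.mem_singleton.1 hE]; exact hIc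
      · exact List.pairwise_append.2 ⟨p1, by simp, fun E hE E' hE' => by
          rw [List.mem_singleton.1 hE', hIt]; exact p3 E hE C (by simp)⟩
      · rw [ino_mk, ino_mk, inoL_append, inoL_append]; simp [inoL_cons, i2, hIt]
      · intro K hK h1 E hE
        rcases List.mem_append.1 hE with hE | hE
        · exact h1 E (by simp [hE])
        · rw [List.mem_singleton.1 hE, hIt]; exact h1 C (by simp)

theorem insertLeft_valid {a b : ℕ} {T : Banana} {Q : List ℕ} (hab : w a < w b) (hT : Valid v T)
    (hQ : T.ino = Q) (hv : ∀ i ∈ Q, w i = v i) (hvb : w b = v b) (hne : ∀ i ∈ Q, v i ≠ v b)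
    (hgap : ∀ i ∈ Q, v i < v b → v i < w a) (hhead : ∀ i ∈ Q.head?, v i < v b) :
    Valid w (insertLeft v a b T) ∧ (insertLeft v a b T).ino = a :: b :: Q := by
  subst hQ
  have := insertLeft_spec (v := v) hab T (hT.congr hv) (fun i hi => (hv i hi).symm) hvb.symm
    (fun i hi => by rw [hv i hi, hvb]; exact hne i hi)
    (fun i hi => by rw [hv i hi, hvb]; exact hgap i hi)
    (fun i hi => by rw [hv i (List.mem_of_mem_head? hi), hvb]; exact hhead i hi)
  exact ⟨this.1, this.2.1⟩

theorem hi_insertLeft (v : ℕ → ℝ) (a b : ℕ) (T : Banana) : (insertLeft v a b T).hi = T.hi := by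
  rw [insertLeft_eq]; rfl

end Banana
end BananaTree

namespace BananaTree

variable {c : ℕ → ℝ} {ε : ℝ} {s t : ℕ}

/-! ### Critical points of a list -/

theorem mem_critPoints {v : ℕ → ℝ} (hst : s < t) {i : ℕ} : i ∈ critPoints v s t ↔
    (i + 1 = s ∧ IsMaxItem v s) ∨ (s ≤ i ∧ i ≤ t ∧ (IsMaxItem v i ∨ IsMinItem v i)) ∨
    (i = t + 1 ∧ IsMaxItem v t) := by
  rw [critPoints, List.mem_filter, List.mem_range, decide_eq_true_iff]
  exact ⟨fun h => h.2, fun h => ⟨by omega, h⟩⟩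

theorem sorted_critPoints (v : ℕ → ℝ) (s t : ℕ) : (critPoints v s t).Pairwise (· < ·) :=
  List.Pairwise.filter _ List.pairwise_lt_range

theorem hooked_item {i : ℕ} (h1 : s ≤ i) (h2 : i ≤ t) : hooked c ε s t i = c i := by
  rw [hooked, if_neg (by omega), if_neg (by omega)]

theorem neg_hooked (c : ℕ → ℝ) (ε : ℝ) (s t : ℕ) :
    (fun i => -hooked c ε s t i) = hooked (fun i => -c i) ε s t := by
  funext i
  have h : ∀ x y : ℝ, (SignType.sign (-x - -y) : ℝ) = -(SignType.sign (x - y) : ℝ) := fun x y => by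
    rw [show -x - -y = -(x - y) by ring, Left.sign_neg]; simp
  simp only [hooked, h]
  split_ifs <;> ring

theorem isMaxItem_neg {v : ℕ → ℝ} {i : ℕ} : IsMaxItem (fun i => -v i) i ↔ IsMinItem v i := by
  simp [IsMaxItem, IsMinItem]

theorem isMinItem_neg {v : ℕ → ℝ} {i : ℕ} : IsMinItem (fun i => -v i) i ↔ IsMaxItem v i := by
  simp [IsMaxItem, IsMinItem]

/-- A list of distinct numbers at positions `s, …, t` with differences larger than `ε`. -/
structure Spread (c : ℕ → ℝ) (ε : ℝ) (s t : ℕ) : Prop where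
  one_le : 1 ≤ s
  lt : s < t
  pos : 0 < ε
  gap : ∀ i, s ≤ i → i ≤ t → ∀ j, s ≤ j → j ≤ t → i ≠ j → ε < |c i - c j|

namespace Spread

variable (h : Spread c ε s t)
include h

theorem neg : Spread (fun i => -c i) ε s t :=
  ⟨h.one_le, h.lt, h.pos, fun i h1 h2 j h3 h4 hne => by
    rw [show -c i - -c j = -(c i - c j) by ring, abs_neg]; exact h.gap i h1 h2 j h3 h4 hne⟩

theorem lt_or {i j : ℕ} (hi : s ≤ i ∧ i ≤ t) (hj : s ≤ j ∧ j ≤ t) (hne : i ≠ j) :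
    c i + ε < c j ∨ c j + ε < c i := by
  rcases lt_abs.1 (h.gap i hi.1 hi.2 j hj.1 hj.2 hne) with h1 | h1
  · right; linarith
  · left; linarith

theorem hook_left : (c s < c (s + 1) ∧ hooked c ε s t (s - 1) = c s + ε) ∨
    (c (s + 1) < c s ∧ hooked c ε s t (s - 1) = c s - ε) := by
  have h1 := h.one_le
  have h2 := h.lt
  rw [hooked, if_pos (by omega)]
  have hp := h.pos
  rcases h.lt_or (i := s) (j := s + 1) (by omega) (by omega) (by omega) with h3 | h3
  · exact Or.inl ⟨by linarith, by rw [sign_pos (by linarith)]; simp⟩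
  · exact Or.inr ⟨by linarith, by rw [sign_neg (by linarith)]; simp; ring⟩

theorem hook_right : (c t < c (t - 1) ∧ hooked c ε s t (t + 1) = c t + ε) ∨
    (c (t - 1) < c t ∧ hooked c ε s t (t + 1) = c t - ε) := by
  have h2 := h.lt
  rw [hooked, if_neg (by omega), if_pos (by omega)]
  have hp := h.pos
  rcases h.lt_or (i := t) (j := t - 1) (by omega) (by omega) (by omega) with h3 | h3
  · exact Or.inl ⟨by linarith, by rw [sign_pos (by linarith)]; simp⟩
  · exact Or.inr ⟨by linarith, by rw [sign_neg (by linarith)]; simp; ring⟩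

theorem isMax_left : IsMaxItem (hooked c ε s t) s ↔ c (s + 1) < c s := by
  have h2 := h.lt
  have hp := h.pos
  rw [IsMaxItem, hooked_item le_rfl h2.le, hooked_item (i := s + 1) (by omega) (by omega)]
  rcases h.hook_left with ⟨h3, h4⟩ | ⟨h3, h4⟩ <;> rw [h4] <;> constructor <;> intro h5
  · exact h5.2
  · linarith
  · exact h3
  · exact ⟨by linarith, h3⟩

theorem isMax_right : IsMaxItem (hooked c ε s t) t ↔ c (t - 1) < c t := by
  have h2 := h.lt
  have hp := h.pos
  rw [IsMaxItem, hooked_item h2.le le_rfl, hooked_item (i := t - 1) (by omega) (by omega)]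
  rcases h.hook_right with ⟨h3, h4⟩ | ⟨h3, h4⟩ <;> rw [h4] <;> constructor <;> intro h5
  · exact h5.1
  · linarith
  · exact h3
  · exact ⟨h3, by linarith⟩

theorem isMin_left : IsMinItem (hooked c ε s t) s ↔ c s < c (s + 1) := by
  rw [← isMaxItem_neg, neg_hooked, h.neg.isMax_left]; simp

theorem isMin_right : IsMinItem (hooked c ε s t) t ↔ c t < c (t - 1) := by
  rw [← isMaxItem_neg, neg_hooked, h.neg.isMax_right]; simp

theorem left_mem : s ∈ critPoints (hooked c ε s t) s t := by
  refine (mem_critPoints h.lt).2 (Or.inr (Or.inl ⟨le_rfl, h.lt.le, ?_⟩))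
  rw [h.isMax_left, h.isMin_left]
  have := h.hook_left
  tauto

theorem right_mem : t ∈ critPoints (hooked c ε s t) s t := by
  refine (mem_critPoints h.lt).2 (Or.inr (Or.inl ⟨h.lt.le, le_rfl, ?_⟩))
  rw [h.isMax_right, h.isMin_right]
  have := h.hook_right
  tauto

/-- The value of a critical point is that of an item, or it is the value of a hook. -/
theorem crit_cases {i : ℕ} (hi : i ∈ critPoints (hooked c ε s t) s t) :
    (s ≤ i ∧ i ≤ t ∧ hooked c ε s t i = c i) ∨ (i + 1 = s ∧ hooked c ε s t i = c s - ε) ∨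
    (i = t + 1 ∧ hooked c ε s t i = c t - ε) := by
  rcases (mem_critPoints h.lt).1 hi with ⟨h1, h2⟩ | ⟨h1, h2, -⟩ | ⟨h1, h2⟩
  · right; left
    have e : i = s - 1 := by omega
    rw [h.isMax_left] at h2
    refine ⟨h1, ?_⟩
    rcases h.hook_left with ⟨h3, -⟩ | ⟨-, h3⟩
    · linarith
    · rw [e, h3]
  · exact Or.inl ⟨h1, h2, hooked_item h1 h2⟩
  · right; right
    rw [h.isMax_right] at h2
    refine ⟨h1, ?_⟩
    rcases h.hook_right with ⟨h3, -⟩ | ⟨-, h3⟩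
    · linarith
    · rw [h1, h3]

/-- Items differ by more than `ε` and a critical hook is `ε` below its item, so only an item and its
own hook can be as close as `ε`. This pair is excluded by `h1` and `h2`. -/
theorem hook_gap {i j : ℕ} (hi : i ∈ critPoints (hooked c ε s t) s t) (hj : s ≤ j ∧ j ≤ t)
    (hij : i ≠ j) (h1 : i + 1 = s → j ≠ s) (h2 : i = t + 1 → j ≠ t)
    (hlt : hooked c ε s t i < c j) : hooked c ε s t i < c j - ε := by
  have hst := h.lt
  have hp := h.pos
  rcases h.crit_cases hi with ⟨h3, h4, e⟩ | ⟨h3, e⟩ | ⟨h3, e⟩ <;> rw [e] at hlt ⊢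
  · rcases h.lt_or ⟨h3, h4⟩ hj hij with h5 | h5 <;> linarith
  · rcases h.lt_or ⟨le_rfl, hst.le⟩ hj (h1 h3).symm with h5 | h5 <;> linarith
  · rcases h.lt_or ⟨hst.le, le_rfl⟩ hj (h2 h3).symm with h5 | h5 <;> linarith

theorem inj {i j : ℕ} (hi : i ∈ critPoints (hooked c ε s t) s t)
    (hj : j ∈ critPoints (hooked c ε s t) s t) (e : hooked c ε s t i = hooked c ε s t j) : i = j := by
  have hst := h.lt
  have hp := h.pos
  have key : ∀ i j, i ∈ critPoints (hooked c ε s t) s t → s ≤ j → j ≤ t → i ≠ j →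
      hooked c ε s t i ≠ c j := fun i j hi hj1 hj2 hne e => by
    rcases h.crit_cases hi with ⟨h3, h4, e'⟩ | ⟨h3, e'⟩ | ⟨h3, e'⟩ <;> rw [e'] at e
    · rcases h.lt_or ⟨h3, h4⟩ ⟨hj1, hj2⟩ hne with h5 | h5 <;> linarith
    · by_cases hs : s = j
      · rw [hs] at e; linarith
      · rcases h.lt_or ⟨le_rfl, hst.le⟩ ⟨hj1, hj2⟩ hs with h5 | h5 <;> linarith
    · by_cases hs : t = j
      · rw [hs] at e; linarith
      · rcases h.lt_or ⟨hst.le, le_rfl⟩ ⟨hj1, hj2⟩ hs with h5 | h5 <;> linarith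
  by_contra hne
  rcases h.crit_cases hj with ⟨h3, h4, e'⟩ | hj'
  · exact key i j hi h3 h4 hne (e.trans e')
  · rcases h.crit_cases hi with ⟨h3, h4, e''⟩ | hi'
    · exact key j i hj h3 h4 (Ne.symm hne) (e.symm.trans e'')
    · have := h.lt_or (i := s) (j := t) (by omega) (by omega) (by omega)
      rcases hj' with ⟨h5, e2⟩ | ⟨h5, e2⟩ <;> rcases hi' with ⟨h6, e1⟩ | ⟨h6, e1⟩ <;>
        first | omega | (rcases this with h7 | h7 <;> linarith)

theorem pairwise_ne : (critPoints (hooked c ε s t) s t).Pairwise fun i j =>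
    hooked c ε s t i ≠ hooked c ε s t j :=
  (sorted_critPoints _ _ _).imp_of_mem fun hi hj hlt e => by have := h.inj hi hj e; omega

theorem mem_neg_iff {i : ℕ} (h1 : s ≤ i) (h2 : i ≤ t) :
    i ∈ critPoints (fun i => -hooked c ε s t i) s t ↔ i ∈ critPoints (hooked c ε s t) s t := by
  rw [mem_critPoints h.lt, mem_critPoints h.lt, isMaxItem_neg, isMinItem_neg, isMaxItem_neg,
    isMaxItem_neg]
  constructor <;> rintro (h3 | h3 | h3) <;> first | omega | exact Or.inr (Or.inl (by tauto))

/-- An item is critical for the map exactly if it is for its negative, so the lists differ in hooks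
only. A critical hook is just below its item and by `Spread.hook_gap` compares with all other
critical points like the item. -/
theorem endsAgree {pos : ℕ → ℤ} (hm : ∀ i j, pos i < pos j ↔ i < j) :
    Banana.EndsAgree (hooked c ε s t) pos (critPoints (hooked c ε s t) s t)
      (critPoints (fun i => -hooked c ε s t i) s t) := by
  have hst := h.lt
  have hp := h.pos
  have hle : ∀ i j, i ≤ j → pos i ≤ pos j := fun i j hij => not_lt.1 fun hlt => by
    rw [hm] at hlt; omega
  have hrange : ∀ w : ℕ → ℝ, ∀ k ∈ critPoints w s t, s ≤ k + 1 ∧ k ≤ t + 1 := fun w k hk => by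
    have := (mem_critPoints hst).1 hk; omega
  have hcmp : ∀ i j k, s ≤ j → j ≤ t → hooked c ε s t i = c j - ε →
      k ∈ critPoints (hooked c ε s t) s t → j ∈ critPoints (hooked c ε s t) s t → k ≠ j →
      (k + 1 = s → j ≠ s) → (k = t + 1 → j ≠ t) →
      ((hooked c ε s t k < hooked c ε s t i ↔ hooked c ε s t k < hooked c ε s t j) ∧
      (hooked c ε s t i < hooked c ε s t k ↔ hooked c ε s t j < hooked c ε s t k)) := by
    intro i j k hj1 hj2 e hk hj hkj h1 h2
    have h3 := h.hook_gap hk ⟨hj1, hj2⟩ hkj h1 h2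
    have h4 : hooked c ε s t k ≠ c j := fun e' =>
      hkj (h.inj hk hj (by rw [e', hooked_item hj1 hj2]))
    rw [e, hooked_item hj1 hj2]
    refine ⟨⟨fun h5 => by linarith, h3⟩, fun h5 => ?_, fun h5 => by linarith⟩
    by_contra h6
    have := h3 (lt_of_le_of_ne (not_lt.1 h6) h4)
    linarith
  refine ⟨fun i hi hi' => ?_, fun i hi hi' => ?_⟩
  · rcases h.crit_cases hi with ⟨h1, h2, -⟩ | ⟨h1, e⟩ | ⟨h1, e⟩
    · exact absurd ((h.mem_neg_iff h1 h2).2 hi) hi'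
    · exact Or.inl ⟨s, h.left_mem, (hm _ _).2 (by omega),
        fun k hk hki => hle _ _ (by have := hrange _ k hk; omega), fun k hk hki hks =>
        hcmp i s k le_rfl hst.le e hk h.left_mem hks (by omega) (by omega)⟩
    · exact Or.inr ⟨t, h.right_mem, (hm _ _).2 (by omega),
        fun k hk hki => hle _ _ (by have := hrange _ k hk; omega), fun k hk hki hks =>
        hcmp i t k hst.le le_rfl e hk h.right_mem hks (by omega) (by omega)⟩
  · have hr := hrange _ i hi
    by_cases h1 : s ≤ i ∧ i ≤ t
    · exact absurd ((h.mem_neg_iff h1.1 h1.2).1 hi) hi'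
    · rcases (by omega : i + 1 = s ∨ i = t + 1) with h2 | h2
      · exact Or.inl fun k hk => hle _ _ (by have := hrange _ k hk; omega)
      · exact Or.inr fun k hk => hle _ _ (by have := hrange _ k hk; omega)

end Spread

theorem _root_.BananaTree.Banana.EndsAgree.neg {v : ℕ → ℝ} {pos : ℕ → ℤ} {l l' : List ℕ}
    (h : Banana.EndsAgree (fun i => -v i) pos l l') : Banana.EndsAgree v pos l l' := by
  refine ⟨fun i hi hi' => ?_, h.right⟩
  refine (h.left i hi hi').imp ?_ ?_ <;> rintro ⟨j, h1, h2, h3, h4⟩ <;>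
    exact ⟨j, h1, h2, h3, fun k hk hki hkj => by
      have := h4 k hk hki hkj; simp only [neg_lt_neg_iff] at this; exact this.symm⟩

/-! ### Monotonicity between consecutive critical points -/

/-- A rise can only be ended by a maximum. -/
theorem rising_right {v : ℕ → ℝ} {k₀ b : ℕ} (h : v k₀ < v (k₀ + 1))
    (hmax : ∀ k, k₀ < k → k < b → ¬ IsMaxItem v k) (hne : ∀ k, k₀ < k → k < b → v (k + 1) ≠ v k)
    (hb : k₀ < b) : v (b - 1) < v b ∧ v (k₀ + 1) ≤ v b := by
  obtain ⟨n, rfl⟩ : ∃ n, b = k₀ + 1 + n := ⟨b - k₀ - 1, by omega⟩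
  induction n with
  | zero => exact ⟨by simpa using h, le_rfl⟩
  | succ n ih =>
    obtain ⟨h1, h2⟩ := ih (fun k hk hk' => hmax k hk (by omega)) (fun k hk hk' => hne k hk (by omega))
      (by omega)
    have h3 := hmax (k₀ + 1 + n) (by omega) (by omega)
    have h4 : v (k₀ + 1 + n) < v (k₀ + 1 + n + 1) := by
      by_contra h5
      exact h3 ⟨h1, lt_of_le_of_ne (not_lt.1 h5) (hne _ (by omega) (by omega))⟩
    exact ⟨h4, h2.trans h4.le⟩

theorem rising_left {v : ℕ → ℝ} {k₀ a : ℕ} (h : v k₀ < v (k₀ + 1))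
    (hmin : ∀ k, a < k → k ≤ k₀ → ¬ IsMinItem v k) (hne : ∀ k, a < k → k ≤ k₀ → v (k - 1) ≠ v k)
    (ha : a ≤ k₀) : v a ≤ v k₀ := by
  obtain ⟨n, rfl⟩ : ∃ n, k₀ = a + n := ⟨k₀ - a, by omega⟩
  clear ha
  induction n with
  | zero => exact le_rfl
  | succ n ih =>
    have h1 := hmin (a + (n + 1)) (by omega) le_rfl
    have h4 : v (a + n) < v (a + n + 1) := by
      by_contra h5
      exact h1 ⟨lt_of_le_of_ne (not_lt.1 h5) (hne (a + (n + 1)) (by omega) le_rfl).symm, h⟩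
    exact (ih h4 (fun k hk hk' => hmin k hk (by omega)) (fun k hk hk' => hne k hk (by omega))).trans
      h4.le

end BananaTree

namespace BananaTree

open Banana

variable {c : ℕ → ℝ} {ε : ℝ} {m ℓ : ℕ}

/-! ### Cutting a list -/

theorem IsUpTree.good {v : ℕ → ℝ} {pos : ℕ → ℤ} {s t : ℕ} {T : Banana} (h : IsUpTree v s t T)
    (hd : (critPoints v s t).Pairwise fun i j => v i ≠ v j) (hm : ∀ i j, pos i < pos j ↔ i < j) :
    Good v pos T ∧ T.ino = critPoints v s t ∧ T.hi = ⊤ := by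
  obtain ⟨h1, h2, h3⟩ := h.valid hd
  exact ⟨⟨h1, by rw [h2]; exact (sorted_critPoints v s t).imp fun h => (hm _ _).2 h⟩, h2, h3⟩

/-- `a` and `b` are the critical items nearest to the cut; they exist because the first and the last
item are always critical. The map is monotone between them, so the midpoint value of the edge that
is cut lies strictly between theirs. -/
theorem Spread.exists_setting (h : Spread c ε 1 m) (h1 : 1 ≤ ℓ) (h2 : ℓ < m) {f : ℕ → ℝ}
    (hf : f = hooked c ε 1 m) {pos : ℕ → ℤ} (hm : ∀ i j, pos i < pos j ↔ i < j)
    (hℓ : ∀ i, pos i < 0 ↔ i ≤ ℓ) (h0 : ∀ i, pos i ≠ 0) {U D : Banana} (hU : IsUpTree f 1 m U)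
    (hD : IsDownTree f 1 m D) :
    ∃ a b, Setting f pos ((f ℓ + f (ℓ + 1)) / 2) U D a b ∧ (IsMaxItem f b ↔ f a < f b) ∧
      (IsMaxItem (fun i => -f i) b ↔ -f a < -f b) ∧
      Cut (fun i => -f i) pos (-((f ℓ + f (ℓ + 1)) / 2)) D.ino a b ∧
      U.ino = critPoints f 1 m ∧ D.ino = critPoints (fun i => -f i) 1 m ∧ 1 ≤ a ∧ b ≤ m ∧
      ((f ℓ < f (ℓ + 1) ∧ f a ≤ f ℓ ∧ f (ℓ + 1) ≤ f b) ∨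
        (f (ℓ + 1) < f ℓ ∧ f ℓ ≤ f a ∧ f b ≤ f (ℓ + 1))) := by
  have hle : ∀ i j, pos i ≤ pos j ↔ i ≤ j := fun i j => by rw [← not_lt, hm, not_lt]
  have hp := h.pos
  have hpos : ∀ i, 0 < pos i ↔ ℓ < i := fun i => (lt_iff_pos h0 hℓ i).symm
  have hneg := neg_hooked c ε 1 m
  rw [← hf] at hneg
  have l1 := h.left_mem
  have l2 := h.right_mem
  have hmem := fun i => h.mem_neg_iff (i := i)
  have hag := h.endsAgree hm
  have hag' := h.neg.endsAgree hm
  have hinj : ∀ i ∈ critPoints f 1 m, ∀ j ∈ critPoints f 1 m, f i = f j → i = j := by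
    rw [hf]; exact fun i hi j hj => h.inj hi hj
  have hinj' : ∀ i ∈ critPoints (fun i => -f i) 1 m, ∀ j ∈ critPoints (fun i => -f i) 1 m,
      f i = f j → i = j := fun i hi j hj e => by
    rw [hneg] at hi hj
    refine h.neg.inj hi hj ?_
    rw [← hneg]; exact congrArg Neg.neg e
  have hpw := h.pairwise_ne
  have hpw' := h.neg.pairwise_ne
  have hitem : ∀ i, 1 ≤ i → i ≤ m → f i = c i := fun i hi hi' => by rw [hf]; exact hooked_item hi hi'
  rw [← hneg] at hag' hpw'
  rw [← hf] at l1 l2 hmem hag hpw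
  simp only [neg_neg] at hag'
  obtain ⟨gU, iU, tU⟩ := hU.good hpw hm
  obtain ⟨gD, iD, tD⟩ := IsUpTree.good hD hpw' hm
  obtain ⟨a, ha, ha1, ha2⟩ := exists_nearest_neg (pos := pos) (P := fun i => i ≤ ℓ) ⟨1, l1, h1⟩
  obtain ⟨b, hb, hb1, hb2⟩ := exists_nearest (pos := pos) (P := fun i => ℓ < i) ⟨m, l2, h2⟩
  simp only [hle] at ha2 hb2
  have a1 := ha2 1 l1 h1
  have b1 := hb2 m l2 h2
  have hcr : ∀ k, 1 ≤ k → k ≤ m → IsMaxItem f k ∨ IsMinItem f k → k ∈ critPoints f 1 m :=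
    fun k k1 k2 k3 => (mem_critPoints h.lt).2 (Or.inr (Or.inl ⟨k1, k2, k3⟩))
  have hne : ∀ k, 1 ≤ k → k < m → f (k + 1) ≠ f k := fun k k1 k2 e => by
    rw [hitem k k1 k2.le, hitem (k + 1) (by omega) (by omega)] at e
    rcases h.lt_or (i := k) (j := k + 1) (by omega) (by omega) (by omega) with h3 | h3 <;> linarith
  have hne' : ∀ k, a < k → k ≤ ℓ → f (k - 1) ≠ f k := fun k k1 k2 e =>
    hne (k - 1) (by omega) (by omega) (by rw [e]; congr 1; omega)
  have hmid : ∀ k, a < k → k < b → ¬ (IsMaxItem f k ∨ IsMinItem f k) := fun k k1 k2 k3 => by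
    have hk := hcr k (by omega) (by omega) k3
    rcases Nat.lt_or_ge ℓ k with h3 | h3
    · have := hb2 k hk h3; omega
    · have := ha2 k hk h3; omega
  have hgap : ∀ w : ℕ → ℝ, (∀ i, 1 ≤ i → i ≤ m → (i ∈ critPoints w 1 m ↔ i ∈ critPoints f 1 m)) →
      ∀ i ∈ critPoints w 1 m, pos i ≤ pos a ∨ pos b ≤ pos i := fun w hw i hi => by
    rw [hle, hle]
    by_cases hi' : 1 ≤ i ∧ i ≤ m
    · have := (hw i hi'.1 hi'.2).1 hi
      rcases Nat.lt_or_ge ℓ i with h3 | h3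
      · exact Or.inr (hb2 i this h3)
      · exact Or.inl (ha2 i this h3)
    · omega
  have hbcr : IsMaxItem f b ∨ IsMinItem f b := by
    rcases (mem_critPoints h.lt).1 hb with h3 | h3 | h3
    · omega
    · exact h3.2.2
    · omega
  have hedge : (f ℓ < f (ℓ + 1) ∧ f (b - 1) < f b ∧ f a ≤ f ℓ ∧ f (ℓ + 1) ≤ f b) ∨
      (f (ℓ + 1) < f ℓ ∧ f b < f (b - 1) ∧ f ℓ ≤ f a ∧ f b ≤ f (ℓ + 1)) := by
    rcases lt_or_gt_of_ne (hne ℓ h1 h2) with h3 | h3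
    · right
      -- A fall is a rise of the negative map, with maxima and minima exchanged.
      have h4 : (fun i => -f i) ℓ < (fun i => -f i) (ℓ + 1) := neg_lt_neg h3
      have h5 := rising_right h4 (b := b) (fun k k1 k2 => by
        rw [isMaxItem_neg]; exact fun k3 => hmid k (by omega) k2 (Or.inr k3))
        (fun k k1 k2 e => hne k (by omega) (by omega) (neg_injective e)) hb1
      have h6 := rising_left h4 (a := a) (fun k k1 k2 => by
        rw [isMinItem_neg]; exact fun k3 => hmid k k1 (by omega) (Or.inl k3))
        (fun k k1 k2 e => hne' k k1 k2 (neg_injective e)) ha1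
      simp only [neg_lt_neg_iff, neg_le_neg_iff] at h5 h6
      exact ⟨h3, h5.1, h6, h5.2⟩
    · left
      have h5 := rising_right h3 (b := b) (fun k k1 k2 k3 => hmid k (by omega) k2 (Or.inl k3))
        (fun k k1 k2 => hne k (by omega) (by omega)) hb1
      have h6 := rising_left h3 (a := a) (fun k k1 k2 k3 => hmid k k1 (by omega) (Or.inr k3))
        hne' ha1
      exact ⟨h3, h5.1, h6, h5.2⟩
  have hab : (f a < (f ℓ + f (ℓ + 1)) / 2 ∧ (f ℓ + f (ℓ + 1)) / 2 < f b) ∨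
      (f b < (f ℓ + f (ℓ + 1)) / 2 ∧ (f ℓ + f (ℓ + 1)) / 2 < f a) := by
    rcases hedge with ⟨h3, -, h5, h6⟩ | ⟨h3, -, h5, h6⟩
    · left; constructor <;> linarith
    · right; constructor <;> linarith
  refine ⟨a, b, ⟨h0, gU, gD, tU, tD, by rwa [iU], by rwa [iD], ?_, by rwa [iU, iD], ?_⟩, ?_, ?_, ?_, iU,
    iD, a1, b1, by tauto⟩
  · rw [iU]
    exact ⟨ha, hb, (hℓ a).2 ha1, (hpos b).2 hb1, hgap f fun i _ _ => Iff.rfl, hab⟩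
  · rw [iU, iD]
    exact hag'.neg
  · rcases hedge with ⟨h3, h4, h5, h6⟩ | ⟨h3, h4, h5, h6⟩
    · refine ⟨fun _ => by linarith, fun _ => hbcr.resolve_right fun h7 => ?_⟩
      exact lt_asymm h4 h7.1
    · exact ⟨fun h7 => absurd h7.1 (lt_asymm h4), fun h7 => by linarith⟩
  · rw [isMaxItem_neg, neg_lt_neg_iff]
    rcases hedge with ⟨h3, h4, h5, h6⟩ | ⟨h3, h4, h5, h6⟩
    · exact ⟨fun h7 => absurd h7.1 (lt_asymm h4), fun h7 => by linarith⟩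
    · refine ⟨fun _ => by linarith, fun _ => hbcr.resolve_left fun h7 => ?_⟩
      exact lt_asymm h4 h7.1
  · rw [iD]
    refine ⟨(hmem a a1 (by omega)).2 ha, (hmem b (by omega) b1).2 hb, (hℓ a).2 ha1, (hpos b).2 hb1,
      hgap _ hmem, ?_⟩
    simp only [neg_lt_neg_iff]
    tauto

theorem hooked_left_eq {i : ℕ} (hi : i ≤ ℓ) (hm : ℓ ≤ m) :
    hooked c ε 1 ℓ i = hooked c ε 1 m i := by
  simp only [hooked]
  split_ifs <;> first | omega | rfl

theorem hooked_right_eq {i : ℕ} (hi : ℓ < i) : hooked c ε (ℓ + 1) m i = hooked c ε 1 m i := by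
  simp only [hooked]
  split_ifs <;> first | omega | rfl

section

variable (h : Spread c ε 1 m) {X Z : List ℕ} (hXZ : X ++ Z = critPoints (hooked c ε 1 m) 1 m)
  (hX : ∀ i ∈ X, i ≤ ℓ) (hZ : ∀ i ∈ Z, ℓ < i)
include h hXZ hX hZ

/-- An item before `ℓ` keeps its value and both neighbours, so its status can change only from `ℓ`
on: `ℓ` becomes the last item, which is always critical, and `ℓ + 1` its hook. -/
theorem mem_crit_left (hℓ : 2 ≤ ℓ) (hm : ℓ < m) {i : ℕ} :
    i ∈ critPoints (hooked c ε 1 ℓ) 1 ℓ ↔ (i ∈ X ∧ i < ℓ) ∨ i = ℓ ∨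
      (i = ℓ + 1 ∧ IsMaxItem (hooked c ε 1 ℓ) ℓ) := by
  have h' : Spread c ε 1 ℓ := ⟨le_rfl, by omega, h.pos, fun i h1 h2 j h3 h4 =>
    h.gap i h1 (by omega) j h3 (by omega)⟩
  have hiX : i ∈ X ↔ i ∈ critPoints (hooked c ε 1 m) 1 m ∧ i ≤ ℓ := by
    rw [← hXZ, List.mem_append]
    exact ⟨fun h1 => ⟨Or.inl h1, hX i h1⟩, fun h1 => h1.1.resolve_right fun h2 => by
      have := hZ i h2; omega⟩
  have h1 : IsMaxItem (hooked c ε 1 ℓ) 1 ↔ IsMaxItem (hooked c ε 1 m) 1 := by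
    rw [h'.isMax_left, h.isMax_left]
  by_cases hi : i < ℓ
  · have hM : (IsMaxItem (hooked c ε 1 ℓ) i ∨ IsMinItem (hooked c ε 1 ℓ) i) ↔
        (IsMaxItem (hooked c ε 1 m) i ∨ IsMinItem (hooked c ε 1 m) i) := by
      simp only [IsMaxItem, IsMinItem, hooked_left_eq (i := i) hi.le hm.le,
        hooked_left_eq (i := i - 1) (by omega) hm.le, hooked_left_eq (i := i + 1) hi hm.le]
    rw [hiX, mem_critPoints h'.lt, mem_critPoints h.lt, hM, h1]
    constructor
    · rintro (h2 | h2 | h2)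
      · exact Or.inl ⟨⟨Or.inl h2, hi.le⟩, hi⟩
      · exact Or.inl ⟨⟨Or.inr (Or.inl ⟨h2.1, by omega, h2.2.2⟩), hi.le⟩, hi⟩
      · omega
    · rintro (⟨⟨h2 | h2 | h2, -⟩, -⟩ | h2 | h2)
      · exact Or.inl h2
      · exact Or.inr (Or.inl ⟨h2.1, by omega, h2.2.2⟩)
      all_goals omega
  · rcases (by omega : i = ℓ ∨ ℓ < i) with rfl | h2
    · simp [h'.right_mem]
    · rw [mem_critPoints h'.lt]
      constructor
      · rintro (h3 | h3 | h3)
        · omega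
        · omega
        · exact Or.inr (Or.inr h3)
      · rintro (h3 | h3 | h3)
        · omega
        · omega
        · exact Or.inr (Or.inr h3)

theorem mem_crit_right (hm : ℓ + 2 ≤ m) {i : ℕ} :
    i ∈ critPoints (hooked c ε (ℓ + 1) m) (ℓ + 1) m ↔ (i ∈ Z ∧ ℓ + 1 < i) ∨ i = ℓ + 1 ∨
      (i = ℓ ∧ IsMaxItem (hooked c ε (ℓ + 1) m) (ℓ + 1)) := by
  have h' : Spread c ε (ℓ + 1) m := ⟨by omega, by omega, h.pos, fun i h1 h2 j h3 h4 =>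
    h.gap i (by omega) h2 j (by omega) h4⟩
  have hiZ : i ∈ Z ↔ i ∈ critPoints (hooked c ε 1 m) 1 m ∧ ℓ < i := by
    rw [← hXZ, List.mem_append]
    exact ⟨fun h1 => ⟨Or.inr h1, hZ i h1⟩, fun h1 => h1.1.resolve_left fun h2 => by
      have := hX i h2; omega⟩
  have h1 : IsMaxItem (hooked c ε (ℓ + 1) m) m ↔ IsMaxItem (hooked c ε 1 m) m := by
    rw [h'.isMax_right, h.isMax_right]
  by_cases hi : ℓ + 1 < i
  · have hM : (IsMaxItem (hooked c ε (ℓ + 1) m) i ∨ IsMinItem (hooked c ε (ℓ + 1) m) i) ↔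
        (IsMaxItem (hooked c ε 1 m) i ∨ IsMinItem (hooked c ε 1 m) i) := by
      simp only [IsMaxItem, IsMinItem, hooked_right_eq (i := i) (by omega : ℓ < i),
        hooked_right_eq (i := i - 1) (by omega : ℓ < i - 1),
        hooked_right_eq (i := i + 1) (by omega : ℓ < i + 1)]
    rw [hiZ, mem_critPoints h'.lt, mem_critPoints h.lt, hM, h1]
    constructor
    · rintro (h2 | h2 | h2)
      · omega
      · exact Or.inl ⟨⟨Or.inr (Or.inl ⟨by omega, h2.2⟩), by omega⟩, hi⟩
      · exact Or.inl ⟨⟨Or.inr (Or.inr h2), by omega⟩, hi⟩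
    · rintro (⟨⟨h2 | h2 | h2, -⟩, -⟩ | h2 | h2)
      · omega
      · exact Or.inr (Or.inl ⟨by omega, h2.2⟩)
      · exact Or.inr (Or.inr h2)
      all_goals omega
  · rcases (by omega : i = ℓ + 1 ∨ i ≤ ℓ) with rfl | h2
    · simp [h'.left_mem]
    · rw [mem_critPoints h'.lt]
      constructor
      · rintro (h3 | h3 | h3)
        · exact Or.inr (Or.inr ⟨by omega, h3.2⟩)
        all_goals omega
      · rintro (h3 | h3 | h3)
        · omega
        · omega
        · exact Or.inl ⟨by omega, h3.2⟩

/-- `t` is what the final adjustment appends. Both lists are increasing, so it suffices to compare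
members. -/
theorem crit_left_eq (hℓ : 2 ≤ ℓ) (hm : ℓ < m) {t : List ℕ} (ht : t.Pairwise (· < ·))
    (h1 : ∀ i ∈ t, ℓ ≤ i) (h2 : ℓ ∈ t ↔ ℓ ∉ X)
    (h3 : ∀ i, ℓ < i → (i ∈ t ↔ i = ℓ + 1 ∧ IsMaxItem (hooked c ε 1 ℓ) ℓ)) :
    critPoints (hooked c ε 1 ℓ) 1 ℓ = X ++ t := by
  have hs := sorted_critPoints (hooked c ε 1 m) 1 m
  rw [← hXZ] at hs
  refine (sorted_critPoints _ _ _).eq_of_mem_iff (List.pairwise_append.2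
    ⟨(List.pairwise_append.1 hs).1, ht, fun i hi j hj => ?_⟩) fun i => ?_
  · have := hX i hi
    have := h1 j hj
    refine lt_of_le_of_ne (by omega) fun e => ?_
    have h5 : i = ℓ := by omega
    have h6 : j = ℓ := by omega
    rw [h5] at hi
    rw [h6] at hj
    exact h2.1 hj hi
  · rw [mem_crit_left h hXZ hX hZ hℓ hm, List.mem_append]
    rcases lt_trichotomy i ℓ with h5 | rfl | h5
    · constructor
      · rintro (h6 | h6 | h6)
        · exact Or.inl h6.1
        all_goals omega
      · rintro (h6 | h6)
        · exact Or.inl ⟨h6, h5⟩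
        · have := h1 i h6; omega
    · simp only [lt_irrefl, and_false, true_or, or_true, true_iff, h2]
      tauto
    · rw [h3 i h5]
      constructor
      · rintro (h6 | h6 | h6)
        · omega
        · omega
        · exact Or.inr h6
      · rintro (h6 | h6)
        · have := hX i h6; omega
        · exact Or.inr (Or.inr h6)

theorem crit_right_eq (hm : ℓ + 2 ≤ m) {t : List ℕ} (ht : t.Pairwise (· < ·))
    (h1 : ∀ i ∈ t, i ≤ ℓ + 1) (h2 : ℓ + 1 ∈ t ↔ ℓ + 1 ∉ Z)
    (h3 : ∀ i, i ≤ ℓ → (i ∈ t ↔ i = ℓ ∧ IsMaxItem (hooked c ε (ℓ + 1) m) (ℓ + 1))) :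
    critPoints (hooked c ε (ℓ + 1) m) (ℓ + 1) m = t ++ Z := by
  have hs := sorted_critPoints (hooked c ε 1 m) 1 m
  rw [← hXZ] at hs
  refine (sorted_critPoints _ _ _).eq_of_mem_iff (List.pairwise_append.2
    ⟨ht, (List.pairwise_append.1 hs).2.1, fun j hj i hi => ?_⟩) fun i => ?_
  · have := hZ i hi
    have := h1 j hj
    refine lt_of_le_of_ne (by omega) fun e => ?_
    have h5 : i = ℓ + 1 := by omega
    have h6 : j = ℓ + 1 := by omega
    rw [h5] at hi
    rw [h6] at hj
    exact h2.1 hj hi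
  · rw [mem_crit_right h hXZ hX hZ hm, List.mem_append]
    rcases lt_trichotomy i (ℓ + 1) with h5 | rfl | h5
    · rw [h3 i (by omega)]
      constructor
      · rintro (h6 | h6 | h6)
        · omega
        · omega
        · exact Or.inl h6
      · rintro (h6 | h6)
        · exact Or.inr (Or.inr h6)
        · have := hZ i h6; omega
    · simp only [lt_irrefl, and_false, true_or, or_true, true_iff, h2]
      tauto
    · constructor
      · rintro (h6 | h6 | h6)
        · exact Or.inr h6.1
        all_goals omega
      · rintro (h6 | h6)
        · have := h1 i h6; omega
        · exact Or.inl ⟨h6, h5⟩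

end

end BananaTree

namespace BananaTree
namespace Banana

variable {v w : ℕ → ℝ} {pos : ℕ → ℤ} {y z δ ε : ℝ} {U D A F : Banana} {α a b k k' : ℕ}
  {gs : List Frame} {P Q : List ℕ}

/-! ### The final adjustment of both trees -/

/-- For both sides at once: `k` is the item next to the cut in the tree of `α`, `k'` its new hook,
and `p` will say that `k` is a maximum of the given map. By `hfar` no other node has a value within
`ε` below that of `k`, so the hook does not pass any node that `k` exceeds. -/
theorem Inv.exists_near (I : Inv v pos y U α gs A F z P Q [] [] []) (h : Setting v pos y U D a b)
    (o : Bool) (hδ : 0 < δ) (hgap : ∀ i ∈ U.ino, ∀ j ∈ U.ino, v i < v j → v i + δ < v j)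
    (hε : 0 < ε) (hy : y < v k) (hak : v k ≤ v a) (hinj : ∀ i ∈ P, v i = v k → i = k)
    (hfar : ∀ i ∈ P, i ≠ k → v i < v k → v i < v k - ε) {p : Prop} [Decidable p] (hp : p → a = k)
    (hnp : ¬ p → k ∉ P) (hw : ∀ i ∈ P, w i = v i) (hwk : w k = v k)
    (hwk' : p → w k' = v k - ε) :
    ∃ T, (if p then placeAlpha α k' δ (v k - ε) (Function.update v α z) (flip o (plugR gs A))
      else placeAlpha α k δ (v k) (Function.update v α z) (flip o (plugR gs A))) = flip o T ∧
      Valid w T ∧ T.ino = P ++ [if p then k' else k] ∧ T.hi = ⊤ := by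
  obtain ⟨-, ⟨P', hP⟩, -⟩ := I.last h
  have hL : LastLeaf (Function.update v α z) P α gs A :=
    ⟨I.near_lo, I.near_right, I.near_ino, I.near_valid, I.near_hi, I.near_ino ▸ I.near_nodup⟩
  have haP : a ∈ P := by rw [hP]; simp
  have hgP : ∀ i ∈ P, ∀ j ∈ P, v i < v j → v i + δ < v j := fun i hi j hj =>
    hgap i (I.mem_P hi) j (I.mem_P hj)
  have hiP : ∀ i ∈ P, ∀ j ∈ P, v i = v j → i = j := fun i hi j hj =>
    h.inj i (I.mem_P hi) j (I.mem_P hj)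
  have hzP : ∀ i ∈ P, v i < z → v i < y := fun i hi => I.rank i (I.mem_P hi)
  by_cases hp' : p
  · simp only [if_pos hp']
    refine hL.placeAlpha o hδ hgP hiP (fun i hi hiz => ?_) hP (by rw [hp hp']; linarith)
      (fun i hi e => ?_) hw (hwk' hp')
    · have := hzP i hi hiz
      exact hfar i hi (fun e => by rw [e] at this; linarith) (by linarith)
    · have := hfar i hi (fun e' => by rw [e'] at e; linarith) (by linarith)
      linarith
  · simp only [if_neg hp']
    refine hL.placeAlpha o hδ hgP hiP (fun i hi hiz => (hzP i hi hiz).trans hy) hP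
      (lt_of_le_of_ne hak fun e => ?_) (fun i hi e => ?_) hw hwk
    · rw [hinj a haP e.symm] at haP; exact hnp hp' haP
    · rw [hinj i hi e] at hi; exact hnp hp' hi

theorem Inv.far_adjusted (I : Inv v pos y U α gs A F z P Q [] [] [])
    (h : Setting v pos y U D a b) (hε : 0 < ε) (hbk : v b ≤ v k)
    (hinj : ∀ i ∈ Q, v i = v k → i = k) (hfar : ∀ i ∈ Q, i ≠ k → v i < v k → v i < v k - ε)
    {p : Prop} [Decidable p] (hnp : ¬ p → k ∉ Q) (hw : ∀ i ∈ Q, w i = v i) (hwk : w k = v k)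
    (hwk' : ¬ p → w k' = v k - ε) :
    Valid w (if p then F else insertLeft v k' k F) ∧
      (if p then F else insertLeft v k' k F).ino = (if p then [] else [k', k]) ++ Q ∧
      (if p then F else insertLeft v k' k F).hi = ⊤ := by
  by_cases hp : p
  · simp only [if_pos hp]
    exact ⟨I.far_valid.congr (by rwa [I.far_ino]), I.far_ino, I.far_hi⟩
  · simp only [if_neg hp]
    have hne : ∀ i ∈ Q, i ≠ k := fun i hi e => hnp hp (e ▸ hi)
    -- The first node of the far tree is `b`, and the values at `b` and `k` differ because `k` is
    -- not a node.
    have hhead : ∀ i ∈ Q.head?, v i < v k := fun i hi => by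
      have hiQ := List.mem_of_mem_head? hi
      refine lt_of_le_of_ne ?_ fun e => hne i hiQ (hinj i hiQ e)
      have hiU := I.mem_Q hiQ
      have hpos := I.nil rfl i hiQ
      have h3 : pos b ≤ pos i := (h.cut.gap i hiU).resolve_left fun h4 => by
        have := h.cut.a_neg; omega
      have hbQ : b ∈ Q := by
        have := h.cut.b_mem
        rw [← I.append] at this
        refine (List.mem_append.1 this).resolve_left fun h4 => ?_
        have := I.neg b h4
        have := h.cut.b_pos
        omega
      have h4 : i = b := by
        obtain ⟨Q', rfl⟩ : ∃ Q', Q = i :: Q' := by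
          cases Q with
          | nil => simp at hi
          | cons j Q' => exact ⟨Q', by simpa using hi⟩
        refine (List.mem_cons.1 hbQ).elim Eq.symm fun h5 => ?_
        have := I.up.sorted
        rw [← I.append] at this
        have := (List.pairwise_cons.1 (List.pairwise_append.1 this).2.1).1 b h5
        omega
      rw [h4]; exact hbk
    obtain ⟨h1, h2⟩ := insertLeft_valid (a := k') (b := k) (by rw [hwk, hwk' hp]; linarith)
      I.far_valid I.far_ino hw hwk (fun i hi e => hne i hi (hinj i hi e))
      (fun i hi hlt => by rw [hwk' hp]; exact hfar i hi (hne i hi) hlt) hhead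
    exact ⟨h1, h2, by rw [hi_insertLeft, I.far_hi]⟩

end Banana

open Banana

theorem Spread.eq_of_crit {c : ℕ → ℝ} {ε : ℝ} {s t : ℕ} (h : Spread c ε s t) {i j : ℕ}
    (hi : i ∈ critPoints (hooked c ε s t) s t) (hj : s ≤ j ∧ j ≤ t)
    (e : hooked c ε s t i = c j) : i = j := by
  have hp := h.pos
  have hl := h.lt
  by_contra hne
  rcases h.crit_cases hi with h1 | h1 | h1
  · rcases h.lt_or ⟨h1.1, h1.2.1⟩ hj hne with h2 | h2 <;> linarith
  · rcases eq_or_ne s j with rfl | h3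
    · linarith
    · rcases h.lt_or ⟨le_rfl, hl.le⟩ hj h3 with h2 | h2 <;> linarith
  · rcases eq_or_ne t j with rfl | h3
    · linarith
    · rcases h.lt_or ⟨hl.le, le_rfl⟩ hj h3 with h2 | h2 <;> linarith

end BananaTree

namespace BananaTree

open Banana

/-! ### Correctness -/

set_option maxHeartbeats 1000000 in
theorem isUpTree_split {m ℓ : ℕ} (hℓ : 2 ≤ ℓ) (hlm : ℓ < m) {c : ℕ → ℝ} {ε : ℝ} (hε : 0 < ε)
    (hε' : ∀ i ∈ Set.Icc 1 m, ∀ j ∈ Set.Icc 1 m, i ≠ j → ε < |c i - c j|)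
    {f g h : ℕ → ℝ} (hf : f = hooked c ε 1 m) (hg : g = hooked c ε 1 ℓ)
    (hh : h = hooked c ε (ℓ + 1) m)
    {δ : ℝ} (hδ : 0 < δ)
    (hδ' : ∀ i ∈ Set.Icc 0 (m + 1), ∀ j ∈ Set.Icc 0 (m + 1), f i ≠ f j → δ < |f i - f j|)
    {U D : Banana} (hU : IsUpTree f 1 m U) (hD : IsDownTree f 1 m D) :
    IsUpTree g 1 ℓ (split f 1 m ℓ ε δ U D).1 ∧
      (ℓ + 2 ≤ m → IsUpTree h (ℓ + 1) m (split f 1 m ℓ ε δ U D).2) := by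
  have hS : Spread c ε 1 m := ⟨le_rfl, by omega, hε, fun i h1 h2 j h3 h4 =>
    hε' i ⟨h1, h2⟩ j ⟨h3, h4⟩⟩
  have hSl : Spread c ε 1 ℓ := ⟨le_rfl, by omega, hε, fun i h1 h2 j h3 h4 =>
    hS.gap i h1 (by omega) j h3 (by omega)⟩
  have hSr : ℓ + 2 ≤ m → Spread c ε (ℓ + 1) m := fun hm2 => ⟨by omega, by omega, hε,
    fun i h1 h2 j h3 h4 => hS.gap i (by omega) h2 j (by omega) h4⟩
  -- Twice the signed distance from the cut; it is odd, so no item is at position zero.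
  set pos : ℕ → ℤ := fun i => 2 * (i : ℤ) - (2 * ℓ + 1) with hpos
  have hmono : ∀ i j, pos i < pos j ↔ i < j := fun i j => by simp only [hpos]; omega
  have hneg : ∀ i, pos i < 0 ↔ i ≤ ℓ := fun i => by simp only [hpos]; omega
  have hpos0 : ∀ i, pos i ≠ 0 := fun i => by simp only [hpos]; omega
  have hlt := fun i => lt_iff_pos hpos0 hneg i
  obtain ⟨a, b, st, hmax, hmin, hcut, hUi, hDi, ha1, hbm, hdir⟩ :=
    hS.exists_setting (by omega) hlm hf hmono hneg hpos0 hU hD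
  obtain ⟨pre, B, tl, scL, scR, ht, hsL, hsR, hstack⟩ :=
    st.splitStacks_spec hmono hneg rfl hUi hDi hmax hmin hcut
  have hmemU : ∀ i ∈ U.ino, i ≤ m + 1 := fun i hi => by
    rw [hUi, mem_critPoints hS.lt] at hi; omega
  have hgap : ∀ i ∈ U.ino, ∀ j ∈ U.ino, f i < f j → f i + δ < f j := fun i hi j hj hij => by
    have := hδ' j ⟨by omega, hmemU j hj⟩ i ⟨by omega, hmemU i hi⟩ hij.ne'
    rw [abs_of_pos (by linarith)] at this
    linarith
  have hrep := Rep.splitLoop st hneg hδ hgap _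
    (Rep.start (ℓ := ℓ) (α := m + 2) st ht hsL hsR hδ fun h1 => by have := hmemU _ h1; omega) rfl
  have hsplit : split f 1 m ℓ ε δ U D = finish f (m + 2) ℓ ε δ (splitLoop f (m + 2) ℓ δ
      ((B :: tl).length + scL.length + scR.length) (loaded ℓ (B :: tl) scL scR)
      (initState U f (m + 2) δ (loaded ℓ (B :: tl) scL scR))) := by
    rw [split, hstack, loaded_size]
  rw [hsplit]
  revert hrep
  generalize splitLoop f (m + 2) ℓ δ ((B :: tl).length + scL.length + scR.length)
    (loaded ℓ (B :: tl) scL scR) (initState U f (m + 2) δ (loaded ℓ (B :: tl) scL scR)) = σ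
  intro hrep
  have hitem : ∀ i, 1 ≤ i → i ≤ m → f i = c i := fun i h1 h2 => by rw [hf]; exact hooked_item h1 h2
  have hgl : ∀ i, i ≤ ℓ → g i = f i := fun i h1 => by rw [hg, hf]; exact hooked_left_eq h1 hlm.le
  have hhr : ∀ i, ℓ < i → h i = f i := fun i h1 => by rw [hh, hf]; exact hooked_right_eq h1
  have e1 := hitem (ℓ - 1) (by omega) (by omega)
  have e2 := hitem ℓ (by omega) (by omega)
  have e3 := hitem (ℓ + 1) (by omega) (by omega)
  have hmg : IsMaxItem g ℓ ↔ f (ℓ - 1) < f ℓ := by rw [hg, hSl.isMax_right, e1, e2]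
  have hmh : ℓ + 2 ≤ m → (IsMaxItem h (ℓ + 1) ↔ f (ℓ + 2) < f (ℓ + 1)) := fun hm2 => by
    rw [hh, (hSr hm2).isMax_left, e3, hitem (ℓ + 2) (by omega) hm2]
  have hgh : f (ℓ - 1) < f ℓ → g (ℓ + 1) = f ℓ - ε := fun h1 => by
    rw [hg, e2]
    exact (hSl.hook_right.resolve_left fun h2 => by rw [← e1, ← e2] at h2; linarith).2
  have hhh : ℓ + 2 ≤ m → f (ℓ + 2) < f (ℓ + 1) → h ℓ = f (ℓ + 1) - ε := fun hm2 h1 => by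
    rw [hh, e3]
    refine ((hSr hm2).hook_left.resolve_left fun h2 => ?_).2
    rw [← e3, ← hitem (ℓ + 1 + 1) (by omega) hm2] at h2; linarith
  have hne1 : f (ℓ - 1) ≠ f ℓ := fun e => by
    rcases hS.lt_or (i := ℓ - 1) (j := ℓ) (by omega) (by omega) (by omega) with h3 | h3 <;> linarith
  have hne2 : ℓ + 2 ≤ m → f (ℓ + 2) ≠ f (ℓ + 1) := fun hm2 e => by
    have := hitem (ℓ + 2) (by omega) hm2
    rcases hS.lt_or (i := ℓ + 1) (j := ℓ + 2) (by omega) (by omega) (by omega) with h3 | h3 <;>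
      linarith
  have hcrit : ∀ i, 1 ≤ i → i ≤ m → (i ∈ U.ino ↔ IsMaxItem f i ∨ IsMinItem f i) :=
    fun i h1 h2 => by
      rw [hUi, mem_critPoints hS.lt]
      constructor
      · rintro (h3 | h3 | h3)
        · omega
        · exact h3.2.2
        · omega
      · exact fun h3 => Or.inr (Or.inl ⟨h1, h2, h3⟩)
  have hinj : ∀ j, 1 ≤ j → j ≤ m → ∀ i ∈ U.ino, f i = f j → i = j := fun j h1 h2 i hi e => by
    rw [hUi, hf] at hi
    exact hS.eq_of_crit hi ⟨h1, h2⟩ (by rw [← hf, e, hitem j h1 h2])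
  -- The end items are excluded, since their hooks are at distance exactly `ε`. For `j = ℓ + 1` this
  -- is where `ℓ + 2 ≤ m` enters.
  have hfar : ∀ j, 2 ≤ j → j < m → ∀ i ∈ U.ino, i ≠ j → f i < f j → f i < f j - ε :=
    fun j h1 h2 i hi hij hlt => by
      rw [hUi, hf] at hi
      rw [hitem j (by omega) h2.le] at hlt ⊢
      have := hS.hook_gap hi (j := j) (by omega) hij (by omega) (by omega)
      rw [← hf] at this
      exact this hlt
  have hleft : ∀ {X Z t : List ℕ} {T : Banana}, X ++ Z = U.ino → (∀ i ∈ X, i ≤ ℓ) →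
      (∀ i ∈ Z, ℓ < i) → Valid g T → T.hi = ⊤ → T.ino = X ++ t → t.Pairwise (· < ·) →
      (∀ i ∈ t, ℓ ≤ i) → (ℓ ∈ t ↔ ℓ ∉ X) →
      (∀ i, ℓ < i → (i ∈ t ↔ i = ℓ + 1 ∧ IsMaxItem g ℓ)) → IsUpTree g 1 ℓ T :=
    fun hXZ hX hZ hT hT' hi t1 t2 t3 t4 => by
      rw [hUi, hf] at hXZ
      rw [hg] at t4 hT ⊢
      refine isUpTree_of_valid hT' hT ?_ hSl.pairwise_ne
      rw [hi, crit_left_eq hS hXZ hX hZ hℓ hlm t1 t2 t3 t4]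
  have hright : ∀ {X Z t : List ℕ} {T : Banana}, ℓ + 2 ≤ m → X ++ Z = U.ino →
      (∀ i ∈ X, i ≤ ℓ) → (∀ i ∈ Z, ℓ < i) → Valid h T → T.hi = ⊤ → T.ino = t ++ Z →
      t.Pairwise (· < ·) → (∀ i ∈ t, i ≤ ℓ + 1) → (ℓ + 1 ∈ t ↔ ℓ + 1 ∉ Z) →
      (∀ i, i ≤ ℓ → (i ∈ t ↔ i = ℓ ∧ IsMaxItem h (ℓ + 1))) → IsUpTree h (ℓ + 1) m T :=
    fun hm2 hXZ hX hZ hT hT' hi t1 t2 t3 t4 => by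
      rw [hUi, hf] at hXZ
      rw [hh] at t4 hT ⊢
      refine isUpTree_of_valid hT' hT ?_ (hSr hm2).pairwise_ne
      rw [hi, crit_right_eq hS hXZ hX hZ hm2 t1 t2 t3 t4]
  have hmem : ∀ {X Z : List ℕ}, X ++ Z = U.ino → (∀ i ∈ X, i ≤ ℓ) → (∀ i ∈ Z, ℓ < i) →
      (ℓ ∈ X ↔ IsMaxItem f ℓ ∨ IsMinItem f ℓ) ∧
        (ℓ + 1 ∈ Z ↔ IsMaxItem f (ℓ + 1) ∨ IsMinItem f (ℓ + 1)) := fun hXZ hX hZ => by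
    rw [← hcrit ℓ (by omega) hlm.le, ← hcrit (ℓ + 1) (by omega) hlm, ← hXZ, List.mem_append,
      List.mem_append]
    exact ⟨⟨Or.inl, fun h1 => h1.resolve_right fun h2 => absurd (hZ _ h2) (by omega)⟩,
      ⟨Or.inr, fun h1 => h1.resolve_left fun h2 => absurd (hX _ h2) (by omega)⟩⟩
  have hnear : IsMaxItem f ℓ → a = ℓ := fun h1 => by
    have h2 := (hcrit ℓ (by omega) hlm.le).2 (Or.inl h1)
    have h3 := st.cut.a_neg
    rcases st.cut.gap ℓ h2 with h4 | h4
    · have h5 := (hneg a).1 h3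
      exact le_antisymm h5 (not_lt.1 fun h6 => not_lt.2 h4 ((hmono _ _).2 h6))
    · have := st.cut.b_pos
      have := (hneg ℓ).2 le_rfl
      omega
  have hnear' : IsMaxItem f (ℓ + 1) → b = ℓ + 1 := fun h1 => by
    have h2 := (hcrit (ℓ + 1) (by omega) hlm).2 (Or.inl h1)
    have h3 := st.cut.b_pos
    rcases st.cut.gap (ℓ + 1) h2 with h4 | h4
    · have := st.cut.a_neg
      have := (hlt (ℓ + 1)).1 (by omega)
      omega
    · have h5 := (hlt b).2 h3
      exact le_antisymm (not_lt.1 fun h6 => not_lt.2 h4 ((hmono _ _).2 h6)) h5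
  -- By `Inv.last` the tree in which `α` ends determines the sign of `f (ℓ + 1) - f ℓ`, and this
  -- matches the case distinction in `finish`.
  rcases hrep with ⟨gs, A, F, z, P, Q, I, rfl⟩ | ⟨-, gs, A, F, z, P, Q, I, rfl⟩
  · obtain ⟨hba, -, hQ⟩ := I.last st
    obtain ⟨hd, hd1, hd2⟩ := hdir.resolve_left fun h1 => by linarith
    have hX : ∀ i ∈ P, i ≤ ℓ := fun i hi => (hneg i).1 (I.neg i hi)
    have hZ : ∀ i ∈ Q, ℓ < i := fun i hi => (hlt i).2 (hQ i hi)
    obtain ⟨m1, m2⟩ := hmem I.append hX hZ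
    have hM : IsMaxItem f ℓ ↔ f (ℓ - 1) < f ℓ := ⟨fun h1 => h1.1, fun h1 => ⟨h1, hd⟩⟩
    have hN : ¬ IsMinItem f ℓ := fun h1 => by have := h1.2; linarith
    have hM' : ¬ IsMaxItem f (ℓ + 1) := fun h1 => by have := h1.1; simp at this; linarith
    rw [finish, if_pos hd]
    constructor
    · obtain ⟨T, h1, h2, h3, h4⟩ := I.exists_near st false (k := ℓ) (k' := ℓ + 1) (ε := ε) (w := g)
        (p := IsMaxItem f ℓ) hδ hgap hε (by linarith) hd1
        (fun i hi => hinj ℓ (by omega) hlm.le i (I.mem_P hi))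
        (fun i hi => hfar ℓ hℓ hlm i (I.mem_P hi)) hnear (fun h1 h2 => (m1.1 h2).elim h1 hN)
        (fun i hi => hgl i (hX i hi)) (hgl ℓ le_rfl) fun h1 => hgh (hM.1 h1)
      simp only [Banana.flip, Bool.false_eq_true, if_false] at h1
      rw [h1]
      refine hleft I.append hX hZ h2 h4 h3 (by simp) ?_ ?_ fun i hi => ?_
      · split_ifs <;> simp
      · split_ifs with h5
        · simp [m1, h5]
        · simp [m1, h5, hN]
      · rw [hmg, ← hM]
        split_ifs with h5
        · simp [h5]
        · simp only [h5, and_false, List.mem_singleton, iff_false]; omega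
    · intro hm2
      have hN' : IsMinItem f (ℓ + 1) ↔ ¬ f (ℓ + 2) < f (ℓ + 1) :=
        ⟨fun h1 => lt_asymm h1.2, fun h1 => ⟨hd, lt_of_le_of_ne (not_lt.1 h1) (hne2 hm2).symm⟩⟩
      obtain ⟨h2, h3, h4⟩ := I.far_adjusted st (k := ℓ + 1) (k' := ℓ) (w := h)
        (p := IsMinItem f (ℓ + 1)) hε hd2
        (fun i hi => hinj (ℓ + 1) (by omega) hlm i (I.mem_Q hi))
        (fun i hi => hfar (ℓ + 1) (by omega) hm2 i (I.mem_Q hi)) (fun h1 h2 => (m2.1 h2).elim hM' h1)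
        (fun i hi => hhr i (hZ i hi)) (hhr (ℓ + 1) (by omega)) fun h1 => hhh hm2 (not_not.1 (mt hN'.2 h1))
      refine hright hm2 I.append hX hZ h2 h4 h3 ?_ ?_ ?_ fun i hi => ?_
      · split_ifs <;> simp
      · split_ifs <;> simp
      · rw [m2]
        split_ifs with h5
        · simp [h5]
        · simp [h5, hM']
      · rw [hmh hm2]
        split_ifs with h5
        · have := hN'.1 h5
          simp [this]
        · have := not_not.1 (mt hN'.2 h5)
          simp only [this, and_true, List.mem_cons, List.not_mem_nil, or_false]; omega
  · obtain ⟨hba, -, hQ⟩ := I.last st.mirror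
    obtain ⟨hd, hd1, hd2⟩ := hdir.resolve_right fun h1 => by linarith
    have happ : Q.reverse ++ P.reverse = U.ino := by
      rw [← List.reverse_append, I.append, ino_mirror, List.reverse_reverse]
    have hP : ∀ i ∈ P, ℓ < i := fun i hi => (hlt i).2 (by simpa using I.neg i hi)
    have hQ' : ∀ i ∈ Q, i ≤ ℓ := fun i hi => (hneg i).1 (by simpa using hQ i hi)
    have hX : ∀ i ∈ Q.reverse, i ≤ ℓ := by simpa using hQ'
    have hZ : ∀ i ∈ P.reverse, ℓ < i := by simpa using hP
    obtain ⟨m1, m2⟩ := hmem happ hX hZ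
    have hPU : ∀ i ∈ P, i ∈ U.ino := fun i hi => by simpa using I.mem_P hi
    have hQU : ∀ i ∈ Q, i ∈ U.ino := fun i hi => by simpa using I.mem_Q hi
    have hN : IsMinItem f ℓ ↔ ¬ f (ℓ - 1) < f ℓ :=
      ⟨fun h1 => lt_asymm h1.1, fun h1 => ⟨lt_of_le_of_ne (not_lt.1 h1) hne1.symm, hd⟩⟩
    have hM : ¬ IsMaxItem f ℓ := fun h1 => by have := h1.2; linarith
    have hN' : ¬ IsMinItem f (ℓ + 1) := fun h1 => by have := h1.1; simp at this; linarith
    rw [finish, if_neg (not_lt.2 hd.le)]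
    constructor
    · obtain ⟨h2, h3, h4⟩ := I.far_adjusted st.mirror (k := ℓ) (k' := ℓ + 1) (w := g)
        (p := IsMinItem f ℓ) hε hd1 (fun i hi => hinj ℓ (by omega) hlm.le i (hQU i hi))
        (fun i hi => hfar ℓ hℓ hlm i (hQU i hi))
        (fun h1 h2 => (m1.1 (List.mem_reverse.2 h2)).elim hM h1)
        (fun i hi => hgl i (hQ' i hi)) (hgl ℓ le_rfl) fun h1 => hgh (not_not.1 (mt hN.2 h1))
      have h1 : (if IsMinItem f ℓ then F.mirror else insertRight f (ℓ + 1) ℓ F.mirror) =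
          (if IsMinItem f ℓ then F else insertLeft f (ℓ + 1) ℓ F).mirror := by
        split_ifs
        · rfl
        · rw [insertRight_eq, mirror_mirror]
      rw [h1]
      refine hleft (t := (if IsMinItem f ℓ then [] else [ℓ + 1, ℓ]).reverse) happ hX hZ h2.mirror
        (by rw [hi_mirror, h4]) (by rw [ino_mirror, h3, List.reverse_append]) ?_ ?_ ?_ fun i hi => ?_
      · split_ifs <;> simp
      · split_ifs <;> simp
      · rw [m1]
        split_ifs with h5
        · simp [h5]
        · simp [h5, hM]
      · rw [hmg]
        split_ifs with h5
        · have := hN.1 h5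
          simp [this]
        · have := not_not.1 (mt hN.2 h5)
          simp only [this, and_true, List.mem_reverse, List.mem_cons, List.not_mem_nil, or_false]
          omega
    · intro hm2
      have hM' : IsMaxItem f (ℓ + 1) ↔ f (ℓ + 2) < f (ℓ + 1) :=
        ⟨fun h1 => h1.2, fun h1 => ⟨hd, h1⟩⟩
      obtain ⟨T, h1, h2, h3, h4⟩ := I.exists_near st.mirror true (k := ℓ + 1) (k' := ℓ) (ε := ε)
        (w := h) (p := IsMaxItem f (ℓ + 1)) hδ (by simpa using hgap) hε (by linarith) hd2
        (fun i hi => hinj (ℓ + 1) (by omega) hlm i (hPU i hi))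
        (fun i hi => hfar (ℓ + 1) (by omega) hm2 i (hPU i hi)) hnear'
        (fun h1 h2 => (m2.1 (List.mem_reverse.2 h2)).elim h1 hN')
        (fun i hi => hhr i (hP i hi)) (hhr (ℓ + 1) (by omega)) fun h1 => hhh hm2 (hM'.1 h1)
      simp only [Banana.flip, if_true] at h1
      rw [h1]
      refine hright (t := [if IsMaxItem f (ℓ + 1) then ℓ else ℓ + 1]) hm2 happ hX hZ h2.mirror
        (by rw [hi_mirror, h4]) (by rw [ino_mirror, h3, List.reverse_append]; rfl) (by simp) ?_ ?_
        fun i hi => ?_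
      · split_ifs <;> simp
      · split_ifs with h5
        · simp [m2, h5]
        · simp [m2, h5, hN']
      · rw [hmh hm2, ← hM']
        split_ifs with h5
        · simp [h5]
        · simp only [h5, and_false, List.mem_singleton, iff_false]; omega

end BananaTree

open BananaTree in
theorem theoremB3 (m ℓ : ℕ) (hℓ : 2 ≤ ℓ) (hm : ℓ ≤ m - 1)
    (c : ℕ → ℝ) (hc : Set.InjOn c (Set.Icc 1 m))
    (ε : ℝ) (hε : 0 < ε)
    (hε' : ∀ i ∈ Set.Icc 1 m, ∀ j ∈ Set.Icc 1 m, i ≠ j → ε < |c i - c j|)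
    (f g h : ℕ → ℝ) (hf : f = hooked c ε 1 m) (hg : g = hooked c ε 1 ℓ)
    (hh : h = hooked c ε (ℓ + 1) m)
    (δ : ℝ) (hδ : 0 < δ)
    (hδ' : ∀ i ∈ Set.Icc 0 (m + 1), ∀ j ∈ Set.Icc 0 (m + 1), f i ≠ f j → δ < |f i - f j|)
    (U D : Banana) (hU : IsUpTree f 1 m U) (hD : IsDownTree f 1 m D) :
    IsUpTree g 1 ℓ (split f 1 m ℓ ε δ U D).1 ∧
      (ℓ ≤ m - 2 → IsUpTree h (ℓ + 1) m (split f 1 m ℓ ε δ U D).2) := by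
  -- As `2 ≤ ℓ`, the truncated subtractions in `ℓ ≤ m - 1` and `ℓ ≤ m - 2` do no harm.
  obtain ⟨h1, h2⟩ := isUpTree_split hℓ (by omega) hε hε' hf hg hh hδ hδ' hU hD
  exact ⟨h1, fun h3 => h2 (by omega)⟩
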